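/- Let $p>1$, $p'=p/(p-1)$, and $\phi_m(s)=|s|^{m-2}s$ for $s\neq 0$, $\phi_m(0)=0$. Let $q:(0,\infty)\to[0,\infty)$ satisfy - (Q1) $q\in C^1((0,\infty))$, $q\ge 0$ and $q'>0$ on $(0,\infty)$; - (Q2) $q'/q$ is strictly decreasing on $(0,\infty)$; - (Q3) there are $C_1,C_2>0$ with $C_1\le r\,q'(r)/q(r)\le C_2$ for all $r>0$; - (Q4) for every $r_0>0$, $\lim_{r\to+\infty}\big[h(r+r_0)-h(r)\big]=+\infty$, where $h=q^{p'}$. Put $Q(r)=\int_0^r q(t)\,dt$. Let $f:\mathbb R\to\mathbb R$, put $F(s)=\int_0^s f(t)\,dt$, and assume - (f1) $f$ is continuous on $\mathbb R$, locally Lipschitz on $\mathbb R\setminus\{0\}$, and $f(0)=0$; - (f2) there are $\beta^-<0<\beta^+$ with $F(s)<0$ for $s\in(\beta^-,\beta^+)\setminus\{0\}$, $F(\beta^\pm)=0$, $f>0$ on $[\beta^+,\infty)$, $f<0$ on $(-\infty,\beta^-]$; and $\lim_{s\to+\infty}F(s)=\lim_{s\to-\infty}F(s)$ (finite or $+\infty$).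 Set $\frac1N=\liminf_{r\to0^+}\big(\frac Qq\big)'(r)$ and $\mu^*=\max\{\frac1p-\frac1N,0\}$, and assume - (SC) there are $\alpha\in(0,1)$, $\mu\ge\mu^*$ and $r_0>0$ such that $\mu+\big(\frac Qq\big)'-\frac1p\ge0$ on $(0,r_0)$ and $$\lim_{s\to+\infty}\ \inf_{s_1,s_2\in[\alpha s,s]}\big(F(s_2)-\mu\,s_2f(s_2)\big)\,Q\!\left(\Big(\tfrac{(1-\alpha)s}{\phi_{p'}(f(s_1))}\Big)^{1/p'}\right)=+\infty .$$ Then for every integer $k\ge0$ there is a function $v\in C^1([0,\infty);\mathbb R)$ with $v(0)>0$ and $q\,\phi_p(v')\in C^1((0,\infty))$ such that $$\big(q\,\phi_p(v')\big)'+q\,f(v)=0\ \text{ on }(0,\infty),\qquad v'(0)=0,\qquad \lim_{r\to+\infty}v(r)=0,$$ and $v$ has exactly $k$ nodes, where a node of $v$ is a zero of $v$ in the interior (relative to $[0,\infty)$) of the support of $v$. -/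

import Mathlib

open Set Filter Topology

noncomputable section

namespace WeightedPLaplace

/-- The function `φ_p(s) = |s|^(p-2) s`, with `φ_p(0) = 0` (the factor `s` makes the value at `0`
equal to `0` for every `p`). -/
def phi (p s : ℝ) : ℝ := |s| ^ (p - 2) * s

/-- The primitive `F(s) = ∫₀ˢ f(t) dt`. -/
def primitiveF (f : ℝ → ℝ) (s : ℝ) : ℝ := ∫ t in (0 : ℝ)..s, f t

/-- The primitive `Q(r) = ∫₀ʳ q(t) dt` of the weight. -/
def primitiveQ (q : ℝ → ℝ) (r : ℝ) : ℝ := ∫ t in (0 : ℝ)..r, q t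

/-- The function `(Q/q)'`. -/
def ratioDeriv (q : ℝ → ℝ) (r : ℝ) : ℝ := deriv (fun t => primitiveQ q t / q t) r

/-- The assumptions on the weight `q`, which concern only its values on `(0,∞)`. Here
`Real.conjExponent p = p / (p - 1)` is the Hölder conjugate exponent `p'` of `p`, and
`h = q ^ p'` in the last assumption. -/
structure IsAdmissibleWeight (p : ℝ) (q : ℝ → ℝ) : Prop where
  contDiffOn : ContDiffOn ℝ 1 q (Ioi 0)
  nonneg : ∀ r, 0 < r → 0 ≤ q r
  deriv_pos : ∀ r, 0 < r → 0 < deriv q r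
  strictAntiOn : StrictAntiOn (fun r => deriv q r / q r) (Ioi 0)
  bounds : ∃ C₁ C₂ : ℝ, 0 < C₁ ∧ 0 < C₂ ∧
    ∀ r, 0 < r → C₁ ≤ r * deriv q r / q r ∧ r * deriv q r / q r ≤ C₂
  tendsto_increment : ∀ r₀ : ℝ, 0 < r₀ →
    Tendsto (fun r => q (r + r₀) ^ Real.conjExponent p - q r ^ Real.conjExponent p) atTop atTop

/-- The assumptions on the nonlinearity `f`. The last field says that `F(∞) = F(-∞)`, where the
two limits are taken in the extended reals. -/
structure IsAdmissibleNonlinearity (f : ℝ → ℝ) : Prop where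
  continuous : Continuous f
  locallyLipschitzOn : LocallyLipschitzOn {0}ᶜ f
  map_zero : f 0 = 0
  exists_beta : ∃ βm βp : ℝ, βm < 0 ∧ 0 < βp ∧
    (∀ s ∈ Ioo βm βp \ {0}, primitiveF f s < 0) ∧
    primitiveF f βm = 0 ∧ primitiveF f βp = 0 ∧
    (∀ s ∈ Ici βp, 0 < f s) ∧ (∀ s ∈ Iic βm, f s < 0)
  limits_eq : ∃ L : EReal,
    Tendsto (fun s => ((primitiveF f s : ℝ) : EReal)) atTop (𝓝 L) ∧
    Tendsto (fun s => ((primitiveF f s : ℝ) : EReal)) atBot (𝓝 L)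

/-- The number `1/N`, i.e. the lower limit of `(Q/q)'(r)` as `r → 0+`. -/
def invDim (q : ℝ → ℝ) : ℝ := liminf (ratioDeriv q) (𝓝[>] 0)

/-- The number `μ* = [1/p - 1/N]₊`. -/
def muStar (p : ℝ) (q : ℝ → ℝ) : ℝ := max (1 / p - invDim q) 0

/-- The expression `(F(s₂) - μ s₂ f(s₂)) Q(((1-α) s / φ_{p'}(f(s₁)))^{1/p'})`. -/
def subcritExpr (p α μ : ℝ) (q f : ℝ → ℝ) (s s₁ s₂ : ℝ) : ℝ :=
  (primitiveF f s₂ - μ * s₂ * f s₂) *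
    primitiveQ q (((1 - α) * s / phi (Real.conjExponent p) (f s₁)) ^ (1 / Real.conjExponent p))

/-- The sub-criticality condition. -/
def IsSubcritical (p : ℝ) (q f : ℝ → ℝ) : Prop :=
  ∃ α ∈ Ioo (0 : ℝ) 1, ∃ μ : ℝ, muStar p q ≤ μ ∧ ∃ r₀ : ℝ, 0 < r₀ ∧
    (∀ r ∈ Ioo 0 r₀, 0 ≤ μ + ratioDeriv q r - 1 / p) ∧
    Tendsto
      (fun s => sInf ((fun x : ℝ × ℝ => subcritExpr p α μ q f s x.1 x.2) ''
        (Icc (α * s) s ×ˢ Icc (α * s) s)))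
      atTop atTop

/-- The flux `q φ_p(v')`, where `v'` is the derivative of `v` as a function on `[0,∞)`. -/
def flux (p : ℝ) (q v : ℝ → ℝ) (r : ℝ) : ℝ := q r * phi p (derivWithin v (Ici 0) r)

/-- `v`, as a function on `[0,∞)`, is a classical solution of
`(q φ_p(v'))' + q f(v) = 0` for `r > 0`, `v'(0) = 0`, `v(r) → 0` as `r → ∞`. -/
structure IsClassicalSolution (p : ℝ) (q f v : ℝ → ℝ) : Prop where
  contDiffOn : ContDiffOn ℝ 1 v (Ici 0)
  contDiffOn_flux : ContDiffOn ℝ 1 (flux p q v) (Ioi 0)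
  equation : ∀ r, 0 < r → deriv (flux p q v) r + q r * f (v r) = 0
  deriv_zero : derivWithin v (Ici 0) 0 = 0
  tendsto_zero : Tendsto v atTop (𝓝 0)

/-- The support in `[0,∞)` of a function `v` on `[0,∞)`. -/
def radialSupport (v : ℝ → ℝ) : Set ℝ := closure {r | 0 ≤ r ∧ v r ≠ 0}

/-- The nodes of `v`: its zeros in the interior (relative to `[0,∞)`) of its support. -/
def nodes (v : ℝ → ℝ) : Set ℝ := {r | 0 ≤ r ∧ v r = 0 ∧ radialSupport v ∈ 𝓝[Ici 0] r}

end WeightedPLaplace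

end

/-! With `y = φ_p(v')` the equation is the system `v' = φ_{p'}(y)`, `y' = -f(v) - (q'/q) y`, started
from `(d, 0)`. The energy `I = |y|^{p'}/p' + F(v)` is nonincreasing, and a zero of `v` at positive
energy is simple. The solution with `k` nodes is found by shooting in `d ≥ β⁺`.

Shooting (`exists_solution_of_hasZeros`). Suppose that some height gives `k + 1` zeros with positive
energy, and let `d` be the infimum of such heights. Having `k + 1` such zeros is an open condition,
so `d` itself has at most `k`. Being a limit of heights with `k + 1` zeros, `d` cannot lead to
negative energy before a stationary point; hence its solution either arrives at `(0, 0)` in finite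
time, where it is continued by zero, or keeps positive energy and tends to zero. On its last
monotone piece `q^{p'} I` is so small compared with the increments of `q^{p'}`, which (Q4) controls
at infinity, that nearby solutions cannot afford to cross the well of `F` (`exists_trap`). They have
therefore at most one zero after that piece begins, so at least `k` zeros come earlier and pass to
the limit `d`.

Uniqueness and continuous dependence are needed although `f` need not be Lipschitz at `0` and
`φ_{p'}` need not be either. They hold away from points with `y = 0 = f(v)`, in particular at
positive energy.

Many zeros. By (Q3) the damping `q'/q` is `O(1/r)`, so energy bounded below at a large radius
produces any number of further zeros (`exists_hasZeros`). It remains to find a height that carries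
enough energy to such a radius, or has enough zeros before. If `F` is bounded, (SC) keeps a tall
solution above `α d` up to any given radius. If `F` is unbounded and `μ ≥ 1/p`, (SC) forces `f(s) ≤
K s^{p-1}`, and tall solutions stay tall up to a fixed radius.

The main case is `F` unbounded, `μ < 1/p`. Here (SC) says nothing about `F(s) - μ s f(s)` for
negative `s`, and the usual Pohozaev argument is not available after the first zero. It is replaced
by an area argument. In the variables `(v, q y)` the flow preserves area; it is approximated by
symplectic Euler schemes, that is by compositions of shears, which are lifted to logarithmic
coordinates. For two lifted orbits, of `P` and `O`, count the signed crossings of the negative real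
axis by their difference. Averaged over `P`, this count is the action of the orbit of `O`
(`integral_branchCrossing_turnedShear`). If `O` is chosen suitably on the real axis, with an end of
prescribed modulus `exp x0` or prescribed angle `θ0`, the count is at most `1`, and it is positive
only if `P` ends in a fixed sector (`NearIdentity.sum_branchCrossing_le`). So the action of `O` is
at most the area of the sector (`exists_orbit_action_le`), whatever the starting radius `ε > 0`.

In the limit of fine meshes this gives solutions on `[ε, ρ]` with bounded action that either end
with large energy or oscillate often (`exists_alternating`). A Pohozaev identity with the action in
place of the missing sign, together with (SC) along the first descent only, bounds their heights
independently of `ε` (`exists_height_bound`). Letting `ε → 0` yields a height with as many zeros as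
desired. -/

noncomputable section

namespace WeightedPLaplace

open scoped Real
open Complex (exp arg I sub_im sub_re abs_im_le_norm exp_im measurableEquivRealProd neg_pi_lt_arg
  exp_add arg_neg_iff abs_re_le_norm arg_le_pi continuous_im ofReal_re arg_nonneg_iff exp_re
  add_re add_im exp_ne_zero ofReal_im volume_preserving_equiv_real_prod slitPlane continuousAt_arg
  mem_slitPlane_iff abs_arg_le_pi_div_two_iff norm_exp arg_div_coe_angle neg_im continuous_exp)
open Real (pi_pos dist_eq Angle sin rpow_pos_of_pos rpow_mul two_pi_pos exp_pos rpow_le_rpow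
  rpow_nonneg rpow_one zero_rpow norm_eq_abs hasDerivAt_rpow_const rpow_sub_one cos exp_le_exp
  rpow_add rpow_lt_rpow one_rpow rpow_neg mul_rpow)

/-! ### Rotation of pairs of orbits of planar maps close to the identity -/

section

variable {n : ℕ} {z P O : ℂ} {r s b x0 θ0 : ℝ} {a g : ℝ → ℝ}

/-- The orbit of a point under a sequence of maps. -/
def orbit (T : ℕ → ℂ → ℂ) : ℕ → ℂ → ℂ
  | 0, P => P
  | i + 1, P => T i (orbit T i P)

/-- A sequence of maps of the plane that are small Lipschitz perturbations of the identity. -/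
structure NearIdentity (T : ℕ → ℂ → ℂ) (C : ℝ) : Prop where
  lip : ∀ i P P', ‖(T i P - T i P') - (P - P')‖ ≤ 1 / 4 * ‖P - P'‖
  disp : ∀ i P, ‖T i P - P‖ ≤ C

/-- The total rotation of the difference of two orbits. -/
def totalRotation (T : ℕ → ℂ → ℂ) (n : ℕ) (P O : ℂ) : ℝ :=
  ∑ i ∈ Finset.range n, arg
    ((orbit T (i + 1) P - orbit T (i + 1) O) / (orbit T i P - orbit T i O))

/-- The (signed) number of times a rotation from `D` to `D'` crosses the negative real axis. -/
def branchCrossing (D D' : ℂ) : ℝ :=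
  (arg D' - arg D - arg (D' / D)) / (2 * π)

/-- The argument with values in `[-π, π)`. -/
def lowerArg (z : ℂ) : ℝ := -arg ((starRingEnd ℂ) z)

lemma lowerArg_eq_arg (hz : z.im < 0) : lowerArg z = arg z := by
  rw [lowerArg, Complex.arg_conj, if_neg (by linarith [arg_neg_iff.2 hz, pi_pos]), neg_neg]

lemma coe_lowerArg (z : ℂ) : (lowerArg z : Angle) = arg z := by
  simp [lowerArg, Complex.arg_conj_coe_angle]

lemma arg_sub_lowerArg : arg z - lowerArg z = 0 ∨
    arg z - lowerArg z = 2 * π := by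
  unfold lowerArg
  rw [Complex.arg_conj]
  split_ifs with h
  exacts [Or.inr (by rw [h]; ring), Or.inl (by ring)]

lemma continuousOn_arg_upper : ContinuousOn arg {z | 0 ≤ z.im ∧ z ≠ 0} := by
  rintro z ⟨h1, h2⟩
  by_cases hz : z ∈ slitPlane
  · exact (continuousAt_arg hz).continuousWithinAt
  · rw [mem_slitPlane_iff] at hz
    push Not at hz
    have hre : z.re < 0 := hz.1.lt_of_ne fun h => h2 (Complex.ext h hz.2)
    exact (Complex.continuousWithinAt_arg_of_re_neg_of_im_zero hre hz.2).mono fun w hw => hw.1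

lemma continuousOn_lowerArg : ContinuousOn lowerArg {z | z.im ≤ 0 ∧ z ≠ 0} := by
  unfold lowerArg
  exact (continuousOn_arg_upper.comp Complex.continuous_conj.continuousOn fun z hz => by
    simpa using hz).neg

/-- The argument in the plane cut along the ray of angle `-π/4`, with values in `(-9π/4, -π/4]`. -/
def rotatedArg (z : ℂ) : ℝ :=
  arg (z * exp (-(3 * π / 4 : ℝ) * I)) - 5 * π / 4

lemma exp_mul_I_eq (z : ℂ) (t : ℝ) : z * exp ((t : ℂ) * I) =
    ⟨z.re * cos t - z.im * sin t, z.re * sin t + z.im * cos t⟩ := by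
  apply Complex.ext <;>
  simp [Complex.exp_ofReal_mul_I_re, Complex.exp_ofReal_mul_I_im]

lemma sqrt_two_half_pos : 0 < √2 / 2 := by positivity

lemma cos_three_pi_div_four : cos (3 * π / 4) = -(√2 / 2) := by
  rw [show 3 * π / 4 = π - π / 4 by ring, Real.cos_pi_sub, Real.cos_pi_div_four]
lemma sin_three_pi_div_four : sin (3 * π / 4) = √2 / 2 := by
  rw [show 3 * π / 4 = π - π / 4 by ring, Real.sin_pi_sub, Real.sin_pi_div_four]

lemma rotate_eq (z : ℂ) : z * exp (-(3 * π / 4 : ℝ) * I) =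
    ⟨√2 / 2 * (z.im - z.re), -(√2 / 2) * (z.re + z.im)⟩ := by
  have := exp_mul_I_eq z (-(3 * π / 4))
  rw [Real.cos_neg, Real.sin_neg, cos_three_pi_div_four, sin_three_pi_div_four] at this
  rw [show (-((3 * π / 4 : ℝ) : ℂ)) = ((-(3 * π / 4) : ℝ) : ℂ) by push_cast; ring, this]
  apply Complex.ext <;> simp <;> ring

lemma rotate_mem_slitPlane (hz : z.re < 0 ∨ 0 < z.im) :
    z * exp (-(3 * π / 4 : ℝ) * I) ∈ slitPlane := by
  rw [rotate_eq, mem_slitPlane_iff]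
  have := sqrt_two_half_pos
  by_contra! h
  obtain ⟨h1, h2⟩ := h
  have e1 : z.im - z.re ≤ 0 := not_lt.1 fun h' => (mul_pos this h').not_ge h1
  have e2 := (mul_eq_zero.1 h2).resolve_left (by linarith)
  rcases hz with h | h <;> linarith

lemma continuousOn_rotatedArg : ContinuousOn rotatedArg {z | z.re < 0 ∨ 0 < z.im} := by
  refine ContinuousOn.sub (fun z hz => ContinuousAt.continuousWithinAt ?_) continuousOn_const
  exact ContinuousAt.comp (f := fun z : ℂ => z * exp (-(3 * π / 4 : ℝ) * I))
    (continuousAt_arg (rotate_mem_slitPlane hz)) (by fun_prop)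

lemma coe_rotatedArg (hz : z ≠ 0) : (rotatedArg z : Angle) = arg z := by
  unfold rotatedArg
  rw [Angle.coe_sub, Complex.arg_mul_coe_angle hz (exp_ne_zero _)]
  have : (arg (exp (-(3 * π / 4 : ℝ) * I)) : Angle)
      = ((-(3 * π / 4) : ℝ) : Angle) := by
    rw [show (-((3 * π / 4 : ℝ) : ℂ)) = ((-(3 * π / 4) : ℝ) : ℂ) by push_cast; ring,
      Complex.arg_exp_mul_I, toIocMod_eq_self two_pi_pos |>.2]
    constructor <;> linarith [pi_pos]
  rw [this, add_sub_assoc, ← Angle.coe_sub,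
    show (-(3 * π / 4) - 5 * π / 4 : ℝ) = -(2 * π) by ring]
  simp

lemma rotatedArg_bounds (z : ℂ) :
    -(9 * π / 4) < rotatedArg z ∧ rotatedArg z ≤ -(π / 4) := by
  unfold rotatedArg
  have := neg_pi_lt_arg (z * exp (-(3 * π / 4 : ℝ) * I))
  have := arg_le_pi (z * exp (-(3 * π / 4 : ℝ) * I))
  constructor <;> linarith

lemma eq_of_coe_eq_of_abs_lt {x y : ℝ} (h : (x : Angle) = y) (h' : |x - y| < 2 * π) :
    x = y := by
  obtain ⟨n, hn⟩ := Angle.angle_eq_iff_two_pi_dvd_sub.1 h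
  rw [hn, abs_mul, abs_of_pos two_pi_pos] at h'
  have : |(n : ℝ)| < 1 := not_le.1 fun hc => by nlinarith [two_pi_pos]
  rw [Int.abs_lt_one_iff.1 (by exact_mod_cast this : |n| < 1)] at hn
  simpa [sub_eq_zero] using hn

lemma rotatedArg_of_im_neg (hz : z.im < 0) (hz' : z.re < 0 ∨ 0 < z.im) :
    rotatedArg z = arg z := by
  have h0 : z ≠ 0 := by rintro rfl; simp at hz
  apply eq_of_coe_eq_of_abs_lt (coe_rotatedArg h0)
  have := rotatedArg_bounds z
  have h1 := arg_neg_iff.2 hz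
  have h2 := neg_pi_lt_arg z
  have hre : z.re < 0 := hz'.resolve_right hz.not_gt
  have h3 : ¬ |arg z| ≤ π / 2 := fun h => (abs_arg_le_pi_div_two_iff.1 h).not_gt hre
  rw [abs_of_neg h1] at h3
  rw [abs_lt]; constructor <;> linarith [pi_pos]

lemma arg_sub_rotatedArg (hz : z ≠ 0) (h : z.re < 0 ∨ 0 < z.im) :
    arg z - rotatedArg z = 0 ∨ arg z - rotatedArg z = 2 * π := by
  by_cases him : z.im < 0
  · left; rw [rotatedArg_of_im_neg him h, sub_self]
  · right
    push Not at him
    have h1 := arg_nonneg_iff.2 him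
    have h2 := arg_le_pi z
    have h3 := rotatedArg_bounds z
    have : arg z - 2 * π = rotatedArg z := by
      apply eq_of_coe_eq_of_abs_lt
      · rw [coe_rotatedArg hz]; simp
      · rw [abs_lt]; constructor <;> linarith [pi_pos]
    linarith

lemma arg_div_eq_sub {D D' : ℂ} (h : D ≠ 0) (h' : D' ≠ 0)
    (h1 : |arg D' - arg D| < π) :
    arg (D' / D) = arg D' - arg D := by
  apply eq_of_coe_eq_of_abs_lt
  · rw [arg_div_coe_angle h' h]; simp
  · have := neg_pi_lt_arg (D' / D)
    have := arg_le_pi (D' / D)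
    rw [abs_lt] at h1 ⊢
    constructor <;> linarith

namespace NearIdentity

variable {T : ℕ → ℂ → ℂ} {C : ℝ} (h : NearIdentity T C)
include h

lemma orbit_ne (hPO : P ≠ O) (i : ℕ) : orbit T i P ≠ orbit T i O := by
  induction i with
  | zero => exact hPO
  | succ i ih =>
    intro he
    have := h.lip i (orbit T i P) (orbit T i O)
    simp only [orbit] at he
    rw [he, sub_self, zero_sub, norm_neg] at this
    linarith [norm_pos_iff.2 (sub_ne_zero.2 ih)]

/-- With constant 1/4 the difference of two orbits turns by less than π/2 in each step. Every
summand of `totalRotation` thus stays away from the cut of `arg`, which makes the total rotation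
continuous in both starting points. -/
lemma ratio_mem_slitPlane (hPO : P ≠ O) (i : ℕ) :
    (orbit T (i + 1) P - orbit T (i + 1) O) / (orbit T i P - orbit T i O) ∈ slitPlane := by
  have h0 : orbit T i P - orbit T i O ≠ 0 := sub_ne_zero.2 (h.orbit_ne hPO i)
  have h1 := h.lip i (orbit T i P) (orbit T i O)
  have : ‖(orbit T (i + 1) P - orbit T (i + 1) O) / (orbit T i P - orbit T i O) - 1‖ ≤ 1 / 4 := by
    rwa [div_sub_one h0, norm_div, div_le_iff₀ (norm_pos_iff.2 h0)]
  rw [mem_slitPlane_iff]; left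
  have h2 := (abs_re_le_norm _).trans this
  rw [abs_le, sub_re, Complex.one_re] at h2
  linarith

lemma continuous_step (i : ℕ) : Continuous (T i) := by
  refine (LipschitzWith.of_dist_le_mul (K := 2) fun P P' => ?_).continuous
  rw [dist_eq_norm, dist_eq_norm]
  push_cast
  linarith [norm_nonneg (P - P'), h.lip i P P',
    norm_le_norm_add_norm_sub' (T i P - T i P') (P - P')]

lemma continuous_orbit (i : ℕ) : Continuous (orbit T i) := by
  induction i with
  | zero => exact continuous_id
  | succ i ih => exact (h.continuous_step i).comp ih

lemma dist_orbit_le (i : ℕ) (P : ℂ) : ‖orbit T i P - P‖ ≤ i * C := by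
  induction i with
  | zero => simp [orbit]
  | succ i ih =>
    calc ‖orbit T (i + 1) P - P‖ = ‖(T i (orbit T i P) - orbit T i P) + (orbit T i P - P)‖ := by
          simp [orbit]
      _ ≤ C + i * C := (norm_add_le _ _).trans (add_le_add (h.disp _ _) ih)
      _ = _ := by push_cast; ring

lemma disp_nonneg : 0 ≤ C := (norm_nonneg _).trans (h.disp 0 0)

lemma dist_orbit_le' {i : ℕ} (hi : i ≤ n) (P : ℂ) : ‖orbit T i P - P‖ ≤ n * C :=
  (h.dist_orbit_le i P).trans (by have := h.disp_nonneg; gcongr)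

/-- A perturbation of the identity with Lipschitz constant below 1 is a homeomorphism of the plane.
This allows orbits to be parametrised by their end points, which are then moved along curves. -/
lemma exists_homeomorph (n : ℕ) : ∃ e : ℂ ≃ₜ ℂ, ∀ P, e P = orbit T n P := by
  induction n with
  | zero => exact ⟨Homeomorph.refl _, fun P => rfl⟩
  | succ n ih =>
    obtain ⟨e, he⟩ := ih
    have ha : ApproximatesLinearOn (T n) ((ContinuousLinearEquiv.refl ℝ ℂ : ℂ ≃L[ℝ] ℂ) : ℂ →L[ℝ] ℂ)
        univ (1 / 4) := fun P _ P' _ => by simpa using h.lip n P P'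
    have hc : Subsingleton ℂ ∨ (1 / 4 : NNReal) <
        ‖((ContinuousLinearEquiv.refl ℝ ℂ).symm : ℂ →L[ℝ] ℂ)‖₊⁻¹ := by
      right
      have : ‖((ContinuousLinearEquiv.refl ℝ ℂ).symm : ℂ →L[ℝ] ℂ)‖₊ = 1 :=
        ContinuousLinearMap.nnnorm_id
      rw [this, inv_one, ← NNReal.coe_lt_coe]
      norm_num
    refine ⟨e.trans (ha.toHomeomorph _ hc), fun P => ?_⟩
    simp only [Homeomorph.trans_apply, he]
    rfl

lemma continuousOn_totalRotation (n : ℕ) :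
    ContinuousOn (fun x : ℂ × ℂ => totalRotation T n x.1 x.2) {x | x.1 ≠ x.2} := by
  unfold totalRotation
  refine continuousOn_finsetSum _ fun i _ x hx => ContinuousAt.continuousWithinAt ?_
  refine ContinuousAt.comp (f := fun x : ℂ × ℂ => ((orbit T (i + 1) x.1 - orbit T (i + 1) x.2) /
    (orbit T i x.1 - orbit T i x.2))) (continuousAt_arg (h.ratio_mem_slitPlane hx i)) ?_
  have h1 := h.continuous_orbit i
  have h2 := h.continuous_orbit (i + 1)
  exact ContinuousAt.div (by fun_prop) (by fun_prop) (sub_ne_zero.2 (h.orbit_ne hx i))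

/-- Modulo 2π the rotation only depends on the two end differences, so that only an integer has to
be determined by homotopy. -/
lemma coe_totalRotation (hPO : P ≠ O) (n : ℕ) :
    (totalRotation T n P O : Angle) =
      arg (orbit T n P - orbit T n O) - arg (P - O) := by
  unfold totalRotation
  induction n with
  | zero => simp [orbit]
  | succ n ih =>
    rw [Finset.sum_range_succ, Angle.coe_add, ih, arg_div_coe_angle
      (sub_ne_zero.2 (h.orbit_ne hPO _)) (sub_ne_zero.2 (h.orbit_ne hPO _))]
    abel

-- By telescoping, the number of crossings compares the total rotation with the principal arguments
-- at the two ends; no intermediate position enters the bound.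
omit h in
lemma sum_branchCrossing (T : ℕ → ℂ → ℂ) (n : ℕ) (P O : ℂ) :
    ∑ i ∈ Finset.range n, branchCrossing (orbit T i P - orbit T i O)
      (orbit T (i + 1) P - orbit T (i + 1) O) =
    (arg (orbit T n P - orbit T n O) - arg (P - O) - totalRotation T n P O) /
      (2 * π) := by
  unfold branchCrossing totalRotation
  rw [← Finset.sum_div, Finset.sum_sub_distrib,
    Finset.sum_range_sub (fun i => arg (orbit T i P - orbit T i O))]
  rfl

/-- If the difference of two orbits stays in one of the open half planes off the real axis, the
total rotation is the difference of principal arguments. -/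
lemma totalRotation_eq (hPO : P ≠ O) (hs : (∀ i ≤ n, 0 < (orbit T i P - orbit T i O).im) ∨
      ∀ i ≤ n, (orbit T i P - orbit T i O).im < 0) :
    totalRotation T n P O = arg (orbit T n P - orbit T n O) - arg (P - O) := by
  unfold totalRotation
  have : ∀ i ∈ Finset.range n, arg
      ((orbit T (i + 1) P - orbit T (i + 1) O) / (orbit T i P - orbit T i O)) =
      arg (orbit T (i + 1) P - orbit T (i + 1) O) - arg (orbit T i P - orbit T i O) := fun i hi => by
    have hi := Finset.mem_range.1 hi
    apply arg_div_eq_sub (sub_ne_zero.2 (h.orbit_ne hPO _)) (sub_ne_zero.2 (h.orbit_ne hPO _))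
    have key : ∀ z : ℂ, 0 < z.im → 0 < arg z ∧ arg z < π := fun z hz =>
      ⟨(arg_nonneg_iff.2 hz.le).lt_of_ne fun h0 => hz.ne' (Complex.arg_eq_zero_iff.1 h0.symm).2,
        Complex.arg_lt_pi_iff.2 (Or.inr hz.ne')⟩
    rw [abs_lt]
    rcases hs with hs | hs
    · have h1 := key _ (hs i hi.le)
      have h2 := key _ (hs (i + 1) hi)
      constructor <;> linarith
    · constructor <;> linarith [arg_neg_iff.2 (hs i hi.le), arg_neg_iff.2 (hs (i + 1) hi),
        neg_pi_lt_arg (orbit T i P - orbit T i O),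
        neg_pi_lt_arg (orbit T (i + 1) P - orbit T (i + 1) O)]
  rw [Finset.sum_congr rfl this,
    Finset.sum_range_sub (fun i => arg (orbit T i P - orbit T i O))]
  rfl

end NearIdentity

/-- Otherwise `g` would take an intermediate value congruent to π modulo 2π. This is the homotopy
invariance behind all rotation counts below. -/
lemma eq_of_continuousOn_of_coe_eq_zero {S : Set ℝ} (hS : IsPreconnected S)
    (hg : ContinuousOn g S) (h0 : ∀ s ∈ S, (g s : Angle) = 0) {t : ℝ} (hs : s ∈ S)
    (ht : t ∈ S) : g s = g t := by
  have key : ∀ s ∈ S, ∀ t ∈ S, ¬ g s < g t := by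
    intro s hs t ht hlt
    obtain ⟨n, hn⟩ := Angle.angle_eq_iff_two_pi_dvd_sub.1 ((h0 t ht).trans (h0 s hs).symm)
    have hn0 : (0 : ℝ) < n := not_le.1 fun hc => by
      linarith [mul_nonpos_of_nonneg_of_nonpos two_pi_pos.le hc]
    have hn1 : (1 : ℝ) ≤ n := by exact_mod_cast (show 0 < n by exact_mod_cast hn0)
    obtain ⟨r, hr, hre⟩ := hS.intermediate_value hs ht hg
      (show g s + π ∈ _ by constructor <;> nlinarith [pi_pos])
    have h2 := h0 r hr
    rw [hre, Angle.coe_add, h0 s hs, zero_add] at h2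
    exact Angle.pi_ne_zero h2
  exact le_antisymm (not_lt.1 (key t ht s hs)) (not_lt.1 (key s hs t ht))

/-- The boundary of the quadrant `{re ≤ x0, θ0 ≤ im}`, run through towards increasing imaginary
part. -/
def corner (x0 θ0 b : ℝ) : ℂ := ⟨x0 + min b 0, θ0 + max b 0⟩

lemma continuous_corner (x0 θ0 : ℝ) : Continuous (corner x0 θ0) := by
  have h : corner x0 θ0 = fun b => ((x0 + min b 0 : ℝ) : ℂ) + ((θ0 + max b 0 : ℝ) : ℂ) * I := by
    funext b; apply Complex.ext <;> simp [corner]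
  rw [h]; fun_prop

lemma sub_corner_of_exterior (h : x0 < z.re ∨ z.im < θ0) :
    0 < (z - corner x0 θ0 b).re ∨ (z - corner x0 θ0 b).im < 0 := by
  simp only [corner, sub_re, sub_im]
  have := min_le_right b 0
  have := le_max_right b 0
  exact h.imp (fun _ => by linarith) fun _ => by linarith

lemma sub_corner_of_interior (h : z.re < x0 ∧ θ0 < z.im) :
    (z - corner x0 θ0 b).re < 0 ∨ 0 < (z - corner x0 θ0 b).im := by
  simp only [corner, sub_re, sub_im]
  rcases le_total b 0 with hb | hb
  · right; rw [max_eq_right hb]; linarith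
  · left; rw [min_eq_right hb]; linarith

/-- The last point of the boundary of the quadrant whose preimage `O` lies on the real axis. -/
structure IsLastCrossing (T : ℕ → ℂ → ℂ) (n : ℕ) (x0 θ0 b : ℝ) (O : ℂ) : Prop where
  orbit_eq : orbit T n O = corner x0 θ0 b
  im_eq : O.im = 0
  im_pos : ∀ P c, b < c → orbit T n P = corner x0 θ0 c → 0 < P.im

namespace NearIdentity
variable {T : ℕ → ℂ → ℂ} {C : ℝ} (h : NearIdentity T C)
include h

/-- Move the end of the reference orbit up along the corner curve, from the end of `O` to infinity.
As `O` is the last crossing, the starts `Ψ c` stay in the closed upper half plane, so `P - Ψ c`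
stays in the closed lower one, where `lowerArg` is continuous; the end differences stay in `S`,
where `α` is continuous. The two sides therefore differ by a constant, which vanishes once the
reference orbit is far above `P`. -/
lemma totalRotation_lower (hO : IsLastCrossing T n x0 θ0 b O)
    {α : ℂ → ℝ} {S : Set ℂ} (hS0 : (0 : ℂ) ∉ S) (hα : ContinuousOn α S)
    (hcoe : ∀ w ∈ S, (α w : Angle) = arg w) (hneg : ∀ w ∈ S, w.im < 0 → α w = arg w) (hP : P.im ≤ 0)
    (hS : ∀ c, orbit T n P - corner x0 θ0 c ∈ S) :
    totalRotation T n P O = α (orbit T n P - corner x0 θ0 b) - lowerArg (P - O) := by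
  obtain ⟨e, he⟩ := h.exists_homeomorph n
  set Ψ : ℝ → ℂ := fun c => e.symm (corner x0 θ0 c) with hΨ
  have hΨc : Continuous Ψ := e.symm.continuous.comp (continuous_corner _ _)
  have hΨo : ∀ c, orbit T n (Ψ c) = corner x0 θ0 c := fun c => by rw [← he]; simp [hΨ]
  have hΨb : Ψ b = O := e.injective (by rw [he, he, hΨo, hO.orbit_eq])
  have hne : ∀ c, P ≠ Ψ c := fun c hc => hS0 (by
    have := hS c; rwa [hc, hΨo, sub_self] at this)
  have him : ∀ c ∈ Ici b, 0 ≤ (Ψ c).im := by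
    intro c hc
    rcases (mem_Ici.1 hc).eq_or_lt with h1 | h1
    · rw [← h1, hΨb, hO.im_eq]
    · exact (hO.im_pos _ c h1 (hΨo c)).le
  set g : ℝ → ℝ := fun c => totalRotation T n P (Ψ c) - α (orbit T n P - corner x0 θ0 c)
    + lowerArg (P - Ψ c) with hg
  have hgc : ContinuousOn g (Ici b) := by
    refine ContinuousOn.add (ContinuousOn.sub ?_ ?_) ?_
    · exact (h.continuousOn_totalRotation n).comp (f := fun c => (P, Ψ c))
        (by fun_prop) (fun c _ => hne c)
    · refine hα.comp (f := fun c => orbit T n P - corner x0 θ0 c) ?_ fun c _ => hS c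
      have := continuous_corner x0 θ0
      fun_prop
    · exact continuousOn_lowerArg.comp (f := fun c => P - Ψ c) (by fun_prop) fun c hc =>
        ⟨by rw [sub_im]; linarith [him c hc], sub_ne_zero.2 (hne c)⟩
  have hg0 : ∀ c ∈ Ici b, (g c : Angle) = 0 := by
    intro c _
    simp only [hg, Angle.coe_add, Angle.coe_sub, h.coe_totalRotation (hne c),
      hcoe _ (hS c), coe_lowerArg, hΨo]
    abel
  -- Three displacements `n * C` have to be beaten: that of the orbit of `P`, that of the orbit of
  -- `Ψ c1`, and the one from the end of the latter orbit back to its start.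
  set c1 : ℝ := max (max b 0) (P.im - θ0 + 3 * (n * C) + 1)
  have hnC : 0 ≤ n * C := mul_nonneg n.cast_nonneg h.disp_nonneg
  have hall : ∀ i ≤ n, (orbit T i P - orbit T i (Ψ c1)).im < 0 := by
    intro i hi
    have h1 := (abs_im_le_norm _).trans (h.dist_orbit_le' hi P)
    have h2 := (abs_im_le_norm _).trans (h.dist_orbit_le' hi (Ψ c1))
    have h3 := (abs_im_le_norm _).trans (h.dist_orbit_le' (le_refl n) (Ψ c1))
    rw [hΨo] at h3
    have h4 : (corner x0 θ0 c1).im = θ0 + c1 := by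
      simp only [corner]; rw [max_eq_left]; exact (le_max_right _ _).trans (le_max_left _ _)
    have h5 : P.im - θ0 + 3 * (n * C) + 1 ≤ c1 := le_max_right _ _
    rw [sub_im, abs_le] at h1 h2 h3
    rw [sub_im]
    linarith [h1.2, h2.1, h3.2]
  have hg1 : g c1 = 0 := by
    simp only [hg]
    rw [h.totalRotation_eq (hne _) (Or.inr hall), hΨo]
    rw [hneg _ (hS _) (hΨo c1 ▸ hall n le_rfl),
      lowerArg_eq_arg (show (P - Ψ c1).im < 0 from hall 0 n.zero_le)]
    ring
  have := eq_of_continuousOn_of_coe_eq_zero isPreconnected_Ici hgc hg0 (self_mem_Ici (a := b))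
    (show c1 ∈ Ici b from mem_Ici.2 ((le_max_left _ _).trans (le_max_left (max b 0) _)))
  rw [hg1] at this
  simp only [hg, hΨb] at this
  linarith

/-- The case of a point of the upper half plane: move its endpoint vertically until its starting
point reaches the real axis. -/
lemma totalRotation_upper (hO : IsLastCrossing T n x0 θ0 b O)
    {α : ℂ → ℝ} {S : Set ℂ} (hS0 : (0 : ℂ) ∉ S) (hα : ContinuousOn α S)
    (hcoe : ∀ w ∈ S, (α w : Angle) = arg w)
    (hneg : ∀ w ∈ S, w.im < 0 → α w = arg w) {σ : ℝ} (hP : 0 < P.im)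
    (hS : ∀ s, 0 ≤ s → ∀ c, orbit T n P + (σ * s : ℝ) * I - corner x0 θ0 c ∈ S)
    {g0 : ℝ} (hg₀ : g0 = totalRotation T n P O - α (orbit T n P - corner x0 θ0 b) + arg (P - O)) :
    (g0 = 0 ∨ g0 = 2 * π) ∧
    (∃ s, 0 ≤ s ∧ ∃ P', orbit T n P' = orbit T n P + (σ * s : ℝ) * I ∧ P'.im ≤ 0) ∨
    (∀ s, 0 ≤ s → ∃ P', P' ≠ O ∧ orbit T n P' = orbit T n P + (σ * s : ℝ) * I ∧ 0 < P'.im ∧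
        g0 = totalRotation T n P' O - α (orbit T n P' - corner x0 θ0 b) + arg (P' - O)) := by
  obtain ⟨e, he⟩ := h.exists_homeomorph n
  set γ : ℝ → ℂ := fun s => e.symm (orbit T n P + (σ * s : ℝ) * I) with hγ
  have hγc : Continuous γ := e.symm.continuous.comp (by fun_prop)
  have hγo : ∀ s, orbit T n (γ s) = orbit T n P + (σ * s : ℝ) * I := fun s => by
    rw [← he]; simp [hγ]
  have hγ0 : γ 0 = P := e.injective (by rw [he, hγo, he]; simp)
  have hne : ∀ s, 0 ≤ s → γ s ≠ O := fun s hs hc => hS0 (by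
    have := hS s hs b; rwa [← hγo, hc, hO.orbit_eq, sub_self] at this)
  set g : ℝ → ℝ := fun s => totalRotation T n (γ s) O - α (orbit T n (γ s) - corner x0 θ0 b)
    + arg (γ s - O) with hg
  have hg00 : g 0 = g0 := by simp only [hg, hγ0, hg₀]
  have key : ∀ s, 0 ≤ s → (∀ t ∈ Icc 0 s, 0 ≤ (γ t).im) → g s = g0 := by
    intro s hs hpos
    have hgc : ContinuousOn g (Icc 0 s) := by
      refine ContinuousOn.add (ContinuousOn.sub ?_ ?_) ?_
      · exact (h.continuousOn_totalRotation n).comp (f := fun s => (γ s, O))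
          (by fun_prop) (fun s hs => hne s hs.1)
      · have := h.continuous_orbit n
        exact hα.comp (f := fun s => orbit T n (γ s) - corner x0 θ0 b) (by fun_prop) fun s hs => by
          simp only [hγo]; exact hS s hs.1 b
      · exact continuousOn_arg_upper.comp (f := fun s => γ s - O) (by fun_prop) fun s hs =>
          ⟨by rw [sub_im, hO.im_eq]; linarith [hpos s hs], sub_ne_zero.2 (hne s hs.1)⟩
    have hg0 : ∀ u ∈ Icc 0 s, (g u : Angle) = 0 := by
      intro s hs
      have h1 := hS s hs.1 b
      rw [← hγo] at h1
      simp only [hg, Angle.coe_add, Angle.coe_sub, h.coe_totalRotation (hne s hs.1),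
        hcoe _ h1, hO.orbit_eq]
      abel
    rw [← hg00]
    exact eq_of_continuousOn_of_coe_eq_zero isPreconnected_Icc hgc hg0 (right_mem_Icc.2 hs)
      (left_mem_Icc.2 hs)
  by_cases hex : ∃ s, 0 ≤ s ∧ (γ s).im ≤ 0
  · left
    obtain ⟨s, hs, hsi⟩ := hex
    refine ⟨?_, s, hs, γ s, hγo s, hsi⟩
    -- At the first time when the start reaches the real axis, both the continuation through the
    -- upper half plane and `totalRotation_lower` apply. Their branches differ by `arg - lowerArg`,
    -- which is 0 or 2π.
    obtain ⟨t, ⟨⟨ht0, hts⟩, hti⟩, htmin⟩ := (isCompact_Icc.inter_right (isClosed_le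
      (continuous_im.comp hγc) continuous_const)).exists_isLeast ⟨s, ⟨hs, le_rfl⟩, hsi⟩
    have hbefore : ∀ u, 0 ≤ u → u < t → 0 < (γ u).im := fun u hu hut => not_le.1 fun hc =>
      (htmin ⟨⟨hu, hut.le.trans hts⟩, hc⟩).not_gt hut
    have ht00 : 0 < t := ht0.lt_of_ne fun h1 => hP.not_ge (by
      rw [← h1] at hti; rw [← hγ0]; exact hti)
    have hti0 : (γ t).im = 0 := le_antisymm hti <| ge_of_tendsto
      (((continuous_im.comp hγc).tendsto t).mono_left nhdsWithin_le_nhds) <| by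
      filter_upwards [Ioo_mem_nhdsLT ht00] with u hu using (hbefore u hu.1.le hu.2).le
    have h1 := key t ht0 fun u hu => hu.2.eq_or_lt.elim (fun h2 => by rw [h2, hti0])
      fun h2 => (hbefore u hu.1 h2).le
    have h2 := h.totalRotation_lower hO hS0 hα hcoe hneg hti (P := γ t) (fun c => by
      rw [hγo]; exact hS t ht0 c)
    rw [← h1]
    simp only [hg]
    rw [h2]
    exact (arg_sub_lowerArg (z := γ t - O)).imp (fun _ => by linarith) fun _ => by linarith
  · right
    push Not at hex
    intro s hs
    exact ⟨γ s, hne s hs, hγo s, hex s hs, (key s hs fun t ht => (hex t ht.1).le).symm⟩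

/-- The number of branch crossings of the difference with the distinguished orbit, bounded by the
position of the end point. -/
lemma sum_branchCrossing_le {θ1 : ℝ}
    (hO : IsLastCrossing T n x0 θ0 b O) (hθ1 : ∀ P, θ1 < (orbit T n P).im → 0 < P.im) (hP : P.im ≠ 0) (hre : (orbit T n P).re ≠ x0) (him : (orbit T n P).im ≠ θ0) :
    ∑ i ∈ Finset.range n, branchCrossing (orbit T i P - orbit T i O)
      (orbit T (i + 1) P - orbit T (i + 1) O) ≤
    if (orbit T n P).re ≤ x0 ∧ θ0 ≤ (orbit T n P).im ∧ (orbit T n P).im ≤ θ1 then 1 else 0 := by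
  rw [sum_branchCrossing, div_le_iff₀ two_pi_pos, hO.orbit_eq]
  have hnC : 0 ≤ n * C := mul_nonneg n.cast_nonneg h.disp_nonneg
  -- Seen from the boundary of the quadrant, an interior end point avoids the directions `re ≥ 0, im
  -- ≤ 0`, so the branch cut at angle `-π/4` is continuous; an exterior one avoids `re ≤ 0, im ≥ 0`,
  -- so the principal branch is. In the exterior case no positive count can arise.
  by_cases hint : (orbit T n P).re < x0 ∧ θ0 < (orbit T n P).im
  · have hw := sub_corner_of_interior (b := b) hint
    have hw0 : orbit T n P - corner x0 θ0 b ≠ 0 := by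
      intro h0; rw [h0] at hw; simp at hw
    have hS0 : (0 : ℂ) ∉ {z : ℂ | z.re < 0 ∨ 0 < z.im} := by simp
    have hcoe : ∀ w ∈ {z : ℂ | z.re < 0 ∨ 0 < z.im}, (rotatedArg w : Angle) = arg w :=
      fun w hw => coe_rotatedArg fun h0 => hS0 (h0 ▸ hw)
    have hneg : ∀ w ∈ {z : ℂ | z.re < 0 ∨ 0 < z.im}, w.im < 0 → rotatedArg w = arg w :=
      fun w hw hi => rotatedArg_of_im_neg hi hw
    have hcase := arg_sub_rotatedArg hw0 hw
    rcases lt_or_gt_of_ne hP with hP | hP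
    · have h1 := h.totalRotation_lower hO hS0 continuousOn_rotatedArg hcoe hneg hP.le
        fun c => sub_corner_of_interior hint
      have h2 : (P - O).im < 0 := by rw [sub_im, hO.im_eq]; linarith
      rw [lowerArg_eq_arg h2] at h1
      have h3 : (orbit T n P).im ≤ θ1 := not_lt.1 fun hc => by linarith [hθ1 P hc]
      rw [if_pos ⟨hint.1.le, hint.2.le, h3⟩, h1]
      rcases hcase with h4 | h4 <;> linarith [pi_pos]
    · obtain ⟨g0, hg0⟩ : ∃ g0, g0 = totalRotation T n P O -
        rotatedArg (orbit T n P - corner x0 θ0 b) + arg (P - O) := ⟨_, rfl⟩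
      have hS : ∀ s : ℝ, 0 ≤ s → ∀ c, orbit T n P + ((1 : ℝ) * s : ℝ) * I - corner x0 θ0 c ∈
          {z : ℂ | z.re < 0 ∨ 0 < z.im} := fun s hs c => by
        apply sub_corner_of_interior
        simp only [one_mul, add_re, Complex.mul_re, Complex.I_re, Complex.I_im,
          add_im, Complex.mul_im, ofReal_re, ofReal_im]
        constructor <;> linarith [hint.1, hint.2]
      have hno : (∀ s, 0 ≤ s → ∃ P', P' ≠ O ∧ orbit T n P' =
          orbit T n P + ((1 : ℝ) * s : ℝ) * I ∧
          0 < P'.im ∧ g0 = totalRotation T n P' O - rotatedArg (orbit T n P' - corner x0 θ0 b) +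
            arg (P' - O)) → g0 = 2 * π := by
        intro hall
        -- High enough to beat the displacements of both orbits, so that all differences with the
        -- orbit of `O` lie in the upper half plane and the rotation is a difference of principal
        -- arguments.
        set s : ℝ := max 0 (2 * (n * C) + 1 - (orbit T n P).im) + max 0 (θ0 + max b 0 - (orbit T n P).im)
          + |(corner x0 θ0 b).im| + n * C + 1
        have hs0 : 0 ≤ s := by positivity
        obtain ⟨P', hne, ho, hpos, hg⟩ := hall s hs0
        have hI : (orbit T n P').im = (orbit T n P).im + s := by rw [ho]; simp
        have hend : ∀ i ≤ n, 0 < (orbit T i P' - orbit T i O).im := by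
          intro i hi
          have h1 := (abs_im_le_norm _).trans (h.dist_orbit_le' hi P')
          have h2 := (abs_im_le_norm _).trans (h.dist_orbit_le' hi O)
          have h3 := (abs_im_le_norm _).trans (h.dist_orbit_le' (le_refl n) P')
          rw [sub_im, abs_le] at h1 h2 h3
          rw [sub_im]
          have h4 := le_max_right 0 (2 * (n * C) + 1 - (orbit T n P).im)
          have h5 := le_max_left 0 (θ0 + max b 0 - (orbit T n P).im)
          have h6 := abs_nonneg (corner x0 θ0 b).im
          have h7 := hO.im_eq
          linarith [h1.1, h2.2, h3.2]
        rw [hg, h.totalRotation_eq hne (Or.inl hend), hO.orbit_eq]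
        have h1 := hend n le_rfl
        rw [hO.orbit_eq] at h1
        have h2 : orbit T n P' - corner x0 θ0 b ≠ 0 := fun h0 => by rw [h0] at h1; simp at h1
        have h3 := arg_sub_rotatedArg h2 (Or.inr h1)
        have h4 := arg_nonneg_iff.2 h1.le
        have h5 := rotatedArg_bounds (orbit T n P' - corner x0 θ0 b)
        rcases h3 with h3 | h3 <;> linarith [pi_pos]
      by_cases hI : (orbit T n P).im ≤ θ1
      · rw [if_pos ⟨hint.1.le, hint.2.le, hI⟩]
        have hg2 : g0 = 0 ∨ g0 = 2 * π :=
          (h.totalRotation_upper hO hS0 continuousOn_rotatedArg hcoe hneg hP hS hg0).elim (·.1)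
            fun h1 => Or.inr (hno h1)
        rcases hcase with h4 | h4 <;> rcases hg2 with h5 | h5 <;> linarith [pi_pos]
      -- Above `θ1` the upward path never brings the start to the real axis, by `hθ1`. Hence `g0 =
      -- 2π`, which cancels the possible gain from the choice of branch.
      · rw [if_neg (fun h => hI h.2.2)]
        push Not at hI
        have hg2 : g0 = 2 * π := by
          rcases h.totalRotation_upper hO hS0 continuousOn_rotatedArg hcoe hneg hP hS hg0 with h1 | h1
          · obtain ⟨s, hs, P', ho, hi⟩ := h1.2
            linarith [hθ1 P' (by rw [ho]; simp; linarith)]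
          · exact hno h1
        rcases hcase with h4 | h4 <;> linarith [pi_pos]
  · have hext : x0 < (orbit T n P).re ∨ (orbit T n P).im < θ0 := by
      by_contra! hc
      exact hint ⟨hc.1.lt_of_ne hre, hc.2.lt_of_ne him.symm⟩
    rw [if_neg (fun hh => by rcases hext with h1 | h1 <;> linarith [hh.1, hh.2.1])]
    set S : Set ℂ := {z : ℂ | 0 < z.re ∨ z.im < 0}
    have hS0 : (0 : ℂ) ∉ S := by simp [S]
    have hcont : ContinuousOn arg S := fun z hz => (continuousAt_arg
      (mem_slitPlane_iff.2 (hz.imp_right fun h => h.ne))).continuousWithinAt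
    rcases lt_or_gt_of_ne hP with hP | hP
    · have h1 := h.totalRotation_lower hO hS0 hcont (fun _ _ => rfl) (fun _ _ _ => rfl) hP.le
        fun c => sub_corner_of_exterior hext
      have h2 : (P - O).im < 0 := by rw [sub_im, hO.im_eq]; linarith
      rw [lowerArg_eq_arg h2] at h1
      rw [h1]; linarith
    · obtain ⟨g0, hg0⟩ : ∃ g0, g0 = totalRotation T n P O -
        arg (orbit T n P - corner x0 θ0 b) + arg (P - O) := ⟨_, rfl⟩
      have hS : ∀ s : ℝ, 0 ≤ s → ∀ c, orbit T n P + ((-1 : ℝ) * s : ℝ) * I - corner x0 θ0 c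
          ∈ S := fun s hs c => by
        apply sub_corner_of_exterior
        simp only [add_re, Complex.mul_re, Complex.I_re, Complex.I_im,
          add_im, Complex.mul_im, ofReal_re, ofReal_im]
        exact hext.imp (fun _ => by linarith) fun _ => by linarith
      have hg2 : g0 = 0 ∨ g0 = 2 * π := by
        rcases h.totalRotation_upper hO hS0 hcont (fun _ _ => rfl) (fun _ _ _ => rfl) hP hS hg0
          with h1 | h1
        · exact h1.1
        · exfalso
          obtain ⟨P', hne, ho, hpos, -⟩ := h1 (|(orbit T n P).im| + n * C + 1) (by positivity)
          have h3 := (abs_im_le_norm _).trans (h.dist_orbit_le' (le_refl n) P')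
          have hI : (orbit T n P').im = (orbit T n P).im - (|(orbit T n P).im| + n * C + 1) := by
            rw [ho]; simp; ring
          rw [sub_im, abs_le, hI] at h3
          linarith [h3.1, le_abs_self (orbit T n P).im]
      rcases hg2 with h5 | h5 <;> linarith [pi_pos]

/-- The image of the real axis is inside the quadrant far to the left, by `hlin` and `θ0 < 0`, and
outside far to the right, so it meets the boundary. The parameters of boundary points whose
preimages have nonpositive imaginary part form a closed set that is bounded above; its supremum is
the last crossing. -/
lemma exists_isLastCrossing (hθ0 : θ0 < 0) (hlin : ∃ x1 : ℝ, ∀ x < x1, 0 ≤ (orbit T n x).im) :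
    ∃ b O, IsLastCrossing T n x0 θ0 b O := by
  obtain ⟨e, he⟩ := h.exists_homeomorph n
  set Ψ : ℝ → ℂ := fun c => e.symm (corner x0 θ0 c) with hΨ
  have hΨc : Continuous Ψ := e.symm.continuous.comp (continuous_corner _ _)
  have hΨo : ∀ c, orbit T n (Ψ c) = corner x0 θ0 c := fun c => by rw [← he]; simp [hΨ]
  have hnC : 0 ≤ n * C := mul_nonneg n.cast_nonneg h.disp_nonneg
  obtain ⟨x1, hx1⟩ := hlin
  set u : ℝ → ℝ := fun x => max ((orbit T n x).re - x0) (θ0 - (orbit T n x).im) with hu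
  have huc : Continuous u := by
    have := h.continuous_orbit n
    simp only [hu]
    fun_prop
  have hlow : u (min (x1 - 1) (x0 - n * C - 1)) < 0 := by
    simp only [hu]
    set x := min (x1 - 1) (x0 - n * C - 1)
    have h1 := (abs_re_le_norm _).trans (h.dist_orbit_le' (le_refl n) (x : ℂ))
    rw [sub_re, ofReal_re, abs_le] at h1
    have h2 : x ≤ x1 - 1 := min_le_left _ _
    have h3 : x ≤ x0 - n * C - 1 := min_le_right _ _
    have h4 := hx1 x (by linarith)
    apply max_lt <;> linarith [h1.2]
  have hhigh : 0 < u (x0 + n * C + 1) := by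
    simp only [hu]
    have h1 := (abs_re_le_norm _).trans
      (h.dist_orbit_le' (le_refl n) ((x0 + n * C + 1 : ℝ) : ℂ))
    rw [sub_re, ofReal_re, abs_le] at h1
    exact lt_max_of_lt_left (by linarith [h1.1])
  obtain ⟨x, hx⟩ := mem_range_of_exists_le_of_exists_ge huc ⟨_, hlow.le⟩ ⟨_, hhigh.le⟩
  obtain ⟨c, hc⟩ : ∃ c, corner x0 θ0 c = orbit T n x := by
    simp only [hu] at hx
    have h1 := le_max_left ((orbit T n x).re - x0) (θ0 - (orbit T n x).im)
    have h2 := le_max_right ((orbit T n x).re - x0) (θ0 - (orbit T n x).im)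
    rw [hx] at h1 h2
    rcases max_choice ((orbit T n x).re - x0) (θ0 - (orbit T n x).im) with h3 | h3 <;> rw [hx] at h3
    · refine ⟨(orbit T n x).im - θ0, ?_⟩
      rw [corner, min_eq_right (by linarith), max_eq_left (by linarith)]
      apply Complex.ext <;> linarith
    · refine ⟨(orbit T n x).re - x0, ?_⟩
      rw [corner, min_eq_left (by linarith), max_eq_right (by linarith)]
      apply Complex.ext <;> linarith
  set A : Set ℝ := {c | (Ψ c).im ≤ 0} with hA
  have hcA : c ∈ A := by
    have : Ψ c = x := e.injective (by rw [he, he, hΨo, hc])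
    simp [hA, this]
  have hbdd : BddAbove A := by
    refine ⟨max 0 (n * C - θ0), fun d hd => not_lt.1 fun hlt => ?_⟩
    have h3 := (abs_im_le_norm _).trans (h.dist_orbit_le' (le_refl n) (Ψ d))
    have h4 : (corner x0 θ0 d).im = θ0 + d := by
      simp only [corner]; rw [max_eq_left]; exact ((le_max_left _ _).trans_lt hlt).le
    rw [hΨo, sub_im, abs_le, h4] at h3
    linarith [h3.2, show (Ψ d).im ≤ 0 from hd, (le_max_right 0 (n * C - θ0)).trans_lt hlt]
  have hmem : sSup A ∈ A :=
    (isClosed_le (continuous_im.comp hΨc) continuous_const).csSup_mem ⟨c, hcA⟩ hbdd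
  have hpos : ∀ d, sSup A < d → 0 < (Ψ d).im := fun d hd => not_le.1 fun hle =>
    (le_csSup hbdd hle).not_gt hd
  refine ⟨sSup A, Ψ (sSup A), hΨo _, le_antisymm hmem ?_, fun P d hd hP => ?_⟩
  · exact ge_of_tendsto (((continuous_im.comp hΨc).tendsto _).mono_left
      (nhdsWithin_le_nhds (s := Ioi _))) (eventually_mem_nhdsWithin.mono fun d hd => (hpos d hd).le)
  · rw [show P = Ψ d from e.injective (by rw [he, he, hΨo, hP])]; exact hpos d hd

end NearIdentity

/-! ### Shears in logarithmic coordinates -/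

/-- The lift to logarithmic coordinates of the shear `z ↦ z + a (im z)`. -/
def liftedShear (a : ℝ → ℝ) (ζ : ℂ) : ℂ :=
  ζ + Complex.log (1 + a (exp ζ).im * exp (-ζ))

/-- A Lipschitz function with small Lipschitz constant, vanishing at the origin. -/
structure SmallField (a : ℝ → ℝ) : Prop where
  zero : a 0 = 0
  lip : ∀ x y, |a x - a y| ≤ 1 / 32 * |x - y|

namespace SmallField
variable (ha : SmallField a)
include ha

lemma abs_le (x : ℝ) : |a x| ≤ 1 / 32 * |x| := by
  have := ha.lip x 0
  rwa [ha.zero, sub_zero, sub_zero] at this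

lemma continuous : Continuous a := by
  have : LipschitzWith (1 / 32) a := by
    refine LipschitzWith.of_dist_le_mul fun x y => ?_
    rw [dist_eq, dist_eq]
    simpa using ha.lip x y
  exact this.continuous

lemma smul {τ : ℝ} (h0 : 0 ≤ τ) (h1 : τ ≤ 1) : SmallField fun x => τ * a x := by
  refine ⟨by simp [ha.zero], fun x y => ?_⟩
  rw [← mul_sub, abs_mul, abs_of_nonneg h0]
  calc τ * |a x - a y| ≤ 1 * |a x - a y| := by gcongr
    _ ≤ _ := by rw [one_mul]; exact ha.lip x y

end SmallField

lemma norm_field_mul_exp_le {κ : ℝ} (ha : ∀ x, |a x| ≤ κ * |x|) (ζ : ℂ) :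
    ‖(a (exp ζ).im : ℂ) * exp (-ζ)‖ ≤ κ := by
  rw [norm_mul, Complex.norm_real, norm_eq_abs, Complex.exp_neg, norm_inv]
  have h0 : 0 < ‖exp ζ‖ := norm_pos_iff.2 (exp_ne_zero _)
  rw [← div_eq_mul_inv, div_le_iff₀ h0]
  have hκ : 0 ≤ κ := by have := (abs_nonneg _).trans (ha 1); simpa using this
  exact (ha _).trans (mul_le_mul_of_nonneg_left (abs_im_le_norm _) hκ)

lemma norm_liftedShear_sub_le {κ : ℝ} (hκ : κ ≤ 1 / 2) (ha : ∀ x, |a x| ≤ κ * |x|)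
    (ζ : ℂ) : ‖liftedShear a ζ - ζ‖ ≤ 2 * κ := by
  unfold liftedShear
  rw [add_sub_cancel_left]
  have h1 := norm_field_mul_exp_le ha ζ
  have h2 := Complex.norm_log_one_add_half_le_self (h1.trans hκ)
  have := norm_nonneg ((a (exp ζ).im : ℂ) * exp (-ζ))
  linarith

lemma one_add_ne_zero_of_norm_lt {u : ℂ} (hu : ‖u‖ < 1) : 1 + u ≠ 0 := by
  intro h
  have : u = -1 := by linear_combination h
  rw [this] at hu; simp at hu

lemma exp_liftedShear (ha : SmallField a) (ζ : ℂ) :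
    exp (liftedShear a ζ) = exp ζ + a (exp ζ).im := by
  have h1 := norm_field_mul_exp_le ha.abs_le ζ
  unfold liftedShear
  rw [exp_add, Complex.exp_log (one_add_ne_zero_of_norm_lt (by linarith)), mul_add,
    mul_one, mul_left_comm, ← exp_add]
  simp

lemma norm_log_one_add_sub_le {u u' : ℂ} (hu : ‖u‖ ≤ 1 / 2) (hu' : ‖u'‖ ≤ 1 / 2) :
    ‖Complex.log (1 + u) - Complex.log (1 + u')‖ ≤ 2 * ‖u - u'‖ := by
  have hmem : ∀ x ∈ Metric.closedBall (0 : ℂ) (1 / 2), 1 + x ∈ slitPlane := by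
    intro x hx
    apply Complex.mem_slitPlane_of_norm_lt_one
    rw [mem_closedBall_zero_iff] at hx; linarith
  refine Convex.norm_image_sub_le_of_norm_hasDerivWithin_le (f := fun x => Complex.log (1 + x))
    (f' := fun x => 1 / (1 + x)) (s := Metric.closedBall (0 : ℂ) (1 / 2)) ?_ ?_
    (convex_closedBall _ _) (by simpa using hu') (by simpa using hu)
  · intro x hx
    exact (((hasDerivAt_id x).const_add 1).clog (hmem x hx)).hasDerivWithinAt
  · intro x hx
    rw [mem_closedBall_zero_iff] at hx
    rw [norm_div, norm_one, div_le_iff₀ (norm_pos_iff.2 (one_add_ne_zero_of_norm_lt (by linarith)))]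
    have := norm_sub_le_norm_add (1 : ℂ) x
    rw [norm_one] at this
    linarith

lemma liftedShear_lip (ha : SmallField a) (P P' : ℂ) :
    ‖(liftedShear a P - liftedShear a P') - (P - P')‖ ≤ 1 / 4 * ‖P - P'‖ := by
  have h1 := norm_field_mul_exp_le ha.abs_le P
  have h2 := norm_field_mul_exp_le ha.abs_le P'
  set u := (a (exp P).im : ℂ) * exp (-P) with hu
  set u' := (a (exp P').im : ℂ) * exp (-P') with hu'
  have h3 : ‖u - u'‖ ≤ 1 / 8 * ‖P - P'‖ := by
    -- For distant points the size 1/32 of each correction is enough. For close points the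
    -- difference splits into a variation of the field and a variation of `exp`, both controlled by
    -- `‖exp w - 1‖ ≤ 2 ‖w‖`.
    rcases le_total 1 ‖P - P'‖ with h | h
    · calc ‖u - u'‖ ≤ ‖u‖ + ‖u'‖ := norm_sub_le _ _
        _ ≤ 1 / 8 * ‖P - P'‖ := by linarith
    · have e1 : u - u' = ((a (exp P).im - a (exp P').im : ℝ) : ℂ) * exp (-P)
          + (a (exp P').im : ℂ) * exp (-P') * (exp (-(P - P')) - 1) := by
        rw [mul_sub, mul_assoc _ _ (exp (-(P - P'))), ← exp_add,
          show -P' + -(P - P') = -P by ring, hu, hu']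
        push_cast; ring
      have e2 : ‖((a (exp P).im - a (exp P').im : ℝ) : ℂ) * exp (-P)‖ ≤
          1 / 32 * ‖exp (-(P - P')) - 1‖ := by
        rw [norm_mul, Complex.norm_real, norm_eq_abs]
        have : |(exp P).im - (exp P').im| ≤ ‖exp P - exp P'‖ := by
          rw [← sub_im]; exact abs_im_le_norm _
        calc _ ≤ 1 / 32 * |(exp P).im - (exp P').im| * ‖exp (-P)‖ := by
              gcongr; exact ha.lip _ _
          _ ≤ 1 / 32 * ‖exp P - exp P'‖ * ‖exp (-P)‖ := by gcongr
          _ = 1 / 32 * ‖exp (-(P - P')) - 1‖ := by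
            rw [mul_assoc, ← norm_mul, ← norm_neg (exp (-(P - P')) - 1), sub_mul,
              ← exp_add, ← exp_add]
            congr 2
            rw [add_neg_cancel, Complex.exp_zero, show P' + -P = -(P - P') by ring]
            ring
      have e3 : ‖exp (-(P - P')) - 1‖ ≤ 2 * ‖P - P'‖ := by
        have := Complex.norm_exp_sub_one_le (x := -(P - P')) (by rwa [norm_neg])
        rwa [norm_neg] at this
      rw [e1]
      refine (norm_add_le _ _).trans ?_
      rw [norm_mul u']
      have : ‖u'‖ * ‖exp (-(P - P')) - 1‖ ≤ 1 / 32 * ‖exp (-(P - P')) - 1‖ := by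
        gcongr
      linarith
  have h4 := norm_log_one_add_sub_le (u := u) (u' := u') (by linarith) (by linarith)
  have h5 : (liftedShear a P - liftedShear a P') - (P - P') =
      Complex.log (1 + u) - Complex.log (1 + u') := by
    unfold liftedShear; ring
  rw [h5]; linarith

/-- The crossing number of a step is read off from the half planes of its end points. -/
lemma branchCrossing_eq {D D' : ℂ} (hD : D ≠ 0) (h : ‖D' - D‖ ≤ 1 / 4 * ‖D‖) :
    branchCrossing D D' = if D.re < 0 then
      ((if 0 ≤ D'.im then 1 else 0) - (if 0 ≤ D.im then 1 else 0)) else 0 := by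
  have hD0 : 0 < ‖D‖ := norm_pos_iff.2 hD
  have hD' : D' ≠ 0 := by
    intro h0; rw [h0, zero_sub, norm_neg] at h; linarith
  have hu : ‖D' / D - 1‖ ≤ 1 / 4 := by
    rw [div_sub_one hD, norm_div, div_le_iff₀ hD0]; exact h
  have hre : 0 < (D' / D).re := by
    have := (abs_re_le_norm _).trans hu
    rw [_root_.abs_le, sub_re, Complex.one_re] at this
    linarith
  have harg := abs_lt.1 (Complex.abs_arg_lt_pi_div_two_iff.2 (Or.inl hre))
  obtain ⟨n, hn⟩ := Angle.angle_eq_iff_two_pi_dvd_sub.1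
    (by rw [arg_div_coe_angle hD' hD]; simp : ((arg D' - arg D : ℝ) : Angle) = arg (D' / D))
  have hval : branchCrossing D D' = n := by
    unfold branchCrossing
    rw [hn]; field_simp [Real.pi_ne_zero]
  have hpi := pi_pos
  have b1 := neg_pi_lt_arg D
  have b2 := arg_le_pi D
  have b3 := neg_pi_lt_arg D'
  have b4 := arg_le_pi D'
  have hint : ∀ m : ℤ, |(n : ℝ) - m| < 1 → (n : ℝ) = m := by
    intro m hm
    have : |n - m| < 1 := by exact_mod_cast hm
    have := Int.abs_lt_one_iff.1 this
    exact_mod_cast (sub_eq_zero.1 this)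
  have hdiff : 2 * π * n = arg D' - arg D - arg (D' / D) := hn.symm
  have hlt : ∀ m : ℤ, |2 * π * n - 2 * π * m| < 2 * π → (n : ℝ) = m := by
    intro m hm
    apply hint
    rw [← mul_sub, abs_mul, abs_of_pos two_pi_pos] at hm
    by_contra hc; push Not at hc
    nlinarith
  have hr2 := (abs_re_le_norm _).trans h
  have hi2 := (abs_im_le_norm _).trans h
  rw [sub_re] at hr2
  rw [sub_im] at hi2
  rw [hval]
  have hsame : (0 ≤ D'.im ↔ 0 ≤ D.im) → (n : ℝ) = 0 := by
    intro hs
    have := hlt 0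
    simp only [Int.cast_zero, mul_zero, sub_zero] at this
    apply this
    rw [hdiff]
    by_cases hh : 0 ≤ D.im
    · have a1 := arg_nonneg_iff.2 hh
      have a2 := arg_nonneg_iff.2 (hs.2 hh)
      rw [abs_lt]; constructor <;> linarith
    · have a1 := arg_neg_iff.2 (not_le.1 hh)
      have a2 := arg_neg_iff.2 (not_le.1 fun hc => hh (hs.1 hc))
      rw [abs_lt]; constructor <;> linarith
  split_ifs with h1 h2 h3 h3
  · rw [hsame (by tauto)]; norm_num
  · -- from the lower to the upper half plane
    have a1 := arg_neg_iff.2 (not_le.1 h3)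
    have a2 := arg_nonneg_iff.2 h2
    have a3 : ¬ |arg D| ≤ π / 2 := by
      rw [abs_arg_le_pi_div_two_iff]; exact not_le.2 h1
    rw [abs_of_neg a1] at a3
    rw [hlt 1 ?_]
    · norm_num
    · rw [hdiff, abs_lt]; push_cast; constructor <;> linarith
  · have a1 := arg_neg_iff.2 (not_le.1 h2)
    have a2 := arg_nonneg_iff.2 h3
    have a3 : ¬ |arg D| ≤ π / 2 := by
      rw [abs_arg_le_pi_div_two_iff]; exact not_le.2 h1
    rw [abs_of_nonneg a2] at a3
    rw [hlt (-1) ?_]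
    · norm_num
    · rw [hdiff, abs_lt]; push_cast; constructor <;> linarith
  · rw [hsame (by tauto)]; norm_num
  · push Not at h1
    have a1 := _root_.abs_le.1 (abs_arg_le_pi_div_two_iff.2 h1)
    have := hlt 0
    simp only [Int.cast_zero, mul_zero, sub_zero] at this
    apply this
    rw [hdiff, abs_lt]
    constructor <;> linarith

/-! ### Area on the logarithmic cover and the mean number of crossings -/

open MeasureTheory

/-- The pull-back of the area by the exponential map. -/
def coverMeasure : Measure ℂ :=
  volume.withDensity fun ζ => ENNReal.ofReal (‖exp ζ‖ ^ 2)

lemma volume_exp_image {s : Set ℂ} (hs : MeasurableSet s) (hinj : InjOn exp s) :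
    volume (exp '' s) = coverMeasure s := by
  have h1 := lintegral_image_eq_lintegral_abs_det_fderiv_mul volume hs
    (fun x _ => ((Complex.hasDerivAt_exp x).hasFDerivAt.restrictScalars ℝ).hasFDerivWithinAt)
    hinj (fun _ => 1)
  rw [setLIntegral_one] at h1
  rw [h1, coverMeasure, withDensity_apply _ hs]
  refine lintegral_congr fun x => ?_
  simp [ContinuousLinearMap.det, LinearMap.det_restrictScalars, Algebra.norm_complex_eq,
    Complex.normSq_eq_norm_sq]

lemma map_exp_restrict {s : Set ℂ} (hs : MeasurableSet s) (hinj : InjOn exp s) :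
    Measure.map exp (coverMeasure.restrict s) = volume.restrict (exp '' s) := by
  ext A hA
  have hm : Measurable exp := continuous_exp.measurable
  rw [Measure.map_apply hm hA, Measure.restrict_apply (hm hA), Measure.restrict_apply hA,
    ← volume_exp_image ((hm hA).inter hs) (hinj.mono inter_subset_right), image_preimage_inter]

lemma measurePreserving_shear (ha : Continuous a) :
    MeasurePreserving (fun z : ℂ => z + a z.im) volume volume := by
  have h1 : MeasurePreserving (fun p : ℝ × ℝ => (p.1, p.2 + a p.1)) (volume.prod volume)
      (volume.prod volume) := by
    refine (MeasurePreserving.id (volume : Measure ℝ)).skew_product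
      (g := fun w v => v + a w) ?_ ?_
    · have : Continuous (Function.uncurry fun w v : ℝ => v + a w) := by
        simp only [Function.uncurry_def]; fun_prop
      exact this.measurable
    · exact Eventually.of_forall fun w => (measurePreserving_add_right volume (a w)).map_eq
  have h2 : MeasurePreserving (fun p : ℝ × ℝ => (p.1 + a p.2, p.2)) volume volume := by
    rw [Measure.volume_eq_prod]
    exact (Measure.measurePreserving_swap.comp h1).comp Measure.measurePreserving_swap
  have h3 := (volume_preserving_equiv_real_prod.symm _).comp
    (h2.comp volume_preserving_equiv_real_prod)
  have h4 : (fun z : ℂ => z + a z.im) = measurableEquivRealProd.symm ∘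
      (fun p : ℝ × ℝ => (p.1 + a p.2, p.2)) ∘ measurableEquivRealProd := by
    funext z
    apply Complex.ext <;> simp [measurableEquivRealProd]
  rw [h4]; exact h3

lemma eq_of_exp_eq {x y : ℂ} (h : exp x = exp y) (h' : |x.im - y.im| < 2 * π) :
    x = y := by
  obtain ⟨n, hn⟩ := Complex.exp_eq_exp_iff_exists_int.1 h
  have him : x.im - y.im = 2 * π * n := by
    rw [hn]; simp; ring
  rw [him, abs_mul, abs_of_pos two_pi_pos] at h'
  have h1 : |(n : ℝ)| < 1 := by
    by_contra hc; push Not at hc; nlinarith [two_pi_pos]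
  have h2 : |n| < 1 := by exact_mod_cast h1
  rw [hn, Int.abs_lt_one_iff.1 h2]; simp

lemma SmallField.norm_sub_le (ha : SmallField a) (ζ : ℂ) :
    ‖liftedShear a ζ - ζ‖ ≤ 1 / 16 := by
  have := norm_liftedShear_sub_le (by norm_num) ha.abs_le ζ
  linarith

lemma nearIdentity_liftedShear (ha : SmallField a) :
    NearIdentity (fun _ => liftedShear a) (1 / 16) :=
  ⟨fun _ => liftedShear_lip ha, fun _ => ha.norm_sub_le⟩

lemma SmallField.surjective (ha : SmallField a) :
    Function.Surjective (liftedShear a) := by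
  obtain ⟨e, he⟩ := (nearIdentity_liftedShear ha).exists_homeomorph 1
  intro z
  obtain ⟨x, hx⟩ := e.surjective z
  exact ⟨x, by rw [← hx, he]; rfl⟩

lemma SmallField.continuous_liftedShear (ha : SmallField a) :
    Continuous (liftedShear a) := (nearIdentity_liftedShear ha).continuous_step 0

lemma SmallField.shear_injective : Function.Injective (fun z : ℂ => z + a z.im) := by
  intro z z' h
  have him : z.im = z'.im := by simpa using congrArg Complex.im h
  simp only [him] at h
  exact add_right_cancel h

lemma SmallField.im_exp (ha : SmallField a) (ζ : ℂ) :
    (exp (liftedShear a ζ)).im = (exp ζ).im := by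
  rw [exp_liftedShear ha]; simp

/-- The shear preserves `im z`, hence both the real axis, which it fixes pointwise near each ray
because `a 0 = 0`, and the half planes. Its lift moves points by at most 1/16 and so preserves each
strip of height π, on which `exp` is injective. -/
lemma SmallField.floor_eq (ha : SmallField a) (ζ : ℂ) :
    ⌊(liftedShear a ζ).im / π⌋ = ⌊ζ.im / π⌋ := by
  set k := ⌊ζ.im / π⌋ with hk
  have hpi := Real.pi_gt_three
  have h1 := Int.floor_le (ζ.im / π)
  have h2 := Int.lt_floor_add_one (ζ.im / π)
  rw [← hk] at h1 h2
  rw [le_div_iff₀ pi_pos] at h1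
  rw [div_lt_iff₀ pi_pos] at h2
  have h3 := (abs_im_le_norm _).trans (ha.norm_sub_le ζ)
  rw [sub_im, _root_.abs_le] at h3
  have him := ha.im_exp ζ
  rw [exp_im, exp_im] at him
  rcases eq_or_lt_of_le h1 with h4 | h4
  · have : liftedShear a ζ = ζ := by
      unfold liftedShear
      rw [exp_im, ← h4, Real.sin_int_mul_pi, mul_zero, ha.zero]; simp
    rw [this]
  · have e1 : ∀ y : ℝ, sin y = (-1) ^ k * sin (y - k * π) := by
      intro y
      rw [Real.sin_sub_int_mul_pi, ← mul_assoc, ← mul_zpow]; norm_num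
    have e2 : Real.exp (liftedShear a ζ).re * sin ((liftedShear a ζ).im - k * π) =
        Real.exp ζ.re * sin (ζ.im - k * π) := by
      rw [e1, e1 ζ.im, mul_left_comm, mul_left_comm (Real.exp ζ.re)] at him
      exact mul_left_cancel₀ (zpow_ne_zero _ (by norm_num)) him
    have e3 : 0 < sin ((liftedShear a ζ).im - k * π) := by
      have : 0 < sin (ζ.im - k * π) := Real.sin_pos_of_pos_of_lt_pi (by linarith) (by linarith)
      have h5 : 0 < Real.exp (liftedShear a ζ).re * sin ((liftedShear a ζ).im - k * π) := by
        rw [e2]; positivity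
      exact pos_of_mul_pos_right h5 (exp_pos _).le
    rw [Int.floor_eq_iff, le_div_iff₀ pi_pos, div_lt_iff₀ pi_pos]
    constructor
    · by_contra hc; push Not at hc
      have := Real.sin_nonpos_of_nonpos_of_neg_pi_le
        (x := (liftedShear a ζ).im - k * π) (by linarith) (by linarith [h3.1])
      linarith
    · by_contra hc; push Not at hc
      have h6 := Real.sin_nonpos_of_nonpos_of_neg_pi_le
        (x := (liftedShear a ζ).im - k * π - 2 * π) (by linarith) (by linarith)
      rw [Real.sin_sub_two_pi] at h6
      linarith

lemma measurableSet_floor (k : ℤ) : MeasurableSet {ζ : ℂ | ⌊ζ.im / π⌋ = k} := by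
  have : Measurable fun ζ : ℂ => ⌊ζ.im / π⌋ :=
    Int.measurable_floor.comp (Complex.measurable_im.div_const _)
  exact this (measurableSet_singleton k)

/-- On each strip of height π the cover measure is the area of the image under `exp`, and the strips
are preserved. The claim thus reduces to the area preservation of the shear in the plane. -/
lemma SmallField.measurePreserving (ha : SmallField a) :
    MeasurePreserving (liftedShear a) coverMeasure coverMeasure := by
  have hT := ha.continuous_liftedShear.measurable
  refine ⟨hT, ?_⟩
  ext A hA
  rw [Measure.map_apply hT hA]
  set V : ℤ → Set ℂ := fun k => {ζ : ℂ | ⌊ζ.im / π⌋ = k}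
  have hV : ∀ k, MeasurableSet (V k) := measurableSet_floor
  have hsum : ∀ B : Set ℂ, MeasurableSet B → coverMeasure B = ∑' k, coverMeasure (B ∩ V k) := by
    intro B hB
    rw [← measure_iUnion]
    · congr 1
      ext z; simp [V]
    · intro i j hij
      rw [Function.onFun, Set.disjoint_left]
      rintro z ⟨-, h1⟩ ⟨-, h2⟩
      exact hij (h1.symm.trans h2)
    · exact fun k => hB.inter (hV k)
  rw [hsum A hA, hsum _ (hT hA)]
  congr 1
  funext k
  have hinj : InjOn exp (V k) := by
    intro x hx y hy hxy
    refine eq_of_exp_eq hxy ?_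
    have hx : ⌊x.im / π⌋ = k := hx
    have hy : ⌊y.im / π⌋ = k := hy
    rw [Int.floor_eq_iff, le_div_iff₀ pi_pos, div_lt_iff₀ pi_pos] at hx hy
    have := pi_pos
    rw [abs_lt]; constructor <;> linarith [hx.1, hx.2, hy.1, hy.2]
  have hpre : liftedShear a ⁻¹' A ∩ V k = liftedShear a ⁻¹' (A ∩ V k) := by
    ext z; simp [V, ha.floor_eq]
  have him : exp '' (liftedShear a ⁻¹' (A ∩ V k)) =
      (fun z : ℂ => z + a z.im) ⁻¹' (exp '' (A ∩ V k)) := by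
    ext z
    constructor
    · rintro ⟨ζ, hζ, rfl⟩
      exact ⟨liftedShear a ζ, hζ, exp_liftedShear ha ζ⟩
    · rintro ⟨ζ', hζ', he⟩
      obtain ⟨ζ, rfl⟩ := ha.surjective ζ'
      refine ⟨ζ, hζ', ?_⟩
      rw [exp_liftedShear ha] at he
      exact SmallField.shear_injective he
  have hAk : MeasurableSet (exp '' (A ∩ V k)) :=
    (hA.inter (hV k)).image_of_continuousOn_injOn continuous_exp.continuousOn
      (hinj.mono inter_subset_right)
  rw [← volume_exp_image ((hT hA).inter (hV k)) (hinj.mono inter_subset_right), hpre, him,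
    (measurePreserving_shear ha.continuous).measure_preimage hAk.nullMeasurableSet,
    volume_exp_image (hA.inter (hV k)) (hinj.mono inter_subset_right)]

/-- The cross product `ẑ × z`. -/
def cross (o z : ℂ) : ℝ := o.re * z.im - o.im * z.re

/-- The crossing number of a shear, in terms of the points of the plane. -/
def planeCrossing (a : ℝ → ℝ) (o z : ℂ) : ℝ :=
  if 0 < z.im / o.im ∧ z.im / o.im < 1 then
    (if 0 ≤ cross (o + a o.im) (z + a z.im) then 1 else 0) - (if 0 ≤ cross o z then 1 else 0)
  else 0

lemma cross_exp (P O : ℂ) : cross (exp O) (exp P) =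
    Real.exp P.re * Real.exp O.re * sin (P - O).im := by
  rw [cross, sub_im, Real.sin_sub, exp_re, exp_re, exp_im,
    exp_im]
  ring

lemma cross_nonneg_iff (h : |(P - O).im| < π) :
    0 ≤ cross (exp O) (exp P) ↔ 0 ≤ (P - O).im := by
  rw [cross_exp, mul_nonneg_iff_of_pos_left (by positivity)]
  rw [abs_lt] at h
  constructor
  · intro h1; by_contra hc; push Not at hc
    linarith [Real.sin_neg_of_neg_of_neg_pi_lt hc h.1]
  · intro h1; exact Real.sin_nonneg_of_nonneg_of_le_pi h1 h.2.le

lemma cross_shear (a : ℝ → ℝ) (o z : ℂ) : cross (o + a o.im) (z + a z.im) =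
    cross o z + (a o.im * z.im - o.im * a z.im) := by
  simp [cross]; ring

/-- A crossing of the negative real axis by `P - O` means that `z = exp P` passes through the
segment from `0` to `o = exp O` as both move: equal angles, smaller modulus. At an intermediate
shear `τ a` the points lie on one ray; their imaginary parts are unchanged, so `im z / im o` is the
ratio of the moduli there, and it is below 1 exactly if `re (P - O) < 0`. -/
lemma branchCrossing_liftedShear (ha : SmallField a) (hPO : P ≠ O) :
    branchCrossing (P - O) (liftedShear a P - liftedShear a O) =
      {P : ℂ | |(P - O).im| < π / 2}.indicator
        (fun P => planeCrossing a (exp O) (exp P)) P := by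
  have hpi := Real.pi_gt_three
  have hlip : ∀ τ : ℝ, 0 ≤ τ → τ ≤ 1 → ‖(liftedShear (fun x => τ * a x) P -
      liftedShear (fun x => τ * a x) O) - (P - O)‖ ≤ 1 / 4 * ‖P - O‖ :=
    fun τ h0 h1 => liftedShear_lip (ha.smul h0 h1) P O
  have hnear : ∀ τ : ℝ, 0 ≤ τ → τ ≤ 1 → |(liftedShear (fun x => τ * a x) P -
      liftedShear (fun x => τ * a x) O).im - (P - O).im| ≤ 1 / 8 := by
    intro τ h0 h1
    have e1 := (abs_im_le_norm _).trans ((ha.smul h0 h1).norm_sub_le P)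
    have e2 := (abs_im_le_norm _).trans ((ha.smul h0 h1).norm_sub_le O)
    rw [sub_im, _root_.abs_le] at e1 e2
    rw [sub_im, sub_im, _root_.abs_le]
    constructor <;> linarith [e1.1, e1.2, e2.1, e2.2]
  have h1 : ‖(liftedShear a P - liftedShear a O) - (P - O)‖ ≤ 1 / 4 * ‖P - O‖ :=
    liftedShear_lip ha P O
  have h2 : |(liftedShear a P - liftedShear a O).im - (P - O).im| ≤ 1 / 8 := by
    simpa only [one_mul] using hnear 1 zero_le_one le_rfl
  rw [branchCrossing_eq (sub_ne_zero.2 hPO) h1]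
  have hD0 : 0 < ‖P - O‖ := norm_pos_iff.2 (sub_ne_zero.2 hPO)
  rw [_root_.abs_le] at h2
  by_cases hs : |(P - O).im| < π / 2
  · rw [indicator_of_mem (by exact hs)]
    rw [abs_lt] at hs
    have c0 := cross_nonneg_iff (P := P) (O := O) (abs_lt.2 ⟨by linarith, by linarith⟩)
    have c1 := cross_nonneg_iff (P := liftedShear a P) (O := liftedShear a O)
      (abs_lt.2 ⟨by linarith, by linarith⟩)
    rw [exp_liftedShear ha, exp_liftedShear ha] at c1
    unfold planeCrossing
    simp only [c0, c1]
    by_cases hsame : 0 ≤ (liftedShear a P - liftedShear a O).im ↔ 0 ≤ (P - O).im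
    · simp only [hsame, sub_self, ite_self]
    have hdiff : cross (exp O) (exp P) ≠
        cross (exp O + a (exp O).im) (exp P + a (exp P).im) := by
      intro he; rw [he] at c0; exact hsame (c1.symm.trans c0)
    set k0 := cross (exp O) (exp P) with hk0
    set k1 := cross (exp O + a (exp O).im) (exp P + a (exp P).im)
      with hk1
    -- By `cross_shear` the cross product of the points sheared by `τ a` is affine in `τ`; it
    -- changes sign, so it has a zero in `[0, 1]`.
    obtain ⟨τ, hτ0, hτ1, hτ⟩ : ∃ τ : ℝ, 0 ≤ τ ∧ τ ≤ 1 ∧ k0 + τ * (k1 - k0) = 0 := by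
      have hd : k0 - k1 ≠ 0 := sub_ne_zero.2 hdiff
      refine ⟨k0 / (k0 - k1), ?_, ?_, by field_simp; ring⟩
      · by_cases h : 0 ≤ k0
        · have : k1 < 0 := by by_contra hc; push Not at hc; exact hsame (by rw [← c1, ← c0]; tauto)
          exact div_nonneg h (by linarith)
        · have : 0 ≤ k1 := by by_contra hc; exact hsame (by rw [← c1, ← c0]; tauto)
          exact div_nonneg_of_nonpos (by linarith) (by linarith)
      · by_cases h : 0 ≤ k0
        · have : k1 < 0 := by by_contra hc; push Not at hc; exact hsame (by rw [← c1, ← c0]; tauto)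
          rw [div_le_one (by linarith)]; linarith
        · have : 0 ≤ k1 := by by_contra hc; exact hsame (by rw [← c1, ← c0]; tauto)
          rw [div_le_one_of_neg (by linarith)]; linarith
    set P' := liftedShear (fun x => τ * a x) P with hP'
    set O' := liftedShear (fun x => τ * a x) O with hO'
    have hn := hnear τ hτ0 hτ1
    have hl := hlip τ hτ0 hτ1
    rw [← hP', ← hO'] at hn hl
    rw [_root_.abs_le] at hn
    have hsin : sin (P' - O').im = 0 := by
      have e1 := cross_exp P' O'
      have e2 : cross (exp O') (exp P') = 0 := by
        rw [hP', hO', exp_liftedShear (ha.smul hτ0 hτ1), exp_liftedShear (ha.smul hτ0 hτ1),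
          cross_shear (fun x => τ * a x), ← hτ, hk1, cross_shear]
        ring
      rw [e2] at e1
      have : Real.exp P'.re * Real.exp O'.re ≠ 0 := by positivity
      exact (mul_eq_zero.1 e1.symm).resolve_left this
    have him : (P' - O').im = 0 :=
      (Real.sin_eq_zero_iff_of_lt_of_lt (by linarith) (by linarith)).1 hsin
    have hexp : exp P' = exp O' * Real.exp (P' - O').re := by
      rw [Complex.ofReal_exp, ← exp_add]
      congr 1
      apply Complex.ext
      · simp
      · simp only [add_im, ofReal_im]
        rw [sub_im] at him; linarith
    have hw : (exp P).im = (exp O).im * Real.exp (P' - O').re := by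
      rw [← (ha.smul hτ0 hτ1).im_exp P, ← (ha.smul hτ0 hτ1).im_exp O, ← hP', ← hO', hexp]
      rw [Complex.im_mul_ofReal]
    have hw0 : (exp O).im ≠ 0 := by
      intro h0
      rw [h0, zero_mul] at hw
      apply hdiff
      rw [hk1, cross_shear, h0, hw, ha.zero]; ring
    have hrat : (exp P).im / (exp O).im = Real.exp (P' - O').re := by
      rw [hw]; field_simp
    have hiff : (P - O).re < 0 ↔ (P' - O').re < 0 := by
      have e1 := (abs_re_le_norm _).trans hl
      have e2 := (abs_im_le_norm _).trans hl
      rw [sub_im (P' - O'), him, zero_sub, abs_neg] at e2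
      rw [sub_re (P' - O'), _root_.abs_le] at e1
      have e3 := Complex.norm_le_abs_re_add_abs_im (P - O)
      constructor
      · intro h; rw [abs_of_neg h] at e3; linarith
      · intro h; by_contra hc; push Not at hc; rw [abs_of_nonneg hc] at e3; linarith
    have hcond : (0 < (exp P).im / (exp O).im ∧
        (exp P).im / (exp O).im < 1) ↔ (P - O).re < 0 := by
      rw [hrat, hiff, Real.exp_lt_one_iff]
      exact and_iff_right (exp_pos _)
    simp only [hcond]
  · rw [indicator_of_notMem (by exact hs)]
    have : (0 ≤ (liftedShear a P - liftedShear a O).im) ↔ 0 ≤ (P - O).im := by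
      push Not at hs
      rcases le_abs'.1 hs with h | h
      · constructor <;> intro h' <;> exfalso <;> linarith
      · constructor <;> intro h' <;> linarith
    simp only [this, sub_self, ite_self]

lemma integral_ite_le_sub (c d : ℝ) :
    ∫ v : ℝ, ((if v ≤ c then (1 : ℝ) else 0) - (if v ≤ d then 1 else 0)) = c - d := by
  have h : (fun v : ℝ => ((if v ≤ c then (1 : ℝ) else 0) - (if v ≤ d then 1 else 0))) =
      fun v => (Ioc d c).indicator (fun _ => (1 : ℝ)) v - (Ioc c d).indicator (fun _ => (1 : ℝ)) v := by
    funext v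
    simp only [indicator_apply, mem_Ioc]
    split_ifs <;> grind
  rw [h, integral_sub, integral_indicator_const _ measurableSet_Ioc,
    integral_indicator_const _ measurableSet_Ioc]
  · simp only [Measure.real, Real.volume_Ioc, smul_eq_mul, mul_one]
    rcases le_total c d with h | h
    · rw [ENNReal.ofReal_of_nonpos (by linarith), ENNReal.toReal_ofReal (by linarith)]; simp
    · rw [ENNReal.toReal_ofReal (by linarith), ENNReal.ofReal_of_nonpos (by linarith)]; simp
  · exact (integrable_indicator_iff measurableSet_Ioc).2 (by simp [integrableOn_const_iff])
  · exact (integrable_indicator_iff measurableSet_Ioc).2 (by simp [integrableOn_const_iff])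

lemma abs_planeCrossing_le (a : ℝ → ℝ) (o z : ℂ) : |planeCrossing a o z| ≤ 1 := by
  unfold planeCrossing
  split_ifs <;> norm_num

lemma measurable_planeCrossing (ha : Continuous a) (o : ℂ) :
    Measurable (planeCrossing a o) := by
  unfold planeCrossing cross
  refine Measurable.ite ?_ (Measurable.sub (Measurable.ite ?_ measurable_const measurable_const)
    (Measurable.ite ?_ measurable_const measurable_const)) measurable_const
  · have h1 : MeasurableSet {z : ℂ | 0 < z.im / o.im} := measurableSet_lt (by fun_prop) (by fun_prop)
    have h2 : MeasurableSet {z : ℂ | z.im / o.im < 1} := measurableSet_lt (by fun_prop) (by fun_prop)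
    exact h1.inter h2
  · refine measurableSet_le measurable_const (Continuous.measurable ?_)
    have := Complex.continuous_re
    have := continuous_im
    fun_prop
  · refine measurableSet_le measurable_const (Continuous.measurable ?_)
    fun_prop

/-- The points with a nonzero crossing number form a bounded set in the half plane of `o`. -/
lemma planeCrossing_support (ha : SmallField a) {o : ℂ}
    (h : planeCrossing a o z ≠ 0) : 0 < o.re * z.re + o.im * z.im ∧
      |z.im| ≤ |o.im| ∧ |z.re| ≤ |o.re| + |o.im| := by
  unfold planeCrossing at h
  split_ifs at h with h1 h2 h3 h3
  · norm_num at h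
  all_goals try norm_num at h
  all_goals
    rw [cross_shear] at h2
    obtain ⟨l0, l1⟩ := h1
    have ho : o.im ≠ 0 := by intro h0; rw [h0] at l0; simp at l0
    set l := z.im / o.im with hl
    have hz : z.im = l * o.im := by rw [hl]; field_simp
    have hc : |cross o z| ≤ 1 / 16 * (l * o.im ^ 2) := by
      have e1 : |a o.im * z.im| ≤ 1 / 32 * (l * o.im ^ 2) := by
        rw [abs_mul, hz, abs_mul, abs_of_pos l0]
        calc |a o.im| * (l * |o.im|) ≤ (1 / 32 * |o.im|) * (l * |o.im|) := by
              gcongr; exact ha.abs_le _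
          _ = 1 / 32 * (l * |o.im| ^ 2) := by ring
          _ = _ := by rw [sq_abs]
      have e2 : |o.im * a z.im| ≤ 1 / 32 * (l * o.im ^ 2) := by
        rw [abs_mul]
        calc |o.im| * |a z.im| ≤ |o.im| * (1 / 32 * |z.im|) := by
              gcongr; exact ha.abs_le _
          _ = 1 / 32 * (l * |o.im| ^ 2) := by rw [hz, abs_mul, abs_of_pos l0]; ring
          _ = _ := by rw [sq_abs]
      rw [abs_le] at e1 e2 ⊢
      constructor <;> linarith
    have hre : z.re = l * o.re - cross o z / o.im := by
      unfold cross; rw [hz]; field_simp; ring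
    have hq : |cross o z / o.im| ≤ 1 / 16 * (l * |o.im|) := by
      rw [abs_div, div_le_iff₀ (abs_pos.2 ho)]
      calc _ ≤ 1 / 16 * (l * o.im ^ 2) := hc
        _ = _ := by rw [← sq_abs]; ring
    refine ⟨?_, ?_, ?_⟩
    · have e1 : |o.re * (cross o z / o.im)| ≤ |o.re| * (1 / 16 * (l * |o.im|)) := by
        rw [abs_mul]; gcongr
      have e2 : |o.re| * |o.im| ≤ o.re ^ 2 + o.im ^ 2 := by
        rw [← sq_abs o.re, ← sq_abs o.im]
        nlinarith [sq_nonneg (|o.re| - |o.im|), sq_nonneg (|o.re|), sq_nonneg (|o.im|)]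
      have e3 : 0 < o.re ^ 2 + o.im ^ 2 := by positivity
      rw [hre, hz]
      rw [abs_le] at e1
      have e4 : l * (|o.re| * |o.im|) ≤ l * (o.re ^ 2 + o.im ^ 2) := by gcongr
      have e5 : 0 < l * (o.re ^ 2 + o.im ^ 2) := by positivity
      nlinarith [e1.2]
    · rw [hz, abs_mul, abs_of_pos l0]
      exact mul_le_of_le_one_left (abs_nonneg _) l1.le
    · rw [hre]
      refine (abs_sub _ _).trans (add_le_add ?_ (hq.trans ?_))
      · rw [abs_mul, abs_of_pos l0]
        exact mul_le_of_le_one_left (abs_nonneg _) l1.le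
      · have := mul_le_of_le_one_left (abs_nonneg o.im) l1.le
        linarith [abs_nonneg o.im]

lemma integrable_planeCrossing (ha : SmallField a) (o : ℂ) :
    Integrable (planeCrossing a o) := by
  set K : Set ℂ := Metric.closedBall 0 (|o.re| + |o.im| + |o.im|)
  have hsupp : ∀ z, z ∉ K → planeCrossing a o z = 0 := by
    intro z hz
    by_contra hne
    obtain ⟨-, h1, h2⟩ := planeCrossing_support ha hne
    apply hz
    rw [mem_closedBall_zero_iff]
    exact (Complex.norm_le_abs_re_add_abs_im z).trans (by linarith)
  have : IntegrableOn (planeCrossing a o) K := by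
    refine Measure.integrableOn_of_bounded (M := 1) (isCompact_closedBall _ _).measure_lt_top.ne
      (measurable_planeCrossing ha.continuous o).aestronglyMeasurable ?_
    exact Eventually.of_forall fun z => abs_planeCrossing_le a o z
  exact this.integrable_of_forall_notMem_eq_zero hsupp

/-- On the line `im z = w` with `0 < w < im o`, the points that cross fill the interval between the
segment to `o` and the pulled back segment to the image of `o`. Its signed length is `a (im o) w /
im o - a w`, and integration in `w` gives the right-hand side. -/
lemma integral_planeCrossing_of_pos (ha : SmallField a) {o : ℂ} (ho : 0 < o.im) :
    ∫ z, planeCrossing a o z = o.im * a o.im / 2 - ∫ t in (0 : ℝ)..o.im, a t := by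
  have hmp := volume_preserving_equiv_real_prod.symm
  rw [← hmp.integral_comp']
  have hint : Integrable (fun p : ℝ × ℝ => planeCrossing a o (measurableEquivRealProd.symm p))
      (volume.prod volume) := by
    rw [← Measure.volume_eq_prod]
    exact (hmp.integrable_comp_emb (MeasurableEquiv.measurableEmbedding _)).2
      (integrable_planeCrossing ha o)
  rw [Measure.volume_eq_prod, integral_prod_symm _ hint]
  have hin : ∀ w : ℝ, ∫ v : ℝ, planeCrossing a o (measurableEquivRealProd.symm (v, w)) =
      (Ioo 0 o.im).indicator (fun w => a o.im / o.im * w - a w) w := by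
    intro w
    have e : ∀ v : ℝ, planeCrossing a o (measurableEquivRealProd.symm (v, w)) =
        if w ∈ Ioo 0 o.im then ((if v ≤ (o.re + a o.im) * w / o.im - a w then (1 : ℝ) else 0) -
          (if v ≤ o.re * w / o.im then 1 else 0)) else 0 := by
      intro v
      have e1 : (measurableEquivRealProd.symm (v, w) : ℂ) = ⟨v, w⟩ := rfl
      rw [e1]
      unfold planeCrossing cross
      have e2 : (0 < w / o.im ∧ w / o.im < 1) ↔ w ∈ Ioo 0 o.im := by
        rw [mem_Ioo, div_lt_one ho, div_pos_iff_of_pos_right ho]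
      simp only [add_re, ofReal_re, add_im, ofReal_im, add_zero, e2]
      have e3 : (0 ≤ (o.re + a o.im) * w - o.im * (v + a w)) ↔
          v ≤ (o.re + a o.im) * w / o.im - a w := by
        rw [sub_nonneg, le_sub_iff_add_le, le_div_iff₀ ho, mul_comm o.im]
      have e4 : (0 ≤ o.re * w - o.im * v) ↔ v ≤ o.re * w / o.im := by
        rw [sub_nonneg, le_div_iff₀ ho, mul_comm o.im]
      simp only [e3, e4]
    simp only [e]
    by_cases hw : w ∈ Ioo 0 o.im
    · simp only [if_pos hw, indicator_of_mem hw]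
      rw [integral_ite_le_sub]
      field_simp; ring
    · simp only [if_neg hw, indicator_of_notMem hw, integral_zero]
  simp only [hin]
  rw [integral_indicator measurableSet_Ioo, ← integral_Ioc_eq_integral_Ioo,
    ← intervalIntegral.integral_of_le ho.le, intervalIntegral.integral_sub,
    intervalIntegral.integral_const_mul, integral_id]
  · field_simp; ring
  · apply Continuous.intervalIntegrable; fun_prop
  · exact ha.continuous.intervalIntegrable _ _

lemma integral_planeCrossing (ha : SmallField a) (o : ℂ) :
    ∫ z, planeCrossing a o z = o.im * a o.im / 2 - ∫ t in (0 : ℝ)..o.im, a t := by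
  rcases lt_trichotomy o.im 0 with ho | ho | ho
  · have ha' : SmallField (fun x => -a (-x)) := by
      refine ⟨by simp [ha.zero], fun x y => ?_⟩
      have := ha.lip (-x) (-y)
      rwa [show -a (-x) - -a (-y) = -(a (-x) - a (-y)) by ring, abs_neg,
        show |x - y| = |-x - -y| by rw [← abs_neg]; ring_nf]
    have h1 := integral_planeCrossing_of_pos ha' (o := -o) (by simpa using ho)
    have h2 : ∀ z, planeCrossing (fun x => -a (-x)) (-o) z = planeCrossing a o (-z) := by
      intro z
      unfold planeCrossing cross
      simp only [neg_im, Complex.neg_re, neg_neg, add_re, add_im,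
        ofReal_re, ofReal_im, add_zero, div_neg, neg_div]
      congr 1
      congr 1
      · congr 2; ring
      · congr 2; ring
    simp only [h2] at h1
    rw [integral_neg_eq_self (fun z => planeCrossing a o z)] at h1
    rw [h1]
    simp only [neg_im, neg_neg, intervalIntegral.integral_neg]
    rw [intervalIntegral.integral_comp_neg (fun x => a x), neg_neg, neg_zero,
      intervalIntegral.integral_symm]
    ring
  · have : ∀ z, planeCrossing a o z = 0 := by intro z; simp [planeCrossing, ho]
    simp [this, ho]
  · exact integral_planeCrossing_of_pos ha ho

lemma measurableSet_strip (O : ℂ) : MeasurableSet {P : ℂ | |(P - O).im| < π / 2} := by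
  refine measurableSet_lt (Continuous.measurable ?_) measurable_const
  have := continuous_im
  fun_prop

/-- The strip `|im (P - O)| < π / 2` is mapped injectively by `exp` onto the open half plane around
`exp O`, which contains all points with a nonzero crossing number. The integral over the cover is
thus the one over the plane. -/
lemma integral_branchCrossing_liftedShear (ha : SmallField a) (O : ℂ) :
    Integrable (fun P => branchCrossing (P - O) (liftedShear a P - liftedShear a O)) coverMeasure ∧
    ∫ P, branchCrossing (P - O) (liftedShear a P - liftedShear a O) ∂coverMeasure =
      (exp O).im * a (exp O).im / 2 - ∫ t in (0 : ℝ)..(exp O).im, a t := by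
  set S : Set ℂ := {P : ℂ | |(P - O).im| < π / 2} with hSdef
  have hS : MeasurableSet S := measurableSet_strip O
  have hinj : InjOn exp S := by
    intro x hx y hy hxy
    refine eq_of_exp_eq hxy ?_
    simp only [hSdef, mem_ofPred_eq, sub_im, abs_lt] at hx hy
    rw [abs_lt]; constructor <;> linarith [hx.1, hx.2, hy.1, hy.2, pi_pos]
  set F := planeCrossing a (exp O) with hF
  have hae : (fun P => branchCrossing (P - O) (liftedShear a P - liftedShear a O)) =
      S.indicator (fun P => F (exp P)) := by
    funext P
    by_cases hP : P = O
    · rw [hP, sub_self, sub_self]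
      by_cases hO : O ∈ S
      · rw [indicator_of_mem hO, hF]
        have e : ∀ z : ℂ, ¬ (0 < z.im / z.im ∧ z.im / z.im < 1) := by
          rintro z ⟨h1, h2⟩
          by_cases h0 : z.im = 0
          · rw [h0] at h1; simp at h1
          · rw [div_self h0] at h2; exact lt_irrefl _ h2
        simp only [planeCrossing, if_neg (e _)]
        simp [branchCrossing]
      · rw [indicator_of_notMem hO]; simp [branchCrossing]
    · exact branchCrossing_liftedShear ha hP
  have hmap := map_exp_restrict hS hinj
  have hFm : Measurable F := measurable_planeCrossing ha.continuous _
  have hexp : Measurable exp := continuous_exp.measurable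
  have hsupp : ∀ z, z ∉ exp '' S → F z = 0 := by
    intro z hz
    by_contra hne
    have h1 := (planeCrossing_support ha hne).1
    apply hz
    have hz0 : z ≠ 0 := by rintro rfl; simp at h1
    have hre : 0 < (z / exp O).re := by
      rw [Complex.div_re, ← add_div]
      apply div_pos
      · linarith
      · exact Complex.normSq_pos.2 (exp_ne_zero _)
    refine ⟨O + Complex.log (z / exp O), ?_, ?_⟩
    · simp only [hSdef, mem_ofPred_eq, add_sub_cancel_left, Complex.log_im]
      exact Complex.abs_arg_lt_pi_div_two_iff.2 (Or.inl hre)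
    · rw [exp_add, Complex.exp_log (div_ne_zero hz0 (exp_ne_zero _))]
      field_simp [exp_ne_zero]
  rw [hae]
  constructor
  · rw [integrable_indicator_iff hS, IntegrableOn]
    have : Integrable F (Measure.map exp (coverMeasure.restrict S)) := by
      rw [hmap]; exact (integrable_planeCrossing ha _).restrict
    exact this.comp_measurable hexp
  · rw [integral_indicator hS, ← integral_planeCrossing ha,
      ← integral_map hexp.aemeasurable (f := F) hFm.aestronglyMeasurable, hmap]
    exact setIntegral_eq_integral_of_forall_compl_eq_zero hsupp

/-! ### Turned shears and the bound of the action by an area -/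

/-- The lift of a shear in the direction `e^{-iθ}`: for `θ = 0` this is `z ↦ z + a (im z)`, for
`θ = π/2` it is `z ↦ z - i a (re z)`. -/
def turnedShear (θ : ℝ) (a : ℝ → ℝ) (ζ : ℂ) : ℂ :=
  liftedShear a (ζ + θ * I) - θ * I

lemma turnedShear_sub (θ : ℝ) (a : ℝ → ℝ) (P O : ℂ) : turnedShear θ a P - turnedShear θ a O =
    liftedShear a (P + θ * I) - liftedShear a (O + θ * I) := by
  unfold turnedShear; ring

lemma turnedShear_zero (a : ℝ → ℝ) : turnedShear 0 a = liftedShear a := by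
  funext ζ; simp [turnedShear]

lemma nearIdentity_turnedShear {θ : ℕ → ℝ} {a : ℕ → ℝ → ℝ} (ha : ∀ i, SmallField (a i)) :
    NearIdentity (fun i => turnedShear (θ i) (a i)) (1 / 16) := by
  refine ⟨fun i P P' => ?_, fun i P => ?_⟩
  · rw [turnedShear_sub]
    have := liftedShear_lip (ha i) (P + θ i * I) (P' + θ i * I)
    rwa [add_sub_add_right_eq_sub] at this
  · have := (ha i).norm_sub_le (P + θ i * I)
    rwa [show turnedShear (θ i) (a i) P - P = liftedShear (a i) (P + θ i * I) -
      (P + θ i * I) by unfold turnedShear; ring]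

lemma norm_turnedShear_sub_le {θ : ℝ} {κ : ℝ} (hκ : κ ≤ 1 / 2)
    (ha : ∀ x, |a x| ≤ κ * |x|) (P : ℂ) : ‖turnedShear θ a P - P‖ ≤ 2 * κ := by
  have := norm_liftedShear_sub_le hκ ha (P + θ * I)
  rwa [show turnedShear θ a P - P = liftedShear a (P + θ * I) - (P + θ * I) by
    unfold turnedShear; ring]

lemma measurePreserving_add_coverMeasure (θ : ℝ) :
    MeasurePreserving (fun ζ : ℂ => ζ + θ * I) coverMeasure coverMeasure := by
  have hm : Measurable (fun ζ : ℂ => ζ + θ * I) := by fun_prop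
  refine ⟨hm, ?_⟩
  ext A hA
  rw [Measure.map_apply hm hA, coverMeasure, withDensity_apply _ (hm hA), withDensity_apply _ hA,
    ← (measurePreserving_add_right (volume : Measure ℂ) (θ * I)).setLIntegral_comp_preimage
      hA]
  · refine lintegral_congr fun ζ => ?_
    rw [norm_exp, norm_exp]; simp
  · exact (ENNReal.continuous_ofReal.comp
      (by fun_prop : Continuous fun ζ : ℂ => ‖exp ζ‖ ^ 2)).measurable

lemma SmallField.measurePreserving_turnedShear (ha : SmallField a) (θ : ℝ) :
    MeasurePreserving (turnedShear θ a) coverMeasure coverMeasure := by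
  have h := (measurePreserving_add_coverMeasure (-θ)).comp
    (ha.measurePreserving.comp (measurePreserving_add_coverMeasure θ))
  have e : turnedShear θ a = (fun ζ : ℂ => ζ + ((-θ : ℝ) : ℂ) * I) ∘ liftedShear a ∘
      (fun ζ : ℂ => ζ + θ * I) := by
    funext ζ; simp [turnedShear]; ring
  rw [e]; exact h

lemma integral_branchCrossing_turnedShear (ha : SmallField a) (θ : ℝ) (O : ℂ)
    (hs : s = (exp (O + θ * I)).im) :
    Integrable (fun P => branchCrossing (P - O) (turnedShear θ a P - turnedShear θ a O))
      coverMeasure ∧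
    ∫ P, branchCrossing (P - O) (turnedShear θ a P - turnedShear θ a O) ∂coverMeasure =
      s * a s / 2 - ∫ t in (0 : ℝ)..s, a t := by
  obtain ⟨h1, h2⟩ := integral_branchCrossing_liftedShear ha (O + θ * I)
  have hmp := measurePreserving_add_coverMeasure θ
  have he : MeasurableEmbedding (fun ζ : ℂ => ζ + θ * I) :=
    measurableEmbedding_addRight _
  have e : (fun P => branchCrossing (P - O) (turnedShear θ a P - turnedShear θ a O)) =
      (fun P => branchCrossing (P - (O + θ * I))
        (liftedShear a P - liftedShear a (O + θ * I))) ∘ fun ζ : ℂ => ζ + θ * I := by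
    funext P
    simp only [Function.comp]
    rw [turnedShear_sub, add_sub_add_right_eq_sub]
  rw [hs]
  constructor
  · rw [e]; exact (hmp.integrable_comp_emb he).2 h1
  · rw [← h2, e]
    exact hmp.integral_comp he fun P => branchCrossing (P - (O + θ * I))
        (liftedShear a P - liftedShear a (O + θ * I))

/-- The area, in the plane, of the truncated sector. -/
def sectorArea (x0 θ0 : ℝ) : ℝ :=
  coverMeasure.real {P : ℂ | P.re ≤ x0 ∧ θ0 ≤ P.im ∧ P.im ≤ π / 2}

lemma measurableSet_sector (x0 θ0 : ℝ) :
    MeasurableSet {P : ℂ | P.re ≤ x0 ∧ θ0 ≤ P.im ∧ P.im ≤ π / 2} := by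
  have h : IsClosed {P : ℂ | P.re ≤ x0 ∧ θ0 ≤ P.im ∧ P.im ≤ π / 2} :=
    (isClosed_le Complex.continuous_re continuous_const).inter
      ((isClosed_le continuous_const continuous_im).inter
        (isClosed_le continuous_im continuous_const))
  exact h.measurableSet

/-- The sector meets finitely many strips of height π, and each piece is mapped injectively into the
disc of radius `exp x0`. -/
lemma coverMeasure_sector_lt_top (x0 θ0 : ℝ) :
    coverMeasure {P : ℂ | P.re ≤ x0 ∧ θ0 ≤ P.im ∧ P.im ≤ π / 2} < ⊤ := by
  set V : ℤ → Set ℂ := fun k => {ζ : ℂ | ⌊ζ.im / π⌋ = k} with hVdef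
  have hsub : {P : ℂ | P.re ≤ x0 ∧ θ0 ≤ P.im ∧ P.im ≤ π / 2} ⊆
      ⋃ k ∈ Finset.Icc ⌊θ0 / π⌋ 0,
        {P : ℂ | P.re ≤ x0 ∧ θ0 ≤ P.im ∧ P.im ≤ π / 2} ∩ V k := by
    rintro P ⟨h1, h2, h3⟩
    simp only [mem_iUnion]
    refine ⟨⌊P.im / π⌋, ?_, ⟨h1, h2, h3⟩, rfl⟩
    rw [Finset.mem_Icc]
    constructor
    · exact Int.floor_le_floor (by have := pi_pos; gcongr)
    · rw [← Int.lt_add_one_iff, Int.floor_lt]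
      rw [div_lt_iff₀ pi_pos]; push_cast; linarith [pi_pos]
  refine (measure_mono hsub).trans_lt ((measure_biUnion_finset_le _ _).trans_lt ?_)
  refine ENNReal.sum_lt_top.2 fun k _ => ?_
  have hinj : InjOn exp (V k) := by
    intro x hx y hy hxy
    refine eq_of_exp_eq hxy ?_
    have hx : ⌊x.im / π⌋ = k := hx
    have hy : ⌊y.im / π⌋ = k := hy
    rw [Int.floor_eq_iff, le_div_iff₀ pi_pos, div_lt_iff₀ pi_pos] at hx hy
    have := pi_pos
    rw [abs_lt]; constructor <;> linarith [hx.1, hx.2, hy.1, hy.2]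
  rw [← volume_exp_image ((measurableSet_sector _ _).inter (measurableSet_floor k))
    (hinj.mono inter_subset_right)]
  refine (measure_mono (t := Metric.closedBall 0 (Real.exp x0)) ?_).trans_lt
    (isCompact_closedBall _ _).measure_lt_top
  rintro z ⟨P, ⟨⟨h1, -, -⟩, -⟩, rfl⟩
  rw [mem_closedBall_zero_iff, norm_exp]
  exact exp_le_exp.2 h1

lemma coverMeasure_absolutelyContinuous : coverMeasure ≪ volume :=
  withDensity_absolutelyContinuous _ _

lemma ae_re_ne (c : ℝ) : ∀ᵐ P ∂coverMeasure, P.re ≠ c := by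
  suffices hv : volume {P : ℂ | P.re = c} = 0 by
    have h1 : coverMeasure {P : ℂ | P.re = c} = 0 := coverMeasure_absolutelyContinuous hv
    rw [ae_iff]; simpa only [ne_eq, not_not] using h1
  have h : {P : ℂ | P.re = c} = measurableEquivRealProd ⁻¹' ({c} ×ˢ univ) := by
    ext z; simp [measurableEquivRealProd]
  rw [h, volume_preserving_equiv_real_prod.measure_preimage
    ((measurableSet_singleton c).prod MeasurableSet.univ).nullMeasurableSet,
    Measure.volume_eq_prod, Measure.prod_prod]
  simp

lemma ae_im_ne (c : ℝ) : ∀ᵐ P ∂coverMeasure, P.im ≠ c := by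
  suffices hv : volume {P : ℂ | P.im = c} = 0 by
    have h1 : coverMeasure {P : ℂ | P.im = c} = 0 := coverMeasure_absolutelyContinuous hv
    rw [ae_iff]; simpa only [ne_eq, not_not] using h1
  have h : {P : ℂ | P.im = c} = measurableEquivRealProd ⁻¹' (univ ×ˢ {c}) := by
    ext z; simp [measurableEquivRealProd]
  rw [h, volume_preserving_equiv_real_prod.measure_preimage
    (MeasurableSet.univ.prod (measurableSet_singleton c)).nullMeasurableSet,
    Measure.volume_eq_prod, Measure.prod_prod]
  simp

/-- The area bound: the discrete action along the orbit of the last crossing is at most the area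
of the sector. -/
lemma exists_orbit_action_le {θ : ℕ → ℝ} {a : ℕ → ℝ → ℝ} (ha : ∀ i, SmallField (a i)) (hθ0 : θ0 < 0)
    (hup : ∀ P, π / 2 < (orbit (fun i => turnedShear (θ i) (a i)) n P).im → 0 < P.im)
    (hlin : ∃ x1 : ℝ, ∀ x < x1, 0 ≤ (orbit (fun i => turnedShear (θ i) (a i)) n (x : ℂ)).im) :
    ∃ (b : ℝ) (O : ℂ), O.im = 0 ∧
      orbit (fun i => turnedShear (θ i) (a i)) n O = corner x0 θ0 b ∧
      ∀ s : ℕ → ℝ, (∀ i, s i = (exp (orbit (fun i => turnedShear (θ i) (a i)) i O +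
        θ i * I)).im) →
      ∑ i ∈ Finset.range n, (s i * a i (s i) / 2 - ∫ t in (0 : ℝ)..s i, a i t) ≤
        sectorArea x0 θ0 := by
  set T : ℕ → ℂ → ℂ := fun i => turnedShear (θ i) (a i) with hT
  have h := nearIdentity_turnedShear (θ := θ) ha
  obtain ⟨b, O, hO⟩ := h.exists_isLastCrossing (n := n) (x0 := x0) hθ0 hlin
  refine ⟨b, O, hO.im_eq, hO.orbit_eq, fun s hs => ?_⟩
  have hmp : ∀ i, MeasurePreserving (orbit T i) coverMeasure coverMeasure := by
    intro i
    induction i with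
    | zero => exact MeasurePreserving.id _
    | succ i ih => exact ((ha i).measurePreserving_turnedShear (θ i)).comp ih
  have hemb : ∀ i, MeasurableEmbedding (orbit T i) := by
    intro i
    obtain ⟨e, he⟩ := h.exists_homeomorph i
    have : orbit T i = e := funext fun P => (he P).symm
    rw [this]; exact e.measurableEmbedding
  have hstep : ∀ i, Integrable (fun P => branchCrossing (orbit T i P - orbit T i O)
        (orbit T (i + 1) P - orbit T (i + 1) O)) coverMeasure ∧
      ∫ P, branchCrossing (orbit T i P - orbit T i O)
        (orbit T (i + 1) P - orbit T (i + 1) O) ∂coverMeasure =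
        s i * a i (s i) / 2 - ∫ t in (0 : ℝ)..s i, a i t := by
    intro i
    obtain ⟨h1, h2⟩ := integral_branchCrossing_turnedShear (ha i) (θ i) (orbit T i O) (hs i)
    set G : ℂ → ℝ := fun P => branchCrossing (P - orbit T i O)
      (turnedShear (θ i) (a i) P - turnedShear (θ i) (a i) (orbit T i O)) with hG
    have e : (fun P => branchCrossing (orbit T i P - orbit T i O)
        (orbit T (i + 1) P - orbit T (i + 1) O)) = G ∘ orbit T i := rfl
    rw [e]
    exact ⟨((hmp i).integrable_comp_emb (hemb i)).2 h1, ((hmp i).integral_comp (hemb i) G).trans h2⟩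
  have hsum : ∑ i ∈ Finset.range n, (s i * a i (s i) / 2 - ∫ t in (0 : ℝ)..s i, a i t) =
      ∫ P, ∑ i ∈ Finset.range n, branchCrossing (orbit T i P - orbit T i O)
        (orbit T (i + 1) P - orbit T (i + 1) O) ∂coverMeasure := by
    rw [integral_finsetSum _ fun i _ => (hstep i).1]
    exact Finset.sum_congr rfl fun i _ => (hstep i).2.symm
  rw [hsum]
  set K : Set ℂ := {P : ℂ | P.re ≤ x0 ∧ θ0 ≤ P.im ∧ P.im ≤ π / 2}
  have hK : MeasurableSet K := measurableSet_sector _ _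
  have hKint : Integrable (fun P => K.indicator (fun _ => (1 : ℝ)) (orbit T n P)) coverMeasure := by
    have h1 : Integrable (K.indicator (fun _ => (1 : ℝ))) coverMeasure := by
      rw [integrable_indicator_iff hK, integrableOn_const_iff]
      exact Or.inr (coverMeasure_sector_lt_top _ _)
    exact ((hmp n).integrable_comp_emb (hemb n) (g := K.indicator (fun _ => (1 : ℝ)))).2 h1
  have e1 : ∀ᵐ P ∂coverMeasure, P.im ≠ 0 := ae_im_ne 0
  have e2 : ∀ᵐ P ∂coverMeasure, (orbit T n P).re ≠ x0 :=
    (hmp n).quasiMeasurePreserving.ae (p := fun P : ℂ => P.re ≠ x0) (ae_re_ne x0)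
  have e3 : ∀ᵐ P ∂coverMeasure, (orbit T n P).im ≠ θ0 :=
    (hmp n).quasiMeasurePreserving.ae (p := fun P : ℂ => P.im ≠ θ0) (ae_im_ne θ0)
  -- The pointwise bound of the crossing count is integrated over the starting point; as the orbit
  -- map preserves the measure, the set of `P` that end in the sector has the measure of the sector.
  calc _ ≤ ∫ P, K.indicator (fun _ => (1 : ℝ)) (orbit T n P) ∂coverMeasure := by
        refine integral_mono_ae (integrable_finsetSum _ fun i _ => (hstep i).1) hKint ?_
        filter_upwards [e1, e2, e3] with P p1 p2 p3
        refine (h.sum_branchCrossing_le hO hup p1 p2 p3).trans_eq ?_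
        rw [indicator_apply]; rfl
    _ = sectorArea x0 θ0 := by
        refine ((hmp n).integral_comp (hemb n) (K.indicator fun _ => (1 : ℝ))).trans ?_
        rw [integral_indicator_const _ hK, sectorArea, smul_eq_mul, mul_one]

/-- If `w` and `a w` have the same sign, the horizontal shear turns every point clockwise. -/
lemma im_liftedShear_le (ha : SmallField a) (hpos : ∀ w, 0 ≤ w * a w) (ζ : ℂ) :
    (liftedShear a ζ).im ≤ ζ.im := by
  unfold liftedShear
  rw [add_im, Complex.log_im]
  have h1 := norm_field_mul_exp_le ha.abs_le ζ
  set u := (a (exp ζ).im : ℂ) * exp (-ζ) with hu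
  have him : u.im ≤ 0 := by
    have e1 : u.im = -((exp ζ).im * a (exp ζ).im) * Real.exp (-ζ.re) ^ 2 := by
      rw [hu, Complex.im_ofReal_mul, exp_im (-ζ), exp_im ζ, Complex.neg_re,
        neg_im, Real.sin_neg]
      have : Real.exp ζ.re * Real.exp (-ζ.re) = 1 := by rw [← Real.exp_add]; simp
      linear_combination (-(a (Real.exp ζ.re * sin ζ.im)) * Real.exp (-ζ.re) *
        sin ζ.im) * this.symm
    rw [e1]
    nlinarith [hpos (exp ζ).im, sq_nonneg (Real.exp (-ζ.re))]
  have hre : 0 < (1 + u).re := by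
    have := (_root_.abs_le.1 ((abs_re_le_norm _).trans h1)).1
    rw [add_re, Complex.one_re]; linarith
  have hle : arg (1 + u) ≤ 0 := by
    rcases eq_or_lt_of_le him with h0 | h0
    · have : arg (1 + u) = 0 := by
        rw [Complex.arg_eq_zero_iff]; exact ⟨hre.le, by simp [h0]⟩
      exact this.le
    · exact (arg_neg_iff.2 (by simpa using h0)).le
  linarith

/-- The vertical shear preserves the real part of the point in the plane, so it does not carry
points across the lifted positive imaginary axis. -/
lemma im_le_of_im_turnedShear_gt (ha : SmallField a)
    (hP : π / 2 < (turnedShear (π / 2) a P).im) : π / 2 < P.im := by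
  by_contra hle
  push Not at hle
  set P' := P + ((π / 2 : ℝ) : ℂ) * I with hP'
  have e1 : (turnedShear (π / 2) a P).im = (liftedShear a P').im - π / 2 := by
    simp [turnedShear, hP']
  have e2 : P'.im = P.im + π / 2 := by simp [hP']
  have h1 := _root_.abs_le.1 ((abs_im_le_norm _).trans (ha.norm_sub_le P'))
  rw [sub_im] at h1
  have h2 := ha.im_exp P'
  rw [exp_im, exp_im] at h2
  have hpi := Real.pi_gt_three
  have h3 : 0 ≤ Real.exp P'.re * sin P'.im := by
    have := Real.sin_nonneg_of_nonneg_of_le_pi (x := P'.im) (by linarith) (by linarith)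
    positivity
  have h4 : sin (liftedShear a P').im < 0 := by
    rw [← Real.sin_sub_two_pi]
    exact Real.sin_neg_of_neg_of_neg_pi_lt (by linarith) (by linarith)
  have := mul_neg_of_pos_of_neg (exp_pos (liftedShear a P').re) h4
  linarith

/-- No orbit ends above the line `im = π/2` unless it starts above it. -/
lemma im_pos_of_im_orbit_gt {θ : ℕ → ℝ} {a : ℕ → ℝ → ℝ} (ha : ∀ i, SmallField (a i))
    (hθ : ∀ i, (θ i = 0 ∧ ∀ w, 0 ≤ w * a i w) ∨ θ i = π / 2) (n : ℕ) (P : ℂ)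
    (hP : π / 2 < (orbit (fun i => turnedShear (θ i) (a i)) n P).im) : 0 < P.im := by
  suffices h : π / 2 < P.im by linarith [pi_pos]
  induction n with
  | zero => exact hP
  | succ n ih =>
    apply ih
    simp only [orbit] at hP
    rcases hθ n with ⟨h0, hpos⟩ | h0
    · rw [h0, turnedShear_zero] at hP
      exact hP.trans_le (im_liftedShear_le (ha n) hpos _)
    · rw [h0] at hP
      exact im_le_of_im_turnedShear_gt (ha n) hP

end

/-! ### Limits of approximate primitives and of step functions -/

variable {n : ℕ} {a b c d h m p p' r s t x0 z α β0 βm βp δ ε μ ρ σ τ B C M T : ℝ} {f g k q u u0 v y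
  : ℝ → ℝ} {S : Set ℝ}

/-- `u` is, up to an error `δ`, a primitive of `g` on `S`. -/
def IncrBound (u g : ℝ → ℝ) (δ : ℝ) (S : Set ℝ) : Prop :=
  ∀ s ∈ S, ∀ t ∈ S, s ≤ t → ∀ c1 c2, (∀ r ∈ Icc s t, c1 ≤ g r ∧ g r ≤ c2) →
    c1 * (t - s) - |c1| * δ ≤ u t - u s ∧ u t - u s ≤ c2 * (t - s) + |c2| * δ

/-- Continuous convergence of a sequence of functions on a set. -/
def ContConv (U : Filter ℕ) (S : Set ℝ) (u : ℕ → ℝ → ℝ) (u0 : ℝ → ℝ) : Prop :=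
  ∀ r ∈ S, Tendsto (fun z : ℕ × ℝ => u z.1 z.2) (U ×ˢ 𝓝[S] r) (𝓝 (u0 r))

lemma ContConv.tendsto {U : Filter ℕ} {u : ℕ → ℝ → ℝ}
    (h : ContConv U S u u0) (hr : r ∈ S) : Tendsto (fun n => u n r) U (𝓝 (u0 r)) :=
  (h r hr).comp (tendsto_id.prodMk (tendsto_const_nhdsWithin hr))

lemma ContConv.tendsto_comp {U : Filter ℕ} {u : ℕ → ℝ → ℝ}
    (h : ContConv U S u u0) {x : ℕ → ℝ} (hr : r ∈ S) (hx : Tendsto x U (𝓝 r))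
    (hxS : ∀ᶠ n in U, x n ∈ S) : Tendsto (fun n => u n (x n)) U (𝓝 (u0 r)) :=
  (h r hr).comp (tendsto_id.prodMk (tendsto_nhdsWithin_iff.2 ⟨hx, hxS⟩))

lemma ContConv.mono {U : Filter ℕ} {S' : Set ℝ} {u : ℕ → ℝ → ℝ}
    (h : ContConv U S u u0) (hS : S' ⊆ S) : ContConv U S' u u0 :=
  fun r hr => (h r (hS hr)).mono_left (prod_mono le_rfl (nhdsWithin_mono r hS))

lemma ContConv.eventually {U : Filter ℕ} {u : ℕ → ℝ → ℝ}
    (h : ContConv U S u u0) (hr : r ∈ S) (hε : 0 < ε) :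
    ∃ δ > 0, ∀ᶠ n in U, ∀ t ∈ S, |t - r| < δ → |u n t - u0 r| < ε := by
  have h1 := (h r hr).eventually (Metric.ball_mem_nhds _ hε)
  obtain ⟨A, hA, B, hB, hAB⟩ := eventually_prod_iff.1 h1
  obtain ⟨δ, hδ, hδB⟩ := Metric.mem_nhdsWithin_iff.1 hB
  refine ⟨δ, hδ, hA.mono fun n hn t ht htr => ?_⟩
  have := hAB hn (hδB ⟨by rwa [Metric.mem_ball, dist_eq], ht⟩)
  rwa [dist_eq] at this

lemma contConv_of_eventually {U : Filter ℕ} {u : ℕ → ℝ → ℝ}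
    (h : ∀ r ∈ S, ∀ ε > 0, ∃ δ > 0, ∀ᶠ n in U, ∀ t ∈ S, |t - r| < δ → |u n t - u0 r| < ε) :
    ContConv U S u u0 := by
  intro r hr
  rw [Metric.tendsto_nhds]
  intro ε hε
  obtain ⟨δ, hδ, hn⟩ := h r hr ε hε
  rw [eventually_prod_iff]
  refine ⟨_, hn, fun t => t ∈ S ∧ |t - r| < δ, ?_, fun {n} hn {t} ht => ?_⟩
  · filter_upwards [self_mem_nhdsWithin, mem_nhdsWithin_of_mem_nhds (Metric.ball_mem_nhds r hδ)]
      with t h1 h2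
    exact ⟨h1, by rwa [Metric.mem_ball, dist_eq] at h2⟩
  · rw [dist_eq]; exact hn t ht.1 ht.2

lemma ContConv.continuousOn {U : Filter ℕ} [U.NeBot] {u : ℕ → ℝ → ℝ}
    (h : ContConv U S u u0) : ContinuousOn u0 S := by
  intro r hr
  rw [ContinuousWithinAt, Metric.tendsto_nhdsWithin_nhds]
  intro ε hε
  obtain ⟨δ, hδ, hn⟩ := h.eventually hr (half_pos hε)
  refine ⟨δ, hδ, fun {t} ht htr => ?_⟩
  rw [dist_eq] at htr ⊢
  have h1 : Tendsto (fun n => |u n t - u0 r|) U (𝓝 |u0 t - u0 r|) :=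
    ((h.tendsto ht).sub_const _).abs
  have := le_of_tendsto h1 (hn.mono fun n hn => (hn t ht htr).le)
  linarith

lemma IncrBound.abs_le (h : IncrBound u g δ S) {K : ℝ}
    (hs : s ∈ S) (ht : t ∈ S) (hK : ∀ r ∈ uIcc s t, |g r| ≤ K) :
    |u t - u s| ≤ K * |t - s| + K * δ := by
  have hK0 : 0 ≤ K := (abs_nonneg _).trans (hK s left_mem_uIcc)
  rcases le_total s t with hst | hst
  · rw [uIcc_of_le hst] at hK
    obtain ⟨h1, h2⟩ := h s hs t ht hst (-K) K fun r hr => _root_.abs_le.1 (hK r hr)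
    rw [abs_neg, abs_of_nonneg hK0] at h1
    rw [abs_of_nonneg hK0] at h2
    rw [abs_of_nonneg (sub_nonneg.2 hst), _root_.abs_le]
    constructor <;> linarith
  · rw [uIcc_of_ge hst] at hK
    obtain ⟨h1, h2⟩ := h t ht s hs hst (-K) K fun r hr => _root_.abs_le.1 (hK r hr)
    rw [abs_neg, abs_of_nonneg hK0] at h1
    rw [abs_of_nonneg hK0] at h2
    rw [abs_of_nonpos (sub_nonpos.2 hst), _root_.abs_le]
    constructor <;> linarith

/-- Limits of approximate primitives exist along an ultrafilter. -/
lemma exists_contConv {U : Ultrafilter ℕ} (hS : S.OrdConnected)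
    {u g : ℕ → ℝ → ℝ} {δ : ℕ → ℝ} (hδ : Tendsto δ U (𝓝 0)) (hu : ∀ n, IncrBound (u n) (g n) (δ n) S)
    (hg : ∀ r ∈ S, ∃ K : ℝ, ∃ η > 0, ∀ᶠ n in (U : Filter ℕ), ∀ t ∈ S, |t - r| < η → |g n t| ≤ K)
    (hb : ∀ r ∈ S, ∃ M : ℝ, ∀ᶠ n in (U : Filter ℕ), |u n r| ≤ M) :
    ∃ u0, ContConv U S u u0 := by
  have hlim : ∀ r ∈ S, ∃ x, Tendsto (fun n => u n r) U (𝓝 x) := by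
    intro r hr
    obtain ⟨M, hM⟩ := hb r hr
    have hc : IsCompact (Icc (-M) M) := isCompact_Icc
    obtain ⟨x, -, hx⟩ := hc.ultrafilter_le_nhds (U.map fun n => u n r) (by
      rw [le_principal_iff]
      exact hM.mono fun n hn => abs_le.1 hn)
    exact ⟨x, hx⟩
  choose! u0 hu0 using hlim
  refine ⟨u0, contConv_of_eventually fun r hr ε hε => ?_⟩
  obtain ⟨K, η, hη, hK⟩ := hg r hr
  have hK1 : 0 < |K| + 1 := by positivity
  refine ⟨min η (ε / 4 / (|K| + 1)), by positivity, ?_⟩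
  have hδ' : ∀ᶠ n in (U : Filter ℕ), |δ n| < ε / 4 / (|K| + 1) := by
    have := hδ.eventually (Metric.ball_mem_nhds _ (show 0 < ε / 4 / (|K| + 1) by positivity))
    refine this.mono fun n hn => ?_
    rwa [dist_eq, sub_zero] at hn
  have hlim' : ∀ᶠ n in (U : Filter ℕ), |u n r - u0 r| < ε / 4 := by
    refine ((hu0 r hr).eventually (Metric.ball_mem_nhds _ (show 0 < ε / 4 by positivity))).mono
      fun n hn => ?_
    rwa [dist_eq] at hn
  filter_upwards [hK, hδ', hlim'] with n h1 h2 h3 t ht htr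
  have h4 := (hu n).abs_le hr ht (K := |K|) fun x hx => by
    refine (h1 x (hS.uIcc_subset hr ht hx) ?_).trans (le_abs_self K)
    exact (abs_sub_left_of_mem_uIcc hx).trans_lt (htr.trans_le (min_le_left _ _))
  have h5 : (|K| + 1) * |t - r| < ε / 4 := by
    have := htr.trans_le (min_le_right _ _)
    rwa [lt_div_iff₀ hK1, mul_comm] at this
  have h6 : (|K| + 1) * |δ n| < ε / 4 := by
    rwa [lt_div_iff₀ hK1, mul_comm] at h2
  have h7 := le_abs_self (δ n)
  have h8 : |K| * δ n ≤ |K| * |δ n| := mul_le_mul_of_nonneg_left h7 (abs_nonneg _)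
  have h9 := abs_sub_le (u n t) (u n r) (u0 r)
  nlinarith [abs_nonneg (t - r), abs_nonneg (δ n)]

/-- The limit of approximate primitives is a primitive of the limit. -/
lemma hasDerivWithinAt_of_contConv {U : Filter ℕ} [U.NeBot] (hS : S.OrdConnected)
    {u g : ℕ → ℝ → ℝ} {g0 : ℝ → ℝ} {δ : ℕ → ℝ} (hδ : Tendsto δ U (𝓝 0))
    (hu : ∀ n, IncrBound (u n) (g n) (δ n) S) (hc : ContConv U S u u0) (hr : r ∈ S)
    (hg : ∀ ε > 0, ∃ η > 0, ∀ᶠ n in U, ∀ t ∈ S, |t - r| < η → |g n t - g0 r| < ε) :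
    HasDerivWithinAt u0 (g0 r) S r := by
  rw [hasDerivWithinAt_iff_isLittleO, Asymptotics.isLittleO_iff]
  intro ε hε
  obtain ⟨η, hη, hn⟩ := hg ε hε
  filter_upwards [self_mem_nhdsWithin, mem_nhdsWithin_of_mem_nhds (Metric.ball_mem_nhds r hη)]
    with t ht htr
  rw [Metric.mem_ball, dist_eq] at htr
  rw [norm_eq_abs, norm_eq_abs, smul_eq_mul]
  have key : ∀ s ∈ S, ∀ t ∈ S, s ≤ t → (∀ x ∈ Icc s t, |x - r| < η) →
      (g0 r - ε) * (t - s) ≤ u0 t - u0 s ∧ u0 t - u0 s ≤ (g0 r + ε) * (t - s) := by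
    intro s hs t ht hst hx
    have hl : Tendsto (fun n => u n t - u n s) U (𝓝 (u0 t - u0 s)) :=
      (hc.tendsto ht).sub (hc.tendsto hs)
    have hev : ∀ᶠ n in U, (g0 r - ε) * (t - s) - |g0 r - ε| * δ n ≤ u n t - u n s ∧
        u n t - u n s ≤ (g0 r + ε) * (t - s) + |g0 r + ε| * δ n := by
      filter_upwards [hn] with n hn
      refine hu n s hs t ht hst _ _ fun x hxx => ?_
      have := abs_lt.1 (hn x (hS.out hs ht hxx) (hx x hxx))
      constructor <;> linarith
    constructor
    · have h1 : Tendsto (fun n => (g0 r - ε) * (t - s) - |g0 r - ε| * δ n) U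
          (𝓝 ((g0 r - ε) * (t - s))) := by
        simpa using tendsto_const_nhds.sub (hδ.const_mul |g0 r - ε|)
      exact le_of_tendsto_of_tendsto h1 hl (hev.mono fun n h => h.1)
    · have h1 : Tendsto (fun n => (g0 r + ε) * (t - s) + |g0 r + ε| * δ n) U
          (𝓝 ((g0 r + ε) * (t - s))) := by
        simpa using tendsto_const_nhds.add (hδ.const_mul |g0 r + ε|)
      exact le_of_tendsto_of_tendsto hl h1 (hev.mono fun n h => h.2)
  have hball : ∀ x ∈ uIcc r t, |x - r| < η := fun x hx =>
    (abs_sub_left_of_mem_uIcc hx).trans_lt htr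
  rcases le_total r t with h | h
  · rw [uIcc_of_le h] at hball
    obtain ⟨h1, h2⟩ := key r hr t ht h hball
    rw [abs_of_nonneg (sub_nonneg.2 h), abs_le]
    constructor <;> nlinarith
  · rw [uIcc_of_ge h] at hball
    obtain ⟨h1, h2⟩ := key t ht r hr h hball
    rw [abs_of_nonpos (sub_nonpos.2 h), abs_le]
    constructor <;> nlinarith

lemma incrBound_of_hasDerivAt (hS : S.OrdConnected)
    (hc : ContinuousOn u S) (hd : ∀ r ∈ interior S, HasDerivAt u (g r) r) : IncrBound u g 0 S := by
  intro s hs t ht hst c1 c2 hg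
  simp only [mul_zero, sub_zero, add_zero]
  rcases eq_or_lt_of_le hst with rfl | hlt
  · simp
  have hsub : Icc s t ⊆ S := hS.out hs ht
  have hsub' : Ioo s t ⊆ interior S := by
    rw [← interior_Icc]; exact interior_mono hsub
  obtain ⟨x, hx, he⟩ := exists_hasDerivAt_eq_slope u g hlt (hc.mono hsub)
    fun x hx => hd x (hsub' hx)
  have h1 := hg x (Ioo_subset_Icc_self hx)
  have h2 : 0 < t - s := sub_pos.2 hlt
  rw [he, le_div_iff₀ h2, div_le_iff₀ h2] at h1
  exact h1

/-- The index of the grid cell of mesh `h`, starting at `a`. -/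
def gridIndex (a h r : ℝ) : ℕ := ⌊(r - a) / h⌋₊

lemma gridIndex_mono (hh : 0 < h) (hst : s ≤ t) :
    gridIndex a h s ≤ gridIndex a h t := Nat.floor_le_floor (by gcongr)

lemma abs_grid_sub_le (hh : 0 < h) (hr : a ≤ r) :
    a + gridIndex a h r * h ≤ r ∧ r < a + gridIndex a h r * h + h := by
  have h1 : 0 ≤ (r - a) / h := div_nonneg (by linarith) hh.le
  have h2 := Nat.floor_le h1
  have h3 := Nat.lt_floor_add_one ((r - a) / h)
  rw [le_div_iff₀ hh] at h2
  rw [div_lt_iff₀ hh] at h3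
  unfold gridIndex
  constructor <;> linarith

lemma gridIndex_eq (hh : 0 < h) (i : ℕ) : gridIndex a h (a + i * h) = i := by
  unfold gridIndex
  rw [add_sub_cancel_left, mul_div_assoc, div_self hh.ne', mul_one, Nat.floor_natCast]

/-- Increments over whole cells are exact; the error `h` accounts for the partial cells at the two
ends. -/
lemma incrBound_grid {x G : ℕ → ℝ} (hh : 0 < h) (hx : ∀ i, x (i + 1) = x i + h * G i) :
    IncrBound (fun r => x (gridIndex a h r)) (fun r => G (gridIndex a h r)) h (Ici a) := by
  intro s hs t ht hst c1 c2 hg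
  have hmono := gridIndex_mono (a := a) hh hst
  have hsum : ∀ j, gridIndex a h s ≤ j → j ≤ gridIndex a h t →
      c1 * (h * (j - gridIndex a h s : ℝ)) ≤ x j - x (gridIndex a h s) ∧
      x j - x (gridIndex a h s) ≤ c2 * (h * (j - gridIndex a h s : ℝ)) := by
    intro j hj
    induction j, hj using Nat.le_induction with
    | base => intro _; simp
    | succ j hj ih =>
      intro hjt
      obtain ⟨h1, h2⟩ := ih (by omega)
      have hGj : c1 ≤ G j ∧ G j ≤ c2 := by
        -- The left end of the cell that contains `s` may lie before `s`; the maximum is a point of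
        -- cell `j` inside `[s, t]`.
        have hr := hg (max s (a + j * h)) ⟨le_max_left _ _, ?_⟩
        · have hidx : gridIndex a h (max s (a + j * h)) = j := by
            rcases max_choice s (a + j * h) with hm | hm
            · refine le_antisymm (by rw [hm]; exact hj) ?_
              exact (gridIndex_eq (a := a) hh j).symm.le.trans (gridIndex_mono hh (le_max_right _ _))
            · rw [hm, gridIndex_eq hh]
          simpa only [hidx] using hr
        · refine max_le hst ?_
          have := (abs_grid_sub_le (a := a) hh ht).1
          have h4 : (j : ℝ) + 1 ≤ gridIndex a h t := by exact_mod_cast hjt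
          nlinarith
      rw [hx]
      push_cast
      constructor <;> nlinarith [mul_le_mul_of_nonneg_left hGj.1 hh.le,
        mul_le_mul_of_nonneg_left hGj.2 hh.le]
  obtain ⟨h1, h2⟩ := hsum _ hmono le_rfl
  have e1 := abs_grid_sub_le (a := a) hh hs
  have e2 := abs_grid_sub_le (a := a) hh ht
  have e3 : |h * ((gridIndex a h t : ℝ) - gridIndex a h s) - (t - s)| ≤ h := by
    rw [abs_le]; constructor <;> linarith [e1.1, e1.2, e2.1, e2.2]
  have e4 : ∀ c : ℝ, |c * (h * ((gridIndex a h t : ℝ) - gridIndex a h s)) - c * (t - s)| ≤ |c| * h := by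
    intro c
    rw [← mul_sub, abs_mul]
    gcongr
  have e5 := abs_le.1 (e4 c1)
  have e6 := abs_le.1 (e4 c2)
  constructor <;> linarith [e5.1, e6.2]

/-- An approximate primitive that is constant to the left of `a` is one beyond `a` as well. -/
lemma IncrBound.extend (hS : S.OrdConnected) (hδ : 0 ≤ δ)
    (h : IncrBound u g δ (S ∩ Ici a)) (hc : ∀ r ∈ S, r ≤ a → u r = u a) :
    IncrBound u (fun r => if r < a then 0 else g r) δ S := by
  intro s hs t ht hst c1 c2 hg
  rcases le_or_gt a s with has | hsa
  · refine h s ⟨hs, has⟩ t ⟨ht, has.trans hst⟩ hst c1 c2 fun r hr => ?_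
    simpa only [if_neg (not_lt.2 (has.trans hr.1))] using hg r hr
  · have h0 := hg s (left_mem_Icc.2 hst)
    simp only [if_pos hsa] at h0
    have hp1 : 0 ≤ |c1| * δ := by positivity
    have hp2 : 0 ≤ |c2| * δ := by positivity
    rcases le_total t a with hta | hat
    · rw [hc t ht hta, hc s hs hsa.le, sub_self]
      constructor <;> nlinarith
    · have haS : a ∈ S := hS.out hs ht ⟨hsa.le, hat⟩
      obtain ⟨h1, h2⟩ := h a ⟨haS, self_mem_Ici⟩ t ⟨ht, hat⟩ hat c1 c2 fun r hr => by
        simpa only [if_neg (not_lt.2 hr.1)] using hg r ⟨hsa.le.trans hr.1, hr.2⟩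
      rw [hc s hs hsa.le]
      constructor <;> nlinarith

/-! ### The functions `φ_m` -/

lemma phi_zero (m : ℝ) : phi m 0 = 0 := by simp [phi]

lemma phi_neg (m s : ℝ) : phi m (-s) = -phi m s := by simp [phi]

lemma phi_of_pos (hs : 0 < s) : phi m s = s ^ (m - 1) := by
  rw [phi, abs_of_pos hs]
  conv_lhs => rw [← rpow_one s, ← rpow_mul hs.le, one_mul, ← rpow_add hs]
  ring_nf

lemma phi_of_nonneg (hm : 1 < m) (hs : 0 ≤ s) : phi m s = s ^ (m - 1) := by
  rcases eq_or_lt_of_le hs with h | h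
  · rw [← h, phi_zero, zero_rpow (by linarith)]
  · exact phi_of_pos h

lemma mul_phi (hm : 1 < m) (s : ℝ) : s * phi m s = |s| ^ m := by
  have key : ∀ s : ℝ, 0 ≤ s → s * phi m s = |s| ^ m := by
    intro s hs
    rcases eq_or_lt_of_le hs with h | h
    · rw [← h, abs_zero, zero_rpow (by linarith)]; ring
    · rw [phi_of_pos h, abs_of_pos h]
      conv_lhs => rw [← rpow_one s, ← rpow_mul h.le, one_mul, ← rpow_add h]
      ring_nf
  rcases le_total 0 s with h | h
  · exact key s h
  · have := key (-s) (by linarith)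
    rw [phi_neg, abs_neg] at this
    linarith

lemma phi_pos (hs : 0 < s) : 0 < phi m s := by
  rw [phi_of_pos hs]; exact rpow_pos_of_pos hs _

lemma phi_neg_of_neg (hs : s < 0) : phi m s < 0 := by
  have := phi_pos (m := m) (neg_pos.2 hs)
  rw [phi_neg] at this; linarith

lemma phi_strictMono (hm : 1 < m) : StrictMono (phi m) := by
  intro s t hst
  rcases le_or_gt 0 s with hs | hs
  · rw [phi_of_nonneg hm hs, phi_of_nonneg hm (hs.trans hst.le)]
    exact rpow_lt_rpow hs hst (by linarith)
  · rcases le_or_gt 0 t with ht | ht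
    · refine (phi_neg_of_neg hs).trans_le ?_
      rw [phi_of_nonneg hm ht]; exact rpow_nonneg ht _
    · rw [← neg_neg s, ← neg_neg t, phi_neg, phi_neg m (-t), phi_of_pos (neg_pos.2 hs),
        phi_of_pos (neg_pos.2 ht), neg_lt_neg_iff]
      exact rpow_lt_rpow (by linarith) (by linarith) (by linarith)

lemma phi_mono (hm : 1 < m) : Monotone (phi m) := (phi_strictMono hm).monotone

lemma continuous_phi (hm : 1 < m) : Continuous (phi m) := by
  have h : phi m = fun s => (max s 0) ^ (m - 1) - (max (-s) 0) ^ (m - 1) := by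
    funext s
    rcases le_total 0 s with hs | hs
    · rw [phi_of_nonneg hm hs, max_eq_left hs, max_eq_right (by linarith),
        zero_rpow (by linarith), sub_zero]
    · rw [max_eq_right hs, max_eq_left (by linarith), zero_rpow (by linarith), zero_sub,
        ← phi_of_nonneg hm (by linarith), phi_neg, neg_neg]
  rw [h]
  have h0 : 0 ≤ m - 1 := by linarith
  exact ((continuous_id.max continuous_const).rpow_const fun _ => Or.inr h0).sub
    ((continuous_neg.max continuous_const).rpow_const fun _ => Or.inr h0)

lemma phi_phi (h : p.HolderConjugate p') (s : ℝ) : phi p (phi p' s) = s := by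
  have key : ∀ s : ℝ, 0 ≤ s → phi p (phi p' s) = s := by
    intro s hs
    have h0 : 0 ≤ phi p' s := by
      rw [phi_of_nonneg h.symm.lt hs]; exact rpow_nonneg hs _
    rw [phi_of_nonneg h.lt h0, phi_of_nonneg h.symm.lt hs, ← rpow_mul hs]
    have : (p' - 1) * (p - 1) = 1 := by
      have := h.mul_eq_add; linarith
    rw [this, rpow_one]
  rcases le_total 0 s with hs | hs
  · exact key s hs
  · have := key (-s) (by linarith)
    rw [phi_neg, phi_neg] at this; linarith

lemma hasDerivAt_kinetic (hm : 1 < m) (s : ℝ) :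
    HasDerivAt (fun x => |x| ^ m / m) (phi m s) s := by
  have h := (hasDerivAt_abs_rpow s hm).div_const m
  have e : m * |s| ^ (m - 2) * s / m = phi m s := by
    unfold phi; field_simp
  rwa [e] at h

/-! ### The weight -/

namespace IsAdmissibleWeight
variable (hq : IsAdmissibleWeight p q)
include hq

lemma pos (hr : 0 < r) : 0 < q r := by
  have hd : StrictMonoOn q (Ioi 0) := by
    apply strictMonoOn_of_deriv_pos (convex_Ioi 0) hq.contDiffOn.continuousOn
    intro x hx
    rw [interior_Ioi] at hx
    exact hq.deriv_pos x hx
  have := hd (show r / 2 ∈ Ioi 0 by simpa using hr) hr (by linarith)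
  exact (hq.nonneg _ (by linarith)).trans_lt this

lemma hasDerivAt (hr : 0 < r) : HasDerivAt q (deriv q r) r :=
  ((hq.contDiffOn.differentiableOn one_ne_zero).differentiableAt (Ioi_mem_nhds hr)).hasDerivAt

lemma continuousAt (hr : 0 < r) : ContinuousAt q r := (hq.hasDerivAt hr).continuousAt

lemma continuousOn_deriv : ContinuousOn (deriv q) (Ioi 0) :=
  hq.contDiffOn.continuousOn_deriv_of_isOpen isOpen_Ioi le_rfl

lemma mono (hr : 0 < r) (hrs : r ≤ s) : q r ≤ q s := by
  have hd : MonotoneOn q (Ioi 0) := by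
    apply monotoneOn_of_deriv_nonneg (convex_Ioi 0) hq.contDiffOn.continuousOn
    · exact (hq.contDiffOn.differentiableOn one_ne_zero).mono interior_subset
    · intro x hx
      rw [interior_Ioi] at hx
      exact (hq.deriv_pos x hx).le
  exact hd hr (hr.trans_le hrs) hrs

lemma exists_deriv_le : ∃ C, 0 < C ∧ ∀ r, 0 < r → r * deriv q r ≤ C * q r := by
  obtain ⟨C1, C2, h1, h2, h⟩ := hq.bounds
  refine ⟨C2, h2, fun r hr => ?_⟩
  have := (h r hr).2
  rwa [div_le_iff₀ (hq.pos hr)] at this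

/-- The weight tends to zero at the origin. -/
lemma tendsto_zero : Tendsto q (𝓝[>] 0) (𝓝 0) := by
  obtain ⟨C1, C2, h1, h2, h⟩ := hq.bounds
  have hle : ∀ r ∈ Ioc (0 : ℝ) 1, q r ≤ q 1 * r ^ C1 := by
    have hmono : MonotoneOn (fun r => q r * r ^ (-C1)) (Ioi 0) := by
      have hder : ∀ r ∈ Ioi (0 : ℝ), HasDerivAt (fun r => q r * r ^ (-C1))
          (deriv q r * r ^ (-C1) + q r * (-C1 * r ^ (-C1 - 1))) r := fun r hr =>
        (hq.hasDerivAt hr).mul (hasDerivAt_rpow_const (Or.inl (ne_of_gt hr)))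
      apply monotoneOn_of_deriv_nonneg (convex_Ioi 0)
      · exact fun r hr => (hder r hr).continuousAt.continuousWithinAt
      · intro r hr
        rw [interior_Ioi] at hr
        exact (hder r hr).differentiableAt.differentiableWithinAt
      · intro r hr
        rw [interior_Ioi] at hr
        rw [(hder r hr).deriv, rpow_sub_one (ne_of_gt hr)]
        have h3 := (h r hr).1
        rw [le_div_iff₀ (hq.pos hr)] at h3
        have h4 : 0 < r ^ (-C1) := rpow_pos_of_pos hr _
        have hr' : (0 : ℝ) < r := hr
        have : deriv q r * r ^ (-C1) + q r * (-C1 * (r ^ (-C1) / r)) =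
            r ^ (-C1) / r * (r * deriv q r - C1 * q r) := by field_simp; ring
        rw [this]
        exact mul_nonneg (by positivity) (by linarith)
    intro r hr
    have := hmono hr.1 (show (1 : ℝ) ∈ Ioi 0 by simp) hr.2
    simp only [one_rpow, mul_one] at this
    rw [rpow_neg hr.1.le, ← div_eq_mul_inv, div_le_iff₀ (rpow_pos_of_pos hr.1 _)] at this
    exact this
  have hlim : Tendsto (fun r : ℝ => q 1 * r ^ C1) (𝓝[>] 0) (𝓝 0) := by
    have : Tendsto (fun r : ℝ => q 1 * r ^ C1) (𝓝 0) (𝓝 (q 1 * 0 ^ C1)) :=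
      ((Real.continuousAt_rpow_const 0 C1 (Or.inr h1.le)).tendsto).const_mul _
    rw [zero_rpow h1.ne', mul_zero] at this
    exact this.mono_left nhdsWithin_le_nhds
  refine tendsto_of_tendsto_of_tendsto_of_le_of_le' tendsto_const_nhds hlim ?_ ?_
  · filter_upwards [self_mem_nhdsWithin] with r hr using hq.nonneg r hr
  · filter_upwards [Ioc_mem_nhdsGT zero_lt_one] with r hr using hle r hr

/-- The weight, extended by zero to `(-∞, 0]`. -/
lemma continuous_ext : Continuous fun r => if r ≤ 0 then 0 else q r := by
  rw [continuous_iff_continuousAt]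
  intro r
  rcases lt_trichotomy r 0 with hr | rfl | hr
  · refine (continuousAt_const (y := (0 : ℝ))).congr ?_
    filter_upwards [Iio_mem_nhds hr] with s hs
    rw [if_pos (le_of_lt hs)]
  · rw [continuousAt_iff_continuous_left'_right']
    constructor
    · refine (continuousWithinAt_const (b := (0 : ℝ))).congr (fun s hs => if_pos (le_of_lt hs)) ?_
      exact if_pos le_rfl
    · rw [ContinuousWithinAt, if_pos le_rfl]
      refine hq.tendsto_zero.congr' ?_
      filter_upwards [self_mem_nhdsWithin] with s hs
      rw [if_neg (not_le.2 hs)]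
  · refine (hq.continuousAt hr).congr ?_
    filter_upwards [Ioi_mem_nhds hr] with s hs
    rw [if_neg (not_le.2 hs)]

omit hq in
lemma primitiveQ_eq (hr : 0 ≤ r) : primitiveQ q r =
    ∫ t in (0 : ℝ)..r, if t ≤ 0 then 0 else q t := by
  unfold primitiveQ
  apply intervalIntegral.integral_congr_ae
  refine Eventually.of_forall fun t ht => ?_
  rw [uIoc_of_le hr] at ht
  rw [if_neg (not_le.2 ht.1)]

lemma hasDerivAt_primitiveQ (hr : 0 < r) : HasDerivAt (primitiveQ q) (q r) r := by
  have h1 := (hq.continuous_ext.integral_hasStrictDerivAt 0 r).hasDerivAt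
  simp only [if_neg (not_le.2 hr)] at h1
  refine h1.congr_of_eventuallyEq ?_
  filter_upwards [Ioi_mem_nhds hr] with s hs using primitiveQ_eq (le_of_lt hs)

lemma continuousOn_primitiveQ : ContinuousOn (primitiveQ q) (Ici 0) := by
  have : Continuous fun r => ∫ t in (0 : ℝ)..r, if t ≤ 0 then 0 else q t :=
    intervalIntegral.continuous_primitive (fun a b => hq.continuous_ext.intervalIntegrable a b) 0
  exact this.continuousOn.congr fun r hr => primitiveQ_eq hr

omit hq in
lemma primitiveQ_zero : primitiveQ q 0 = 0 := by simp [primitiveQ]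

lemma primitiveQ_strictMono (hr : 0 ≤ r) (hrs : r < s) :
    primitiveQ q r < primitiveQ q s := by
  have : StrictMonoOn (primitiveQ q) (Ici 0) := by
    apply strictMonoOn_of_deriv_pos (convex_Ici 0) hq.continuousOn_primitiveQ
    intro x hx
    rw [interior_Ici] at hx
    rw [(hq.hasDerivAt_primitiveQ hx).deriv]; exact hq.pos hx
  exact this hr (hr.trans hrs.le) hrs

lemma primitiveQ_pos (hr : 0 < r) : 0 < primitiveQ q r := by
  have := hq.primitiveQ_strictMono le_rfl hr
  rwa [primitiveQ_zero] at this

end IsAdmissibleWeight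

/-- A function with nonnegative derivative inside an interval is monotone from end to end. -/
lemma le_of_hasDerivAt_nonneg {u' : ℝ → ℝ} (hab : a ≤ b)
    (hc : ContinuousOn u (Icc a b)) (hd : ∀ r ∈ Ioo a b, HasDerivAt u (u' r) r)
    (h0 : ∀ r ∈ Ioo a b, 0 ≤ u' r) : u a ≤ u b := by
  have : MonotoneOn u (Icc a b) := by
    apply monotoneOn_of_deriv_nonneg (convex_Icc a b) hc
    · rw [interior_Icc]; exact fun r hr => (hd r hr).differentiableAt.differentiableWithinAt
    · rw [interior_Icc]; intro r hr; rw [(hd r hr).deriv]; exact h0 r hr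
  exact this (left_mem_Icc.2 hab) (right_mem_Icc.2 hab) hab

namespace IsAdmissibleWeight
variable (hq : IsAdmissibleWeight p q)
include hq

lemma primitiveQ_sub_le (hs : 0 ≤ s) (hsr : s ≤ r) :
    primitiveQ q r - primitiveQ q s ≤ (r - s) * q r := by
  have h := le_of_hasDerivAt_nonneg (u := fun x => x * q r - primitiveQ q x)
    (u' := fun x => 1 * q r - q x) hsr
    (ContinuousOn.sub (by fun_prop) (hq.continuousOn_primitiveQ.mono fun x hx => hs.trans hx.1))
    (fun x hx => ((hasDerivAt_id x).mul_const (q r)).sub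
      (hq.hasDerivAt_primitiveQ (hs.trans_lt hx.1)))
    (fun x hx => by have := hq.mono (hs.trans_lt hx.1) hx.2.le; linarith)
  linarith

/-- The derivative `q + (x - s) q'` of `(x - s) q` is at most `(1 + C) q`. With this converse of
`primitiveQ_sub_le`, a lower bound of `f` along a solution becomes a linear bound of `y`. -/
lemma le_primitiveQ_sub (hCq : ∀ r, 0 < r → r * deriv q r ≤ C * q r) (hs : 0 ≤ s) (hr : 0 < r) (hsr : s ≤ r) :
    (r - s) * q r ≤ (1 + C) * (primitiveQ q r - primitiveQ q s) := by
  have hcont : ContinuousOn (fun x => (1 + C) * primitiveQ q x - (x - s) * (if x ≤ 0 then 0 else q x))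
      (Icc s r) := by
    refine ContinuousOn.sub (continuousOn_const.mul
      (hq.continuousOn_primitiveQ.mono fun x hx => hs.trans hx.1)) ?_
    have := hq.continuous_ext
    fun_prop
  have h := le_of_hasDerivAt_nonneg
    (u := fun x => (1 + C) * primitiveQ q x - (x - s) * (if x ≤ 0 then 0 else q x))
    (u' := fun x => (1 + C) * q x - (1 * q x + (x - s) * deriv q x)) hsr hcont
    (fun x hx => by
      have hx0 := hs.trans_lt hx.1
      refine (((hq.hasDerivAt_primitiveQ hx0).const_mul (1 + C)).sub
        (((hasDerivAt_id x).sub_const s).mul (hq.hasDerivAt hx0))).congr_of_eventuallyEq ?_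
      filter_upwards [Ioi_mem_nhds hx0] with y hy
      rw [if_neg (not_le.2 hy)]; rfl)
    (fun x hx => by
      have hx0 := hs.trans_lt hx.1
      have h1 := hCq x hx0
      have h2 := mul_nonneg hs (hq.deriv_pos x hx0).le
      nlinarith)
  simp only [sub_self, zero_mul, sub_zero, if_neg (not_le.2 hr)] at h
  linarith

/-- The doubling-type estimate `q r / r ^ C` is nonincreasing. -/
lemma div_rpow_anti (hCq : ∀ r, 0 < r → r * deriv q r ≤ C * q r) (hs : 0 < s)
    (hsr : s ≤ r) : q r * s ^ C ≤ q s * r ^ C := by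
  have hder : ∀ x, 0 < x → HasDerivAt (fun x => -(q x * x ^ (-C)))
      (-(deriv q x * x ^ (-C) + q x * (-C * x ^ (-C - 1)))) x := fun x hx =>
    ((hq.hasDerivAt hx).mul (hasDerivAt_rpow_const (Or.inl (ne_of_gt hx)))).neg
  have h := le_of_hasDerivAt_nonneg hsr
    (fun x hx => (hder x (hs.trans_le hx.1)).continuousAt.continuousWithinAt)
    (fun x hx => hder x (hs.trans hx.1))
    (fun x hx => by
      have hx0 := hs.trans hx.1
      rw [rpow_sub_one hx0.ne']
      have h3 := hCq x hx0
      have h4 : 0 < x ^ (-C) := rpow_pos_of_pos hx0 _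
      have : -(deriv q x * x ^ (-C) + q x * (-C * (x ^ (-C) / x))) =
          x ^ (-C) / x * (C * q x - x * deriv q x) := by field_simp; ring
      rw [this]
      exact mul_nonneg (by positivity) (by linarith))
  have hr := hs.trans_le hsr
  rw [rpow_neg hs.le, rpow_neg hr.le, neg_le_neg_iff, ← div_eq_mul_inv, ← div_eq_mul_inv,
    div_le_div_iff₀ (rpow_pos_of_pos hr _) (rpow_pos_of_pos hs _)] at h
  exact h

end IsAdmissibleWeight

/-! ### The nonlinearity -/

lemma hasDerivAt_primitiveF (hf : Continuous f) (s : ℝ) :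
    HasDerivAt (primitiveF f) (f s) s := (hf.integral_hasStrictDerivAt 0 s).hasDerivAt

lemma continuous_primitiveF (hf : Continuous f) : Continuous (primitiveF f) :=
  continuous_iff_continuousAt.2 fun s => (hasDerivAt_primitiveF hf s).continuousAt

lemma primitiveF_zero (f : ℝ → ℝ) : primitiveF f 0 = 0 := by simp [primitiveF]

lemma primitiveF_reflect (f : ℝ → ℝ) (s : ℝ) :
    primitiveF (fun x => -f (-x)) s = primitiveF f (-s) := by
  unfold primitiveF
  rw [intervalIntegral.integral_neg, intervalIntegral.integral_comp_neg, neg_zero,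
    intervalIntegral.integral_symm, neg_neg]

/-! ### Symplectic Euler schemes and their limits -/

/-- A sequence of symplectic Euler schemes for `v' = g (w / q)`, `w' = -q f(v)`, with the `n`-th one
starting at `a n`, having mesh `h n` and initial data `(d n, 0)`. -/
structure EulerScheme (q g f : ℝ → ℝ) (a h d : ℕ → ℝ) (V W : ℕ → ℕ → ℝ) : Prop where
  mesh_pos : ∀ n, 0 < h n
  start_pos : ∀ n, 0 < a n
  V_zero : ∀ n, V n 0 = d n
  W_zero : ∀ n, W n 0 = 0
  V_succ : ∀ n i, V n (i + 1) = V n i + h n * g (W n i / q (a n + i * h n))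
  W_succ : ∀ n i, W n (i + 1) = W n i + h n * -(q (a n + i * h n) * f (V n (i + 1)))

/-- The step function of a sequence on the grid. -/
def stepFun (a h : ℕ → ℝ) (x : ℕ → ℕ → ℝ) (n : ℕ) (r : ℝ) : ℝ := x n (gridIndex (a n) (h n) r)

lemma gridIndex_of_le (hh : 0 < h) (hr : r ≤ a) : gridIndex a h r = 0 :=
  Nat.floor_of_nonpos (div_nonpos_of_nonpos_of_nonneg (by linarith) hh.le)

lemma gridIndex_add (hh : 0 < h) (hr : a ≤ r) :
    gridIndex a h (r + h) = gridIndex a h r + 1 := by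
  unfold gridIndex
  rw [← Nat.floor_add_one (div_nonneg (by linarith) hh.le)]
  congr 1; field_simp; ring

lemma incrBound_stepFun {a h : ℕ → ℝ} {x G : ℕ → ℕ → ℝ} (hh : ∀ n, 0 < h n)
    (hx : ∀ n i, x n (i + 1) = x n i + h n * G n i) (n : ℕ) :
    IncrBound (stepFun a h x n) (fun r => if r < a n then 0 else stepFun a h G n r) (h n) univ := by
  refine IncrBound.extend ordConnected_univ (hh n).le ?_ ?_
  · rw [univ_inter]; exact incrBound_grid (hh n) (hx n)
  · intro r _ hr
    simp only [stepFun]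
    rw [gridIndex_of_le (hh n) hr, gridIndex_of_le (hh n) le_rfl]

/-- The grid points converge to the continuous variable. -/
lemma tendsto_gridPoint {U : Filter ℕ} {a h : ℕ → ℝ} {a0 : ℝ} (hh : ∀ n, 0 < h n)
    (ha : Tendsto a U (𝓝 a0)) (hh0 : Tendsto h U (𝓝 0)) (hr : a0 < r) :
    (∀ᶠ z : ℕ × ℝ in U ×ˢ 𝓝 r, a z.1 ≤ z.2) ∧
    Tendsto (fun z : ℕ × ℝ => a z.1 + gridIndex (a z.1) (h z.1) z.2 * h z.1) (U ×ˢ 𝓝 r) (𝓝 r) := by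
  have hev : ∀ᶠ z : ℕ × ℝ in U ×ˢ 𝓝 r, a z.1 ≤ z.2 :=
    (((ha.comp tendsto_fst).eventually_lt (tendsto_snd (f := U) (g := 𝓝 r)) hr)).mono
      fun z hz => hz.le
  refine ⟨hev, ?_⟩
  have h2 : Tendsto (fun z : ℕ × ℝ => z.2 - h z.1) (U ×ˢ 𝓝 r) (𝓝 r) := by
    simpa using (tendsto_snd (f := U) (g := 𝓝 r)).sub (hh0.comp tendsto_fst)
  refine tendsto_of_tendsto_of_tendsto_of_le_of_le' h2 tendsto_snd ?_ ?_
  · exact hev.mono fun z hz => by linarith [(abs_grid_sub_le (hh z.1) hz).2]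
  · exact hev.mono fun z hz => (abs_grid_sub_le (hh z.1) hz).1

lemma ContConv.tendsto_prod {U : Filter ℕ} {u : ℕ → ℝ → ℝ} (h : ContConv U univ u u0) (r : ℝ) :
    Tendsto (fun z : ℕ × ℝ => u z.1 z.2) (U ×ˢ 𝓝 r) (𝓝 (u0 r)) := by
  simpa using h r (mem_univ r)

/-- A limit of increments `G` that converge continuously has the limit as its derivative. -/
lemma hasDerivAt_of_stepFun {U : Filter ℕ} [U.NeBot] {a h : ℕ → ℝ} {x G : ℕ → ℕ → ℝ}
    {x0 : ℝ → ℝ} {a0 g0 : ℝ} (hh : ∀ n, 0 < h n) (hx : ∀ n i, x n (i + 1) = x n i + h n * G n i)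
    (ha : Tendsto a U (𝓝 a0)) (hh0 : Tendsto h U (𝓝 0)) (hr : a0 < r)
    (hc : ContConv U univ (stepFun a h x) x0)
    (hG : Tendsto (fun z : ℕ × ℝ => stepFun a h G z.1 z.2) (U ×ˢ 𝓝 r) (𝓝 g0)) :
    HasDerivAt x0 g0 r := by
  rw [← hasDerivWithinAt_univ]
  refine hasDerivWithinAt_of_contConv (g0 := fun _ => g0) ordConnected_univ hh0
    (incrBound_stepFun (a := a) hh hx) hc (mem_univ r) fun ε hε => ?_
  have h1 : ∀ᶠ z : ℕ × ℝ in U ×ˢ 𝓝 r,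
      |(if z.2 < a z.1 then 0 else stepFun a h G z.1 z.2) - g0| < ε := by
    filter_upwards [(tendsto_gridPoint hh ha hh0 hr).1, hG.eventually (Metric.ball_mem_nhds _ hε)]
      with z hz1 hz2
    rw [if_neg (not_lt.2 hz1)]
    rwa [dist_eq] at hz2
  obtain ⟨A, hA, B, hB, hAB⟩ := eventually_prod_iff.1 h1
  obtain ⟨η, hη, hηB⟩ := Metric.mem_nhds_iff.1 hB
  exact ⟨η, hη, hA.mono fun n hn t _ ht => hAB hn (hηB (by
    rwa [Metric.mem_ball, dist_eq]))⟩

lemma exists_contConv_stepFun {U : Ultrafilter ℕ} {a h : ℕ → ℝ} {x G : ℕ → ℕ → ℝ}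
    (hh : ∀ n, 0 < h n) (hx : ∀ n i, x n (i + 1) = x n i + h n * G n i)
    (ha : ∀ n, 0 < a n) (hh0 : Tendsto h U (𝓝 0))
    (hG : ∀ R : ℝ, ∃ K : ℝ, ∀ n i : ℕ, a n + i * h n ≤ R → |G n i| ≤ K)
    (hb : ∃ M : ℝ, ∀ n, |x n 0| ≤ M) :
    ∃ x0, ContConv U univ (stepFun a h x) x0 := by
  have hK : ∀ R : ℝ, ∃ K : ℝ, 0 ≤ K ∧ ∀ n t, t ≤ R →
      |if t < a n then 0 else stepFun a h G n t| ≤ K := by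
    intro R
    obtain ⟨K, hK⟩ := hG R
    refine ⟨|K|, abs_nonneg K, fun n t ht => ?_⟩
    split_ifs with hta
    · simp
    · exact (hK n _ ((abs_grid_sub_le (hh n) (not_lt.1 hta)).1.trans ht)).trans (le_abs_self K)
  refine exists_contConv ordConnected_univ hh0 (incrBound_stepFun (a := a) hh hx) ?_ ?_
  · intro r _
    obtain ⟨K, -, hK⟩ := hK (r + 1)
    refine ⟨K, 1, one_pos, Eventually.of_forall fun n t _ ht => hK n t ?_⟩
    rw [abs_lt] at ht; linarith [ht.2]
  · intro r _
    obtain ⟨M, hM⟩ := hb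
    obtain ⟨K, hK0, hK⟩ := hK (max 0 r)
    have hh1 : ∀ᶠ n in (U : Filter ℕ), h n < 1 := hh0.eventually_lt_const one_pos
    refine ⟨M + (K * |r| + K), hh1.mono fun n hn => ?_⟩
    have h1 := (incrBound_stepFun (a := a) hh hx n).abs_le (mem_univ 0) (mem_univ r)
      fun t ht => hK n t (by rcases mem_uIcc.1 ht with h | h <;> simp [h.2])
    have h2 : stepFun a h x n 0 = x n 0 := by
      simp only [stepFun]; rw [gridIndex_of_le (hh n) (ha n).le]
    rw [h2, sub_zero] at h1
    have h3 := hM n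
    have h4 := abs_sub_abs_le_abs_sub (stepFun a h x n r) (x n 0)
    nlinarith

namespace EulerScheme
variable {a h d : ℕ → ℝ} {V W : ℕ → ℕ → ℝ}

/-- As `q` increases, earlier increments of the flux are dominated by the current weight. Therefore
`W / q` stays bounded even though `q` vanishes at the origin. -/
lemma abs_W_le (hq : IsAdmissibleWeight p q) (hE : EulerScheme q g f a h d V W)
    (hM : ∀ s, |f s| ≤ M) (n i : ℕ) :
    |W n i| ≤ M * (i * h n) * q (a n + i * h n) := by
  have hM0 : 0 ≤ M := (abs_nonneg _).trans (hM 0)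
  have hh := hE.mesh_pos n
  have hpos : ∀ i : ℕ, 0 < a n + i * h n := fun i => by have := hE.start_pos n; positivity
  induction i with
  | zero => simp [hE.W_zero]
  | succ i ih =>
    rw [hE.W_succ]
    have hm := hq.mono (hpos i) (s := a n + (i + 1 : ℕ) * h n) (by push_cast; nlinarith)
    have hqi := hq.pos (hpos i)
    have h1 : |h n * -(q (a n + i * h n) * f (V n (i + 1)))| ≤ h n * (q (a n + i * h n) * M) := by
      rw [abs_mul, abs_of_pos hh, abs_neg, abs_mul, abs_of_pos hqi]
      gcongr; exact hM _
    calc _ ≤ M * (i * h n) * q (a n + i * h n) + h n * (q (a n + i * h n) * M) :=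
          (abs_add_le _ _).trans (add_le_add ih h1)
      _ = M * ((i + 1 : ℕ) * h n) * q (a n + i * h n) := by push_cast; ring
      _ ≤ _ := by gcongr

/-- The fields of the scheme are bounded on bounded time intervals. -/
lemma exists_bounds (hq : IsAdmissibleWeight p q) (hE : EulerScheme q g f a h d V W)
    (hg : Continuous g) (hM : ∀ s, |f s| ≤ M) (R : ℝ) :
    ∃ K : ℝ, ∀ n i : ℕ, a n + i * h n ≤ R →
      |g (W n i / q (a n + i * h n))| ≤ K ∧ |-(q (a n + i * h n) * f (V n (i + 1)))| ≤ K := by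
  have hM0 : 0 ≤ M := (abs_nonneg _).trans (hM 0)
  obtain ⟨K, hK⟩ := (isCompact_Icc (a := -(M * R)) (b := M * R)).exists_bound_of_continuousOn
    hg.continuousOn
  refine ⟨max K (q R * M), fun n i hi => ?_⟩
  have hh := hE.mesh_pos n
  have ha := hE.start_pos n
  have hpos : 0 < a n + i * h n := by positivity
  have hqi := hq.pos hpos
  constructor
  · refine (hK _ (abs_le.1 ?_)).trans (le_max_left _ _)
    rw [abs_div, abs_of_pos hqi, div_le_iff₀ hqi]
    refine (hE.abs_W_le hq hM n i).trans ?_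
    gcongr; linarith
  · refine le_trans ?_ (le_max_right _ _)
    rw [abs_neg, abs_mul, abs_of_pos hqi]
    exact mul_le_mul (hq.mono hpos hi) (hM _) (abs_nonneg _) (hq.nonneg _ (hpos.trans_le hi))

/-- The scheme converges along ultrafilters to solutions. -/
lemma exists_limit (hq : IsAdmissibleWeight p q) (hE : EulerScheme q g f a h d V W)
    (hg : Continuous g) (hf : Continuous f) (hM : ∀ s, |f s| ≤ M) {U : Ultrafilter ℕ}
    {a0 d0 : ℝ} (ha0 : 0 ≤ a0) (haa : ∀ n, a0 ≤ a n) (ha : Tendsto a U (𝓝 a0))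
    (hh0 : Tendsto h U (𝓝 0)) (hd : Tendsto d U (𝓝 d0)) (hdb : ∃ D, ∀ n, |d n| ≤ D) :
    ∃ v w : ℝ → ℝ, ContConv U univ (stepFun a h V) v ∧ ContConv U univ (stepFun a h W) w ∧
      (∀ r ≤ a0, v r = d0 ∧ w r = 0) ∧ (∀ r, a0 < r → |w r| ≤ M * (r - a0) * q r) ∧
      (∀ r, a0 < r → HasDerivAt v (g (w r / q r)) r) ∧
      (∀ r, a0 < r → HasDerivAt w (-(q r * f (v r))) r) ∧
      ∀ H : ℝ × ℝ × ℝ → ℝ, (∀ r, 0 < r → ∀ z, ContinuousAt H (r, z)) → ∀ r, a0 < r →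
        Tendsto (fun z : ℕ × ℝ => stepFun a h (fun n i =>
          H (a n + i * h n, V n (i + 1), W n i)) z.1 z.2) (U ×ˢ 𝓝 r) (𝓝 (H (r, v r, w r))) := by
  have hh := hE.mesh_pos
  have hb := hE.exists_bounds hq hg hM
  obtain ⟨v, hv⟩ := exists_contConv_stepFun (U := U) (x := V) hh hE.V_succ hE.start_pos hh0
    (fun R => (hb R).imp fun K hK n i hi => (hK n i hi).1)
    (hdb.imp fun D hD n => by rw [hE.V_zero]; exact hD n)
  obtain ⟨w, hw⟩ := exists_contConv_stepFun (U := U) (x := W) hh hE.W_succ hE.start_pos hh0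
    (fun R => (hb R).imp fun K hK n i hi => (hK n i hi).2)
    ⟨0, fun n => by simp [hE.W_zero]⟩
  have hH : ∀ H : ℝ × ℝ × ℝ → ℝ, (∀ r, 0 < r → ∀ z, ContinuousAt H (r, z)) → ∀ r, a0 < r →
        Tendsto (fun z : ℕ × ℝ => stepFun a h (fun n i =>
          H (a n + i * h n, V n (i + 1), W n i)) z.1 z.2) (U ×ˢ 𝓝 r) (𝓝 (H (r, v r, w r))) := by
    intro H hHc r hr
    obtain ⟨e1, e2⟩ := tendsto_gridPoint hh ha hh0 hr
    -- The symplectic scheme evaluates `f` at the new value `V n (i + 1)`, which is the step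
    -- function shifted by one mesh; continuous convergence absorbs the shift.
    have e3 : Tendsto (fun z : ℕ × ℝ => stepFun a h V z.1 (z.2 + h z.1)) (U ×ˢ 𝓝 r) (𝓝 (v r)) := by
      have e5 : Tendsto (fun z : ℕ × ℝ => z.2 + h z.1) (U ×ˢ 𝓝 r) (𝓝 r) := by
        simpa using (tendsto_snd (f := (U : Filter ℕ)) (g := 𝓝 r)).add (hh0.comp tendsto_fst)
      exact (hv.tendsto_prod r).comp (tendsto_fst.prodMk e5)
    have e4 := hw.tendsto_prod r
    refine ((hHc r (ha0.trans_lt hr) (v r, w r)).tendsto.comp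
      (e2.prodMk_nhds (e3.prodMk_nhds e4))).congr' ?_
    filter_upwards [e1] with z hz
    simp only [stepFun, Function.comp]
    rw [gridIndex_add (hh _) hz]
  have hdv : ∀ r, a0 < r → HasDerivAt v (g (w r / q r)) r := by
    intro r hr
    refine hasDerivAt_of_stepFun hh hE.V_succ ha hh0 hr hv ?_
    refine hH (fun z => g (z.2.2 / q z.1)) (fun r hr z => ?_) r hr
    refine hg.continuousAt.comp (ContinuousAt.div (by fun_prop) ?_ (hq.pos hr).ne')
    exact ContinuousAt.comp (f := Prod.fst) (hq.continuousAt hr) continuousAt_fst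
  have hdw : ∀ r, a0 < r → HasDerivAt w (-(q r * f (v r))) r := by
    intro r hr
    refine hasDerivAt_of_stepFun hh hE.W_succ ha hh0 hr hw ?_
    refine hH (fun z => -(q z.1 * f z.2.1)) (fun r hr z => ?_) r hr
    refine (ContinuousAt.mul ?_ ?_).neg
    · exact ContinuousAt.comp (f := Prod.fst) (hq.continuousAt hr) continuousAt_fst
    · exact hf.continuousAt.comp (by fun_prop)
  refine ⟨v, w, hv, hw, fun r hr => ⟨?_, ?_⟩, fun r hr => ?_, hdv, hdw, hH⟩
  · have h1 : Tendsto (fun n => stepFun a h V n r) U (𝓝 (v r)) := hv.tendsto (mem_univ r)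
    refine tendsto_nhds_unique h1 (hd.congr fun n => ?_)
    simp only [stepFun]; rw [gridIndex_of_le (hh n) (hr.trans (haa n)), hE.V_zero]
  · have h1 : Tendsto (fun n => stepFun a h W n r) U (𝓝 (w r)) := hw.tendsto (mem_univ r)
    refine tendsto_nhds_unique h1 (tendsto_const_nhds.congr fun n => ?_)
    simp only [stepFun]; rw [gridIndex_of_le (hh n) (hr.trans (haa n)), hE.W_zero]
  · have h1 : Tendsto (fun n => |stepFun a h W n r|) U (𝓝 |w r|) := (hw.tendsto (mem_univ r)).abs
    refine le_of_tendsto h1 ?_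
    have h2 : ∀ᶠ n in (U : Filter ℕ), a n < r := ha.eventually_lt_const hr
    filter_upwards [h2] with n hn
    have h3 := hE.abs_W_le hq hM n (gridIndex (a n) (h n) r)
    obtain ⟨h4, -⟩ := abs_grid_sub_le (hh n) hn.le
    have h5 := hE.start_pos n
    have h6 := hh n
    have hM0 : 0 ≤ M := (abs_nonneg _).trans (hM 0)
    refine h3.trans (mul_le_mul (mul_le_mul_of_nonneg_left (by linarith [haa n]) hM0) (hq.mono ?_ h4)
      (hq.nonneg _ ?_) ?_)
    · positivity
    · positivity
    · exact mul_nonneg hM0 (by linarith)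

end EulerScheme

/-! ### Solutions of the first order system: energy and flux -/

/-- A solution of `v' = g (y)`, `y' = -f(v) - (q'/q) y` on `(a, T)` with data `(d, 0)` at `a`,
extended by its initial data to the left of `a`. -/
structure Sol (g q f : ℝ → ℝ) (a d T : ℝ) (v y : ℝ → ℝ) : Prop where
  cont_v : Continuous v
  cont_y : Continuous y
  init : ∀ r ≤ a, v r = d ∧ y r = 0
  deriv_v : ∀ r, a < r → r < T → HasDerivAt v (g (y r)) r
  deriv_y : ∀ r, a < r → r < T → HasDerivAt y (-f (v r) - deriv q r / q r * y r) r

/-- The weight, extended by zero. -/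
def extWeight (q : ℝ → ℝ) (r : ℝ) : ℝ := if r ≤ 0 then 0 else q r

lemma extWeight_of_pos (q : ℝ → ℝ) (hr : 0 < r) : extWeight q r = q r :=
  if_neg (not_le.2 hr)

/-- The energy with kinetic part `k`. -/
def energy (k f v y : ℝ → ℝ) (r : ℝ) : ℝ := k (y r) + primitiveF f (v r)

lemma Sol.of_flux {w : ℝ → ℝ} (hq : IsAdmissibleWeight p q)
    (ha : 0 ≤ a) (hv : Continuous v) (hw : Continuous w) (hinit : ∀ r ≤ a, v r = d ∧ w r = 0)
    (hM : ∀ r, a < r → |w r| ≤ M * (r - a) * q r)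
    (hdv : ∀ r, a < r → r < T → HasDerivAt v (g (w r / q r)) r)
    (hdw : ∀ r, a < r → r < T → HasDerivAt w (-(q r * f (v r))) r) :
    Sol g q f a d T v (fun r => if r ≤ a then 0 else w r / q r) := by
  have hev : ∀ r, a < r → (fun r => if r ≤ a then 0 else w r / q r) =ᶠ[𝓝 r] fun r => w r / q r := by
    intro r hr
    filter_upwards [Ioi_mem_nhds hr] with s hs
    rw [if_neg (not_le.2 hs)]
  refine ⟨hv, ?_, fun r hr => ⟨(hinit r hr).1, if_pos hr⟩, fun r hr hrT => ?_, fun r hr hrT => ?_⟩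
  · rw [continuous_iff_continuousAt]
    intro r
    rcases lt_trichotomy r a with hr | rfl | hr
    · refine (continuousAt_const (y := (0 : ℝ))).congr ?_
      filter_upwards [Iio_mem_nhds hr] with s hs
      rw [if_pos (le_of_lt hs)]
    · rw [continuousAt_iff_continuous_left'_right']
      constructor
      · exact (continuousWithinAt_const (b := (0 : ℝ))).congr (fun s hs => if_pos (le_of_lt hs))
          (if_pos le_rfl)
      · rw [ContinuousWithinAt, if_pos le_rfl]
        refine squeeze_zero_norm' (a := fun s => M * (s - r)) ?_ ?_
        · filter_upwards [self_mem_nhdsWithin] with s hs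
          have hs' : r < s := hs
          have hqs := hq.pos (ha.trans_lt hs')
          rw [if_neg (not_le.2 hs'), norm_eq_abs, abs_div, abs_of_pos hqs, div_le_iff₀ hqs]
          exact hM s hs'
        · have : Tendsto (fun s => M * (s - r)) (𝓝 r) (𝓝 (M * (r - r))) := by
            apply Continuous.tendsto; fun_prop
          rw [sub_self, mul_zero] at this
          exact this.mono_left nhdsWithin_le_nhds
    · exact (hw.continuousAt.div (hq.continuousAt (ha.trans_lt hr))
        (hq.pos (ha.trans_lt hr)).ne').congr (hev r hr).symm
  · rw [if_neg (not_le.2 hr)]; exact hdv r hr hrT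
  · have hq0 := hq.pos (ha.trans_lt hr)
    refine (((hdw r hr hrT).div (hq.hasDerivAt (ha.trans_lt hr)) hq0.ne').congr_of_eventuallyEq
      (hev r hr)).congr_deriv ?_
    rw [if_neg (not_le.2 hr)]
    field_simp

/-- Global existence for a bounded nonlinearity. -/
lemma exists_sol_of_bounded (hq : IsAdmissibleWeight p q)
    (hg : Continuous g) (hf : Continuous f) (hM : ∀ s, |f s| ≤ M) (d : ℝ) :
    ∃ v y : ℝ → ℝ, ∀ T, Sol g q f 0 d T v y := by
  -- The schemes start at positive radii, where `q` does not vanish, and the starting radius, equal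
  -- to the mesh, tends to zero.
  set a : ℕ → ℝ := fun n => 1 / ((n : ℝ) + 1) with ha
  set Z : ℕ → ℕ → ℝ × ℝ := fun n i => Nat.rec (d, 0) (fun i z =>
    (z.1 + a n * g (z.2 / q (a n + i * a n)), z.2 + a n * -(q (a n + i * a n) *
      f (z.1 + a n * g (z.2 / q (a n + i * a n)))))) i with hZ
  have hapos : ∀ n, 0 < a n := fun n => by simp only [ha]; positivity
  have hE : EulerScheme q g f a a (fun _ => d) (fun n i => (Z n i).1) (fun n i => (Z n i).2) :=
    ⟨hapos, hapos, fun n => rfl, fun n => rfl, fun n i => rfl, fun n i => rfl⟩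
  have hlim : Tendsto a (hyperfilter ℕ : Filter ℕ) (𝓝 0) :=
    tendsto_one_div_add_atTop_nhds_zero_nat.mono_left Nat.hyperfilter_le_atTop
  obtain ⟨v, w, hv, hw, h1, h2, h3, h4, -⟩ := hE.exists_limit hq hg hf hM le_rfl
    (fun n => (hapos n).le) hlim hlim tendsto_const_nhds ⟨|d|, fun _ => le_rfl⟩
  refine ⟨v, _, fun T => Sol.of_flux hq le_rfl ?_ ?_ h1 h2 (fun r hr _ => h3 r hr)
    fun r hr _ => h4 r hr⟩
  · rw [← continuousOn_univ]; exact hv.continuousOn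
  · rw [← continuousOn_univ]; exact hw.continuousOn

namespace Sol

lemma mono (h : Sol g q f a d T v y) {T' : ℝ} (hT : T' ≤ T) : Sol g q f a d T' v y :=
  ⟨h.cont_v, h.cont_y, h.init, fun r hr hrT => h.deriv_v r hr (hrT.trans_le hT),
    fun r hr hrT => h.deriv_y r hr (hrT.trans_le hT)⟩

/-- The solution only depends on the values of the fields along it. -/
lemma congr (h : Sol g q f a d T v y) {g' f' : ℝ → ℝ} (hg : ∀ r, a < r → r < T → g (y r) = g' (y r))
    (hf : ∀ r, a < r → r < T → f (v r) = f' (v r)) : Sol g' q f' a d T v y :=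
  ⟨h.cont_v, h.cont_y, h.init, fun r hr hrT => (h.deriv_v r hr hrT).congr_deriv (hg r hr hrT),
    fun r hr hrT => (h.deriv_y r hr hrT).congr_deriv (by rw [hf r hr hrT])⟩

lemma reflect (h : Sol g q f a d T v y) (hg : ∀ s, g (-s) = -g s) :
    Sol g q (fun s => -f (-s)) a (-d) T (fun r => -v r) (fun r => -y r) := by
  refine ⟨h.cont_v.neg, h.cont_y.neg, fun r hr => ?_, fun r hr hrT => ?_, fun r hr hrT => ?_⟩
  · rw [(h.init r hr).1, (h.init r hr).2]; simp
  · rw [hg]; exact (h.deriv_v r hr hrT).neg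
  · refine (h.deriv_y r hr hrT).neg.congr_deriv ?_
    simp only [neg_neg]; ring

lemma hasDerivAt_energy (h : Sol g q f a d T v y) (hf : Continuous f)
    (hk : ∀ s, HasDerivAt k (g s) s) (hr : a < r) (hrT : r < T) :
    HasDerivAt (energy k f v y) (-(deriv q r / q r * (y r * g (y r)))) r := by
  refine (((hk (y r)).comp r (h.deriv_y r hr hrT)).add
    ((hasDerivAt_primitiveF hf (v r)).comp r (h.deriv_v r hr hrT))).congr_deriv ?_
  ring

lemma continuous_energy (h : Sol g q f a d T v y) (hf : Continuous f)
    (hk : ∀ s, HasDerivAt k (g s) s) : Continuous (energy k f v y) := by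
  have hkc : Continuous k := continuous_iff_continuousAt.2 fun s => (hk s).continuousAt
  exact (hkc.comp h.cont_y).add ((continuous_primitiveF hf).comp h.cont_v)

lemma energy_anti (hq : IsAdmissibleWeight p q) (ha : 0 ≤ a) (h : Sol g q f a d T v y)
    (hf : Continuous f) (hk : ∀ s, HasDerivAt k (g s) s) (hg : ∀ s, 0 ≤ s * g s) (hs : a ≤ s) (hst : s ≤ t) (ht : t ≤ T) :
    energy k f v y t ≤ energy k f v y s := by
  have := le_of_hasDerivAt_nonneg (u := fun r => -energy k f v y r) hst
    (h.continuous_energy hf hk).neg.continuousOn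
    (fun r hr => (h.hasDerivAt_energy hf hk (hs.trans_lt hr.1) (hr.2.trans_le ht)).neg)
    (fun r hr => by
      have hr0 : 0 < r := ha.trans_lt (hs.trans_lt hr.1)
      rw [neg_neg]
      exact mul_nonneg (div_nonneg (hq.deriv_pos r hr0).le (hq.pos hr0).le) (hg _))
  linarith

lemma energy_start (h : Sol g q f a d T v y) (hk0 : k 0 = 0) :
    energy k f v y a = primitiveF f d := by
  rw [energy, (h.init a le_rfl).1, (h.init a le_rfl).2, hk0, zero_add]

lemma continuous_flux (hq : IsAdmissibleWeight p q) (h : Sol g q f a d T v y) :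
    Continuous fun r => extWeight q r * y r := hq.continuous_ext.mul h.cont_y

lemma hasDerivAt_flux (hq : IsAdmissibleWeight p q) (ha : 0 ≤ a) (h : Sol g q f a d T v y)
    (hr : a < r) (hrT : r < T) :
    HasDerivAt (fun r => extWeight q r * y r) (-(q r * f (v r))) r := by
  have hr0 := ha.trans_lt hr
  refine (((hq.hasDerivAt hr0).mul (h.deriv_y r hr hrT)).congr_of_eventuallyEq ?_).congr_deriv ?_
  · filter_upwards [Ioi_mem_nhds hr0] with s hs
    simp only [Pi.mul_apply, extWeight_of_pos q hs]
  · have := (hq.pos hr0).ne'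
    field_simp; ring

/-- Upper bound of the flux from a lower bound of the nonlinearity. -/
lemma flux_le (hq : IsAdmissibleWeight p q) (ha : 0 ≤ a) (h : Sol g q f a d T v y)
    (hs : a ≤ s) (hst : s ≤ t) (ht : t ≤ T) (hc : ∀ r ∈ Ioo s t, c ≤ f (v r)) :
    extWeight q t * y t + c * (primitiveQ q t - primitiveQ q s) ≤ extWeight q s * y s := by
  have := le_of_hasDerivAt_nonneg (u := fun r => -(extWeight q r * y r) - c * primitiveQ q r) hst
    ((h.continuous_flux hq).neg.continuousOn.sub (continuousOn_const.mul
      (hq.continuousOn_primitiveQ.mono fun r hr => ha.trans (hs.trans hr.1))))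
    (fun r hr => (h.hasDerivAt_flux hq ha (hs.trans_lt hr.1) (hr.2.trans_le ht)).neg.sub
      ((hq.hasDerivAt_primitiveQ (ha.trans_lt (hs.trans_lt hr.1))).const_mul c))
    (fun r hr => by
      have := hq.pos (ha.trans_lt (hs.trans_lt hr.1))
      nlinarith [hc r hr])
  linarith

lemma flux_ge (hq : IsAdmissibleWeight p q) (ha : 0 ≤ a) (h : Sol g q f a d T v y)
    (hs : a ≤ s) (hst : s ≤ t) (ht : t ≤ T) (hc : ∀ r ∈ Ioo s t, f (v r) ≤ c) :
    extWeight q s * y s ≤ extWeight q t * y t + c * (primitiveQ q t - primitiveQ q s) := by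
  have := le_of_hasDerivAt_nonneg (u := fun r => extWeight q r * y r + c * primitiveQ q r) hst
    ((h.continuous_flux hq).continuousOn.add (continuousOn_const.mul
      (hq.continuousOn_primitiveQ.mono fun r hr => ha.trans (hs.trans hr.1))))
    (fun r hr => (h.hasDerivAt_flux hq ha (hs.trans_lt hr.1) (hr.2.trans_le ht)).add
      ((hq.hasDerivAt_primitiveQ (ha.trans_lt (hs.trans_lt hr.1))).const_mul c))
    (fun r hr => by
      have := hq.pos (ha.trans_lt (hs.trans_lt hr.1))
      nlinarith [hc r hr])
  linarith

/-- The energy, raised by a constant, does not decay faster than `q ^ (-m)` if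
`s g(s) ≤ m k(s)`. -/
lemma weighted_energy_mono (hq : IsAdmissibleWeight p q) (h : Sol g q f a d T v y)
    (hf : Continuous f) (hk : ∀ s, HasDerivAt k (g s) s) (hm : 0 < m)
    (hkg : ∀ s, s * g s ≤ m * k s) (hs0 : 0 < s) (hs : a ≤ s) (hst : s ≤ t)
    (ht : t ≤ T) (hB : ∀ r ∈ Ioo s t, -B ≤ primitiveF f (v r)) :
    q s ^ m * (energy k f v y s + B) ≤ q t ^ m * (energy k f v y t + B) := by
  have hd : ∀ r, 0 < r → HasDerivAt (fun r => q r ^ m) (deriv q r * m * q r ^ (m - 1)) r :=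
    fun r hr => (hq.hasDerivAt hr).rpow_const (Or.inl (hq.pos hr).ne')
  refine le_of_hasDerivAt_nonneg (u := fun r => q r ^ m * (energy k f v y r + B)) hst
    (ContinuousOn.mul (fun r hr => (hd r (hs0.trans_le hr.1)).continuousAt.continuousWithinAt)
      ((h.continuous_energy hf hk).add continuous_const).continuousOn)
    (fun r hr => (hd r (hs0.trans hr.1)).mul
      ((h.hasDerivAt_energy hf hk (hs.trans_lt hr.1) (hr.2.trans_le ht)).add_const B))
    (fun r hr => ?_)
  have hr0 := hs0.trans hr.1
  have hq0 := hq.pos hr0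
  rw [rpow_sub_one hq0.ne']
  have e : deriv q r * m * (q r ^ m / q r) * (energy k f v y r + B) +
      q r ^ m * -(deriv q r / q r * (y r * g (y r))) =
      deriv q r * (q r ^ m / q r) * (m * (energy k f v y r + B) - y r * g (y r)) := by
    field_simp; ring
  rw [e]
  refine mul_nonneg (mul_nonneg (hq.deriv_pos r hr0).le (by positivity)) ?_
  have h1 := hB r hr
  have h2 := hkg (y r)
  unfold energy
  nlinarith

end Sol

/-- The kinetic energy of the `p`-Laplacian. -/
def kin (p' s : ℝ) : ℝ := |s| ^ p' / p'

lemma hasDerivAt_kin (h : 1 < p') (s : ℝ) : HasDerivAt (kin p') (phi p' s) s :=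
  hasDerivAt_kinetic h s

lemma kin_zero (h : 1 < p') : kin p' 0 = 0 := by
  unfold kin; rw [abs_zero, zero_rpow (by linarith), zero_div]

lemma kin_nonneg (h : 1 < p') (s : ℝ) : 0 ≤ kin p' s := by
  unfold kin; positivity

lemma mul_phi_eq_kin (h : 1 < p') (s : ℝ) : s * phi p' s = p' * kin p' s := by
  rw [mul_phi h]; unfold kin; field_simp

lemma kin_eq_zero (h : 1 < p') (hs : kin p' s = 0) : s = 0 := by
  unfold kin at hs
  have h1 : |s| ^ p' = 0 := by
    rcases div_eq_zero_iff.1 hs with h1 | h1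
    · exact h1
    · linarith
  rw [Real.rpow_eq_zero (abs_nonneg _) (by linarith)] at h1
  exact abs_eq_zero.1 h1

lemma mul_phi_nonneg (h : 1 < p') (s : ℝ) : 0 ≤ s * phi p' s := by
  rw [mul_phi h]; positivity

lemma continuous_kin (h : 1 < p') : Continuous (kin p') :=
  continuous_iff_continuousAt.2 fun s => (hasDerivAt_kin h s).continuousAt

/-- The energy times `q ^ p'` is nonincreasing while the potential is nonpositive, with an explicit
loss. -/
lemma Sol.weighted_energy_le (hp : 1 < p')
    (hq : IsAdmissibleWeight p q) (h : Sol (phi p') q f a d T v y) (hf : Continuous f)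
    {κ : ℝ} (hs0 : 0 < s) (hs : a ≤ s) (hst : s ≤ t) (ht : t ≤ T)
    (hB : ∀ r ∈ Ioo s t, primitiveF f (v r) ≤ -κ) :
    q t ^ p' * energy (kin p') f v y t + κ * (q t ^ p' - q s ^ p') ≤
      q s ^ p' * energy (kin p') f v y s := by
  have hd : ∀ r, 0 < r → HasDerivAt (fun r => q r ^ p') (deriv q r * p' * q r ^ (p' - 1)) r :=
    fun r hr => (hq.hasDerivAt hr).rpow_const (Or.inl (hq.pos hr).ne')
  have hk := hasDerivAt_kin hp
  have := le_of_hasDerivAt_nonneg (u := fun r => -(q r ^ p' * (energy (kin p') f v y r + κ))) hst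
    (ContinuousOn.neg (ContinuousOn.mul
      (fun r hr => (hd r (hs0.trans_le hr.1)).continuousAt.continuousWithinAt)
      ((h.continuous_energy hf hk).add continuous_const).continuousOn))
    (fun r hr => ((hd r (hs0.trans hr.1)).mul
      ((h.hasDerivAt_energy hf hk (hs.trans_lt hr.1) (hr.2.trans_le ht)).add_const κ)).neg)
    (fun r hr => ?_)
  · linarith
  · have hr0 := hs0.trans hr.1
    have hq0 := hq.pos hr0
    rw [rpow_sub_one hq0.ne', mul_phi_eq_kin hp]
    have e : -(deriv q r * p' * (q r ^ p' / q r) * (energy (kin p') f v y r + κ) +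
        q r ^ p' * -(deriv q r / q r * (p' * kin p' (y r)))) =
        deriv q r * (q r ^ p' / q r) * p' * (-κ - primitiveF f (v r)) := by
      unfold energy; field_simp; ring
    rw [e]
    refine mul_nonneg (mul_nonneg (mul_nonneg (hq.deriv_pos r hr0).le (by positivity))
      (by linarith)) ?_
    linarith [hB r hr]

/-! ### Truncation, global existence and compactness -/

/-- Truncation to the interval `[a, b]`. -/
def clampTo (a b s : ℝ) : ℝ := max a (min b s)

lemma continuous_clampTo (a b : ℝ) : Continuous (clampTo a b) := by unfold clampTo; fun_prop

lemma clampTo_mem (hab : a ≤ b) (s : ℝ) : clampTo a b s ∈ Icc a b :=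
  ⟨le_max_left _ _, max_le hab (min_le_left _ _)⟩

lemma clampTo_eq (hs : s ∈ Icc a b) : clampTo a b s = s := by
  unfold clampTo; rw [min_eq_right hs.2, max_eq_right hs.1]

lemma exists_bound_clampTo (hf : Continuous f) (hab : a ≤ b) :
    ∃ M, ∀ s, |f (clampTo a b s)| ≤ M := by
  obtain ⟨M, hM⟩ := isCompact_Icc.exists_bound_of_continuousOn (s := Icc a b) hf.continuousOn
  exact ⟨M, fun s => hM _ (clampTo_mem hab s)⟩

lemma primitiveF_congr (ha : a ≤ 0) (hb : 0 ≤ b) (hs : s ∈ Icc a b)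
    (h : ∀ t ∈ Icc a b, f t = g t) : primitiveF f s = primitiveF g s := by
  unfold primitiveF
  refine intervalIntegral.integral_congr fun t ht => h t ?_
  exact uIcc_subset_Icc ⟨ha, hb⟩ hs ht

/-- A continuous function stays in an open interval if it never meets the end points. -/
lemma mem_Ioo_of_ne (hv : Continuous v) {A x : ℝ} (hx : v x ∈ Ioo A B)
    (hA : ∀ r, (∀ t ∈ uIcc x r, v t ∈ Icc A B) → v r ≠ A ∧ v r ≠ B) (r : ℝ) : v r ∈ Ioo A B := by
  have hex : ∀ t, v t ∉ Ioo A B → ∃ s ∈ uIcc x t, v s = A ∨ v s = B := fun t ht => by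
    have hi := intermediate_value_uIcc (a := x) (b := t) hv.continuousOn
    rcases le_or_gt (v t) A with h | h
    · exact (hi (mem_uIcc.2 (Or.inr ⟨h, hx.1.le⟩))).imp fun s hs => ⟨hs.1, Or.inl hs.2⟩
    · exact (hi (mem_uIcc.2 (Or.inl ⟨hx.2.le, not_lt.1 fun h' => ht ⟨h, h'⟩⟩))).imp
        fun s hs => ⟨hs.1, Or.inr hs.2⟩
  by_contra hr
  obtain ⟨s, hs, hvs⟩ := hex r hr
  -- The point nearest to `x` at which an end point of the interval is attained: up to it `v` stays
  -- in `[A, B]`, so `hA` applies.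
  obtain ⟨m, ⟨hm, hvm⟩, hmin⟩ := (isCompact_uIcc.inter_right ((isClosed_eq hv continuous_const).union
    (isClosed_eq hv continuous_const)) : IsCompact (uIcc x r ∩ ({s | v s = A} ∪ {s | v s = B})))
    |>.exists_isMinOn ⟨s, hs, hvs⟩ (f := fun t => |t - x|) (by fun_prop)
  refine (not_and_or.2 (hvm.imp not_not.2 not_not.2)) (hA m fun t ht => ?_)
  by_cases h : v t ∈ Ioo A B
  · exact Ioo_subset_Icc_self h
  obtain ⟨z, hz, hvz⟩ := hex t h
  have hzt : z = t := by
    have h1 := hmin (show z ∈ _ from ⟨uIcc_subset_uIcc_left (uIcc_subset_uIcc_left hm ht) hz, hvz⟩)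
    rcases mem_uIcc.1 hz with h2 | h2 <;> rcases mem_uIcc.1 ht with h3 | h3 <;>
      rcases abs_cases (m - x) with h4 | h4 <;> rcases abs_cases (z - x) with h5 | h5 <;>
      linarith [show |m - x| ≤ |z - x| from h1]
  have := hx.1.trans hx.2
  rcases hzt ▸ hvz with h | h <;> rw [h] <;> constructor <;> linarith

/-- Global existence if the potential is larger than `F d` at two points around `0` and `d`. -/
lemma exists_sol (hp : 1 < p') (hq : IsAdmissibleWeight p q)
    (hf : Continuous f) {A : ℝ} (hA : A < 0) (hB : 0 < B) (hd : d ∈ Ioo A B)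
    (hFA : primitiveF f d < primitiveF f A) (hFB : primitiveF f d < primitiveF f B) :
    ∃ v y : ℝ → ℝ, (∀ T, Sol (phi p') q f 0 d T v y) ∧ ∀ r, v r ∈ Ioo A B := by
  have hAB : A ≤ B := (hA.trans hB).le
  have hfc := hf.comp (continuous_clampTo A B)
  obtain ⟨M, hM⟩ := exists_bound_clampTo hf hAB
  obtain ⟨v, y, hs⟩ := exists_sol_of_bounded hq (continuous_phi hp) hfc hM d
  have hFeq : ∀ s ∈ Icc A B, primitiveF (f ∘ clampTo A B) s = primitiveF f s := fun s hs =>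
    primitiveF_congr hA.le hB.le hs fun t ht => by simp [clampTo_eq ht]
  have hmem : ∀ r, v r ∈ Ioo A B := by
    refine mem_Ioo_of_ne (hs 0).cont_v (x := 0) (by rwa [((hs 0).init 0 le_rfl).1]) fun r hr => ?_
    have hvr := hr r right_mem_uIcc
    rcases le_total r 0 with h0 | h0
    · rw [((hs 0).init r h0).1]; exact ⟨hd.1.ne', hd.2.ne⟩
    have hen := (hs r).energy_anti hq le_rfl hfc (hasDerivAt_kin hp) (mul_phi_nonneg hp)
      le_rfl h0 le_rfl
    rw [(hs r).energy_start (kin_zero hp), hFeq d (Ioo_subset_Icc_self hd), energy, hFeq _ hvr] at hen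
    have hk := kin_nonneg hp (y r)
    constructor <;> intro h <;> rw [h] at hen <;> linarith
  refine ⟨v, y, fun T => (hs T).congr (fun _ _ _ => rfl) fun r _ _ => ?_, hmem⟩
  simp [clampTo_eq (Ioo_subset_Icc_self (hmem r))]

lemma Sol.abs_flux_le (hq : IsAdmissibleWeight p q)
    (ha : 0 ≤ a) (h : Sol g q f a d T v y) (hr : a ≤ r) (hrT : r ≤ T)
    (hM : ∀ t ∈ Ioo a r, |f (v t)| ≤ M) : |y r| ≤ M * (r - a) := by
  rcases eq_or_lt_of_le hr with rfl | hlt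
  · rw [(h.init a le_rfl).2]; simp
  have hM0 : 0 ≤ M := (abs_nonneg _).trans (hM ((a + r) / 2) ⟨by linarith, by linarith⟩)
  have h1 := h.flux_le hq ha le_rfl hr hrT fun t ht => (abs_le.1 (hM t ht)).1
  have h2 := h.flux_ge hq ha le_rfl hr hrT fun t ht => (abs_le.1 (hM t ht)).2
  have hr0 := ha.trans_lt hlt
  have hq0 := hq.pos hr0
  rw [extWeight_of_pos q hr0, (h.init a le_rfl).2, mul_zero] at h1 h2
  have h4 := mul_le_mul_of_nonneg_left (hq.primitiveQ_sub_le ha hr) hM0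
  rw [abs_le]
  constructor <;> refine le_of_mul_le_mul_left ?_ hq0 <;> linarith

/-- Limits of bounded solutions are solutions. -/
lemma Sol.exists_limit (hq : IsAdmissibleWeight p q) {U : Ultrafilter ℕ}
    {g f : ℕ → ℝ → ℝ} {g0 f0 : ℝ → ℝ} {a d : ℕ → ℝ} {a0 d0 : ℝ} {v y : ℕ → ℝ → ℝ} {M' : ℝ}
    (ha0 : 0 ≤ a0) (haT : a0 < T) (haa : ∀ n, a0 ≤ a n) (ha : Tendsto a U (𝓝 a0))
    (hd : Tendsto d U (𝓝 d0)) (h : ∀ n, Sol (g n) q (f n) (a n) (d n) T (v n) (y n))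
    (hg : ∀ s, Tendsto (fun z : ℕ × ℝ => g z.1 z.2) ((U : Filter ℕ) ×ˢ 𝓝 s) (𝓝 (g0 s)))
    (hf : ∀ s, Tendsto (fun z : ℕ × ℝ => f z.1 z.2) ((U : Filter ℕ) ×ˢ 𝓝 s) (𝓝 (f0 s)))
    (hB : ∀ n, ∀ r ≤ T, |v n r| ≤ B) (hM : ∀ n s, |s| ≤ B → |f n s| ≤ M)
    (hM' : ∀ n s, |s| ≤ M * (T - a0) → |g n s| ≤ M') :
    ∃ v0 y0 : ℝ → ℝ, Sol g0 q f0 a0 d0 T v0 y0 ∧ ContConv U (Iic T) v v0 ∧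
      ContConv U (Iic T) y y0 := by
  have hB0 : 0 ≤ B := (abs_nonneg _).trans (hB 0 T le_rfl)
  have hM0 : 0 ≤ M := (abs_nonneg _).trans (hM 0 0 (by simpa using hB0))
  have hM'0 : 0 ≤ M' := (abs_nonneg _).trans (hM' 0 0 (by
    rw [abs_zero]; exact mul_nonneg hM0 (by linarith)))
  have hy : ∀ n, ∀ r ≤ T, |y n r| ≤ M * (max (r - a0) 0) := by
    intro n r hr
    rcases le_total r (a n) with h1 | h1
    · rw [((h n).init r h1).2, abs_zero]; positivity
    · have := (h n).abs_flux_le hq (ha0.trans (haa n)) h1 hr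
        fun t ht => hM n _ (hB n t (ht.2.le.trans hr))
      exact this.trans (mul_le_mul_of_nonneg_left (le_max_of_le_left (by linarith [haa n])) hM0)
  have hyT : ∀ n, ∀ r ≤ T, |y n r| ≤ M * (T - a0) := fun n r hr => (hy n r hr).trans
    (mul_le_mul_of_nonneg_left (max_le (by linarith) (by linarith)) hM0)
  -- The limit is taken for the flux instead of `y`: its derivative `-q f(v)` is bounded up to the
  -- origin, whereas `q'/q` is not.
  set w : ℕ → ℝ → ℝ := fun n r => extWeight q r * y n r with hw
  have hint : ∀ n, interior (Iic T ∩ Ici (a n)) ⊆ Ioo (a n) T := fun n => by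
    rw [interior_inter, interior_Iic, interior_Ici]; exact fun x hx => ⟨hx.2, hx.1⟩
  have hord : ∀ n, (Iic T ∩ Ici (a n)).OrdConnected := fun n => ordConnected_Iic.inter ordConnected_Ici
  have hvI : ∀ n, IncrBound (v n) (fun r => if r < a n then 0 else g n (y n r)) 0 (Iic T) := fun n =>
    IncrBound.extend ordConnected_Iic le_rfl (incrBound_of_hasDerivAt (hord n)
      (h n).cont_v.continuousOn fun r hr => (h n).deriv_v r (hint n hr).1 (hint n hr).2)
      fun r _ hr => by rw [((h n).init r hr).1, ((h n).init _ le_rfl).1]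
  have hwI : ∀ n, IncrBound (w n) (fun r => if r < a n then 0 else -(extWeight q r * f n (v n r))) 0
      (Iic T) := fun n =>
    IncrBound.extend ordConnected_Iic le_rfl (incrBound_of_hasDerivAt (hord n)
      ((h n).continuous_flux hq).continuousOn fun r hr => by
        rw [extWeight_of_pos q ((ha0.trans (haa n)).trans_lt (hint n hr).1)]
        exact (h n).hasDerivAt_flux hq (ha0.trans (haa n)) (hint n hr).1 (hint n hr).2)
      fun r _ hr => by simp only [hw]; rw [((h n).init r hr).2, ((h n).init _ le_rfl).2]; simp
  have hT0 : 0 < T := ha0.trans_lt haT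
  have hqT := hq.pos hT0
  have hqle : ∀ r ≤ T, |extWeight q r| ≤ q T := by
    intro r hr
    unfold extWeight
    split_ifs with h0
    · simpa using hqT.le
    · rw [abs_of_pos (hq.pos (not_le.1 h0))]; exact hq.mono (not_le.1 h0) hr
  obtain ⟨v0, hv0⟩ := exists_contConv (U := U) ordConnected_Iic tendsto_const_nhds hvI
    (fun r _ => ⟨M', 1, one_pos, Eventually.of_forall fun n t ht _ => by
      split_ifs
      · rwa [abs_zero]
      · exact hM' n _ (hyT n t ht)⟩)
    fun r hr => ⟨B, Eventually.of_forall fun n => hB n r hr⟩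
  obtain ⟨w0, hw0⟩ := exists_contConv (U := U) ordConnected_Iic tendsto_const_nhds hwI
    (fun r _ => ⟨q T * M, 1, one_pos, Eventually.of_forall fun n t ht _ => by
      split_ifs
      · rw [abs_zero]; positivity
      · rw [abs_neg, abs_mul]
        exact mul_le_mul (hqle t ht) (hM n _ (hB n t ht)) (abs_nonneg _) hqT.le⟩)
    fun r hr => ⟨q T * (M * (T - a0)), Eventually.of_forall fun n => by
      simp only [hw, abs_mul]
      exact mul_le_mul (hqle r hr) (hyT n r hr) (abs_nonneg _) hqT.le⟩
  have hpr : ∀ {r : ℝ}, r < T → 𝓝[Iic T] r = 𝓝 r := fun hr => nhdsWithin_eq_nhds.2 (Iic_mem_nhds hr)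
  have hav : ∀ {r : ℝ}, a0 < r → ∀ᶠ z : ℕ × ℝ in (U : Filter ℕ) ×ˢ 𝓝 r, a z.1 < z.2 := fun hr =>
    (ha.comp tendsto_fst).eventually_lt tendsto_snd hr
  have hyq : ∀ {r : ℝ}, a0 < r → r ≤ T →
      Tendsto (fun z : ℕ × ℝ => y z.1 z.2) ((U : Filter ℕ) ×ˢ 𝓝[Iic T] r) (𝓝 (w0 r / q r)) := by
    intro r hr hrT
    have hr0 := ha0.trans_lt hr
    have hqr : Tendsto (fun z : ℕ × ℝ => q z.2) ((U : Filter ℕ) ×ˢ 𝓝[Iic T] r) (𝓝 (q r)) :=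
      (hq.continuousAt hr0).tendsto.comp (tendsto_snd.mono_right nhdsWithin_le_nhds)
    refine ((hw0 r hrT).div hqr (hq.pos hr0).ne').congr' ?_
    filter_upwards [tendsto_snd.eventually ((lt_mem_nhds hr0).filter_mono nhdsWithin_le_nhds)]
      with z hz
    simp only [Pi.div_apply, hw]
    rw [extWeight_of_pos q hz, mul_div_cancel_left₀ _ (hq.pos hz).ne']
  have hloc : ∀ {F : ℕ × ℝ → ℝ} {r l : ℝ}, Tendsto F ((U : Filter ℕ) ×ˢ 𝓝 r) (𝓝 l) → ∀ ε > 0,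
      ∃ η > 0, ∀ᶠ n in (U : Filter ℕ), ∀ t ∈ Iic T, |t - r| < η → |F (n, t) - l| < ε := by
    intro F r l h1 ε hε
    obtain ⟨A, hA, A', hA', hAA⟩ := eventually_prod_iff.1 (h1.eventually (Metric.ball_mem_nhds _ hε))
    obtain ⟨η, hη, hη'⟩ := Metric.eventually_nhds_iff.1 hA'
    exact ⟨η, hη, hA.mono fun n hn t _ ht => hAA hn (hη' ht)⟩
  have hdv : ∀ r, a0 < r → r < T → HasDerivAt v0 (g0 (w0 r / q r)) r := by
    intro r hr hrT
    refine (hasDerivWithinAt_of_contConv ordConnected_Iic tendsto_const_nhds hvI hv0 hrT.le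
      (g0 := fun r => g0 (w0 r / q r)) ?_).hasDerivAt (Iic_mem_nhds hrT)
    have h2 := hyq hr hrT.le
    rw [hpr hrT] at h2
    refine hloc (F := fun z => if z.2 < a z.1 then 0 else g z.1 (y z.1 z.2))
      (((hg (w0 r / q r)).comp (tendsto_fst.prodMk h2)).congr' ?_)
    filter_upwards [hav hr] with z hz
    rw [if_neg hz.not_gt]; rfl
  have hdw : ∀ r, a0 < r → r < T → HasDerivAt w0 (-(q r * f0 (v0 r))) r := by
    intro r hr hrT
    refine (hasDerivWithinAt_of_contConv ordConnected_Iic tendsto_const_nhds hwI hw0 hrT.le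
      (g0 := fun r => -(q r * f0 (v0 r))) ?_).hasDerivAt (Iic_mem_nhds hrT)
    have h2 := hv0 r hrT.le
    rw [hpr hrT] at h2
    refine hloc (F := fun z => if z.2 < a z.1 then 0 else -(extWeight q z.2 * f z.1 (v z.1 z.2)))
      ((((hq.continuousAt (ha0.trans_lt hr)).tendsto.comp tendsto_snd).mul
        ((hf (v0 r)).comp (tendsto_fst.prodMk h2))).neg.congr' ?_)
    filter_upwards [hav hr, tendsto_snd.eventually (lt_mem_nhds (ha0.trans_lt hr))] with z hz hz0
    rw [if_neg hz.not_gt, extWeight_of_pos q hz0]; rfl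
  have hinit : ∀ r ≤ a0, v0 r = d0 ∧ w0 r = 0 := by
    intro r hr
    have hrT : r ≤ T := hr.trans haT.le
    refine ⟨tendsto_nhds_unique (hv0.tendsto hrT) (hd.congr fun n => ?_),
      tendsto_nhds_unique (hw0.tendsto hrT) (tendsto_const_nhds.congr fun n => ?_)⟩
    · rw [((h n).init r (hr.trans (haa n))).1]
    · simp only [hw]; rw [((h n).init r (hr.trans (haa n))).2, mul_zero]
  have hwb : ∀ r, a0 < r → r ≤ T → |w0 r| ≤ M * (r - a0) * q r := by
    intro r hr hrT
    refine le_of_tendsto (hw0.tendsto hrT).abs (Eventually.of_forall fun n => ?_)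
    have hr0 := ha0.trans_lt hr
    simp only [hw]
    rw [extWeight_of_pos q hr0, abs_mul, abs_of_pos (hq.pos hr0), mul_comm]
    have := hy n r hrT
    rw [max_eq_left (by linarith)] at this
    exact mul_le_mul_of_nonneg_right this (hq.pos hr0).le
  -- The limits are only known up to `T`; they are frozen beyond it because `Sol` asks for functions
  -- that are continuous on the line.
  have hcont : ∀ {u : ℝ → ℝ}, ContinuousOn u (Iic T) → Continuous fun r => u (min r T) := fun hu =>
    hu.comp_continuous (by fun_prop) fun r => min_le_right r T
  have hcongr : ∀ {u : ℝ → ℝ} {u' r : ℝ}, r < T → HasDerivAt u u' r →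
      HasDerivAt (fun r => u (min r T)) u' r := by
    intro u u' r hr hu
    exact hu.congr_of_eventuallyEq (by
      filter_upwards [Iio_mem_nhds hr] with s (hs : s < T) using by rw [min_eq_left hs.le])
  have hsol := Sol.of_flux (g := g0) (f := f0) (d := d0) (T := T) (M := M) hq ha0
    (hcont hv0.continuousOn) (hcont hw0.continuousOn)
    (fun r hr => by rw [min_eq_left (hr.trans haT.le)]; exact hinit r hr)
    (fun r hr => by
      refine (hwb _ (lt_min hr haT) (min_le_right _ _)).trans ?_
      have hmin : 0 < min r T := ha0.trans_lt (lt_min hr haT)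
      refine mul_le_mul (mul_le_mul_of_nonneg_left (by linarith [min_le_left r T]) hM0)
        (hq.mono hmin (min_le_left _ _)) (hq.pos hmin).le (mul_nonneg hM0 (by linarith)))
    (fun r hr hrT => by rw [min_eq_left hrT.le]; exact hcongr hrT (hdv r hr hrT))
    (fun r hr hrT => by rw [min_eq_left hrT.le]; exact hcongr hrT (hdw r hr hrT))
  refine ⟨_, _, hsol, ?_, ?_⟩
  · intro r hr
    beta_reduce
    rw [min_eq_left (mem_Iic.1 hr)]; exact hv0 r hr
  · intro r hr
    beta_reduce
    rcases le_or_gt r a0 with hra | hra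
    · rw [if_pos hra]
      refine squeeze_zero_norm' (a := fun z : ℕ × ℝ => M * max (z.2 - a0) 0) ?_ ?_
      · filter_upwards [tendsto_snd.eventually (self_mem_nhdsWithin : ∀ᶠ t in 𝓝[Iic T] r, t ∈ Iic T)]
          with z hz
        exact hy z.1 z.2 hz
      · have h1 : Tendsto (fun t : ℝ => M * max (t - a0) 0) (𝓝 r) (𝓝 (M * max (r - a0) 0)) := by
          apply Continuous.tendsto; fun_prop
        rw [max_eq_right (by linarith), mul_zero] at h1
        exact h1.comp (tendsto_snd.mono_right nhdsWithin_le_nhds)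
    · rw [if_neg (not_le.2 hra), min_eq_left (mem_Iic.1 hr)]
      exact hyq hra hr

lemma abs_sub_le_of_hasDerivAt {u' : ℝ → ℝ} (hab : a ≤ b)
    (hc : ContinuousOn u (Icc a b)) (hd : ∀ r ∈ Ioo a b, HasDerivAt u (u' r) r)
    (hC : ∀ r ∈ Ioo a b, |u' r| ≤ C) : |u b - u a| ≤ C * (b - a) := by
  rcases hab.eq_or_lt with rfl | h
  · simp
  obtain ⟨r, hr, e⟩ := exists_hasDerivAt_eq_slope u u' h hc hd
  have := hC r hr
  rwa [e, abs_div, abs_of_pos (sub_pos.2 h), div_le_iff₀ (sub_pos.2 h)] at this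

/-! ### Uniqueness and continuous dependence -/

lemma contDiff_primitiveF (hf : Continuous f) : ContDiff ℝ 1 (primitiveF f) := by
  rw [contDiff_one_iff_deriv]
  have h : deriv (primitiveF f) = f := funext fun s => (hasDerivAt_primitiveF hf s).deriv
  exact ⟨fun s => (hasDerivAt_primitiveF hf s).differentiableAt, by rw [h]; exact hf⟩

lemma phi_eq_sign_mul {y : ℝ} (hp : 1 < p') (hσ : σ = 1 ∨ σ = -1) (hy : 0 < σ * y) :
    phi p' y = σ * (|y| ^ p') ^ ((p' - 1) / p') := by
  rw [← rpow_mul (abs_nonneg _), mul_div_cancel₀ _ (by linarith : p' ≠ 0)]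
  rcases hσ with rfl | rfl
  · have h : 0 < y := by linarith
    rw [phi_of_pos h, abs_of_pos h, one_mul]
  · have h : y < 0 := by linarith
    rw [abs_of_neg h, ← phi_of_pos (neg_pos.2 h), phi_neg]; ring

namespace Sol
variable {v1 y1 v2 y2 : ℝ → ℝ}

/-- In the variables `(v, I)`, with `I` the energy, `f` enters only through `F`, which is `C¹`:
`|y|^{p'} = p' (I - F(v))`, and while `y` keeps its sign `v'` is a smooth function of this quantity.
The new system is locally Lipschitz where `y ≠ 0`, although `f` is merely continuous. -/
lemma unique_right_of_ne (hp : 1 < p') (hq : IsAdmissibleWeight p q) (hf : Continuous f)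
    (ha : 0 ≤ a) {d1 d2 : ℝ} (h₁ : Sol (phi p') q f a d1 T v1 y1) (h₂ : Sol (phi p') q f a d2 T v2 y2)
    {x : ℝ} (hx : a < x) (hxT : x < T) (hv : v1 x = v2 x) (hy : y1 x = y2 x) (hy0 : y1 x ≠ 0) :
    ∃ η > 0, ∀ r ∈ Icc x (x + η), v1 r = v2 r ∧ y1 r = y2 r := by
  have hx0 := ha.trans_lt hx
  obtain ⟨σ, hσ, hσy⟩ : ∃ σ : ℝ, (σ = 1 ∨ σ = -1) ∧ 0 < σ * y1 x := by
    rcases lt_or_gt_of_ne hy0 with h | h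
    · exact ⟨-1, Or.inr rfl, by linarith⟩
    · exact ⟨1, Or.inl rfl, by linarith⟩
  set ρ : ℝ → ℝ := fun t => deriv q t / q t
  set Φ : ℝ × ℝ → ℝ := fun z => p' * (z.2 - primitiveF f z.1)
  set Ψ : ℝ × ℝ → ℝ := fun z => σ * (Φ z) ^ ((p' - 1) / p')
  have hen : ∀ {v y : ℝ → ℝ} (r : ℝ), Φ (v r, energy (kin p') f v y r) = |y r| ^ p' := fun r => by
    simp only [Φ, energy, kin]; field_simp; ring
  have hΦc : ContDiff ℝ 1 Φ :=
    contDiff_const.mul (contDiff_snd.sub ((contDiff_primitiveF hf).comp contDiff_fst))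
  set z1 : ℝ → ℝ × ℝ := fun r => (v1 r, energy (kin p') f v1 y1 r)
  set z2 : ℝ → ℝ × ℝ := fun r => (v2 r, energy (kin p') f v2 y2 r)
  have hzx : z1 x = z2 x := by simp only [z1, z2, energy, hv, hy]
  have hΨc : ContDiffAt ℝ 1 Ψ (z1 x) := by
    refine contDiffAt_const.mul (hΦc.contDiffAt.rpow_const_of_ne ?_)
    rw [hen]
    exact (rpow_pos_of_pos (abs_pos.2 hy0) _).ne'
  obtain ⟨K1, t1, ht1, hK1⟩ := hΦc.contDiffAt.exists_lipschitzOnWith (x := z1 x)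
  obtain ⟨K2, t2, ht2, hK2⟩ := hΨc.exists_lipschitzOnWith
  have hkc := hasDerivAt_kin hp
  have hz1c : Continuous z1 := h₁.cont_v.prodMk (h₁.continuous_energy hf hkc)
  have hz2c : Continuous z2 := h₂.cont_v.prodMk (h₂.continuous_energy hf hkc)
  have hρc : ContinuousAt ρ x := (hq.continuousOn_deriv.continuousAt (Ioi_mem_nhds hx0)).div
    (hq.continuousAt hx0) (hq.pos hx0).ne'
  have hev : ∀ᶠ t in 𝓝 x, (z1 t ∈ t1 ∩ t2 ∧ z2 t ∈ t1 ∩ t2) ∧ (0 < σ * y1 t ∧ 0 < σ * y2 t) ∧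
      |ρ t| ≤ |ρ x| + 1 ∧ t < T := by
    refine (((hz1c.continuousAt.eventually_mem (inter_mem ht1 ht2))).and
      (hz2c.continuousAt.eventually_mem (hzx ▸ inter_mem ht1 ht2))).and
      ((Eventually.and ?_ ?_).and (Eventually.and ?_ (gt_mem_nhds hxT)))
    · exact (continuous_const.mul h₁.cont_y).continuousAt.eventually (lt_mem_nhds hσy)
    · exact (continuous_const.mul h₂.cont_y).continuousAt.eventually (lt_mem_nhds (by simpa [← hy] using hσy))
    · exact (hρc.abs.eventually (gt_mem_nhds (lt_add_one _))).mono fun t ht => ht.le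
  obtain ⟨η, hη, hηe⟩ := Metric.eventually_nhds_iff.1 hev
  have hin : ∀ t ∈ Icc x (x + η / 2), dist t x < η := fun t ht => by
    rw [dist_eq, abs_of_nonneg (by linarith [ht.1])]; linarith [ht.2]
  set X : ℝ → ℝ × ℝ → ℝ × ℝ := fun t z => (Ψ z, -ρ t * Φ z)
  have hder : ∀ {d : ℝ} {v y : ℝ → ℝ}, Sol (phi p') q f a d T v y → ∀ t, a < t → t < T →
      0 < σ * y t → HasDerivAt (fun r => (v r, energy (kin p') f v y r))
        (X t (v t, energy (kin p') f v y t)) t := by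
    intro d v y h t ht htT hσt
    convert (h.deriv_v t ht htT).prodMk (h.hasDerivAt_energy hf hkc ht htT) using 1
    simp only [X, Ψ, ρ]
    rw [hen, ← phi_eq_sign_mul hp hσ hσt, mul_phi hp, neg_mul]
  have hLip : ∀ t ∈ Ico x (x + η / 2),
      LipschitzOnWith (max K2 (Real.toNNReal (|ρ x| + 1) * K1)) (X t) (t1 ∩ t2) := by
    intro t ht
    refine (hK2.mono inter_subset_right).prodMk (.of_dist_le_mul fun z hz z' hz' => ?_)
    have h1 := (hK1.mono inter_subset_left).dist_le_mul z hz z' hz'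
    have h2 := (hηe (hin t (Ico_subset_Icc_self ht))).2.2.1
    rw [dist_eq] at h1 ⊢
    rw [← mul_sub, abs_mul, abs_neg, NNReal.coe_mul, Real.coe_toNNReal _ (by positivity), mul_assoc]
    exact mul_le_mul h2 h1 (abs_nonneg _) (by positivity)
  have heq := ODE_solution_unique_of_mem_Icc_right (v := X) (s := fun _ => t1 ∩ t2) hLip
    hz1c.continuousOn
    (fun t ht => have := hηe (hin t (Ico_subset_Icc_self ht))
      (hder h₁ t (hx.trans_le ht.1) this.2.2.2 this.2.1.1).hasDerivWithinAt)
    (fun t ht => (hηe (hin t (Ico_subset_Icc_self ht))).1.1) hz2c.continuousOn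
    (fun t ht => have := hηe (hin t (Ico_subset_Icc_self ht))
      (hder h₂ t (hx.trans_le ht.1) this.2.2.2 this.2.1.2).hasDerivWithinAt)
    (fun t ht => (hηe (hin t (Ico_subset_Icc_self ht))).1.2) hzx
  refine ⟨η / 2, by positivity, fun r hr => ?_⟩
  have h2 := (hηe (hin r hr)).2.1
  refine ⟨congrArg Prod.fst (heq hr), (phi_strictMono hp).injective ?_⟩
  rw [phi_eq_sign_mul hp hσ h2.1, phi_eq_sign_mul hp hσ h2.2, ← hen (v := v1), ← hen (v := v2)]
  exact congrArg Ψ (heq hr)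

lemma flux_sub_le (hq : IsAdmissibleWeight p q) (ha : 0 ≤ a) {d1 d2 : ℝ}
    (h₁ : Sol g q f a d1 T v1 y1) (h2 : Sol g q f a d2 T v2 y2) (hs : a ≤ s) (hst : s ≤ t)
    (ht : t ≤ T) (hc : ∀ r ∈ Ioo s t, |f (v1 r) - f (v2 r)| ≤ c) :
    extWeight q s * (y1 s - y2 s) ≤
      extWeight q t * (y1 t - y2 t) + c * (primitiveQ q t - primitiveQ q s) := by
  have := le_of_hasDerivAt_nonneg
    (u := fun r => extWeight q r * y1 r - extWeight q r * y2 r + c * primitiveQ q r) hst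
    (((h₁.continuous_flux hq).sub (h2.continuous_flux hq)).continuousOn.add (continuousOn_const.mul
      (hq.continuousOn_primitiveQ.mono fun r hr => ha.trans (hs.trans hr.1))))
    (fun r hr => ((h₁.hasDerivAt_flux hq ha (hs.trans_lt hr.1) (hr.2.trans_le ht)).sub
      (h2.hasDerivAt_flux hq ha (hs.trans_lt hr.1) (hr.2.trans_le ht))).add
      ((hq.hasDerivAt_primitiveQ (ha.trans_lt (hs.trans_lt hr.1))).const_mul c))
    (fun r hr => by
      have h1 := hq.pos (ha.trans_lt (hs.trans_lt hr.1))
      nlinarith [(abs_le.1 (hc r hr)).2])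
  linarith

lemma phi_neg_mul (hδ : 0 < δ) (hz : 0 < z) :
    phi p' (-(δ * z)) = -(δ ^ (p' - 1) * phi p' z) := by
  rw [phi_neg, phi_of_pos (mul_pos hδ hz), phi_of_pos hz, mul_rpow hδ.le hz.le]

lemma exists_lipschitz_phi (hm : 0 < m) :
    ∃ K : ℝ, 0 ≤ K ∧ ∀ x ∈ Icc m M, ∀ y ∈ Icc m M, |phi p' x - phi p' y| ≤ K * |x - y| := by
  have hd : ∀ x ∈ Icc m M, HasDerivAt (fun x => x ^ (p' - 1)) ((p' - 1) * x ^ (p' - 1 - 1)) x :=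
    fun x hx => hasDerivAt_rpow_const (Or.inl (hm.trans_le hx.1).ne')
  obtain ⟨K, hK⟩ := isCompact_Icc.exists_bound_of_continuousOn (s := Icc m M)
    (f := fun x : ℝ => (p' - 1) * x ^ (p' - 1 - 1))
    (continuousOn_const.mul (continuousOn_id.rpow_const fun x hx => Or.inl (hm.trans_le hx.1).ne'))
  refine ⟨|K|, abs_nonneg _, fun x hx y hy => ?_⟩
  rw [phi_of_pos (hm.trans_le hx.1), phi_of_pos (hm.trans_le hy.1)]
  exact (convex_Icc m M).norm_image_sub_le_of_norm_hasDerivWithin_le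
    (fun z hz => (hd z hz).hasDerivWithinAt) (fun z hz => (hK z hz).trans (le_abs_self _)) hy hx

/-- At a turning point, possibly at the origin, `φ_{p'}` need not be Lipschitz at `y = 0`. But `f >
0` makes `-y / (r - x)` stay in a compact subinterval of `(0, ∞)`, and `φ_{p'}` is homogeneous, so
its increments are controlled after the factor `r - x` has been taken out. The difference of the two
solutions then satisfies a contraction estimate on a short interval. -/
lemma unique_right_of_eq_zero (hp : 1 < p') (hq : IsAdmissibleWeight p q) (hf : Continuous f)
    (ha : 0 ≤ a) {d1 d2 : ℝ} (h1 : Sol (phi p') q f a d1 T v1 y1) (h2 : Sol (phi p') q f a d2 T v2 y2)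
    {x : ℝ} (hx : a ≤ x) (hxT : x < T) (hv : v1 x = v2 x) (hy1 : y1 x = 0) (hy2 : y2 x = 0)
    (hf0 : 0 < f (v1 x)) (hL : ∃ K, ∃ t ∈ 𝓝 (v1 x), LipschitzOnWith K f t) :
    ∃ η > 0, ∀ r ∈ Icc x (x + η), v1 r = v2 r ∧ y1 r = y2 r := by
  obtain ⟨L, t, ht, hL⟩ := hL
  obtain ⟨C, hC, hCq⟩ := hq.exists_deriv_le
  set c := f (v1 x)
  have hev : ∀ᶠ r in 𝓝 x, (v1 r ∈ t ∧ v2 r ∈ t) ∧ (c / 2 < f (v1 r) ∧ c / 2 < f (v2 r)) ∧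
      (f (v1 r) < 2 * c ∧ f (v2 r) < 2 * c) ∧ r < T := by
    have e1 : ContinuousAt (fun r => f (v1 r)) x := (hf.comp h1.cont_v).continuousAt
    have e2 : ContinuousAt (fun r => f (v2 r)) x := (hf.comp h2.cont_v).continuousAt
    have e3 : f (v2 x) = c := hv ▸ rfl
    exact ((h1.cont_v.continuousAt.eventually_mem ht).and
      (h2.cont_v.continuousAt.eventually_mem (hv ▸ ht))).and
      (((e1.eventually (lt_mem_nhds (by linarith))).and
        (e2.eventually (lt_mem_nhds (by linarith)))).and
      (((e1.eventually (gt_mem_nhds (by linarith))).and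
        (e2.eventually (gt_mem_nhds (by linarith)))).and (gt_mem_nhds hxT)))
  obtain ⟨η0, hη₀, hη⟩ := Metric.eventually_nhds_iff.1 hev
  -- The lower bound of `-y / (r - x)` that follows from `f ≥ c / 2` and `le_primitiveQ_sub`.
  set m' := c / 2 / (1 + C)
  have hm'0 : 0 < m' := by positivity
  obtain ⟨K, hK0, hK⟩ := exists_lipschitz_phi (p' := p') (M := 2 * c) hm'0
  -- The last term makes `K L η < 1/2`, so that `N ≤ K L η N` forces `N = 0`; `η ≤ 1` bounds the
  -- power of `r - x` by 1.
  set η := min (η0 / 2) (min 1 (1 / (2 * (K * L + 1))))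
  have hη0 : 0 < η := by positivity
  have hη1 : η ≤ 1 := (min_le_right _ _).trans (min_le_left _ _)
  have hη2 : η * (2 * (K * L + 1)) ≤ 1 := by
    have : η ≤ 1 / (2 * (K * L + 1)) := (min_le_right _ _).trans (min_le_right _ _)
    rwa [le_div_iff₀ (by positivity)] at this
  have hin : ∀ r ∈ Icc x (x + η), dist r x < η0 := fun r hr => by
    have : η ≤ η0 / 2 := min_le_left _ _
    rw [dist_eq, abs_of_nonneg (by linarith [hr.1])]; linarith [hr.2]
  have hslope : ∀ {d : ℝ} {v y : ℝ → ℝ}, Sol (phi p') q f a d T v y → y x = 0 →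
      (∀ r ∈ Icc x (x + η), c / 2 < f (v r) ∧ f (v r) < 2 * c ∧ r < T) →
      ∀ r ∈ Ioc x (x + η), -y r / (r - x) ∈ Icc m' (2 * c) := by
    intro d v y h hy0 hb r hr
    have hrT := (hb r ⟨hr.1.le, hr.2⟩).2.2.le
    have hx0 := ha.trans hx
    have hr0 := hx0.trans_lt hr.1
    have hb' : ∀ t ∈ Ioo x r, _ := fun t ht => hb t ⟨ht.1.le, ht.2.le.trans hr.2⟩
    have e1 := h.flux_le hq ha hx hr.1.le hrT fun t ht => (hb' t ht).1.le
    have e2 := h.flux_ge hq ha hx hr.1.le hrT fun t ht => (hb' t ht).2.1.le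
    rw [hy0, mul_zero, extWeight_of_pos q hr0] at e1 e2
    have e3 := hq.le_primitiveQ_sub hCq hx0 hr0 hr.1.le
    have e4 := hq.primitiveQ_sub_le hx0 hr.1.le
    have hd : 0 < r - x := by linarith [hr.1]
    have hqr := hq.pos hr0
    constructor
    · rw [div_le_div_iff₀ (by positivity) hd]
      refine le_of_mul_le_mul_left ?_ hqr
      linarith [mul_le_mul_of_nonneg_left e3 (show 0 ≤ c / 2 by positivity),
        mul_le_mul_of_nonneg_left e1 (show 0 ≤ 1 + C by positivity)]
    · exact (div_le_iff₀ hd).2 (le_of_mul_le_mul_left (by nlinarith) hqr)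
  have hb : ∀ r ∈ Icc x (x + η), _ := fun r hr => hη (hin r hr)
  have hs1 := hslope h1 hy1 fun r hr => ⟨(hb r hr).2.1.1, (hb r hr).2.2.1.1, (hb r hr).2.2.2⟩
  have hs2 := hslope h2 hy2 fun r hr => ⟨(hb r hr).2.1.2, (hb r hr).2.2.1.2, (hb r hr).2.2.2⟩
  obtain ⟨rm, hrm, hmax⟩ := isCompact_Icc.exists_isMaxOn (s := Icc x (x + η))
    ⟨x, le_rfl, by linarith⟩ (f := fun r => |v1 r - v2 r|)
    ((h1.cont_v.sub h2.cont_v).abs.continuousOn)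
  set N := |v1 rm - v2 rm|
  have hN' : ∀ r ∈ Icc x (x + η), |v1 r - v2 r| ≤ N := fun r hr => hmax hr
  have hN0 : 0 ≤ N := abs_nonneg _
  have hfd : ∀ r ∈ Icc x (x + η), |f (v1 r) - f (v2 r)| ≤ L * N := by
    intro r hr
    have := hL.dist_le_mul _ (hb r hr).1.1 _ (hb r hr).1.2
    rw [dist_eq, dist_eq] at this
    exact this.trans (mul_le_mul_of_nonneg_left (hN' r hr) L.2)
  have hyd : ∀ r ∈ Ioc x (x + η), |y1 r - y2 r| ≤ L * N * (r - x) := by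
    intro r hr
    have hrT := (hb r ⟨hr.1.le, hr.2⟩).2.2.2.le
    have hx0 := ha.trans hx
    have hr0 := hx0.trans_lt hr.1
    have hfr : ∀ t ∈ Ioo x r, |f (v1 t) - f (v2 t)| ≤ L * N := fun t ht =>
      hfd t ⟨ht.1.le, ht.2.le.trans hr.2⟩
    have e1 := h1.flux_sub_le hq ha h2 hx hr.1.le hrT hfr
    have e2 := h2.flux_sub_le hq ha h1 hx hr.1.le hrT fun t ht => by
      rw [abs_sub_comm]; exact hfr t ht
    rw [hy1, hy2, sub_zero, mul_zero, extWeight_of_pos q hr0] at e1 e2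
    have e4 := mul_le_mul_of_nonneg_left (hq.primitiveQ_sub_le hx0 hr.1.le)
      (show 0 ≤ L * N by positivity)
    have hqr := hq.pos hr0
    rw [abs_le]
    constructor <;> refine le_of_mul_le_mul_left ?_ hqr <;> linarith
  have hphi : ∀ r ∈ Ioo x rm, |phi p' (y1 r) - phi p' (y2 r)| ≤ K * (L * N) := by
    intro r hr
    have hr' : r ∈ Ioc x (x + η) := ⟨hr.1, hr.2.le.trans hrm.2⟩
    have hδ : 0 < r - x := by linarith [hr.1]
    have e1 := hs1 r hr'
    have e2 := hs2 r hr'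
    have f1 : y1 r = -((r - x) * (-y1 r / (r - x))) := by field_simp
    have f2 : y2 r = -((r - x) * (-y2 r / (r - x))) := by field_simp
    rw [f1, f2, phi_neg_mul hδ (hm'0.trans_le e1.1), phi_neg_mul hδ (hm'0.trans_le e2.1),
      neg_sub_neg, abs_sub_comm, ← mul_sub, abs_mul, abs_of_nonneg (by positivity)]
    have g3 : |-y1 r / (r - x) - -y2 r / (r - x)| ≤ L * N := by
      rw [← sub_div, abs_div, abs_of_pos hδ, div_le_iff₀ hδ, neg_sub_neg, abs_sub_comm]
      exact hyd r hr'
    exact (mul_le_of_le_one_left (abs_nonneg _) (Real.rpow_le_one hδ.le (by linarith [hr'.2])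
      (by linarith))).trans ((hK _ e1 _ e2).trans (mul_le_mul_of_nonneg_left g3 hK0))
  have hNz : N = 0 := by
    have e := abs_sub_le_of_hasDerivAt (u := fun r => v1 r - v2 r) hrm.1
      (h1.cont_v.sub h2.cont_v).continuousOn
      (fun r hr => (h1.deriv_v r (hx.trans_lt hr.1)
        (hb r ⟨hr.1.le, hr.2.le.trans hrm.2⟩).2.2.2).sub (h2.deriv_v r (hx.trans_lt hr.1)
        (hb r ⟨hr.1.le, hr.2.le.trans hrm.2⟩).2.2.2)) hphi
    rw [hv, sub_self, sub_zero] at e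
    nlinarith [mul_le_mul_of_nonneg_left (show rm - x ≤ η by linarith [hrm.2])
      (show 0 ≤ K * (L * N) by positivity)]
  refine ⟨η, hη0, fun r hr => ⟨?_, ?_⟩⟩
  · linarith [abs_nonpos_iff.1 ((hN' r hr).trans_eq hNz)]
  · rcases hr.1.eq_or_lt with h | h
    · rw [← h, hy1, hy2]
    · have := hyd r ⟨h, hr.2⟩
      rw [hNz, mul_zero, zero_mul] at this
      linarith [abs_nonpos_iff.1 this]

/-- The set of agreement is closed, and it can be extended to the right at every point that is not
stationary; the case `f < 0` follows by reflection. -/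
lemma unique (hp : 1 < p') (hq : IsAdmissibleWeight p q) (hf : Continuous f)
    (hL : ∀ s, f s ≠ 0 → ∃ K, ∃ t ∈ 𝓝 s, LipschitzOnWith K f t)
    (ha : 0 ≤ a) (h1 : Sol (phi p') q f a d T v1 y1) (h2 : Sol (phi p') q f a d T v2 y2)
    (hns : ∀ r, a ≤ r → r < T → y1 r ≠ 0 ∨ f (v1 r) ≠ 0) (hr : r ≤ T) :
    v1 r = v2 r ∧ y1 r = y2 r := by
  rcases le_or_gt r a with hra | hra
  · simp [h1.init r hra, h2.init r hra]
  set S : Set ℝ := {r | v1 r = v2 r ∧ y1 r = y2 r}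
  have hSc : IsClosed S := (isClosed_eq h1.cont_v h2.cont_v).inter (isClosed_eq h1.cont_y h2.cont_y)
  have hsub : Icc a T ⊆ S := by
    refine (hSc.inter isClosed_Icc).Icc_subset_of_forall_mem_nhdsWithin ?_ ?_
    · simp [S, h1.init a le_rfl, h2.init a le_rfl]
    · rintro x ⟨⟨hv, hy⟩, hxa, hxT⟩
      have hloc : ∃ η > 0, ∀ r ∈ Icc x (x + η), v1 r = v2 r ∧ y1 r = y2 r := by
        by_cases hy0 : y1 x = 0
        · have hf0 := (hns x hxa hxT).resolve_left (not_not.2 hy0)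
          obtain ⟨K, t, ht, hK⟩ := hL _ hf0
          rcases lt_or_gt_of_ne hf0 with hneg | hpos
          · have hcf : Continuous fun s => -f (-s) := (hf.comp continuous_neg).neg
            have ht' : Neg.neg ⁻¹' t ∈ 𝓝 (-v1 x) :=
              continuous_neg.continuousAt.preimage_mem_nhds (by rwa [neg_neg])
            have hK' : LipschitzOnWith K (fun s => -f (-s)) (Neg.neg ⁻¹' t) := by
              refine .of_dist_le_mul fun s hs s' hs' => ?_
              have := hK.dist_le_mul _ hs _ hs'
              rwa [dist_neg_neg] at this ⊢
            obtain ⟨η, hη, hηr⟩ := unique_right_of_eq_zero hp hq hcf ha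
              (h1.reflect (phi_neg p')) (h2.reflect (phi_neg p')) hxa hxT (by rw [hv])
              (by rw [hy0, neg_zero]) (by rw [← hy, hy0, neg_zero])
              (by simp only [neg_neg]; linarith) ⟨K, _, ht', hK'⟩
            exact ⟨η, hη, fun r hr => ⟨neg_injective (hηr r hr).1, neg_injective (hηr r hr).2⟩⟩
          · exact unique_right_of_eq_zero hp hq hf ha h1 h2 hxa hxT hv hy0 (hy ▸ hy0) hpos
              ⟨K, t, ht, hK⟩
        · exact unique_right_of_ne hp hq hf ha h1 h2
            (hxa.lt_of_ne fun h => hy0 (h ▸ (h1.init a le_rfl).2)) hxT hv hy hy0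
      obtain ⟨η, hη, h⟩ := hloc
      exact mem_of_superset (Icc_mem_nhdsGT (by linarith)) fun r hr => h r hr
  exact hsub ⟨hra.le, hr⟩

/-- Continuous dependence on the initial height. -/
lemma continuous_dependence (hp : 1 < p') (hq : IsAdmissibleWeight p q) (hf : Continuous f)
    (hL : ∀ s, f s ≠ 0 → ∃ K, ∃ t ∈ 𝓝 s, LipschitzOnWith K f t) (ha : 0 ≤ a) (haT : a < T)
    {D : Set ℝ} {V Y : ℝ → ℝ → ℝ} (h : ∀ d ∈ D, Sol (phi p') q f a d T (V d) (Y d))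
    (hB : ∀ d ∈ D, ∀ r ≤ T, |V d r| ≤ B) (hd : d ∈ D)
    (hns : ∀ r, a ≤ r → r < T → Y d r ≠ 0 ∨ f (V d r) ≠ 0) (hε : 0 < ε) :
    ∃ δ > 0, ∀ d' ∈ D, |d' - d| < δ → ∀ r ∈ Icc a T, |V d' r - V d r| < ε ∧ |Y d' r - Y d r| < ε := by
  -- Heights that violate the estimate would tend to `d`; by compactness their solutions converge
  -- along an ultrafilter to a solution of height `d`, which is the given one by uniqueness.
  by_contra! hcon
  choose dn hdD hdn rn hrn hbad using fun n : ℕ => hcon (1 / ((n : ℝ) + 1)) (by positivity)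
  set U : Ultrafilter ℕ := hyperfilter ℕ
  have hd0 : Tendsto dn U (𝓝 d) := by
    rw [tendsto_iff_dist_tendsto_zero]
    refine squeeze_zero (fun _ => dist_nonneg) (fun n => (hdn n).le) ?_
    exact tendsto_one_div_add_atTop_nhds_zero_nat.mono_left Nat.hyperfilter_le_atTop
  obtain ⟨r, hr, hUr⟩ := isCompact_Icc.ultrafilter_le_nhds' (s := Icc a T) (U.map rn)
    (Eventually.of_forall hrn : ∀ᶠ n in (U : Filter ℕ), rn n ∈ Icc a T)
  have hrt : Tendsto rn U (𝓝 r) := hUr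
  obtain ⟨M, hM⟩ := isCompact_Icc.exists_bound_of_continuousOn (s := Icc (-B) B) hf.continuousOn
  obtain ⟨M', hM'⟩ := isCompact_Icc.exists_bound_of_continuousOn
    (s := Icc (-(M * (T - a))) (M * (T - a))) (continuous_phi hp).continuousOn
  obtain ⟨v0, y0, hs, hv0, hy0⟩ := Sol.exists_limit hq (U := U) (g := fun _ => phi p')
    (f := fun _ => f) (g0 := phi p') (f0 := f) (a := fun _ => a) ha haT (fun _ => le_rfl)
    tendsto_const_nhds hd0 (fun n => h _ (hdD n))
    (fun s => ((continuous_phi hp).tendsto s).comp tendsto_snd)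
    (fun s => (hf.tendsto s).comp tendsto_snd) (fun n r hr => hB _ (hdD n) r hr)
    (fun n s hs => hM s (abs_le.1 hs)) (fun n s hs => hM' s (abs_le.1 hs))
  obtain ⟨e1, e2⟩ := (h d hd).unique hp hq hf hL ha hs hns hr.2
  have l1 := ((hv0.tendsto_comp hr.2 hrt (Eventually.of_forall fun n => (hrn n).2)).sub
    (((h d hd).cont_v.tendsto r).comp hrt)).abs
  have l2 := ((hy0.tendsto_comp hr.2 hrt (Eventually.of_forall fun n => (hrn n).2)).sub
    (((h d hd).cont_y.tendsto r).comp hrt)).abs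
  rw [← e1, sub_self, abs_zero] at l1
  rw [← e2, sub_self, abs_zero] at l2
  obtain ⟨n, h1, h2⟩ := ((l1.eventually (gt_mem_nhds hε)).and (l2.eventually (gt_mem_nhds hε))).exists
  exact (hbad n h1).not_gt h2

end Sol

/-! ### The double well potential -/

/-- The sign conditions on `f` and its primitive. -/
structure DoubleWell (f : ℝ → ℝ) (βm βp : ℝ) : Prop where
  cont : Continuous f
  map_zero : f 0 = 0
  neg_left : βm < 0
  pos_right : 0 < βp
  well : ∀ s ∈ Ioo βm βp, s ≠ 0 → primitiveF f s < 0
  left_eq : primitiveF f βm = 0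
  right_eq : primitiveF f βp = 0
  pos : ∀ s, βp ≤ s → 0 < f s
  neg : ∀ s, s ≤ βm → f s < 0

namespace DoubleWell

lemma reflect (h : DoubleWell f βm βp) : DoubleWell (fun s => -f (-s)) (-βp) (-βm) where
  cont := (h.cont.comp continuous_neg).neg
  map_zero := by simp [h.map_zero]
  neg_left := by linarith [h.pos_right]
  pos_right := by linarith [h.neg_left]
  well s hs h0 := by
    rw [primitiveF_reflect]
    exact h.well _ ⟨by linarith [hs.2], by linarith [hs.1]⟩ (by simpa using h0)
  left_eq := by rw [primitiveF_reflect, neg_neg, h.right_eq]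
  right_eq := by rw [primitiveF_reflect, neg_neg, h.left_eq]
  pos s hs := by linarith [h.neg (-s) (by linarith)]
  neg s hs := by linarith [h.pos (-s) (by linarith)]

lemma strictMonoOn (h : DoubleWell f βm βp) : StrictMonoOn (primitiveF f) (Ici βp) := by
  refine strictMonoOn_of_deriv_pos (convex_Ici βp) (continuous_primitiveF h.cont).continuousOn
    fun x hx => ?_
  rw [interior_Ici] at hx
  rw [(hasDerivAt_primitiveF h.cont x).deriv]
  exact h.pos x hx.le

lemma nonpos (h : DoubleWell f βm βp) (hs : s ∈ Icc βm βp) : primitiveF f s ≤ 0 := by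
  rcases hs.1.eq_or_lt with h1 | h1
  · rw [← h1, h.left_eq]
  rcases hs.2.eq_or_lt with h2 | h2
  · rw [h2, h.right_eq]
  rcases eq_or_ne s 0 with h3 | h3
  · rw [h3, primitiveF_zero]
  · exact (h.well s ⟨h1, h2⟩ h3).le

lemma gt_of_pos (h : DoubleWell f βm βp) (hs : 0 < primitiveF f s) (hs0 : 0 ≤ s) :
    βp < s :=
  not_le.1 fun hcon => (h.nonpos ⟨h.neg_left.le.trans hs0, hcon⟩).not_gt hs

lemma lt_of_pos (h : DoubleWell f βm βp) (hs : 0 < primitiveF f s) (hs0 : s ≤ 0) :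
    s < βm :=
  not_le.1 fun hcon => (h.nonpos ⟨hcon, hs0.trans h.pos_right.le⟩).not_gt hs

lemma ne_zero_of_pos (h : DoubleWell f βm βp) (hs : 0 < primitiveF f s) : f s ≠ 0 := by
  rcases le_total 0 s with h0 | h0
  · exact (h.pos s (h.gt_of_pos hs h0).le).ne'
  · exact (h.neg s (h.lt_of_pos hs h0).le).ne

lemma nonneg_of_ge (h : DoubleWell f βm βp) (hs : βp ≤ s) : 0 ≤ primitiveF f s := by
  rw [← h.right_eq]; exact h.strictMonoOn.monotoneOn self_mem_Ici hs hs

lemma mono_of_nonneg (h : DoubleWell f βm βp) (hs : 0 ≤ s) (hst : s ≤ t) (ht : βp ≤ t) :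
    primitiveF f s ≤ primitiveF f t := by
  rcases le_total s βp with h1 | h1
  · exact (h.nonpos ⟨h.neg_left.le.trans hs, h1⟩).trans (h.nonneg_of_ge ht)
  · exact h.strictMonoOn.monotoneOn h1 ht hst

lemma exists_lower_bound (h : DoubleWell f βm βp) : ∃ B, 0 ≤ B ∧ ∀ s, -B ≤ primitiveF f s := by
  obtain ⟨M, hM⟩ := isCompact_Icc.exists_bound_of_continuousOn (s := Icc βm βp)
    (continuous_primitiveF h.cont).continuousOn
  refine ⟨max M 0, le_max_right _ _, fun s => ?_⟩
  rcases lt_or_ge βp s with h1 | h1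
  · linarith [h.nonneg_of_ge h1.le, le_max_right M 0]
  rcases lt_or_ge s βm with h2 | h2
  · have := h.reflect.nonneg_of_ge (s := -s) (by linarith)
    rw [primitiveF_reflect, neg_neg] at this
    linarith [le_max_right M 0]
  · have := (abs_le.1 (hM s ⟨h2, h1⟩)).1
    linarith [le_max_left M 0]

lemma exists_eq (h : DoubleWell f βm βp) (hc : 0 < c) (hs : βp ≤ s)
    (hcs : c ≤ primitiveF f s) : ∃ b, βp < b ∧ primitiveF f b = c := by
  obtain ⟨b, hb, hbc⟩ := intermediate_value_Icc hs (continuous_primitiveF h.cont).continuousOn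
    (show c ∈ Icc (primitiveF f βp) (primitiveF f s) from ⟨by rw [h.right_eq]; exact hc.le, hcs⟩)
  exact ⟨b, hb.1.lt_of_ne fun e => hc.ne (by rw [← hbc, ← e, h.right_eq]), hbc⟩

end DoubleWell

/-! ### Oscillation at positive energy -/

lemma kin_neg (p' s : ℝ) : kin p' (-s) = kin p' s := by simp [kin]

lemma energy_reflect (p' : ℝ) (f v y : ℝ → ℝ) (r : ℝ) :
    energy (kin p') (fun s => -f (-s)) (fun r => -v r) (fun r => -y r) r =
      energy (kin p') f v y r := by
  simp only [energy, kin_neg, primitiveF_reflect, neg_neg]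

lemma exists_le_abs_of_kin (hp : 1 < p') {e : ℝ} (he : 0 < e) :
    ∃ η > 0, ∀ s, e ≤ kin p' s → η ≤ |s| := by
  refine ⟨(p' * e) ^ (1 / p'), by positivity, fun s hs => ?_⟩
  have h0 : 0 < p' := by linarith
  rw [kin, le_div_iff₀' h0] at hs
  refine (rpow_le_rpow (by positivity) hs (by positivity)).trans_eq ?_
  rw [← rpow_mul (abs_nonneg _), mul_one_div_cancel h0.ne', rpow_one]

/-- A function which decreases where it vanishes does not become positive. -/
lemma nonpos_of_deriv_neg {u' : ℝ → ℝ} (hc : Continuous u)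
    (hd : ∀ r ∈ Ico s t, HasDerivAt u (u' r) r) (hs : u s ≤ 0)
    (h0 : ∀ r ∈ Ico s t, u r = 0 → u' r < 0) (hr : r ∈ Icc s t) : u r ≤ 0 :=
  image_le_of_deriv_right_lt_deriv_boundary (B := fun _ => 0) (B' := fun _ => 0)
    hc.continuousOn (fun x hx => (hd x hx).hasDerivWithinAt) hs (fun _ => hasDerivAt_const _ _)
    h0 hr

lemma exists_first_le (hv : Continuous v) (hst : s ≤ t) (hs : b < v s)
    (ht : v t ≤ b) : ∃ z ∈ Ioc s t, v z = b ∧ ∀ r ∈ Ico s z, b < v r := by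
  obtain ⟨z, hz, hmin⟩ := (isCompact_Icc.inter_right (isClosed_Iic.preimage hv)).exists_isLeast
    ⟨t, ⟨hst, le_rfl⟩, ht⟩
  have hlt : ∀ r ∈ Ico s z, b < v r := fun r hr => not_le.1 fun h =>
    (hmin ⟨⟨hr.1, hr.2.le.trans hz.1.2⟩, h⟩).not_gt hr.2
  have hsz : s < z := hz.1.1.lt_of_ne fun h => hs.not_ge (h ▸ hz.2)
  refine ⟨z, ⟨hsz, hz.1.2⟩, le_antisymm hz.2 ?_, hlt⟩
  exact (closure_Ico hsz.ne ▸ closure_minimal (fun r hr => (hlt r hr).le)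
    (isClosed_Ici.preimage hv) : Icc s z ⊆ v ⁻¹' Ici b) ⟨hsz.le, le_rfl⟩

/-- Over a fixed length, the energy is almost constant far away. -/
lemma exists_window (hp : 1 < p') (hq : IsAdmissibleWeight p q)
    {c1 c2 : ℝ} (hB : 0 ≤ B) (hc1 : 0 < c1) (hc : c1 < c2) (hT : 0 ≤ T) :
    ∃ R ≥ 1, ∀ {f v y : ℝ → ℝ} {d : ℝ}, Continuous f → (∀ T, Sol (phi p') q f 0 d T v y) →
      (∀ s, -B ≤ primitiveF f s) → ∀ s ≥ R, ∀ t ∈ Icc s (s + T),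
      c2 ≤ energy (kin p') f v y s → c1 ≤ energy (kin p') f v y t := by
  obtain ⟨C, hC, hCq⟩ := hq.exists_deriv_le
  -- On a window of length `T` beyond `R` the weight `q^{p'}` grows at most by this factor, which
  -- tends to 1. By `weighted_energy_mono`, the energy raised by `B` decays at most by the same
  -- factor.
  have hlim : Tendsto (fun R : ℝ => (1 + T / R) ^ (C * p')) atTop (𝓝 ((1 + 0) ^ (C * p'))) :=
    (tendsto_const_nhds.add (tendsto_const_nhds.div_atTop tendsto_id)).rpow_const
      (Or.inl (by norm_num))
  rw [add_zero, one_rpow] at hlim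
  have h1 : 1 < (c2 + B) / (c1 + B) := by rw [one_lt_div (by linarith)]; linarith
  obtain ⟨R, hR, hR1⟩ := ((hlim.eventually (gt_mem_nhds h1)).and (eventually_ge_atTop 1)).exists
  refine ⟨R, hR1, fun {f v y d} hf h hF s hs t ht hen => ?_⟩
  have hs0 : 0 < s := by linarith
  have hp0 : 0 < p' := by linarith
  have ht0 : 0 < t := hs0.trans_le ht.1
  have hqs := hq.pos hs0
  have hqt := hq.pos ht0
  have hmono := (h t).weighted_energy_mono hq hf (hasDerivAt_kin hp) hp0
    (fun s => (mul_phi_eq_kin hp s).le) hs0 hs0.le ht.1 le_rfl (fun r _ => hF (v r))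
  have hr1 : q t / q s ≤ (t / s) ^ C := by
    rw [div_le_iff₀ hqs, Real.div_rpow ht0.le hs0.le, div_mul_eq_mul_div, le_div_iff₀ (by positivity)]
    linarith [hq.div_rpow_anti hCq hs0 ht.1]
  have hr2 : t / s ≤ 1 + T / R := by
    have : T / s ≤ T / R := div_le_div_of_nonneg_left hT (by linarith) hs
    calc t / s ≤ (s + T) / s := by gcongr; exact ht.2
      _ ≤ _ := by rw [add_div, div_self hs0.ne']; linarith
  have hr3 : (q t / q s) ^ p' ≤ (c2 + B) / (c1 + B) := by
    calc (q t / q s) ^ p' ≤ ((t / s) ^ C) ^ p' := rpow_le_rpow (by positivity) hr1 hp0.le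
      _ = (t / s) ^ (C * p') := by rw [rpow_mul (by positivity)]
      _ ≤ (1 + T / R) ^ (C * p') := rpow_le_rpow (by positivity) hr2 (by positivity)
      _ ≤ _ := hR.le
  rw [Real.div_rpow hqt.le hqs.le, div_le_div_iff₀ (by positivity) (by linarith)] at hr3
  have hA : 0 < q s ^ p' := by positivity
  have hA' : 0 < q t ^ p' := by positivity
  have h5 : q t ^ p' * (c1 + B) ≤ q t ^ p' * (energy (kin p') f v y t + B) := by
    calc _ ≤ (c2 + B) * q s ^ p' := hr3
      _ ≤ q s ^ p' * (energy (kin p') f v y s + B) := by rw [mul_comm]; gcongr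
      _ ≤ _ := hmono
  linarith [le_of_mul_le_mul_left h5 hA']

lemma energy_antitone (hp : 1 < p') (hq : IsAdmissibleWeight p q) (hf : Continuous f)
    (h : ∀ T, Sol (phi p') q f 0 d T v y) (hs : 0 ≤ s) (hst : s ≤ t) :
    energy (kin p') f v y t ≤ energy (kin p') f v y s :=
  (h t).energy_anti hq le_rfl hf (hasDerivAt_kin hp) (mul_phi_nonneg hp) hs hst le_rfl

/-- A solution above `b` comes back to `b`. -/
lemma exists_return (hp : 1 < p') (hq : IsAdmissibleWeight p q) (hw : DoubleWell f βm βp)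
    (h : ∀ T, Sol (phi p') q f 0 d T v y) (hb : ∃ M, ∀ r, |v r| ≤ M) (hβ : βp ≤ b)
    (ht : 0 < t) (hvt : b ≤ v t) : ∃ r, t ≤ r ∧ v r = b ∧ y r ≤ 0 := by
  -- Otherwise `v` remains above `b`, where it is bounded and `f` has a positive minimum; then `y`
  -- decreases linearly and eventually `v' ≤ -1`, which contradicts boundedness.
  by_contra! hcon
  have hge : ∀ r, t ≤ r → b ≤ v r := by
    intro r hr
    have := nonpos_of_deriv_neg (u := fun r => b - v r) (u' := fun r => 0 - phi p' (y r)) (s := t)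
      (t := r) (continuous_const.sub (h 0).cont_v)
      (fun x hx => (hasDerivAt_const x b).sub ((h r).deriv_v x (ht.trans_le hx.1) hx.2))
      (by linarith)
      (fun x hx hx0 => by linarith [phi_pos (m := p') (hcon x hx.1 (by linarith))]) (r := r)
      ⟨hr, le_rfl⟩
    linarith
  obtain ⟨M, hM⟩ := hb
  have hbM : b ≤ M := (hge t le_rfl).trans ((le_abs_self _).trans (hM t))
  obtain ⟨x, hx, hmin⟩ := isCompact_Icc.exists_isMinOn (s := Icc b M) ⟨b, le_rfl, hbM⟩
    hw.cont.continuousOn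
  have hm : 0 < f x := hw.pos x (hβ.trans hx.1)
  obtain ⟨C, hC, hCq⟩ := hq.exists_deriv_le
  have hy : ∀ r, t ≤ r → y r ≤ |y t| - f x * (r - t) / (1 + C) := by
    intro r hr
    have e1 := (h r).flux_le hq le_rfl ht.le hr le_rfl fun z hz =>
      hmin (show v z ∈ Icc b M from ⟨hge z hz.1.le, (le_abs_self _).trans (hM z)⟩)
    have e2 := hq.le_primitiveQ_sub hCq ht.le (ht.trans_le hr) hr
    rw [extWeight_of_pos q ht, extWeight_of_pos q (ht.trans_le hr)] at e1
    have hqr := hq.pos (ht.trans_le hr)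
    have hqt := hq.pos ht
    have e3 : q t * y t ≤ q r * |y t| :=
      (mul_le_mul_of_nonneg_left (le_abs_self _) hqt.le).trans
        (mul_le_mul_of_nonneg_right (hq.mono ht hr) (abs_nonneg _))
    have e4 : q r * (f x * (r - t) / (1 + C)) ≤ f x * (primitiveQ q r - primitiveQ q t) := by
      rw [mul_div_assoc', div_le_iff₀ (by linarith)]
      nlinarith
    refine le_of_mul_le_mul_left ?_ hqr
    rw [mul_sub]; linarith
  set r1 := t + (|y t| + 1) * (1 + C) / f x
  have hr1t : t ≤ r1 := le_add_of_nonneg_right (by positivity)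
  have hy1 : ∀ r, r1 ≤ r → y r ≤ -1 := by
    intro r hr
    have e2 : |y t| + 1 ≤ f x * (r - t) / (1 + C) := by
      rw [le_div_iff₀ (by linarith)]
      linarith [(div_le_iff₀ hm).1 (le_sub_iff_add_le'.2 hr)]
    linarith [hy r (hr1t.trans hr)]
  have hphi1 : phi p' (-1) = -1 := by rw [phi_neg, phi_of_pos one_pos, one_rpow]
  set r2 := r1 + 2 * M + 1
  have hM0 : 0 ≤ M := (abs_nonneg _).trans (hM 0)
  have hdrop := le_of_hasDerivAt_nonneg (u := fun r => -v r - r) (u' := fun r => -phi p' (y r) - 1)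
    (a := r1) (b := r2) (by linarith) ((h 0).cont_v.neg.sub continuous_id).continuousOn
    (fun r hr => ((h r2).deriv_v r (by linarith [hr.1]) hr.2).neg.sub (hasDerivAt_id r))
    (fun r hr => by linarith [phi_mono hp (hy1 r hr.1.le)])
  linarith [(abs_le.1 (hM r1)).2, (abs_le.1 (hM r2)).1]

lemma Sol.sub_le_of_phi_le (h : Sol g q f 0 d T v y) {ζ : ℝ}
    (hs : 0 ≤ s) (hst : s ≤ t) (ht : t ≤ T) (hg : ∀ r ∈ Ioo s t, g (y r) ≤ -ζ) :
    v t ≤ v s - ζ * (t - s) := by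
  have := le_of_hasDerivAt_nonneg (u := fun r => -v r - ζ * r) (u' := fun r => -g (y r) - ζ * 1) hst
    (h.cont_v.neg.sub (by fun_prop)).continuousOn
    (fun r hr => (h.deriv_v r (hs.trans_lt hr.1) (hr.2.trans_le ht)).neg.sub
      ((hasDerivAt_id r).const_mul ζ))
    (fun r hr => by linarith [hg r hr])
  linarith

/-- A solution which moves down from a positive value at most `b` has a zero after a bounded
time, if its energy stays away from zero. -/
lemma exists_descent (hp : 1 < p') (hq : IsAdmissibleWeight p q) (hw : DoubleWell f βm βp) (hc : 0 < c) (hb : βp ≤ b) (hFb : c < 8 * primitiveF f b) :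
    ∃ T, 0 ≤ T ∧ ∀ {d : ℝ} {v y : ℝ → ℝ}, (∀ T, Sol (phi p') q f 0 d T v y) → ∀ s > 0, 0 < v s →
      v s ≤ b → y s ≤ 0 → (∀ t ∈ Icc s (s + T), c / 2 ≤ energy (kin p') f v y t) →
      ∃ z ∈ Ioc s (s + T), v z = 0 := by
  obtain ⟨β', hβ', hFβ'⟩ := hw.exists_eq (c := c / 8) (by positivity) hb (by linarith)
  have hβ'b : β' ≤ b := not_lt.1 fun h => by linarith [hw.strictMonoOn hb hβ'.le h]
  obtain ⟨x, hx, hmin⟩ := isCompact_Icc.exists_isMinOn (s := Icc β' b) ⟨β', le_rfl, hβ'b⟩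
    hw.cont.continuousOn
  have hm : 0 < f x := hw.pos x (hβ'.le.trans hx.1)
  obtain ⟨C, hC, hCq⟩ := hq.exists_deriv_le
  obtain ⟨η, hη, hηk⟩ := exists_le_abs_of_kin hp (e := c / 4) (by positivity)
  have hb0 : 0 < b := hw.pos_right.trans_le hb
  set ζ := phi p' (f x / (1 + C))
  have hζ0 : 0 < ζ := phi_pos (by positivity)
  set ηv := phi p' η
  have hηv0 : 0 < ηv := phi_pos hη
  have hT3 : 0 < b / ζ := by positivity
  have hT4 : 0 < b / ηv := by positivity
  -- One unit of time for `f ≥ f x` to create the speed `ζ`, then `b / ζ` to fall from `b` to `β'`,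
  -- and `b / ηv` from `β'` to zero, where `F ≤ c / 8` leaves enough kinetic energy for the speed
  -- `ηv`.
  refine ⟨1 + b / ζ + b / ηv, by positivity, fun {d v y} h s hs hv0 hvb hy0 hen => ?_⟩
  set T := 1 + b / ζ + b / ηv with hT
  by_contra! hcon
  have hpos : ∀ t ∈ Icc s (s + T), 0 < v t := fun t ht => not_le.1 fun hneg => by
    obtain ⟨z, hz, hvz, -⟩ := exists_first_le (h 0).cont_v ht.1 hv0 hneg
    exact hcon z ⟨hz.1, hz.2.trans ht.2⟩ hvz
  have hyneg : ∀ t ∈ Icc s (s + T), y t ≤ 0 := by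
    intro t ht
    refine nonpos_of_deriv_neg (u := y) (s := s) (t := s + T) (h 0).cont_y
      (fun r hr => (h (s + T)).deriv_y r (hs.trans_le hr.1) hr.2) hy0 (fun r hr hyr => ?_) ht
    have h1 := hen r ⟨hr.1, hr.2.le⟩
    rw [energy, hyr, kin_zero hp, zero_add] at h1
    rw [hyr]; linarith [hw.pos _ (hw.gt_of_pos (by linarith) (hpos r ⟨hr.1, hr.2.le⟩).le).le]
  have hanti : ∀ r1 r2, s ≤ r1 → r1 ≤ r2 → r2 ≤ s + T → v r2 ≤ v r1 := by
    intro r1 r2 h1 h12 h2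
    have := (h (s + T)).sub_le_of_phi_le (ζ := 0) (hs.le.trans h1) h12 h2 fun r hr => by
      simpa [phi_zero] using phi_mono hp (hyneg r ⟨h1.trans hr.1.le, hr.2.le.trans h2⟩)
    linarith
  have hmid : v (s + (1 + b / ζ)) ≤ β' := by
    by_contra hgt
    have hge : ∀ r ∈ Icc s (s + (1 + b / ζ)), β' ≤ v r := fun r hr =>
      (not_le.1 hgt).le.trans (hanti _ _ hr.1 hr.2 (by linarith))
    have hd := (h (s + T)).sub_le_of_phi_le (s := s + 1) (t := s + (1 + b / ζ)) (ζ := ζ)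
      (by linarith) (by linarith) (by linarith) fun r hr => by
        rw [← phi_neg]
        refine phi_mono hp ?_
        have e1 := (h r).flux_le hq le_rfl hs.le (by linarith [hr.1]) le_rfl (c := f x) fun z hz =>
          hmin (show v z ∈ Icc β' b from ⟨hge z ⟨hz.1.le, by linarith [hz.2, hr.2]⟩,
            (hanti s z le_rfl hz.1.le (by linarith [hz.2, hr.2])).trans hvb⟩)
        have hr0 : 0 < r := by linarith [hr.1]
        have e2 := hq.le_primitiveQ_sub hCq hs.le hr0 (by linarith [hr.1])
        have hqr := hq.pos hr0
        rw [extWeight_of_pos q hs, extWeight_of_pos q hr0] at e1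
        have e3 := mul_nonpos_of_nonneg_of_nonpos (hq.pos hs).le hy0
        have e4 : q r * 1 ≤ (r - s) * q r := by nlinarith [hr.1]
        rw [← neg_div, le_div_iff₀ (by linarith)]
        exact le_of_mul_le_mul_left (by nlinarith) hqr
    have e : ζ * (s + (1 + b / ζ) - (s + 1)) = b := by field_simp; ring
    rw [e] at hd
    linarith [hanti s (s + 1) le_rfl (by linarith) (by linarith),
      hpos (s + (1 + b / ζ)) ⟨by linarith, by linarith⟩]
  have hd := (h (s + T)).sub_le_of_phi_le (s := s + (1 + b / ζ)) (t := s + T) (ζ := ηv)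
    (by linarith) (by linarith) le_rfl fun r hr => by
      have hr' : r ∈ Icc s (s + T) := ⟨by linarith [hr.1], hr.2.le⟩
      have e2 := hw.mono_of_nonneg (hpos r hr').le
        ((hanti _ _ (by linarith) hr.1.le hr.2.le).trans hmid) hβ'.le
      have e3 := hen r hr'
      have e4 := hηk (y r) (by unfold energy at e3; linarith)
      rw [abs_of_nonpos (hyneg r hr')] at e4
      rw [← phi_neg]
      exact phi_mono hp (by linarith)
  have e : ηv * (s + T - (s + (1 + b / ζ))) = b := by rw [hT]; field_simp; ring
  rw [e] at hd
  linarith [hpos (s + T) ⟨by linarith, le_rfl⟩]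

/-- Let `F(b) = 3c/4`. However long an excursion above `b` takes, at the return to `b` the energy is
at least `F(b)`, so no energy estimate is needed there. The ascent to `b` and the descent from `b`
to zero take bounded time, during which the loss of energy is small by `exists_window`. -/
lemma exists_zero_of_pos (hp : 1 < p') (hq : IsAdmissibleWeight p q) (hw : DoubleWell f βm βp) (hc : 0 < c) (hF : ∃ s, βp ≤ s ∧ c ≤ primitiveF f s) :
    ∃ R ≥ 1, ∀ {d : ℝ} {v y : ℝ → ℝ}, (∀ T, Sol (phi p') q f 0 d T v y) → (∃ M, ∀ r, |v r| ≤ M) →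
      ∀ r ≥ R, c ≤ energy (kin p') f v y r → (0 < v r ∨ (v r = 0 ∧ 0 < y r)) →
      ∃ z > r, v z = 0 ∧ c / 4 ≤ energy (kin p') f v y z := by
  obtain ⟨s0, hs0, hcs0⟩ := hF
  obtain ⟨b, hβb, hFb⟩ := hw.exists_eq (c := 3 * c / 4) (by positivity) hs0 (by linarith)
  obtain ⟨T2, hT2, hdesc⟩ := exists_descent hp hq hw hc hβb.le (by linarith)
  obtain ⟨η, hη, hηk⟩ := exists_le_abs_of_kin hp (e := c / 8) (by positivity)
  obtain ⟨B, hB, hFB⟩ := hw.exists_lower_bound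
  have hb0 : 0 < b := hw.pos_right.trans hβb
  have hηv0 : 0 < phi p' η := phi_pos hη
  set T1 := b / phi p' η with hT1
  have hT10 : 0 < T1 := by positivity
  obtain ⟨R1, hR1, hwin1⟩ := exists_window hp hq (T := T1) (c1 := 7 * c / 8) (c2 := c) hB
    (by positivity) (by linarith) hT10.le
  obtain ⟨R2, hR2, hwin2⟩ := exists_window hp hq (T := T2) (c1 := c / 2) (c2 := 3 * c / 4) hB
    (by positivity) (by linarith) hT2
  refine ⟨max R1 R2, le_max_of_le_left hR1, fun {d v y} h hM r hr hen hst => ?_⟩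
  have hrR1 : R1 ≤ r := (le_max_left _ _).trans hr
  have hrR2 : R2 ≤ r := (le_max_right _ _).trans hr
  have hr0 : 0 < r := by linarith
  obtain ⟨s, hrs, hvs0, hvsb, hys, hens⟩ : ∃ s, r ≤ s ∧ 0 < v s ∧ v s ≤ b ∧ y s ≤ 0 ∧
      3 * c / 4 ≤ energy (kin p') f v y s := by
    have habove : ∀ t, r ≤ t → b ≤ v t → ∃ s, r ≤ s ∧ 0 < v s ∧ v s ≤ b ∧ y s ≤ 0 ∧
        3 * c / 4 ≤ energy (kin p') f v y s := by
      intro t ht hvt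
      obtain ⟨s, hs, hvs, hys⟩ := exists_return hp hq hw h hM hβb.le (hr0.trans_le ht) hvt
      refine ⟨s, ht.trans hs, hvs ▸ hb0, hvs.le, hys, ?_⟩
      rw [energy, hvs, hFb]
      linarith [kin_nonneg hp (y s)]
    rcases le_or_gt b (v r) with hvb | hvb
    · exact habove r le_rfl hvb
    have hv0 : 0 ≤ v r := by rcases hst with h | h <;> linarith [h]
    rcases le_or_gt (y r) 0 with hy | hy
    · exact ⟨r, le_rfl, hst.resolve_right fun h => h.2.not_ge hy, hvb.le, hy, by linarith⟩
    by_contra hcon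
    have hlt : ∀ t ∈ Icc r (r + T1), v t < b := fun t ht => not_le.1 fun h =>
      hcon (habove t ht.1 h)
    have hkey : ∀ t ∈ Icc r (r + T1), 0 ≤ v t → η ≤ |y t| := by
      refine fun t ht hvt => hηk _ ?_
      have e1 := hwin1 hw.cont h hFB r hrR1 t ht hen
      have e2 := hw.mono_of_nonneg hvt (hlt t ht).le hβb.le
      unfold energy at e1
      linarith
    have hvnn : ∀ t ∈ Icc r (r + T1), 0 ≤ v t ∧ 0 < y t := by
      have hinv : ∀ z ∈ Icc r (r + T1), (∀ x ∈ Ico r z, 0 < y x) → 0 ≤ v z := by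
        intro z hz hzx
        have := le_of_hasDerivAt_nonneg (u := v) hz.1 (h 0).cont_v.continuousOn
          (fun x hx => (h z).deriv_v x (hr0.trans hx.1) hx.2)
          (fun x hx => (phi_pos (hzx x (Ioo_subset_Ico_self hx))).le)
        linarith
      have hall : ∀ x ∈ Icc r (r + T1), 0 < y x := fun x hx => not_le.1 fun hyx => by
        obtain ⟨z, hz, hyz, hzx⟩ := exists_first_le (h 0).cont_y hx.1 hy hyx
        have hzI : z ∈ Icc r (r + T1) := ⟨hz.1.le, hz.2.trans hx.2⟩
        have := hkey z hzI (hinv z hzI hzx)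
        rw [hyz, abs_zero] at this
        linarith
      exact fun t ht => ⟨hinv t ht fun x hx => hall x ⟨hx.1, hx.2.le.trans ht.2⟩, hall t ht⟩
    have hd := le_of_hasDerivAt_nonneg (u := fun x => v x - phi p' η * x)
      (u' := fun x => phi p' (y x) - phi p' η * 1) (show r ≤ r + T1 by linarith)
      ((h 0).cont_v.sub (by fun_prop)).continuousOn
      (fun x hx => ((h (r + T1)).deriv_v x (hr0.trans hx.1) hx.2).sub
        ((hasDerivAt_id x).const_mul _))
      (fun x hx => by
        have hx' := Ioo_subset_Icc_self hx
        have h1 := hvnn x hx'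
        have h2 := hkey x hx' h1.1
        rw [abs_of_pos h1.2] at h2
        linarith [phi_mono hp h2])
    have e : phi p' η * (r + T1) = phi p' η * r + b := by rw [hT1]; field_simp
    linarith [hlt (r + T1) ⟨by linarith, le_rfl⟩]
  have hwin := hwin2 hw.cont h hFB s (hrR2.trans hrs)
  obtain ⟨z, hz, hvz⟩ := hdesc h s (hr0.trans_le hrs) hvs0 hvsb hys fun t ht => hwin t ht hens
  exact ⟨z, hrs.trans_lt hz.1, hvz, by linarith [hwin z (Ioc_subset_Icc_self hz) hens]⟩

/-- A solution with energy at least `c` far away has a further zero with energy at least `c / 4`. -/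
lemma exists_zero (hp : 1 < p') (hq : IsAdmissibleWeight p q) (hw : DoubleWell f βm βp) (hc : 0 < c) (hF : ∃ s, βp ≤ s ∧ c ≤ primitiveF f s)
    (hF' : ∃ s, s ≤ βm ∧ c ≤ primitiveF f s) :
    ∃ R ≥ 1, ∀ {d : ℝ} {v y : ℝ → ℝ}, (∀ T, Sol (phi p') q f 0 d T v y) → (∃ M, ∀ r, |v r| ≤ M) →
      ∀ r ≥ R, c ≤ energy (kin p') f v y r →
      ∃ z > r, v z = 0 ∧ c / 4 ≤ energy (kin p') f v y z := by
  obtain ⟨s', hs', hcs'⟩ := hF'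
  obtain ⟨R1, hR1, h1⟩ := exists_zero_of_pos hp hq hw hc hF
  obtain ⟨R2, hR2, h2⟩ := exists_zero_of_pos hp hq hw.reflect hc
    ⟨-s', by linarith, by rwa [primitiveF_reflect, neg_neg]⟩
  refine ⟨max R1 R2, le_max_of_le_left hR1, fun {d v y} h hM r hr hen => ?_⟩
  have hneg : (0 < -v r ∨ (-v r = 0 ∧ 0 < -y r)) → ∃ z > r, v z = 0 ∧
      c / 4 ≤ energy (kin p') f v y z := by
    intro hst
    obtain ⟨z, hz, hvz, hez⟩ := h2 (fun T => (h T).reflect (phi_neg p'))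
      (by simpa only [abs_neg] using hM) r ((le_max_right _ _).trans hr)
      (by rwa [energy_reflect]) hst
    rw [energy_reflect] at hez
    exact ⟨z, hz, by linarith, hez⟩
  rcases lt_trichotomy (v r) 0 with hv | hv | hv
  · exact hneg (Or.inl (by linarith))
  · rcases lt_trichotomy (y r) 0 with hy | hy | hy
    · exact hneg (Or.inr ⟨by linarith, by linarith⟩)
    · rw [energy, hv, hy, kin_zero hp, primitiveF_zero] at hen
      linarith
    · exact h1 h hM r ((le_max_left _ _).trans hr) hen (Or.inr ⟨hv, hy⟩)
  · exact h1 h hM r ((le_max_left _ _).trans hr) hen (Or.inl hv)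

/-- `v` has at least `n` zeros in `(r, ∞)` at which the energy is positive. -/
def HasZeros (p' : ℝ) (f v y : ℝ → ℝ) (r : ℝ) (n : ℕ) : Prop :=
  ∃ s : Finset ℝ, s.card = n ∧ ∀ z ∈ s, r < z ∧ v z = 0 ∧ 0 < energy (kin p') f v y z

lemma HasZeros.mono {r' : ℝ} (h : HasZeros p' f v y r n) (hr : r' ≤ r) :
    HasZeros p' f v y r' n := by
  obtain ⟨s, hs, hz⟩ := h
  exact ⟨s, hs, fun z hzs => ⟨hr.trans_lt (hz z hzs).1, (hz z hzs).2⟩⟩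

lemma HasZeros.cons (h : HasZeros p' f v y z n) (hz : r < z) (hv : v z = 0)
    (he : 0 < energy (kin p') f v y z) : HasZeros p' f v y r (n + 1) := by
  obtain ⟨s, hs, hzs⟩ := h
  refine ⟨insert z s, ?_, fun x hx => ?_⟩
  · rw [Finset.card_insert_of_notMem fun hmem => lt_irrefl z (hzs z hmem).1, hs]
  · rcases Finset.mem_insert.1 hx with rfl | hx
    · exact ⟨hz, hv, he⟩
    · exact ⟨hz.trans (hzs x hx).1, (hzs x hx).2⟩

/-- Enough energy far away gives any number of zeros. -/
lemma exists_hasZeros (hp : 1 < p') (hq : IsAdmissibleWeight p q) (hw : DoubleWell f βm βp)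
    (n : ℕ) (hc : 0 < c) (hF : ∃ s, βp ≤ s ∧ c ≤ primitiveF f s)
    (hF' : ∃ s, s ≤ βm ∧ c ≤ primitiveF f s) :
    ∃ R ≥ 1, ∀ {d : ℝ} {v y : ℝ → ℝ}, (∀ T, Sol (phi p') q f 0 d T v y) → (∃ M, ∀ r, |v r| ≤ M) →
      ∀ r ≥ R, c ≤ energy (kin p') f v y r → HasZeros p' f v y r n := by
  induction n generalizing c with
  | zero => exact ⟨1, le_rfl, fun _ _ r _ _ => ⟨∅, rfl, by simp⟩⟩
  | succ n ih =>
    obtain ⟨R1, hR1, h1⟩ := exists_zero hp hq hw hc hF hF'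
    obtain ⟨s, hs, hcs⟩ := hF
    obtain ⟨s', hs', hcs'⟩ := hF'
    obtain ⟨R2, hR2, h2⟩ := ih (c := c / 4) (by positivity) ⟨s, hs, by linarith⟩
      ⟨s', hs', by linarith⟩
    refine ⟨max R1 R2, le_max_of_le_left hR1, fun {d v y} h hM r hr hen => ?_⟩
    obtain ⟨z, hz, hvz, hez⟩ := h1 h hM r ((le_max_left _ _).trans hr) hen
    exact (h2 h hM z ((le_max_right _ _).trans (hr.le.trans hz.le)) hez).cons hz hvz (by linarith)

/-- If `F` is unbounded in both directions, enough energy at any positive radius gives any number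
of zeros. -/
lemma exists_hasZeros_of_unbounded (hp : 1 < p') (hq : IsAdmissibleWeight p q)
    (hw : DoubleWell f βm βp) (n : ℕ) (hF : Tendsto (primitiveF f) atTop atTop)
    (hF' : Tendsto (primitiveF f) atBot atTop) (hρ : 0 < ρ) :
    ∃ E, ∀ {d : ℝ} {v y : ℝ → ℝ}, (∀ T, Sol (phi p') q f 0 d T v y) → (∃ M, ∀ r, |v r| ≤ M) →
      ∀ r ≥ ρ, E ≤ energy (kin p') f v y r → HasZeros p' f v y r n := by
  obtain ⟨s, hs1, hs2⟩ := ((eventually_ge_atTop βp).and (hF.eventually (eventually_ge_atTop 1))).exists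
  obtain ⟨s', hs1', hs2'⟩ :=
    ((eventually_le_atBot βm).and (hF'.eventually (eventually_ge_atTop 1))).exists
  obtain ⟨R, hR, h⟩ := exists_hasZeros hp hq hw n one_pos ⟨s, hs1, hs2⟩ ⟨s', hs1', hs2'⟩
  obtain ⟨B, hB, hFB⟩ := hw.exists_lower_bound
  have hR0 : 0 < R := by linarith
  have hp0 : 0 < p' := by linarith
  have hA : 0 < q ρ ^ p' := rpow_pos_of_pos (hq.pos hρ) _
  -- By `weighted_energy_mono` this much energy at a radius between `ρ` and `R` leaves energy at
  -- least 1 at `R`.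
  refine ⟨max 1 (q R ^ p' * (1 + B) / q ρ ^ p'), fun {d v y} hs hM r hr hen => ?_⟩
  rcases le_total R r with hRr | hRr
  · exact h hs hM r hRr ((le_max_left _ _).trans hen)
  have hr0 := hρ.trans_le hr
  refine (h hs hM R le_rfl ?_).mono hRr
  have hmono := (hs R).weighted_energy_mono hq hw.cont (hasDerivAt_kin hp) hp0
    (fun s => (mul_phi_eq_kin hp s).le) hr0 hr0.le hRr le_rfl (fun r _ => hFB (v r))
  have h1 := (le_max_right _ _).trans hen
  rw [div_le_iff₀ hA] at h1
  have h2 : q ρ ^ p' ≤ q r ^ p' := rpow_le_rpow (hq.pos hρ).le (hq.mono hρ hr) hp0.le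
  have hB' : 0 < q R ^ p' := rpow_pos_of_pos (hq.pos hR0) _
  have he0 : 0 ≤ energy (kin p') f v y r := zero_le_one.trans ((le_max_left _ _).trans hen)
  have h3 : q R ^ p' * (1 + B) ≤ q R ^ p' * (energy (kin p') f v y R + B) := by
    linarith [mul_nonneg (rpow_nonneg (hq.pos hr0).le p') hB, mul_le_mul_of_nonneg_left h2 he0]
  linarith [le_of_mul_le_mul_left h3 hB']

/-! ### Families of solutions and semicontinuity of the number of zeros -/

/-- A family of global solutions, one for each height in `D`, which is locally bounded. -/
structure IsFlow (p' : ℝ) (q f : ℝ → ℝ) (D : Set ℝ) (V Y : ℝ → ℝ → ℝ) : Prop where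
  sol : ∀ d ∈ D, ∀ T, Sol (phi p') q f 0 d T (V d) (Y d)
  bdd : ∀ d ∈ D, ∃ δ > 0, ∃ B, ∀ d' ∈ D, |d' - d| < δ → ∀ r, |V d' r| ≤ B

lemma mem_Ioo_of_energy (hp : 1 < p') (hq : IsAdmissibleWeight p q)
    (hf : Continuous f) {A : ℝ} (h : ∀ T, Sol (phi p') q f 0 d T v y)
    (hd : d ∈ Ioo A B) (hFA : primitiveF f d < primitiveF f A)
    (hFB : primitiveF f d < primitiveF f B) (r : ℝ) : v r ∈ Ioo A B := by
  refine mem_Ioo_of_ne (h 0).cont_v (x := 0) (by rwa [((h 0).init 0 le_rfl).1]) (fun r _ => ?_) r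
  rcases le_total r 0 with h0 | h0
  · rw [((h 0).init r h0).1]; exact ⟨hd.1.ne', hd.2.ne⟩
  have hen := energy_antitone hp hq hf h le_rfl h0
  rw [(h 0).energy_start (kin_zero hp), energy] at hen
  have hk := kin_nonneg hp (y r)
  constructor <;> intro h <;> rw [h] at hen <;> linarith

/-- Energy barriers confine the solutions: on the right every larger height is one, as `F` increases
there, and on the left the point `A` is one. The barriers for the height `d + 1` serve all nearby
heights. -/
lemma exists_flow (hp : 1 < p') (hq : IsAdmissibleWeight p q) (hw : DoubleWell f βm βp)
    (hlt : ∀ d, βp ≤ d → ∃ A ≤ βm, primitiveF f d < primitiveF f A) :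
    ∃ V Y : ℝ → ℝ → ℝ, IsFlow p' q f (Ici βp) V Y := by
  have hsol : ∀ d ∈ Ici βp, ∃ v y : ℝ → ℝ, ∀ T, Sol (phi p') q f 0 d T v y := by
    intro d hd
    obtain ⟨A, hA, hFA⟩ := hlt d hd
    have hd0 : 0 < d := hw.pos_right.trans_le hd
    have hA0 : A < 0 := hA.trans_lt hw.neg_left
    obtain ⟨v, y, h, -⟩ := exists_sol hp hq hw.cont (B := d + 1) hA0 (by linarith)
      ⟨by linarith, by linarith⟩ hFA
      (hw.strictMonoOn hd (mem_Ici.2 (le_trans hd (by linarith))) (by linarith))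
    exact ⟨v, y, h⟩
  choose! V Y hVY using hsol
  refine ⟨V, Y, hVY, fun d hd => ?_⟩
  have hd1 : βp ≤ d + 1 := le_trans hd (by linarith)
  obtain ⟨A, hA, hFA⟩ := hlt (d + 1) hd1
  refine ⟨1, one_pos, max (-A) (d + 2), fun d' hd' hdd r => ?_⟩
  have hd'1 : d' < d + 1 := by linarith [(abs_lt.1 hdd).2]
  have hF : primitiveF f d' < primitiveF f (d + 1) := hw.strictMonoOn hd' hd1 hd'1
  have hF2 : primitiveF f (d + 1) < primitiveF f (d + 2) :=
    hw.strictMonoOn hd1 (mem_Ici.2 (by linarith)) (by linarith)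
  have hd'0 : 0 < d' := hw.pos_right.trans_le hd'
  have := mem_Ioo_of_energy hp hq hw.cont (hVY d' hd') (A := A) (B := d + 2)
    ⟨by linarith [hw.neg_left], by linarith⟩ (hF.trans hFA) (hF.trans hF2) r
  rw [abs_le]
  exact ⟨by linarith [this.1, le_max_left (-A) (d + 2)], this.2.le.trans (le_max_right _ _)⟩

section
variable {D : Set ℝ} {V Y : ℝ → ℝ → ℝ}

/-- Lipschitz continuity of `f` near the points where it does not vanish. -/
def LipschitzOffZeros (f : ℝ → ℝ) : Prop := ∀ s, f s ≠ 0 → ∃ K, ∃ t ∈ 𝓝 s, LipschitzOnWith K f t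

lemma IsFlow.bound (hV : IsFlow p' q f D V Y) (hd : d ∈ D) : ∃ M, ∀ r, |V d r| ≤ M := by
  obtain ⟨δ, hδ, B, hB⟩ := hV.bdd d hd
  exact ⟨B, hB d hd (by simpa using hδ)⟩

lemma IsFlow.eventually (hp : 1 < p') (hq : IsAdmissibleWeight p q) (hf : Continuous f)
    (hL : LipschitzOffZeros f) (hV : IsFlow p' q f D V Y) (hd : d ∈ D)
    (hns : ∀ r, 0 ≤ r → r < τ → Y d r ≠ 0 ∨ f (V d r) ≠ 0) (hτ : 0 < τ) (hε : 0 < ε) :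
    ∀ᶠ d' in 𝓝[D] d, ∀ r ∈ Icc 0 τ, |V d' r - V d r| < ε ∧ |Y d' r - Y d r| < ε := by
  obtain ⟨δ0, hδ0, B, hB⟩ := hV.bdd d hd
  obtain ⟨δ, hδ, h⟩ := Sol.continuous_dependence (T := τ) (D := D ∩ {d' | |d' - d| < δ0}) hp hq hf hL
    le_rfl hτ (fun d' hd' => hV.sol d' hd'.1 τ) (fun d' hd' r _ => hB d' hd'.1 hd'.2 r)
    (d := d) ⟨hd, by simpa using hδ0⟩ hns hε
  filter_upwards [self_mem_nhdsWithin, mem_nhdsWithin_of_mem_nhds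
    (Metric.ball_mem_nhds d (lt_min hδ hδ0))] with d' hd' hball
  rw [Metric.mem_ball, dist_eq] at hball
  exact h d' ⟨hd', hball.trans_le (min_le_right _ _)⟩ (hball.trans_le (min_le_left _ _))

lemma IsFlow.tendsto (hp : 1 < p') (hq : IsAdmissibleWeight p q) (hf : Continuous f)
    (hL : LipschitzOffZeros f) (hV : IsFlow p' q f D V Y) (hd : d ∈ D)
    (hns : ∀ r, 0 ≤ r → r < τ → Y d r ≠ 0 ∨ f (V d r) ≠ 0) (hτ : 0 < τ) (hr : r ∈ Icc 0 τ) :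
    Tendsto (fun d' => V d' r) (𝓝[D] d) (𝓝 (V d r)) ∧
      Tendsto (fun d' => Y d' r) (𝓝[D] d) (𝓝 (Y d r)) := by
  constructor <;> rw [Metric.tendsto_nhds] <;> intro ε hε
  · exact (hV.eventually hp hq hf hL hd hns hτ hε).mono fun d' h => (h r hr).1
  · exact (hV.eventually hp hq hf hL hd hns hτ hε).mono fun d' h => (h r hr).2

lemma nonstationary_of_energy_pos (hp : 1 < p') (hw : DoubleWell f βm βp)
    (h : 0 < energy (kin p') f v y r) : y r ≠ 0 ∨ f (v r) ≠ 0 := by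
  refine or_iff_not_imp_left.2 fun hy => hw.ne_zero_of_pos ?_
  rwa [energy, not_not.1 hy, kin_zero hp, zero_add] at h

lemma IsFlow.tendsto_energy (hp : 1 < p') (hq : IsAdmissibleWeight p q) (hf : Continuous f)
    (hL : LipschitzOffZeros f) (hV : IsFlow p' q f D V Y) (hd : d ∈ D)
    (hns : ∀ r, 0 ≤ r → r < τ → Y d r ≠ 0 ∨ f (V d r) ≠ 0) (hτ : 0 < τ) (hr : r ∈ Icc 0 τ) :
    Tendsto (fun d' => energy (kin p') f (V d') (Y d') r) (𝓝[D] d)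
      (𝓝 (energy (kin p') f (V d) (Y d) r)) := by
  obtain ⟨h1, h2⟩ := hV.tendsto hp hq hf hL hd hns hτ hr
  exact (((continuous_kin hp).tendsto _).comp h2).add (((continuous_primitiveF hf).tendsto _).comp h1)

/-- Sign of a function on both sides of a simple zero. -/
lemma exists_signs_of_hasDerivAt (h : HasDerivAt u c z) (hz : u z = 0) (hc : c ≠ 0) (hρ : 0 < ρ) :
    ∃ a ∈ Ioo (z - ρ) z, ∃ b ∈ Ioo z (z + ρ), u a * c < 0 ∧ 0 < u b * c := by
  have h1 : ∀ᶠ x in 𝓝[≠] z, 0 < slope u z x * c :=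
    ((hasDerivAt_iff_tendsto_slope.1 h).mul_const c).eventually (lt_mem_nhds (mul_self_pos.2 hc))
  obtain ⟨a, ha, ha'⟩ := ((h1.filter_mono (nhdsWithin_mono z (s := Iio z) fun x hx => hx.ne)).and
    (Ioo_mem_nhdsLT (show z - ρ < z by linarith))).exists
  obtain ⟨b, hb, hb'⟩ := ((h1.filter_mono (nhdsWithin_mono z (s := Ioi z) fun x hx => hx.ne')).and
    (Ioo_mem_nhdsGT (show z < z + ρ by linarith))).exists
  rw [slope_def_field, hz, sub_zero, div_mul_eq_mul_div] at ha hb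
  exact ⟨a, ha', b, hb',
    not_le.1 fun h => ha.not_ge (div_nonpos_of_nonneg_of_nonpos h (by linarith [ha'.2])),
    not_le.1 fun h => hb.not_ge (div_nonpos_of_nonpos_of_nonneg h (by linarith [hb'.1]))⟩

lemma phi_ne_zero (hs : s ≠ 0) : phi m s ≠ 0 := by
  rcases lt_or_gt_of_ne hs with h | h
  · exact (phi_neg_of_neg h).ne
  · exact (phi_pos h).ne'

/-- The number of zeros with positive energy is lower semicontinuous in the height. -/
lemma IsFlow.eventually_hasZeros (hp : 1 < p') (hq : IsAdmissibleWeight p q)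
    (hw : DoubleWell f βm βp) (hL : LipschitzOffZeros f) (hV : IsFlow p' q f D V Y) (hd : d ∈ D) (h : HasZeros p' f (V d) (Y d) 0 n) :
    ∀ᶠ d' in 𝓝[D] d, HasZeros p' f (V d') (Y d') 0 n := by
  obtain ⟨s, hs, hz⟩ := h
  rcases s.eq_empty_or_nonempty with rfl | hne
  · exact Eventually.of_forall fun d' => ⟨∅, hs, by simp⟩
  set m := s.max' hne
  have hsol := hV.sol d hd
  have hmz := hz m (s.max'_mem hne)
  have hEc : Continuous (energy (kin p') f (V d) (Y d)) :=
    (hsol 0).continuous_energy hw.cont (hasDerivAt_kin hp)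
  -- Positive energy slightly beyond the last zero excludes stationary points up to `T`, so
  -- continuous dependence holds on `[0, T]`; it also provides positive energy at the zeros of
  -- nearby solutions.
  obtain ⟨T, hT, hmT⟩ : ∃ T, 0 < energy (kin p') f (V d) (Y d) T ∧ m < T :=
    (((hEc.continuousAt.eventually (lt_mem_nhds hmz.2.2)).filter_mono nhdsWithin_le_nhds).and
      (self_mem_nhdsWithin : ∀ᶠ T in 𝓝[>] m, T ∈ Ioi m)).exists
  have hT0 : 0 < T := hmz.1.trans hmT
  have hns : ∀ r, 0 ≤ r → r < T → Y d r ≠ 0 ∨ f (V d r) ≠ 0 := fun r hr hrT =>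
    nonstationary_of_energy_pos hp hw
      (hT.trans_le (energy_antitone hp hq hw.cont hsol hr hrT.le))
  have hlt : ∀ z ∈ s, z < T := fun z hzs => (s.le_max' z hzs).trans_lt hmT
  -- Neighbourhoods of radius `ρ` of the zeros are disjoint and contained in `(0, T)`, so that the
  -- perturbed zeros are distinct.
  obtain ⟨ρ, hρ, hρ0⟩ : ∃ ρ : ℝ, (∀ z ∈ s, ρ < z ∧ ρ < T - z ∧ ∀ z' ∈ s, z ≠ z' → ρ < |z - z'| / 2) ∧
      0 < ρ := by
    have hsm : ∀ {x : ℝ}, 0 < x → ∀ᶠ ρ in 𝓝[>] (0 : ℝ), ρ < x := fun hx =>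
      (gt_mem_nhds hx).filter_mono nhdsWithin_le_nhds
    refine Eventually.exists (f := 𝓝[>] (0 : ℝ)) (Eventually.and ?_ self_mem_nhdsWithin)
    refine (eventually_all_finset s).2 fun z hzs => (hsm (hz z hzs).1).and
      ((hsm (by linarith [hlt z hzs])).and ((eventually_all_finset s).2 fun z' hzs' => ?_))
    by_cases hzz : z = z'
    · simp [hzz]
    · exact (hsm (half_pos (abs_pos.2 (sub_ne_zero.2 hzz)))).mono fun ρ h _ => h
  have hloc : ∀ z ∈ s, ∀ᶠ d' in 𝓝[D] d, ∃ z', |z' - z| < ρ ∧ V d' z' = 0 := by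
    intro z hzs
    have hyz : Y d z ≠ 0 := fun hy => by
      simpa [energy, hy, (hz z hzs).2.1, kin_zero hp, primitiveF_zero] using (hz z hzs).2.2
    obtain ⟨a, ha, b, hb, hac, hbc⟩ := exists_signs_of_hasDerivAt
      ((hsol T).deriv_v z (hz z hzs).1 (hlt z hzs)) (hz z hzs).2.1 (phi_ne_zero hyz) hρ0
    have hρz := hρ z hzs
    have ta := (hV.tendsto hp hq hw.cont hL hd hns hT0 (r := a)
      ⟨by linarith [ha.1], by linarith [ha.2, hlt z hzs]⟩).1
    have tb := (hV.tendsto hp hq hw.cont hL hd hns hT0 (r := b)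
      ⟨by linarith [hb.1, (hz z hzs).1], by linarith [hb.2]⟩).1
    filter_upwards [(ta.mul_const _).eventually (gt_mem_nhds hac),
      (tb.mul_const _).eventually (lt_mem_nhds hbc), self_mem_nhdsWithin] with d' h1 h2 hd'
    obtain ⟨z', hz', hz'0⟩ := intermediate_value_Icc (show a ≤ b by linarith [ha.2, hb.1])
      (f := fun x => V d' x * phi p' (Y d z)) (((hV.sol d' hd' 0).cont_v.mul
        continuous_const).continuousOn) (show (0 : ℝ) ∈ Icc _ _ from ⟨h1.le, h2.le⟩)
    exact ⟨z', abs_lt.2 ⟨by linarith [hz'.1, ha.1], by linarith [hz'.2, hb.2]⟩,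
      (mul_eq_zero.1 hz'0).resolve_right (phi_ne_zero hyz)⟩
  filter_upwards [(eventually_all_finset s).2 hloc, self_mem_nhdsWithin,
    (hV.tendsto_energy hp hq hw.cont hL hd hns hT0 (r := T) ⟨hT0.le, le_rfl⟩).eventually
      (lt_mem_nhds hT)] with d' h1 hd' hen
  choose! g hg using h1
  refine ⟨s.image g, ?_, fun x hx => ?_⟩
  · rw [Finset.card_image_of_injOn, hs]
    intro z hzs z' hzs' hgz
    by_contra hne
    have e1 := (hg z hzs).1
    rw [hgz, abs_sub_comm] at e1
    linarith [abs_sub_le z (g z') z', (hg z' hzs').1, (hρ z hzs).2.2 z' hzs' hne]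
  · obtain ⟨z, hzs, rfl⟩ := Finset.mem_image.1 hx
    have e1 := abs_lt.1 (hg z hzs).1
    have e2 := hρ z hzs
    have hpos : 0 < g z := by linarith
    exact ⟨hpos, (hg z hzs).2, hen.trans_le
      (energy_antitone hp hq hw.cont (hV.sol d' hd') hpos.le (by linarith))⟩

/-- The number of zeros in a compact interval is upper semicontinuous in the height, if all the zeros
of the limit are simple. -/
lemma IsFlow.exists_zeros_of_tendsto (hp : 1 < p') (hq : IsAdmissibleWeight p q)
    (hf : Continuous f) (hf0 : f 0 = 0) (hL : LipschitzOffZeros f) (hV : IsFlow p' q f D V Y)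
    (hd : d ∈ D) (hτ : 0 < τ) (hns : ∀ r ∈ Icc 0 τ, Y d r ≠ 0 ∨ f (V d r) ≠ 0)
    (h : ∃ᶠ d' in 𝓝[D] d, ∃ s : Finset ℝ, s.card = n ∧ ∀ z ∈ s, z ∈ Icc 0 τ ∧ V d' z = 0) :
    ∃ s : Finset ℝ, s.card = n ∧ ∀ z ∈ s, z ∈ Icc 0 τ ∧ V d z = 0 := by
  obtain ⟨dn, hdn, hdz⟩ := exists_seq_forall_of_frequently h
  choose s hs hz using hdz
  set t : ℕ → Fin n → ℝ := fun i => (s i).orderEmbOfFin (hs i)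
  have htm : ∀ i j, t i j ∈ Icc 0 τ ∧ V (dn i) (t i j) = 0 := fun i j =>
    hz i _ (Finset.orderEmbOfFin_mem _ _ _)
  set U : Ultrafilter ℕ := hyperfilter ℕ
  have hdU : Tendsto dn U (𝓝[D] d) := hdn.mono_left Nat.hyperfilter_le_atTop
  have hlim : ∀ j, ∃ x ∈ Icc 0 τ, Tendsto (fun i => t i j) U (𝓝 x) := by
    intro j
    obtain ⟨x, hx, hUx⟩ := isCompact_Icc.ultrafilter_le_nhds' (s := Icc 0 τ) (U.map fun i => t i j)
      (Eventually.of_forall fun i => (htm i j).1 : ∀ᶠ i in (U : Filter ℕ), t i j ∈ Icc 0 τ)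
    exact ⟨x, hx, hUx⟩
  choose x hx hxt using hlim
  have hns' : ∀ r, 0 ≤ r → r < τ → Y d r ≠ 0 ∨ f (V d r) ≠ 0 := fun r h0 h1 => hns r ⟨h0, h1.le⟩
  have hconv : ∀ {a : ℕ → ℝ} {r : ℝ}, r ∈ Icc 0 τ → (∀ i, a i ∈ Icc 0 τ) → Tendsto a U (𝓝 r) →
      Tendsto (fun i => V (dn i) (a i)) U (𝓝 (V d r)) ∧
      Tendsto (fun i => Y (dn i) (a i)) U (𝓝 (Y d r)) := by
    intro a r hr ha hat
    have e := fun {ε : ℝ} (hε : 0 < ε) => hdU.eventually (hV.eventually hp hq hf hL hd hns' hτ hε)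
    have ev : Tendsto (fun i => V (dn i) (a i) - V d (a i)) U (𝓝 0) := Metric.tendsto_nhds.2
      fun ε hε => (e hε).mono fun i h => by simpa [dist_eq] using (h _ (ha i)).1
    have ey : Tendsto (fun i => Y (dn i) (a i) - Y d (a i)) U (𝓝 0) := Metric.tendsto_nhds.2
      fun ε hε => (e hε).mono fun i h => by simpa [dist_eq] using (h _ (ha i)).2
    exact ⟨by simpa using ev.add (((hV.sol d hd 0).cont_v.tendsto r).comp hat),
      by simpa using ey.add (((hV.sol d hd 0).cont_y.tendsto r).comp hat)⟩
  have hzero : ∀ j, V d (x j) = 0 := fun j =>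
    tendsto_nhds_unique (hconv (hx j) (fun i => (htm i j).1) (hxt j)).1
      (tendsto_const_nhds.congr fun i => (htm i j).2.symm)
  have hinj : StrictMono x := by
    intro j j' hjj
    refine lt_of_le_of_ne (le_of_tendsto_of_tendsto (hxt j) (hxt j')
      (Eventually.of_forall fun i => ((s i).orderEmbOfFin (hs i)).monotone hjj.le)) fun hxx => ?_
    -- If two zeros merged in the limit, Rolle's theorem between them would give `v = y = 0` at the
    -- limit point, which would then be stationary.
    have hroll : ∀ i, ∃ c ∈ Icc (t i j) (t i j'), dn i ∈ D → Y (dn i) c = 0 := by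
      intro i
      have hlt : t i j < t i j' := ((s i).orderEmbOfFin (hs i)).strictMono hjj
      by_cases hi : dn i ∈ D
      · obtain ⟨c, hc, hc0⟩ := exists_hasDerivAt_eq_zero hlt
          ((hV.sol _ hi 0).cont_v.continuousOn) ((htm i j).2.trans (htm i j').2.symm)
          fun r hr => (hV.sol _ hi τ).deriv_v r ((htm i j).1.1.trans_lt hr.1)
            (hr.2.trans_le (htm i j').1.2)
        exact ⟨c, Ioo_subset_Icc_self hc, fun _ => not_not.1 fun hy => phi_ne_zero hy hc0⟩
      · exact ⟨t i j, ⟨le_rfl, hlt.le⟩, fun h => absurd h hi⟩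
    choose c hc hc0 using hroll
    have hct : Tendsto c U (𝓝 (x j)) := tendsto_of_tendsto_of_tendsto_of_le_of_le (hxt j)
      (hxx ▸ hxt j') (fun i => (hc i).1) (fun i => (hc i).2)
    have hy0 : Y d (x j) = 0 := tendsto_nhds_unique (hconv (hx j) (fun i =>
      ⟨(htm i j).1.1.trans (hc i).1, (hc i).2.trans (htm i j').1.2⟩) hct).2
      (tendsto_const_nhds.congr' ((hdU.eventually self_mem_nhdsWithin).mono fun i hi => (hc0 i hi).symm))
    exact (hns (x j) (hx j)).elim (· hy0) fun h1 => h1 (by rw [hzero j, hf0])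
  refine ⟨Finset.univ.image x, ?_, fun z hz => ?_⟩
  · rw [Finset.card_image_of_injective _ hinj.injective, Finset.card_univ, Fintype.card_fin]
  · obtain ⟨j, -, rfl⟩ := Finset.mem_image.1 hz
    exact ⟨hx j, hzero j⟩

end

/-! ### Decay to zero and the trap in the well -/

lemma Sol.mul_sub_le_of_le (hq : IsAdmissibleWeight p q) (hC : 0 < C)
    (hCq : ∀ r, 0 < r → r * deriv q r ≤ C * q r) (h : Sol g q f 0 d T v y)
    (hs : 0 < s) (hst : s ≤ t) (ht : t ≤ T) (hc0 : 0 ≤ c) (hc : ∀ r ∈ Ioo s t, c ≤ f (v r)) :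
    c * (t - s) ≤ (1 + C) * (|y s| - y t) := by
  have e1 := h.flux_le hq le_rfl hs.le hst ht hc
  have ht0 := hs.trans_le hst
  have e2 := hq.le_primitiveQ_sub hCq hs.le ht0 hst
  rw [extWeight_of_pos q hs, extWeight_of_pos q ht0] at e1
  have hqt := hq.pos ht0
  have hqs := hq.pos hs
  have e3 : q s * y s ≤ q t * |y s| :=
    (mul_le_mul_of_nonneg_left (le_abs_self _) hqs.le).trans
      (mul_le_mul_of_nonneg_right (hq.mono hs hst) (abs_nonneg _))
  refine le_of_mul_le_mul_left ?_ hqt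
  linarith [mul_le_mul_of_nonneg_left e2 hc0, mul_le_mul_of_nonneg_left
    (show c * (primitiveQ q t - primitiveQ q s) ≤ q t * (|y s| - y t) by linarith)
    (show 0 ≤ 1 + C by linarith)]

lemma abs_le_of_kin (hp : 1 < p') {e : ℝ} (he : 0 ≤ e) :
    ∃ M, 0 ≤ M ∧ ∀ s, kin p' s ≤ e → |s| ≤ M := by
  have h0 : 0 < p' := by linarith
  refine ⟨(p' * e) ^ (1 / p'), by positivity, fun s hs => ?_⟩
  rw [kin, div_le_iff₀' h0] at hs
  refine le_of_eq_of_le ?_ (rpow_le_rpow (by positivity) hs (by positivity : 0 ≤ 1 / p'))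
  rw [← rpow_mul (abs_nonneg _), mul_one_div_cancel h0.ne', rpow_one]

/-- A bounded solution which is eventually decreasing and has nonnegative energy tends to `0`. -/
lemma tendsto_zero_of_decreasing (hp : 1 < p') (hq : IsAdmissibleWeight p q)
    (hw : DoubleWell f βm βp) (h : ∀ T, Sol (phi p') q f 0 d T v y) (hM : ∀ r, |v r| ≤ M)
    (hE : ∀ r, 0 ≤ r → 0 ≤ energy (kin p') f v y r) (ht : 0 < t) (hy : ∀ r ≥ t, y r ≤ 0) :
    Tendsto v atTop (𝓝 0) := by
  have hsub : ∀ {s r ζ : ℝ}, t ≤ s → s ≤ r → (∀ x ∈ Ioo s r, phi p' (y x) ≤ -ζ) →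
      v r ≤ v s - ζ * (r - s) := fun {s r ζ} hs hsr hx =>
    (h r).sub_le_of_phi_le (ht.le.trans hs) hsr le_rfl hx
  have hanti : Antitone fun r => v (max t r) := fun r s hrs => by
    have := hsub (ζ := 0) (le_max_left t r) (max_le_max le_rfl hrs) fun x hx => by
      simpa [phi_zero] using phi_mono hp (hy x ((le_max_left t r).trans hx.1.le))
    linarith
  have hEanti : Antitone fun r => energy (kin p') f v y (max t r) := fun r s hrs =>
    energy_antitone hp hq hw.cont h (ht.le.trans (le_max_left t r)) (max_le_max le_rfl hrs)
  have hconv : ∀ {u : ℝ → ℝ} {m : ℝ}, (Antitone fun r => u (max t r)) → (∀ r ≥ t, m ≤ u r) →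
      ∃ ℓ, Tendsto u atTop (𝓝 ℓ) := fun {u m} hu hm =>
    ⟨_, (tendsto_atTop_ciInf hu ⟨m, by rintro _ ⟨r, rfl⟩; exact hm _ (le_max_left t r)⟩).congr'
      ((eventually_ge_atTop t).mono fun r hr => congrArg u (max_eq_right hr))⟩
  obtain ⟨ℓ, hℓ⟩ := hconv hanti fun r _ => (abs_le.1 (hM r)).1
  obtain ⟨e, he⟩ := hconv hEanti fun r hr => hE r (ht.le.trans hr)
  have he0 : 0 ≤ e := ge_of_tendsto he ((eventually_ge_atTop 0).mono hE)
  -- Both `v` and the energy are monotone and bounded, so the kinetic energy converges as well; a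
  -- positive limit would make `v` decrease at least linearly.
  have hkin : Tendsto (fun r => kin p' (y r)) atTop (𝓝 (e - primitiveF f ℓ)) := by
    refine (he.sub (((continuous_primitiveF hw.cont).tendsto ℓ).comp hℓ)).congr fun r => ?_
    simp [energy]
  have hnd : ∀ ζ > 0, ∀ s ≥ t, ¬ ∀ r ≥ s, y r ≤ -ζ := by
    intro ζ hζ s hs hcon
    have hM0 : 0 ≤ M := (abs_nonneg _).trans (hM 0)
    have hφ := phi_pos (m := p') hζ
    have := hsub (ζ := phi p' ζ) hs (le_add_of_nonneg_right (b := (2 * M + 1) / phi p' ζ)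
      (by positivity)) fun x hx => by
        rw [← phi_neg]; exact phi_mono hp (hcon x hx.1.le)
    rw [add_sub_cancel_left, mul_div_cancel₀ _ hφ.ne'] at this
    linarith [(abs_le.1 (hM s)).2, (abs_le.1 (hM (s + (2 * M + 1) / phi p' ζ))).1]
  have hkl : e = primitiveF f ℓ := by
    by_contra hne
    have hkpos : 0 < e - primitiveF f ℓ :=
      (ge_of_tendsto' hkin fun r => kin_nonneg hp _).lt_of_ne fun h0 => hne (by linarith)
    obtain ⟨η, hη, hηk⟩ := exists_le_abs_of_kin hp (half_pos hkpos)
    obtain ⟨s, hs⟩ := eventually_atTop.1 (hkin.eventually (lt_mem_nhds (half_lt_self hkpos)))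
    refine hnd η hη (max t s) (le_max_left _ _) fun r hr => ?_
    have h1 := hηk _ (hs r ((le_max_right _ _).trans hr)).le
    rw [abs_of_nonpos (hy r ((le_max_left _ _).trans hr))] at h1
    linarith
  obtain ⟨C, hC, hCq⟩ := hq.exists_deriv_le
  obtain ⟨M', hM', hyM⟩ := abs_le_of_kin hp (e := |e - primitiveF f ℓ| + 1) (by positivity)
  obtain ⟨s0, hs0⟩ := eventually_atTop.1 (hkin.eventually (gt_mem_nhds
    ((le_abs_self _).trans_lt (lt_add_one _))))
  -- If `f(ℓ) ≠ 0`, the force would keep a sign and `y` would be unbounded, while the kinetic energy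
  -- converges.
  have hfℓ : f ℓ = 0 := by
    by_contra hne
    have habs : ∀ s ≥ max t s0, |y s| ≤ M' := fun s hs => hyM _ (hs0 s ((le_max_right _ _).trans hs)).le
    have key : ∀ {d l : ℝ} {g w z : ℝ → ℝ}, (∀ T, Sol (phi p') q g 0 d T w z) →
        (∀ s ≥ max t s0, |z s| ≤ M') → 0 < l → ¬ ∀ᶠ r in atTop, l < g (w r) := by
      intro d l g w z h habs hl hev
      obtain ⟨s1, hs1⟩ := eventually_atTop.1 hev
      set s := max (max t s0) s1
      have hst : t ≤ s := (le_max_left _ _).trans (le_max_left _ _)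
      set r := s + (1 + C) * (2 * M' + 1) / l with hr
      have hsr : s ≤ r := le_add_of_nonneg_right (by positivity)
      have h1 := (h r).mul_sub_le_of_le hq hC hCq (ht.trans_le hst) hsr le_rfl hl.le
        fun x hx => (hs1 x ((le_max_right _ _).trans hx.1.le)).le
      rw [show l * (r - s) = (1 + C) * (2 * M' + 1) by
        rw [hr, add_sub_cancel_left, mul_div_cancel₀ _ hl.ne']] at h1
      linarith [le_of_mul_le_mul_left h1 (by linarith), habs s (le_max_left _ _),
        (abs_le.1 (habs r ((le_max_left _ _).trans hsr))).1]
    have hcℓ := (hw.cont.tendsto ℓ).comp hℓ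
    rcases lt_or_gt_of_ne hne with hneg | hpos
    · exact key (fun T => (h T).reflect (phi_neg p')) (by simpa only [abs_neg] using habs)
        (half_pos (neg_pos.2 hneg)) (by
          simpa using hcℓ.neg.eventually (lt_mem_nhds (half_lt_self (neg_pos.2 hneg))))
    · exact key h habs (half_pos hpos) (hcℓ.eventually (lt_mem_nhds (half_lt_self hpos)))
  -- The only `ℓ` with `f(ℓ) = 0` and `F(ℓ) ≥ 0` is zero.
  have hℓ0 : ℓ = 0 := by
    by_contra hne
    have hF : 0 ≤ primitiveF f ℓ := hkl ▸ he0
    rcases le_or_gt βp ℓ with h1 | h1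
    · exact (hw.pos ℓ h1).ne' hfℓ
    rcases le_or_gt ℓ βm with h2 | h2
    · exact (hw.neg ℓ h2).ne hfℓ
    · exact (hw.well ℓ ⟨h2, h1⟩ hne).not_ge hF
  rwa [hℓ0] at hℓ

/-- After descending through small positive values with little weighted energy, a solution has at most
one zero with positive energy: to have a second one it would have to cross the well, which costs too
much energy. -/
lemma exists_trap (hp : 1 < p') (hq : IsAdmissibleWeight p q) (hw : DoubleWell f βm βp) {E0 : ℝ}
    (hβ0 : 0 < β0) (hβp : β0 ≤ βp) (hβm : β0 ≤ -βm) (hE0 : 0 ≤ E0) :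
    ∃ κ > 0, ∃ T0 > 0, ∀ {d : ℝ} {u y : ℝ → ℝ}, (∀ T, Sol (phi p') q f 0 d T u y) → ∀ R > 0,
      energy (kin p') f u y R ≤ E0 → 0 < u R → u R < β0 → y R < 0 →
      ∀ m, q R ^ p' * energy (kin p') f u y R < m →
      (∀ s ≥ R, m ≤ κ * (q (s + T0) ^ p' - q s ^ p')) →
      ∀ z1 z2, R < z1 → z1 < z2 → u z1 = 0 → u z2 = 0 → energy (kin p') f u y z2 ≤ 0 := by
  obtain ⟨B, hB, hFB⟩ := hw.exists_lower_bound
  obtain ⟨Y0, hY0, hYk⟩ := abs_le_of_kin hp (e := E0 + B) (by linarith)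
  obtain ⟨x0, hx0, hmax⟩ := isCompact_Icc.exists_isMaxOn (s := Icc (-(2 * β0 / 3)) (-(β0 / 3)))
    ⟨-(β0 / 3), by linarith, le_rfl⟩ (continuous_primitiveF hw.cont).continuousOn
  have hκ : 0 < -primitiveF f x0 := by
    linarith [hw.well x0 ⟨by linarith [hx0.1], by linarith [hx0.2, hw.pos_right]⟩
      (by linarith [hx0.2] : x0 < 0).ne]
  have hS : 0 ≤ phi p' Y0 := phi_zero p' ▸ phi_mono hp hY0
  -- `κ` is the least depth of the well over `[-2β0/3, -β0/3]`, and `T0` is the width of this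
  -- interval divided by a bound of the speed.
  refine ⟨_, hκ, β0 / 3 / (phi p' Y0 + 1), by positivity,
    fun {d u y} h R hR hER hu0 huβ hyR m hm hmκ z1 z2 hz1 hz12 huz1 huz2 => ?_⟩
  by_contra! hpos
  have hpos' : ∀ t, 0 ≤ t → t ≤ z2 → 0 < energy (kin p') f u y t := fun t h0 ht =>
    hpos.trans_le (energy_antitone hp hq hw.cont h h0 ht)
  have hanti : ∀ s t, R ≤ s → s ≤ t → (∀ x ∈ Ioo s t, y x ≤ 0) → u t ≤ u s := fun s t hs hst hx => by
    have := (h t).sub_le_of_phi_le (ζ := 0) (hR.le.trans hs) hst le_rfl fun x hxx => by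
      simpa [phi_zero] using phi_mono hp (hx x hxx)
    linarith
  have hsign : ∀ t, t ≤ z2 → (∀ x ∈ Ico R t, -β0 < u x) → ∀ x ∈ Ico R t, y x < 0 := by
    intro t ht hu x hx
    by_contra hyx
    obtain ⟨z, hz, hyz, hzx⟩ := exists_first_le (v := fun x => -y x) (b := 0) (h 0).cont_y.neg hx.1
      (by linarith) (by linarith)
    have h1 := hanti R z le_rfl hz.1.le fun x hx => by linarith [hzx x (Ioo_subset_Ico_self hx)]
    have h2 := hu z ⟨hz.1.le, hz.2.trans_lt hx.2⟩
    have h3 := hpos' z (hR.le.trans hz.1.le) (hz.2.trans (hx.2.le.trans ht))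
    have hyz0 : y z = 0 := by linarith
    rw [energy, hyz0, kin_zero hp, zero_add] at h3
    exact (hw.nonpos ⟨by linarith, by linarith⟩).not_gt h3
  obtain ⟨t', ht', hut'⟩ : ∃ t ∈ Icc R z2, u t ≤ -β0 := by
    by_contra! hcon
    have hneg := hsign z2 le_rfl fun x hx => hcon x (Ico_subset_Icc_self hx)
    obtain ⟨c, hc, hc0⟩ := exists_hasDerivAt_eq_zero hz12 (h 0).cont_v.continuousOn
      (huz1.trans huz2.symm) fun r hr => (h z2).deriv_v r (hR.trans (hz1.trans hr.1)) hr.2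
    exact phi_ne_zero (hneg c ⟨hz1.le.trans hc.1.le, hc.2⟩).ne hc0
  obtain ⟨t, ht, hut, htx⟩ := exists_first_le (h 0).cont_v ht'.1 (show -β0 < u R by linarith) hut'
  have htz : t ≤ z2 := ht.2.trans ht'.2
  have hyneg := hsign t htz htx
  obtain ⟨s1, hs1, hus1⟩ := intermediate_value_Icc' ht.1.le (h 0).cont_v.continuousOn
    (show -(β0 / 3) ∈ Icc (u t) (u R) from ⟨by linarith, by linarith⟩)
  obtain ⟨s2, hs2, hus2⟩ := intermediate_value_Icc' hs1.2 (h 0).cont_v.continuousOn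
    (show -(2 * β0 / 3) ∈ Icc (u t) (u s1) from ⟨by linarith, by linarith⟩)
  have hs10 : 0 < s1 := hR.trans_le hs1.1
  have hRange : ∀ x ∈ Icc R t, u x ∈ Icc (-β0) β0 := fun x hx =>
    ⟨hut ▸ hanti x t hx.1 hx.2 fun r hr => (hyneg r ⟨hx.1.trans hr.1.le, hr.2⟩).le,
      (hanti R x le_rfl hx.1 fun r hr => (hyneg r ⟨hr.1.le, hr.2.trans_le hx.2⟩).le).trans huβ.le⟩
  have hR1 := (h t).weighted_energy_le hp hq hw.cont (κ := 0) hR hR.le hs1.1 hs1.2 fun r hr => by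
    have := hRange r ⟨hr.1.le, hr.2.le.trans hs1.2⟩
    rw [neg_zero]
    exact hw.nonpos ⟨by linarith [this.1], this.2.trans hβp⟩
  have h12 := (h t).weighted_energy_le hp hq hw.cont (κ := -primitiveF f x0) hs10 hs10.le hs2.1 hs2.2
    fun r hr => by
      rw [neg_neg]
      refine hmax (show u r ∈ Icc _ _ from ⟨?_, ?_⟩)
      · rw [← hus2]
        exact hanti r s2 (hs1.1.trans hr.1.le) hr.2.le fun x hx =>
          (hyneg x ⟨hs1.1.trans (hr.1.trans hx.1).le, hx.2.trans_le hs2.2⟩).le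
      · rw [← hus1]
        exact hanti s1 r hs1.1 hr.1.le fun x hx =>
          (hyneg x ⟨hs1.1.trans hx.1.le, hx.2.trans_le (hr.2.le.trans hs2.2)⟩).le
  have hspeed := abs_sub_le_of_hasDerivAt (C := phi p' Y0 + 1) hs2.1 (h 0).cont_v.continuousOn
    (fun r hr => (h t).deriv_v r (hs10.trans hr.1) (hr.2.trans_le hs2.2)) fun r hr => by
      have hyr : |y r| ≤ Y0 := by
        refine hYk _ ?_
        have e1 := energy_antitone hp hq hw.cont h hR.le (hs1.1.trans hr.1.le)
        unfold energy at e1 hER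
        linarith [hFB (u r)]
      rw [abs_le] at hyr ⊢
      have e1 := phi_mono hp hyr.1
      have e2 := phi_mono hp hyr.2
      rw [phi_neg] at e1
      constructor <;> linarith
  have hT0 : s1 + β0 / 3 / (phi p' Y0 + 1) ≤ s2 := by
    rw [hus1, hus2, abs_sub_comm, abs_of_pos (by linarith)] at hspeed
    rw [← le_sub_iff_add_le', div_le_iff₀ (by linarith)]; linarith
  have hmon : q (s1 + β0 / 3 / (phi p' Y0 + 1)) ^ p' ≤ q s2 ^ p' := by
    have hpos0 : 0 < s1 + β0 / 3 / (phi p' Y0 + 1) := by positivity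
    exact rpow_le_rpow (hq.pos hpos0).le (hq.mono hpos0 hT0) (by linarith)
  -- Crossing the deep part takes at least `T0`, and the loss of `q^{p'} I` there is at least `m`,
  -- more than was left at `R`; the energy would be negative at `s2`.
  linarith [hmκ s1 hs1.1, mul_le_mul_of_nonneg_left hmon hκ.le, mul_pos
    (rpow_pos_of_pos (hq.pos (hs10.trans_le hs2.1)) p') (hpos' s2 (hs10.le.trans hs2.1) (hs2.2.trans htz))]

/-! ### Classical solutions and their nodes -/

/-- A global solution which tends to `0` is a classical solution. -/
lemma isClassicalSolution_of_sol (hpp : p.HolderConjugate p') (hq : IsAdmissibleWeight p q)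
    (hf : Continuous f) (h : ∀ T, Sol (phi p') q f 0 d T v y) (hlim : Tendsto v atTop (𝓝 0)) :
    IsClassicalSolution p q f v := by
  have hp := hpp.symm.lt
  have hphi := continuous_phi hp
  have hd : ∀ r, 0 < r → HasDerivAt v (phi p' (y r)) r := fun r hr =>
    (h (r + 1)).deriv_v r hr (by linarith)
  have hy0 : y 0 = 0 := ((h 0).init 0 le_rfl).2
  have hdw : ∀ r, 0 ≤ r → HasDerivWithinAt v (phi p' (y r)) (Ici 0) r := by
    intro r hr
    rcases eq_or_lt_of_le hr with rfl | hr
    · refine hasDerivWithinAt_Ici_of_tendsto_deriv (s := Ioi 0)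
        (fun r hr => (hd r hr).differentiableAt.differentiableWithinAt)
        (h 0).cont_v.continuousWithinAt self_mem_nhdsWithin ?_
      refine (((hphi.comp (h 0).cont_y).tendsto 0).mono_left nhdsWithin_le_nhds).congr' ?_
      filter_upwards [self_mem_nhdsWithin] with r hr using (hd r hr).deriv.symm
    · exact (hd r hr).hasDerivWithinAt
  have hderiv : ∀ r, 0 ≤ r → derivWithin v (Ici 0) r = phi p' (y r) := fun r hr =>
    (hdw r hr).derivWithin (uniqueDiffOn_Ici 0 r hr)
  have hflux : ∀ r, 0 < r → flux p q v r = extWeight q r * y r := fun r hr => by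
    rw [flux, hderiv r hr.le, phi_phi hpp, extWeight_of_pos q hr]
  have hdf : ∀ r, 0 < r → HasDerivAt (flux p q v) (-(q r * f (v r))) r := fun r hr =>
    ((h (r + 1)).hasDerivAt_flux hq le_rfl hr (by linarith)).congr_of_eventuallyEq
      (by filter_upwards [Ioi_mem_nhds hr] with s hs using hflux s hs)
  refine ⟨?_, ?_, fun r hr => ?_, ?_, hlim⟩
  · rw [contDiffOn_one_iff_derivWithin (uniqueDiffOn_Ici 0)]
    exact ⟨fun r hr => (hdw r hr).differentiableWithinAt,
      (hphi.comp (h 0).cont_y).continuousOn.congr fun r hr => hderiv r hr⟩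
  · rw [contDiffOn_one_iff_derivWithin isOpen_Ioi.uniqueDiffOn]
    refine ⟨fun r hr => (hdf r hr).differentiableAt.differentiableWithinAt, ?_⟩
    refine ContinuousOn.congr (f := fun r => -(q r * f (v r))) ?_ fun r hr => ?_
    · exact (hq.contDiffOn.continuousOn.mul (hf.comp (h 0).cont_v).continuousOn).neg
    · rw [derivWithin_of_isOpen isOpen_Ioi hr, (hdf r hr).deriv]
  · rw [(hdf r hr).deriv]; ring
  · rw [hderiv 0 le_rfl, hy0, phi_zero]

lemma hasDerivAt_truncate {u' : ℝ} (hu : r ≤ τ → HasDerivAt u u' r)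
    (hτ : u τ = 0) (h0 : τ ≤ r → u' = 0) :
    HasDerivAt (fun r => if r < τ then u r else 0) u' r := by
  rcases lt_trichotomy r τ with hr | rfl | hr
  · refine (hu hr.le).congr_of_eventuallyEq ?_
    filter_upwards [Iio_mem_nhds hr] with s hs using if_pos hs
  · rw [← hasDerivWithinAt_univ, ← Iic_union_Ici (a := r)]
    refine HasDerivWithinAt.union ?_ ?_
    · refine (hu le_rfl).hasDerivWithinAt.congr (fun s hs => ?_) (by simp [hτ])
      rcases eq_or_lt_of_le (mem_Iic.1 hs) with rfl | hs
      · simp [hτ]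
      · exact if_pos hs
    · rw [h0 le_rfl]
      exact (hasDerivWithinAt_const _ _ 0).congr (fun s hs => if_neg (not_lt.2 hs)) (by simp)
  · rw [h0 hr.le]
    refine (hasDerivAt_const r (0 : ℝ)).congr_of_eventuallyEq ?_
    filter_upwards [Ioi_mem_nhds hr] with s hs using if_neg (not_lt.2 (le_of_lt hs))

lemma continuous_truncate (hu : Continuous u) (hτ : u τ = 0) :
    Continuous fun r => if r < τ then u r else 0 := by
  refine hu.if (fun a ha => ?_) continuous_const
  have : frontier {r : ℝ | r < τ} = {τ} := frontier_Iio
  rw [this] at ha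
  rw [mem_singleton_iff.1 ha, hτ]

/-- A solution which reaches the origin can be continued by zero. -/
lemma Sol.truncate (h : ∀ T, Sol (phi p') q f 0 d T v y) (hf : f 0 = 0) (hτ : 0 < τ)
    (hv : v τ = 0) (hy : y τ = 0) (T : ℝ) :
    Sol (phi p') q f 0 d T (fun r => if r < τ then v r else 0) fun r => if r < τ then y r else 0 := by
  refine ⟨continuous_truncate (h 0).cont_v hv, continuous_truncate (h 0).cont_y hy, fun r hr => ?_,
    fun r hr _ => ?_, fun r hr _ => ?_⟩
  · rw [if_pos (hr.trans_lt hτ), if_pos (hr.trans_lt hτ)]; exact (h 0).init r hr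
  · refine hasDerivAt_truncate (fun hrτ => ?_) hv fun hrτ => ?_
    · rcases eq_or_lt_of_le hrτ with rfl | hlt
      · rw [if_neg (lt_irrefl _)]
        have := (h (r + 1)).deriv_v r hr (by linarith)
        rwa [hy] at this
      · rw [if_pos hlt]
        exact (h (r + 1)).deriv_v r hr (by linarith)
    · rw [if_neg (not_lt.2 hrτ), phi_zero]
  · refine hasDerivAt_truncate (fun hrτ => ?_) hy fun hrτ => ?_
    · rcases eq_or_lt_of_le hrτ with rfl | hlt
      · rw [if_neg (lt_irrefl _), if_neg (lt_irrefl _)]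
        have := (h (r + 1)).deriv_y r hr (by linarith)
        rwa [hy, hv] at this
      · rw [if_pos hlt, if_pos hlt]
        exact (h (r + 1)).deriv_y r hr (by linarith)
    · rw [if_neg (not_lt.2 hrτ), if_neg (not_lt.2 hrτ), hf]; simp

/-- Stopping a solution when its energy vanishes gives a classical solution, whose nodes are the
zeros with positive energy. -/
lemma exists_classical (hpp : p.HolderConjugate p') (hq : IsAdmissibleWeight p q)
    (hw : DoubleWell f βm βp) (hd : 0 < d) (h : ∀ T, Sol (phi p') q f 0 d T v y)
    (hvan : ∀ r, 0 ≤ r → energy (kin p') f v y r ≤ 0 →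
      (∀ s, 0 ≤ s → s < r → 0 < energy (kin p') f v y s) → v r = 0 ∧ y r = 0)
    (hlim : (∀ r, 0 ≤ r → 0 < energy (kin p') f v y r) → Tendsto v atTop (𝓝 0)) :
    ∃ u, IsClassicalSolution p q f u ∧ 0 < u 0 ∧
      nodes u = {r | 0 < r ∧ 0 < energy (kin p') f v y r ∧ v r = 0} := by
  have hp := hpp.symm.lt
  have hEc : Continuous (energy (kin p') f v y) :=
    (h 0).continuous_energy hw.cont (hasDerivAt_kin hp)
  -- `u` agrees with `v` while the energy is positive and is zero afterwards: either the energy is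
  -- always positive and `u = v`, or `v` is cut off at the first zero `τ` of the energy, where `v =
  -- y = 0` by `hvan`.
  obtain ⟨u, z, hu, hul, hue, huz⟩ : ∃ u z : ℝ → ℝ, (∀ T, Sol (phi p') q f 0 d T u z) ∧
      Tendsto u atTop (𝓝 0) ∧ (∀ r, 0 ≤ r → 0 < energy (kin p') f v y r → u =ᶠ[𝓝 r] v) ∧
      (∀ r, 0 ≤ r → energy (kin p') f v y r ≤ 0 → u r = 0) := by
    by_cases hall : ∀ r, 0 ≤ r → 0 < energy (kin p') f v y r
    · exact ⟨v, y, h, hlim hall, fun r _ _ => EventuallyEq.rfl,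
        fun r hr h0 => absurd (hall r hr) (not_lt.2 h0)⟩
    push Not at hall
    obtain ⟨r0, hr0, hEr0⟩ := hall
    obtain ⟨τ, hτ, hmin⟩ := (isCompact_Icc.inter_right
      (isClosed_le hEc continuous_const)).exists_isLeast (s := Icc 0 r0 ∩ {r | energy (kin p') f v y r ≤ 0})
      ⟨r0, ⟨hr0, le_rfl⟩, hEr0⟩
    have hpos : ∀ s, 0 ≤ s → s < τ → 0 < energy (kin p') f v y s := fun s hs hsτ => by
      by_contra hcon
      exact absurd (hmin ⟨⟨hs, hsτ.le.trans hτ.1.2⟩, not_lt.1 hcon⟩) (not_le.2 hsτ)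
    obtain ⟨hv, hy⟩ := hvan τ hτ.1.1 hτ.2 hpos
    have hτ0 : 0 < τ := lt_of_le_of_ne hτ.1.1 fun h0 => by
      rw [← h0, ((h 0).init 0 le_rfl).1] at hv
      exact hd.ne' hv
    have hnonpos : ∀ r, τ ≤ r → energy (kin p') f v y r ≤ 0 := fun r hr =>
      (energy_antitone hp hq hw.cont h hτ0.le hr).trans hτ.2
    refine ⟨_, _, Sol.truncate h hw.map_zero hτ0 hv hy, ?_, fun r hr hE => ?_, fun r hr hE => ?_⟩
    · refine tendsto_const_nhds.congr' ?_
      filter_upwards [eventually_ge_atTop τ] with r hr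
      rw [if_neg (not_lt.2 hr)]
    · have hrτ : r < τ := by
        by_contra hcon
        exact absurd hE (not_lt.2 (hnonpos r (not_lt.1 hcon)))
      filter_upwards [Iio_mem_nhds hrτ] with s hs using if_pos hs
    · refine if_neg fun hrτ => ?_
      exact absurd (hpos r hr hrτ) (not_lt.2 hE)
  refine ⟨u, isClassicalSolution_of_sol hpp hq hw.cont hu hul, ?_, ?_⟩
  · rw [((hu 0).init 0 le_rfl).1]; exact hd
  ext r
  constructor
  · rintro ⟨hr, hur, hsup⟩
    -- Without energy at `r`, `u` vanishes from `r` on; then `r` is not in the relative interior of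
    -- the support.
    have hE : 0 < energy (kin p') f v y r := by
      by_contra hE
      have hsub : radialSupport u ⊆ Iic r := by
        refine closure_minimal (fun s hs => ?_) isClosed_Iic
        by_contra hsr
        have hrs : r < s := not_le.1 hsr
        exact hs.2 (huz s hs.1 ((energy_antitone hp hq hw.cont h hr hrs.le).trans (not_lt.1 hE)))
      have h1 : Iic r ∈ 𝓝[>] r :=
        (nhdsWithin_mono r fun s hs => hr.trans (le_of_lt hs)) (mem_of_superset hsup hsub)
      obtain ⟨s, hs1, hs2⟩ := ((eventually_of_mem h1 fun _ hx => hx).and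
        (self_mem_nhdsWithin : ∀ᶠ s in 𝓝[>] r, s ∈ Ioi r)).exists
      exact absurd hs1 (not_le.2 hs2)
    have hvr : v r = 0 := by rw [← (hue r hr hE).self_of_nhds]; exact hur
    refine ⟨lt_of_le_of_ne hr fun h0 => ?_, hE, hvr⟩
    rw [← h0, ((h 0).init 0 le_rfl).1] at hvr
    exact hd.ne' hvr
  · rintro ⟨hr, hE, hvr⟩
    have hur : u r = 0 := by rw [(hue r hr.le hE).self_of_nhds]; exact hvr
    refine ⟨hr.le, hur, mem_nhdsWithin_of_mem_nhds ?_⟩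
    -- A zero with positive energy is simple and hence isolated, so the support contains a full
    -- neighbourhood of it.
    have hyr : y r ≠ 0 := by
      intro hy
      rw [energy, hy, hvr, kin_zero hp, primitiveF_zero] at hE
      simp at hE
    have hdu := ((h (r + 1)).deriv_v r hr (by linarith)).congr_of_eventuallyEq (hue r hr.le hE)
    have hne : ∀ᶠ s in 𝓝[≠] r, u s ≠ 0 := by
      have := hdu.eventually_ne (c := 0) (phi_ne_zero hyr)
      exact this
    have hpos : ∀ᶠ s in 𝓝[≠] r, 0 ≤ s := ((lt_mem_nhds hr).mono fun s hs => hs.le).filter_mono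
      nhdsWithin_le_nhds
    have hmem : {s | 0 ≤ s ∧ u s ≠ 0} ∈ 𝓝[≠] r := by
      filter_upwards [hne, hpos] with s h1 h2 using ⟨h2, h1⟩
    have hcl : r ∈ radialSupport u := by
      refine mem_closure_iff_nhdsWithin_neBot.2 ?_
      exact NeBot.mono (inferInstance : NeBot (𝓝[≠] r)) (le_inf nhdsWithin_le_nhds
        (le_principal_iff.2 hmem))
    rw [← nhdsNE_sup_pure, mem_sup]
    exact ⟨mem_of_superset hmem subset_closure, hcl⟩

/-! ### The shooting argument -/

/-- An eventually positive solution of positive energy decreases to zero. -/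
lemma decreasing_of_eventually_pos (hp : 1 < p') (hq : IsAdmissibleWeight p q)
    (hw : DoubleWell f βm βp) (h : ∀ T, Sol (phi p') q f 0 d T v y) (hM : ∀ r, |v r| ≤ M)
    (hE : ∀ r, 0 ≤ r → 0 < energy (kin p') f v y r) (ht : 0 < t) (hv : ∀ r ≥ t, 0 < v r) :
    Tendsto v atTop (𝓝 0) ∧ ∃ t1 ≥ t, ∀ r ≥ t1, y r < 0 := by
  have hslope : ∀ r ≥ t, y r = 0 → -f (v r) - deriv q r / q r * y r < 0 := by
    intro r hr hyr
    have h1 := hE r (ht.le.trans hr)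
    rw [energy, hyr, kin_zero hp, zero_add] at h1
    rw [hyr]
    linarith [hw.pos _ (hw.gt_of_pos h1 (hv r hr).le).le]
  -- If `y > 0` throughout, `v` would increase, and still tend to zero by
  -- `tendsto_zero_of_decreasing` for the reflected solution.
  obtain ⟨s, hs, hys⟩ : ∃ s ≥ t, y s ≤ 0 := by
    by_contra! hcon
    have h1 := tendsto_zero_of_decreasing hp hq hw.reflect (fun T => (h T).reflect (phi_neg p'))
      (M := M) (by simpa using hM) (fun r hr => by rw [energy_reflect]; exact (hE r hr).le) ht
      fun r hr => by linarith [hcon r hr]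
    have h2 := h1.neg
    simp only [neg_neg, neg_zero] at h2
    have h3 : v t ≤ 0 := by
      refine ge_of_tendsto h2 ((eventually_ge_atTop t).mono fun r hr => ?_)
      exact le_of_hasDerivAt_nonneg hr (h 0).cont_v.continuousOn
        (fun x hx => (h r).deriv_v x (ht.trans hx.1) hx.2) fun x hx => (phi_pos (hcon x hx.1.le)).le
    linarith [hv t le_rfl]
  have hyle : ∀ r ≥ s, y r ≤ 0 := fun r hr =>
    nonpos_of_deriv_neg (t := r) (h 0).cont_y
      (fun x hx => (h r).deriv_y x (ht.trans_le (hs.le.trans hx.1)) hx.2) hys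
      (fun x hx hyx => hslope x (hs.le.trans hx.1) hyx) ⟨hr, le_rfl⟩
  refine ⟨tendsto_zero_of_decreasing hp hq hw h hM (fun r hr => (hE r hr).le) (ht.trans_le hs) hyle,
    s + 1, by linarith, fun r hr => lt_of_le_of_ne (hyle r (by linarith)) fun hyr => ?_⟩
  have hc := hslope r (by linarith) hyr
  obtain ⟨a, ha, -, -, hac, -⟩ := exists_signs_of_hasDerivAt
    ((h (r + 1)).deriv_y r (by linarith) (by linarith)) hyr hc.ne one_pos
  have h1 := hyle a (by linarith [ha.1])
  exact absurd hac (not_lt.2 (mul_nonneg_of_nonpos_of_nonpos h1 hc.le))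

/-- The version of `exists_trap` for both signs. -/
lemma exists_trap_sign (hp : 1 < p') (hq : IsAdmissibleWeight p q) (hw : DoubleWell f βm βp)
    {E0 : ℝ} (hσ : σ = 1 ∨ σ = -1) (hβ0 : 0 < β0) (hβp : β0 ≤ βp) (hβm : β0 ≤ -βm) (hE0 : 0 ≤ E0) :
    ∃ κ > 0, ∃ T0 > 0, ∀ {d : ℝ} {u y : ℝ → ℝ}, (∀ T, Sol (phi p') q f 0 d T u y) → ∀ R > 0,
      energy (kin p') f u y R ≤ E0 → 0 < σ * u R → σ * u R < β0 → σ * y R < 0 →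
      ∀ m, q R ^ p' * energy (kin p') f u y R < m →
      (∀ s ≥ R, m ≤ κ * (q (s + T0) ^ p' - q s ^ p')) →
      ∀ z1 z2, R < z1 → z1 < z2 → u z1 = 0 → u z2 = 0 → energy (kin p') f u y z2 ≤ 0 := by
  rcases hσ with rfl | rfl
  · obtain ⟨κ, hκ, T0, hT0, H⟩ := exists_trap hp hq hw hβ0 hβp hβm hE0
    refine ⟨κ, hκ, T0, hT0, fun {d u y} h R hR hER h1 h2 h3 => ?_⟩
    rw [one_mul] at h1 h2 h3
    exact H h R hR hER h1 h2 h3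
  · obtain ⟨κ, hκ, T0, hT0, H⟩ := exists_trap hp hq hw.reflect hβ0 (by linarith)
      (by linarith) hE0
    refine ⟨κ, hκ, T0, hT0, fun {d u y} h R hR hER h1 h2 h3 m hm hmκ z1 z2 hz1 hz hu1 hu2 => ?_⟩
    have := H (fun T => (h T).reflect (phi_neg p')) R hR (by rwa [energy_reflect]) (by linarith)
      (by linarith) (by linarith) m (by rwa [energy_reflect]) hmκ z1 z2 hz1 hz (by rw [hu1, neg_zero])
      (by rw [hu2, neg_zero])
    rwa [energy_reflect] at this

/-- The increments tend to infinity by (Q4) and are positive on compact intervals as `q` is strictly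
increasing. This is the cost of crossing the well when the limiting solution stops at a finite
radius. -/
lemma exists_pos_le_increment (hpp : p.HolderConjugate p') (hq : IsAdmissibleWeight p q) {T0 R0 : ℝ}
    (hT0 : 0 < T0) (hR0 : 0 < R0) : ∃ m > 0, ∀ s ≥ R0, m ≤ q (s + T0) ^ p' - q s ^ p' := by
  have hp0 : 0 < p' := hpp.symm.pos
  have hlim := hq.tendsto_increment T0 hT0
  rw [show p.conjExponent = p' from hpp.conjExponent_eq] at hlim
  obtain ⟨S, hS⟩ := eventually_atTop.1 (hlim.eventually (eventually_ge_atTop 1))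
  have hpos : ∀ s, 0 < s → 0 < q (s + T0) ^ p' - q s ^ p' := by
    intro s hs
    have hmono : StrictMonoOn q (Ioi 0) := by
      apply strictMonoOn_of_deriv_pos (convex_Ioi 0) hq.contDiffOn.continuousOn
      intro x hx
      rw [interior_Ioi] at hx
      exact hq.deriv_pos x hx
    have := rpow_lt_rpow (hq.pos hs).le (hmono (mem_Ioi.2 hs) (mem_Ioi.2 (by linarith))
      (show s < s + T0 by linarith)) hp0
    linarith
  have hcont : ContinuousOn (fun s => q (s + T0) ^ p' - q s ^ p') (Icc R0 (max R0 S)) := by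
    intro s hs
    have hs0 : 0 < s := hR0.trans_le hs.1
    have h1 : ContinuousAt (fun s => q (s + T0)) s :=
      ContinuousAt.comp (f := fun s => s + T0) (hq.continuousAt (by linarith : 0 < s + T0))
        (by fun_prop)
    exact ((h1.rpow_const (Or.inr hp0.le)).sub
      ((hq.continuousAt hs0).rpow_const (Or.inr hp0.le))).continuousWithinAt
  obtain ⟨x, hx, hmin⟩ := isCompact_Icc.exists_isMinOn ⟨R0, le_rfl, le_max_left _ _⟩ hcont
  refine ⟨min 1 (q (x + T0) ^ p' - q x ^ p'), lt_min one_pos (hpos x (hR0.trans_le hx.1)),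
    fun s hs => ?_⟩
  rcases le_total S s with h | h
  · exact (min_le_left _ _).trans (hS s h)
  · exact (min_le_right _ _).trans (hmin ⟨hs, h.trans (le_max_right _ _)⟩)

lemma exists_sign (hu : Continuous u) (hS : S.OrdConnected)
    (hne : S.Nonempty) (h0 : ∀ r ∈ S, u r ≠ 0) :
    ∃ σ : ℝ, (σ = 1 ∨ σ = -1) ∧ ∀ r ∈ S, 0 < σ * u r := by
  obtain ⟨t, ht⟩ := hne
  obtain ⟨σ, hσ, hσt⟩ : ∃ σ : ℝ, (σ = 1 ∨ σ = -1) ∧ 0 < σ * u t := by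
    rcases lt_or_gt_of_ne (h0 t ht) with h | h
    · exact ⟨-1, Or.inr rfl, by linarith⟩
    · exact ⟨1, Or.inl rfl, by linarith⟩
  refine ⟨σ, hσ, fun r hr => ?_⟩
  by_contra hcon
  obtain ⟨x, hx, hx0⟩ := intermediate_value_uIcc (a := t) (b := r) (f := fun x => σ * u x)
    (continuous_const.mul hu).continuousOn (show (0 : ℝ) ∈ uIcc _ _ from
      mem_uIcc.2 (Or.inr ⟨not_lt.1 hcon, hσt.le⟩))
  rcases mul_eq_zero.1 hx0 with h | h
  · rcases hσ with rfl | rfl <;> norm_num at h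
  · exact h0 x (hS.uIcc_subset ht hr hx) h

/-- The flux vanishes where the energy does not decrease. -/
lemma Sol.flux_eq_zero_of_energy_le (hp : 1 < p')
    (hq : IsAdmissibleWeight p q) (hf : Continuous f) (ha : 0 ≤ a) (h : Sol (phi p') q f a d T v y) (hs : a ≤ s) (ht : t ≤ T)
    (he : energy (kin p') f v y s ≤ energy (kin p') f v y t) :
    ∀ r ∈ Ioo s t, y r = 0 := by
  intro r hr
  have hk := hasDerivAt_kin hp
  have hanti : ∀ r ∈ Icc s t, energy (kin p') f v y r = energy (kin p') f v y s := fun r hr =>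
    le_antisymm (h.energy_anti hq ha hf hk (mul_phi_nonneg hp) hs hr.1 (hr.2.trans ht))
      (he.trans (h.energy_anti hq ha hf hk (mul_phi_nonneg hp) (hs.trans hr.1) hr.2 ht))
  have hr0 : 0 < r := ha.trans_lt (hs.trans_lt hr.1)
  have e1 := (h.hasDerivAt_energy hf hk (hs.trans_lt hr.1) (hr.2.trans_le ht)).unique
    ((hasDerivAt_const r (energy (kin p') f v y s)).congr_of_eventuallyEq (by
      filter_upwards [Icc_mem_nhds hr.1 hr.2] with x hx using hanti x hx))
  have e2 := div_pos (hq.deriv_pos r hr0) (hq.pos hr0)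
  rw [neg_eq_zero, mul_eq_zero, or_iff_right e2.ne', mul_phi_eq_kin hp] at e1
  exact kin_eq_zero hp ((mul_eq_zero.1 e1).resolve_left (by linarith))

lemma Sol.eq_of_energy_le (hp : 1 < p')
    (hq : IsAdmissibleWeight p q) (hf : Continuous f) (ha : 0 ≤ a) (h : Sol (phi p') q f a d T v y) (hs : a ≤ s) (hst : s ≤ t) (ht : t ≤ T)
    (he : energy (kin p') f v y s ≤ energy (kin p') f v y t) : v t = v s := by
  have := abs_sub_le_of_hasDerivAt hst h.cont_v.continuousOn
    (fun r hr => h.deriv_v r (hs.trans_lt hr.1) (hr.2.trans_le ht)) (C := 0) fun r hr => by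
      rw [h.flux_eq_zero_of_energy_le hp hq hf ha hs ht he r hr, phi_zero, abs_zero]
  simpa [sub_eq_zero] using this

lemma DoubleWell.le_abs (hw : DoubleWell f βm βp) (hs : s ≠ 0)
    (hF : 0 ≤ primitiveF f s) : min βp (-βm) ≤ |s| := by
  by_contra hcon
  have h := abs_lt.1 (not_le.1 hcon)
  have := hw.well s ⟨by linarith [min_le_right βp (-βm)], by linarith [min_le_left βp (-βm)]⟩ hs
  linarith

/-- The shooting argument: if some height gives more than `k` zeros, then there is a solution with
exactly `k` nodes. -/
lemma exists_solution_of_hasZeros {V Y : ℝ → ℝ → ℝ}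
    (hpp : p.HolderConjugate p') (hq : IsAdmissibleWeight p q) (hw : DoubleWell f βm βp)
    (hL : LipschitzOffZeros f) (hV : IsFlow p' q f (Ici βp) V Y) (k : ℕ)
    (hne : ∃ d ∈ Ici βp, HasZeros p' f (V d) (Y d) 0 (k + 1)) :
    ∃ u, IsClassicalSolution p q f u ∧ 0 < u 0 ∧ (nodes u).encard = k := by
  have hp := hpp.symm.lt
  set S : Set ℝ := {d | HasZeros p' f (V d) (Y d) 0 (k + 1) ∧ d ∈ Ici βp} with hS
  have hSne : S.Nonempty := by obtain ⟨d, hd, h⟩ := hne; exact ⟨d, h, hd⟩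
  have hSb : BddBelow S := ⟨βp, fun d hd => hd.2⟩
  -- The critical height: it does not belong to `S` itself (`hnot`) but is a limit of heights in `S`
  -- (`hfreq`).
  set d := sInf S with hd_def
  have hd : d ∈ Ici βp := le_csInf hSne fun x hx => hx.2
  have hd0 : 0 < d := hw.pos_right.trans_le hd
  have hsol := hV.sol d hd
  set E := energy (kin p') f (V d) (Y d) with hE
  have hEc : Continuous E := (hsol 0).continuous_energy hw.cont (hasDerivAt_kin hp)
  have hEanti : ∀ {s t}, 0 ≤ s → s ≤ t → E t ≤ E s := fun hs hst =>
    energy_antitone hp hq hw.cont hsol hs hst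
  have hv0 : V d 0 = d := ((hsol 0).init 0 le_rfl).1
  have hE0 : E 0 = primitiveF f d := (hsol 0).energy_start (kin_zero hp)
  have hE0n : 0 ≤ E 0 := by rw [hE0]; exact hw.nonneg_of_ge hd
  have hfreq : ∃ᶠ d' in 𝓝[Ici βp] d, HasZeros p' f (V d') (Y d') 0 (k + 1) := by
    rw [frequently_nhdsWithin_iff]
    exact mem_closure_iff_frequently.1 (csInf_mem_closure hSne hSb)
  -- At `βp` the initial energy is zero, so there are no zeros with positive energy. Above `βp`
  -- lower semicontinuity would put smaller heights into `S`.
  have hnot : ¬HasZeros p' f (V d) (Y d) 0 (k + 1) := by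
    intro hz
    rcases eq_or_lt_of_le (mem_Ici.1 hd) with hβ | hβ
    · obtain ⟨s, hs, hzs⟩ := hz
      obtain ⟨z, hz⟩ := Finset.card_pos.1 (by rw [hs]; exact Nat.succ_pos k)
      have h1 := hEanti le_rfl (hzs z hz).1.le
      rw [hE0, ← hβ, hw.right_eq] at h1
      exact absurd (hzs z hz).2.2 (not_lt.2 h1)
    · have h1 := hV.eventually_hasZeros hp hq hw hL hd hz
      rw [nhdsWithin_eq_nhds.2 (Ici_mem_nhds hβ)] at h1
      obtain ⟨x, hx, hx1, hx2⟩ := ((h1.filter_mono (nhdsWithin_le_nhds (s := Iio d))).and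
        (Ioo_mem_nhdsLT hβ)).exists
      exact absurd (csInf_le hSb ⟨hx, hx1.le⟩) (not_le.2 hx2)
  -- zeros of `V d` on a nonstationary interval have positive energy
  have hposz : ∀ r, 0 ≤ r → (Y d r ≠ 0 ∨ f (V d r) ≠ 0) → V d r = 0 → 0 < r ∧ 0 < E r := by
    intro r hr hns hvr
    refine ⟨hr.lt_of_ne fun h0 => by rw [← h0, hv0] at hvr; exact hd0.ne' hvr, ?_⟩
    have hy := hns.resolve_right (by simp [hvr, hw.map_zero])
    rw [hE, energy, hvr, primitiveF_zero, add_zero]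
    exact (kin_nonneg hp _).lt_of_ne fun h0 => hy (kin_eq_zero hp h0.symm)
  -- If the energy were negative at `r`, nearby heights in `S` would have all their `k + 1` zeros
  -- before `r`, and these would survive in the limit.
  have hnn : ∀ r, 0 ≤ r → (∀ s ∈ Icc 0 r, Y d s ≠ 0 ∨ f (V d s) ≠ 0) → 0 ≤ E r := by
    intro r hr hns
    by_contra! hneg
    have hr0 : 0 < r := hr.lt_of_ne fun h0 => by rw [← h0] at hneg; linarith
    have ht := hV.tendsto_energy hp hq hw.cont hL hd (fun s h0 h1 => hns s ⟨h0, h1.le⟩) hr0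
      (r := r) ⟨hr, le_rfl⟩
    obtain ⟨s, hs, hzs⟩ := hV.exists_zeros_of_tendsto hp hq hw.cont hw.map_zero hL hd hr0 hns
      (n := k + 1) (((hfreq.and_eventually (ht.eventually (gt_mem_nhds hneg))).and_eventually
        self_mem_nhdsWithin).mono fun d' h => by
          obtain ⟨⟨⟨s, hs, hzs⟩, hE'⟩, hd'⟩ := h
          refine ⟨s, hs, fun z hz => ⟨⟨(hzs z hz).1.le, ?_⟩, (hzs z hz).2.1⟩⟩
          by_contra! hzr
          exact hE'.not_gt ((hzs z hz).2.2.trans_le (energy_antitone hp hq hw.cont (hV.sol d' hd') hr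
            hzr.le)))
    refine hnot ⟨s, hs, fun z hz => ?_⟩
    obtain ⟨h1, h2⟩ := hzs z hz
    obtain ⟨h3, h4⟩ := hposz z h1.1 (hns z h1) h2
    exact ⟨h3, h2, h4⟩
  have hns_of_pos : ∀ {r}, 0 < E r → Y d r ≠ 0 ∨ f (V d r) ≠ 0 := fun h =>
    nonstationary_of_energy_pos hp hw h
  -- If the point were not stationary, `hnn` would keep the energy nonnegative a little longer,
  -- hence constant; then `y = 0` on an interval and `f(v) = 0` there, a contradiction. A stationary
  -- point with `F(v) ≥ 0` is the origin.
  have hvan : ∀ r, 0 ≤ r → E r ≤ 0 → (∀ s, 0 ≤ s → s < r → 0 < E s) → V d r = 0 ∧ Y d r = 0 := by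
    intro r hr hEr hpre
    have hstat : Y d r = 0 ∧ f (V d r) = 0 := by
      by_contra hns
      rw [not_and_or] at hns
      have hopen : ∀ᶠ s in 𝓝 r, Y d s ≠ 0 ∨ f (V d s) ≠ 0 := by
        rcases hns with h | h
        exacts [((hsol 0).cont_y.continuousAt.eventually_ne h).mono fun _ => Or.inl,
          ((hw.cont.comp (hsol 0).cont_v).continuousAt.eventually_ne h).mono fun _ => Or.inr]
      obtain ⟨ε, hε, hεs⟩ := Metric.eventually_nhds_iff.1 hopen
      have hns' : ∀ s, 0 ≤ s → s < r + ε → Y d s ≠ 0 ∨ f (V d s) ≠ 0 := by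
        intro s hs hsr
        rcases lt_or_ge s r with h | h
        · exact hns_of_pos (hpre s hs h)
        · exact hεs (by rw [dist_eq, abs_of_nonneg (by linarith)]; linarith)
      have hyz := (hsol (r + ε / 2)).flux_eq_zero_of_energy_le hp hq hw.cont le_rfl hr le_rfl
        (hEr.trans (hnn _ (by linarith) fun x hx => hns' x hx.1 (by linarith [hx.2])))
      have hs : r + ε / 4 ∈ Ioo r (r + ε / 2) := ⟨by linarith, by linarith⟩
      have h3 := ((hsol (r + ε / 2)).deriv_y _ (hr.trans_lt hs.1) hs.2).unique
        ((hasDerivAt_const _ (0 : ℝ)).congr_of_eventuallyEq (by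
          filter_upwards [Ioo_mem_nhds hs.1 hs.2] with x hx using hyz x hx))
      rw [hyz _ hs, mul_zero, sub_zero, neg_eq_zero] at h3
      exact (hns' _ (hr.trans hs.1.le) (by linarith)).elim (· (hyz _ hs)) (· h3)
    have hEr0 : 0 ≤ E r := by
      rcases hr.eq_or_lt with h0 | h0
      · rw [← h0]; exact hE0n
      have hsub : Icc 0 r ⊆ {s | 0 ≤ E s} := by
        rw [← closure_Ico h0.ne]
        exact closure_minimal (fun s hs => (hpre s hs.1 hs.2).le) (isClosed_le continuous_const hEc)
      exact hsub ⟨hr, le_rfl⟩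
    refine ⟨?_, hstat.1⟩
    have hF : 0 ≤ primitiveF f (V d r) := by
      have : E r = kin p' (Y d r) + primitiveF f (V d r) := rfl
      rwa [this, hstat.1, kin_zero hp, zero_add] at hEr0
    by_contra hvr
    rcases le_or_gt βp (V d r) with h1 | h1
    · exact (hw.pos _ h1).ne' hstat.2
    rcases le_or_gt (V d r) βm with h2 | h2
    · exact (hw.neg _ h2).ne hstat.2
    · exact absurd hF (not_le.2 (hw.well _ ⟨h2, h1⟩ hvr))
  set P : Set ℝ := {r | 0 < r ∧ 0 < E r ∧ V d r = 0} with hP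
  have hPle : P.encard ≤ k := by
    by_contra! hcon
    obtain ⟨t, htP, htc⟩ := exists_subset_encard_eq (s := P) (k := ((k + 1 : ℕ) : ℕ∞))
      (by exact_mod_cast Order.add_one_le_of_lt hcon)
    have htf : t.Finite := finite_of_encard_eq_coe htc
    refine hnot ⟨htf.toFinset, ?_, fun z hz => ?_⟩
    · have := htf.encard_eq_coe_toFinset_card
      rw [htc] at this
      exact_mod_cast this.symm
    · have := htP (htf.mem_toFinset.1 hz)
      exact ⟨this.1, this.2.2, this.2.1⟩
  have hPfin : P.Finite := finite_of_encard_le_coe hPle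
  set β0 := min βp (-βm) with hβ0
  have hβ00 : 0 < β0 := lt_min hw.pos_right (by linarith [hw.neg_left])
  have hyz : ∀ r, 0 < E r → |V d r| < β0 → Y d r ≠ 0 := by
    intro r hEr hvr hy
    have : E r = kin p' (Y d r) + primitiveF f (V d r) := rfl
    rw [this, hy, kin_zero hp, zero_add] at hEr
    exact hvr.not_ge (hw.le_abs (fun h => by simp [h, primitiveF_zero] at hEr) hEr.le)
  -- the last monotone piece
  obtain ⟨M, hM⟩ := hV.bound hd
  have hdich : (∀ r, 0 ≤ r → 0 < E r) ∨ ∃ τ > 0, V d τ = 0 ∧ E τ ≤ 0 ∧ (∀ s, 0 ≤ s → s < τ → 0 < E s) ∧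
      ∀ s, 0 ≤ s → 0 < E s → s < τ := by
    by_cases hall : ∀ r, 0 ≤ r → 0 < E r
    · exact Or.inl hall
    push Not at hall
    obtain ⟨r0, hr₀, hEr₀⟩ := hall
    obtain ⟨τ, hτ, hmin⟩ := (isCompact_Icc.inter_right (isClosed_le hEc continuous_const)).exists_isLeast
      (s := Icc 0 r0 ∩ {r | E r ≤ 0}) ⟨r0, ⟨hr₀, le_rfl⟩, hEr₀⟩
    have hpos : ∀ s, 0 ≤ s → s < τ → 0 < E s := fun s hs hsτ =>
      not_le.1 fun h => hsτ.not_ge (hmin ⟨⟨hs, hsτ.le.trans hτ.1.2⟩, h⟩)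
    obtain ⟨hv, hy⟩ := hvan τ hτ.1.1 hτ.2 hpos
    exact Or.inr ⟨τ, hτ.1.1.lt_of_ne fun h0 => by rw [← h0, hv0] at hv; exact hd0.ne' hv, hv, hτ.2,
      hpos, fun s hs hEs => not_le.1 fun h => hEs.not_ge ((hEanti hτ.1.1 h).trans hτ.2)⟩
  -- Beyond its finitely many zeros with positive energy the solution has a sign `σ`, and as long as
  -- its energy is positive it is eventually smaller than `β0` and moves towards zero. These are the
  -- entry conditions of the trap.
  have htail : ∃ σ : ℝ, (σ = 1 ∨ σ = -1) ∧ ((∀ r, 0 ≤ r → 0 < E r) → Tendsto (V d) atTop (𝓝 0)) ∧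
      ∃ R0 > 0, 0 < E R0 ∧ (∀ r ≥ R0, 0 < E r → 0 < σ * V d r ∧ σ * V d r < β0 ∧ σ * Y d r < 0) := by
    rcases hdich with hall | ⟨τ, hτ0, hvτ, hEτ, hpre, hlt⟩
    · obtain ⟨B, hB⟩ := hPfin.bddAbove
      set t := max B 0 + 1 with ht
      have ht0 : 0 < t := by have := le_max_right B 0; linarith
      have htne : ∀ r ∈ Ici t, V d r ≠ 0 := fun r hr h0 => by
        have h1 := hB ⟨ht0.trans_le hr, hall r (ht0.le.trans hr), h0⟩
        have h2 := le_max_left B 0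
        have h3 : t ≤ r := hr
        linarith
      obtain ⟨σ, hσ, hσv⟩ := exists_sign (hsol 0).cont_v ordConnected_Ici ⟨t, self_mem_Ici⟩ htne
      have hdec : Tendsto (V d) atTop (𝓝 0) ∧ ∃ t1 ≥ t, ∀ r ≥ t1, σ * Y d r < 0 := by
        rcases hσ with rfl | rfl
        · simpa using decreasing_of_eventually_pos hp hq hw hsol hM hall ht0
            fun r hr => by simpa using hσv r hr
        · have := decreasing_of_eventually_pos hp hq hw.reflect (M := M)
            (fun T => (hsol T).reflect (phi_neg p')) (by simpa using hM)
            (fun r hr => by rw [energy_reflect]; exact hall r hr) ht0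
            fun r hr => by simpa using hσv r hr
          refine ⟨by simpa using this.1.neg, ?_⟩
          obtain ⟨t1, ht₁, h⟩ := this.2
          exact ⟨t1, ht₁, fun r hr => by linarith [h r hr]⟩
      obtain ⟨hl, t1, ht₁, hy1⟩ := hdec
      have hsm := (hl.const_mul σ)
      rw [mul_zero] at hsm
      obtain ⟨t2, ht₂⟩ := eventually_atTop.1 (hsm.eventually (gt_mem_nhds hβ00))
      refine ⟨σ, hσ, fun _ => hl, max t1 t2, ht0.trans_le (ht₁.le.trans (le_max_left _ _)),
        hall _ (ht0.le.trans (ht₁.le.trans (le_max_left _ _))), fun r hr _ => ⟨?_, ?_, ?_⟩⟩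
      · exact hσv r (ht₁.le.trans ((le_max_left _ _).trans hr))
      · exact ht₂ r ((le_max_right _ _).trans hr)
      · exact hy1 r ((le_max_left _ _).trans hr)
    · have hcl : ∀ᶠ r in 𝓝 τ, |V d r| < β0 :=
        (hsol 0).cont_v.abs.continuousAt.eventually (gt_mem_nhds (by simpa [hvτ] using hβ00))
      obtain ⟨ε, hε, hεr⟩ := Metric.eventually_nhds_iff.1 hcl
      obtain ⟨R0, ⟨hR0P, hR0ε⟩, hR₀⟩ : ∃ R0, ((∀ z ∈ P, z < R0) ∧ τ - ε < R0) ∧ R0 ∈ Ioo 0 τ := by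
        refine Eventually.exists (f := 𝓝[<] τ) (Eventually.and
          (Eventually.and ((eventually_all_finite hPfin).2 fun z hz => ?_) ?_)
          (Ioo_mem_nhdsLT hτ0))
        · exact (lt_mem_nhds (hlt z hz.1.le hz.2.1)).filter_mono nhdsWithin_le_nhds
        · exact (lt_mem_nhds (by linarith)).filter_mono nhdsWithin_le_nhds
      have hne : (Ico R0 τ).Nonempty := ⟨R0, le_rfl, hR₀.2⟩
      have hsmall : ∀ r ∈ Ico R0 τ, |V d r| < β0 := fun r hr =>
        hεr (by rw [dist_eq, abs_sub_comm, abs_of_nonneg (by linarith [hr.2])]; linarith [hr.1])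
      have hEr : ∀ r ∈ Ico R0 τ, 0 < E r := fun r hr => hpre r (hR₀.1.le.trans hr.1) hr.2
      obtain ⟨σ, hσ, hσv⟩ := exists_sign (hsol 0).cont_v ordConnected_Ico hne fun r hr h0 =>
        absurd (hR0P r ⟨hR₀.1.trans_le hr.1, hEr r hr, h0⟩) (not_lt.2 hr.1)
      obtain ⟨σ', hσ', hσy⟩ := exists_sign (hsol 0).cont_y ordConnected_Ico hne fun r hr =>
        hyz r (hEr r hr) (hsmall r hr)
      have hopp : σ' = -σ := by
        refine (show σ' = σ ∨ σ' = -σ by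
          clear_value E P
          rcases hσ with rfl | rfl <;> rcases hσ' with rfl | rfl <;> simp).resolve_left fun heq => ?_
        rw [heq] at hσy
        have h1 := le_of_hasDerivAt_nonneg (u := fun r => σ * V d r) hR₀.2.le
          (continuous_const.mul (hsol 0).cont_v).continuousOn
          (fun r hr => ((hsol τ).deriv_v r (hR₀.1.trans hr.1) hr.2).const_mul σ) fun r hr => by
            have h2 := hσy r (Ioo_subset_Ico_self hr)
            rcases hσ with rfl | rfl
            · rw [one_mul] at h2 ⊢; exact (phi_pos h2).le
            · have := phi_neg_of_neg (m := p') (show Y d r < 0 by linarith)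
              linarith
        rw [hvτ, mul_zero] at h1
        exact h1.not_gt (hσv R0 ⟨le_rfl, hR₀.2⟩)
      refine ⟨σ, hσ, fun hall => absurd (hall τ hτ0.le) (not_lt.2 hEτ), R0, hR₀.1,
        hEr R0 ⟨le_rfl, hR₀.2⟩, fun r hr hErp => ?_⟩
      have hrm : r ∈ Ico R0 τ := ⟨hr, hlt r (hR₀.1.le.trans hr) hErp⟩
      have h1 := abs_lt.1 (hsmall r hrm)
      have := hσy r hrm
      rw [hopp] at this
      exact ⟨hσv r hrm, by rcases hσ with rfl | rfl <;> linarith, by linarith⟩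
  obtain ⟨σ, hσ, hlim, R0, hR₀, hER0, htail⟩ := htail
  obtain ⟨κ, hκ, T0, hT0, htrap⟩ := exists_trap_sign hp hq hw (E0 := E 0 + 1) hσ hβ00
    (min_le_left _ _) (min_le_right _ _) (by linarith)
  -- For an everlasting solution `q^{p'} E` does not increase beyond `R0`, while the increments of
  -- `q^{p'}` tend to infinity, so any large `R` works. If the energy vanishes at `τ`, `q^{p'} E`
  -- gets below the fixed cost `κ m` near `τ`.
  have hR : ∃ R ≥ R0, 0 < E R ∧ ∃ m, q R ^ p' * E R < m ∧
      ∀ s ≥ R, m ≤ κ * (q (s + T0) ^ p' - q s ^ p') := by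
    rcases hdich with hall | ⟨τ, hτ0, -, hEτ, hpre, hlt⟩
    · have hincr := (hq.tendsto_increment T0 hT0).const_mul_atTop hκ
      rw [show p.conjExponent = p' from hpp.conjExponent_eq] at hincr
      obtain ⟨S', hS'⟩ := eventually_atTop.1 (hincr.eventually
        (eventually_ge_atTop (q R0 ^ p' * E R0 + 1)))
      have hmax := le_max_left R0 S'
      refine ⟨max R0 S', hmax, hall _ (hR₀.le.trans hmax), q R0 ^ p' * E R0 + 1, ?_,
        fun s hs => hS' s ((le_max_right _ _).trans hs)⟩
      have := (hsol (max R0 S')).weighted_energy_le hp hq hw.cont (κ := 0) hR₀ hR₀.le hmax le_rfl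
        fun r hr => by
          obtain ⟨h1, h2, -⟩ := htail r hr.1.le (hall r (hR₀.le.trans hr.1.le))
          rw [neg_zero]
          have h3 := min_le_left βp (-βm)
          have h4 := min_le_right βp (-βm)
          rcases hσ with rfl | rfl <;> exact hw.nonpos ⟨by linarith, by linarith⟩
      linarith
    · obtain ⟨m, hm, hmi⟩ := exists_pos_le_increment hpp hq hT0 hR₀
      have hR0τ := hlt R0 hR₀.le hER0
      have hc : ContinuousAt (fun r => q r ^ p' * E r) τ :=
        ((hq.continuousAt hτ0).rpow_const (Or.inl (hq.pos hτ0).ne')).mul hEc.continuousAt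
      have hlim0 : q τ ^ p' * E τ < κ * m :=
        (mul_nonpos_of_nonneg_of_nonpos (rpow_nonneg (hq.pos hτ0).le _) hEτ).trans_lt
          (by positivity)
      obtain ⟨R, hR, hRm⟩ := (((hc.eventually (gt_mem_nhds hlim0)).filter_mono
        nhdsWithin_le_nhds).and (Ioo_mem_nhdsLT hR0τ)).exists
      exact ⟨R, hRm.1.le, hpre R (hR₀.le.trans hRm.1.le) hRm.2, κ * m, hR,
        fun s hs => mul_le_mul_of_nonneg_left (hmi s (hRm.1.le.trans hs)) hκ.le⟩
  obtain ⟨R, hRR0, hER, m, hRm, hmκ⟩ := hR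
  have hR0 : 0 < R := hR₀.trans_le hRR0
  obtain ⟨ht1, ht2, ht3⟩ := htail R hRR0 hER
  have hnsR : ∀ r ∈ Icc 0 R, Y d r ≠ 0 ∨ f (V d r) ≠ 0 := fun r hr =>
    hns_of_pos (hER.trans_le (hEanti hr.1 hr.2))
  have hnsR' : ∀ r, 0 ≤ r → r < R → Y d r ≠ 0 ∨ f (V d r) ≠ 0 := fun r h0 h1 => hnsR r ⟨h0, h1.le⟩
  have hRmem : R ∈ Icc 0 R := ⟨hR0.le, le_rfl⟩
  obtain ⟨tv, ty⟩ := hV.tendsto hp hq hw.cont hL hd hnsR' hR0 hRmem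
  have te := hV.tendsto_energy hp hq hw.cont hL hd hnsR' hR0 hRmem
  -- Nearby heights in `S` have `k + 1` zeros with positive energy, and the trap allows at most one
  -- of them beyond `R`; the other `k` lie in `[0, R]` and pass to the limit.
  have hzeros := hV.exists_zeros_of_tendsto hp hq hw.cont hw.map_zero hL hd hR0 hnsR (n := k) (by
    refine (hfreq.and_eventually ((((tv.const_mul σ).eventually (lt_mem_nhds ht1)).and
      ((tv.const_mul σ).eventually (gt_mem_nhds ht2))).and (((ty.const_mul σ).eventually
      (gt_mem_nhds ht3)).and (((te.const_mul (q R ^ p')).eventually (gt_mem_nhds hRm)).and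
      ((te.eventually (gt_mem_nhds (show E R < E 0 + 1 by linarith [hEanti le_rfl hR0.le]))).and
        self_mem_nhdsWithin))))).mono ?_
    rintro d' ⟨⟨s, hs, hzs⟩, ⟨h1, h2⟩, h3, h4, h5, hd'⟩
    have htr := htrap (hV.sol d' hd') R hR0 h5.le h1 h2 h3 m h4 hmκ
    have hcard : (s.filter fun z => R < z).card ≤ 1 := by
      rw [Finset.card_le_one]
      have key : ∀ a ∈ s, ∀ b ∈ s, R < a → ¬a < b := fun a ha b hb hRa hab =>
        absurd (hzs b hb).2.2 (not_lt.2 (htr a b hRa hab (hzs a ha).2.1 (hzs b hb).2.1))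
      intro a ha b hb
      rw [Finset.mem_filter] at ha hb
      exact le_antisymm (not_lt.1 (key b hb.1 a ha.1 hb.2)) (not_lt.1 (key a ha.1 b hb.1 ha.2))
    have hsplit := Finset.card_filter_add_card_filter_not (s := s) (fun z => R < z)
    obtain ⟨t, hts, htc⟩ := Finset.exists_subset_card_eq (s := s.filter fun z => ¬R < z) (n := k)
      (by omega)
    refine ⟨t, htc, fun z hz => ?_⟩
    have := Finset.mem_filter.1 (hts hz)
    exact ⟨⟨(hzs z this.1).1.le, not_lt.1 this.2⟩, (hzs z this.1).2.1⟩)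
  have hPge : (k : ℕ∞) ≤ P.encard := by
    obtain ⟨s, hs, hzs⟩ := hzeros
    rw [← hs, ← encard_coe_eq_coe_finsetCard]
    refine encard_le_encard fun z hz => ?_
    have h1 := hzs z hz
    have h2 := hposz z h1.1.1 (hnsR z h1.1) h1.2
    exact ⟨h2.1, h2.2, h1.2⟩
  obtain ⟨u, hu, hu0, hnodes⟩ := exists_classical hpp hq hw hd0 hsol hvan hlim
  exact ⟨u, hu, hu0, by rw [hnodes]; exact le_antisymm hPle hPge⟩

/-! ### Lifted Euler schemes and solutions with prescribed rotation -/

lemma exp_turnedShear_pi_div_two {a : ℝ → ℝ} (ha : SmallField a) (ζ : ℂ) :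
    exp (turnedShear (π / 2) a ζ) =
      exp ζ - a (exp ζ).re * I := by
  have h1 : ∀ ζ : ℂ, exp (ζ + (π / 2 : ℝ) * I) = exp ζ * I := by
    intro ζ
    rw [exp_add]; push_cast; rw [Complex.exp_pi_div_two_mul_I]
  have h2 : exp (-((π / 2 : ℝ) * I)) = -I := by
    rw [Complex.exp_neg]; push_cast; rw [Complex.exp_pi_div_two_mul_I, Complex.inv_I]
  rw [turnedShear, sub_eq_add_neg, exp_add, exp_liftedShear ha, h1, h2]
  have h3 : (exp ζ * I).im = (exp ζ).re := by simp
  rw [h3]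
  linear_combination -(exp ζ) * Complex.I_sq

lemma sum_range_two_mul' (u : ℕ → ℝ) (N : ℕ) :
    ∑ j ∈ Finset.range (2 * N), u j = ∑ i ∈ Finset.range N, (u (2 * i) + u (2 * i + 1)) := by
  induction N with
  | zero => simp
  | succ N ih =>
    rw [show 2 * (N + 1) = 2 * N + 1 + 1 by ring, Finset.sum_range_succ, Finset.sum_range_succ, ih,
      Finset.sum_range_succ, add_assoc]

/-- The lifted orbit of a symplectic Euler scheme with a prescribed total rotation or a prescribed
final size, whose action is bounded by an area. -/
lemma exists_lifted_scheme {K L : ℝ} {c : ℕ → ℝ}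
    (hg0 : g 0 = 0) (hf0 : f 0 = 0) (hgK : ∀ s t, |g s - g t| ≤ K * |s - t|)
    (hfK : ∀ s t, |f s - f t| ≤ K * |s - t|) (hgs : ∀ s, 0 ≤ s * g s) (hσ : 0 < σ)
    (hfs : ∀ s, |s| ≤ σ → s * f s ≤ 0) (hh : 0 < h) (hc : ∀ i, 0 < c i)
    (hcL : ∀ i, K / c i ≤ L ∧ K * c i ≤ L) (hL : h * L ≤ 1 / 32) (N : ℕ) {θ0 : ℝ} (hθ0 : θ0 < 0) :
    ∃ (b : ℝ) (Z : ℕ → ℂ), (Z 0).im = 0 ∧ Z N = corner x0 θ0 b ∧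
      (∀ i, ‖Z (i + 1) - Z i‖ ≤ 4 * (h * L)) ∧
      ((Z N).im < 0 → Real.log σ - 4 * (N * (h * L)) ≤ (Z 0).re) ∧
      (∀ i, (exp (Z (i + 1))).re = (exp (Z i)).re +
        h * g ((exp (Z i)).im / c i)) ∧
      (∀ i, (exp (Z (i + 1))).im = (exp (Z i)).im +
        h * -(c i * f (exp (Z (i + 1))).re)) ∧
      ∑ i ∈ Finset.range N, h * ((exp (Z i)).im * g ((exp (Z i)).im / c i) / 2 -
        c i * primitiveF g ((exp (Z i)).im / c i) + c i * ((exp (Z (i + 1))).re *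
        f (exp (Z (i + 1))).re / 2 - primitiveF f (exp (Z (i + 1))).re)) ≤
        sectorArea x0 θ0 := by
  -- One step of the scheme consists of two shears: the even one updates `V = re exp Z` and the odd
  -- one updates `W = im exp Z`.
  set θ : ℕ → ℝ := fun j => if Even j then 0 else π / 2 with hθ
  set a : ℕ → ℝ → ℝ := fun j s => if Even j then h * g (s / c (j / 2)) else h * (c (j / 2) * f s)
    with ha
  have haL : ∀ j s t, |a j s - a j t| ≤ h * L * |s - t| := by
    intro j s t
    have hcj := hc (j / 2)
    have h0 := abs_nonneg (s - t)
    simp only [ha]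
    split_ifs
    · rw [← mul_sub, abs_mul, abs_of_pos hh, mul_assoc]
      refine mul_le_mul_of_nonneg_left ((hgK _ _).trans ?_) hh.le
      rw [← sub_div, abs_div, abs_of_pos hcj, mul_div_left_comm, mul_comm]
      exact mul_le_mul_of_nonneg_right (hcL _).1 h0
    · rw [← mul_sub, ← mul_sub, abs_mul, abs_mul, abs_of_pos hh, abs_of_pos hcj, mul_assoc]
      refine mul_le_mul_of_nonneg_left ((mul_le_mul_of_nonneg_left (hfK s t) hcj.le).trans ?_) hh.le
      nlinarith [mul_le_mul_of_nonneg_right (hcL (j / 2)).2 h0]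
  have ha0 : ∀ j, a j 0 = 0 := fun j => by simp [ha, hg0, hf0]
  have hS : ∀ j, SmallField (a j) := fun j => ⟨ha0 j, fun s t => (haL j s t).trans
    (mul_le_mul_of_nonneg_right hL (abs_nonneg _))⟩
  set T : ℕ → ℂ → ℂ := fun j => turnedShear (θ j) (a j) with hT
  have hdisp : ∀ j P, ‖T j P - P‖ ≤ 2 * (h * L) := fun j P =>
    norm_turnedShear_sub_le (by linarith) (fun s => by simpa [ha0] using haL j s 0) P
  have hNI : NearIdentity T (2 * (h * L)) := ⟨(nearIdentity_turnedShear hS).lip, hdisp⟩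
  have heven : ∀ i P, exp (orbit T (2 * i + 1) P) = exp (orbit T (2 * i) P) +
      ((h * g ((exp (orbit T (2 * i) P)).im / c i) : ℝ) : ℂ) := by
    intro i P
    simp only [orbit, hT]
    rw [show θ (2 * i) = 0 by simp [hθ], turnedShear_zero, exp_liftedShear (hS _)]
    simp [ha]
  have hodd : ∀ i P, exp (orbit T (2 * (i + 1)) P) = exp (orbit T (2 * i + 1) P) -
      ((h * (c i * f (exp (orbit T (2 * i + 1) P)).re) : ℝ) : ℂ) * I := by
    intro i P
    rw [show 2 * (i + 1) = 2 * i + 1 + 1 by ring]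
    simp only [orbit, hT]
    rw [show θ (2 * i + 1) = π / 2 by simp [hθ], exp_turnedShear_pi_div_two (hS _)]
    have : (2 * i + 1) / 2 = i := by omega
    simp [ha, this]
  have hre : ∀ i P, (exp (orbit T (2 * (i + 1)) P)).re =
      (exp (orbit T (2 * i + 1) P)).re := fun i P => by rw [hodd]; simp
  have hVs : ∀ i P, (exp (orbit T (2 * (i + 1)) P)).re = (exp (orbit T (2 * i) P)).re +
      h * g ((exp (orbit T (2 * i) P)).im / c i) := fun i P => by
    rw [hre, heven, add_re, ofReal_re]
  have hWs : ∀ i P, (exp (orbit T (2 * (i + 1)) P)).im = (exp (orbit T (2 * i) P)).im +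
      h * -(c i * f (exp (orbit T (2 * (i + 1)) P)).re) := fun i P => by
    rw [hre, hodd, heven]; simp; ring
  have hstep : ∀ i P, ‖orbit T (2 * (i + 1)) P - orbit T (2 * i) P‖ ≤ 4 * (h * L) := by
    intro i P
    have h1 := hdisp (2 * i) (orbit T (2 * i) P)
    have h2 := hdisp (2 * i + 1) (orbit T (2 * i + 1) P)
    have h3 := norm_add_le (orbit T (2 * (i + 1)) P - orbit T (2 * i + 1) P)
      (orbit T (2 * i + 1) P - orbit T (2 * i) P)
    rw [sub_add_sub_cancel] at h3
    simp only [orbit, show 2 * (i + 1) = 2 * i + 1 + 1 by ring] at *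
    linarith
  have htot : ∀ i ≤ N, ∀ P, ‖orbit T (2 * i) P - P‖ ≤ 4 * (N * (h * L)) := fun i hi P => by
    refine (hNI.dist_orbit_le' (show 2 * i ≤ 2 * N by omega) P).trans_eq ?_
    push_cast; ring
  -- Where `s f(s) ≤ 0` the closed first quadrant is invariant: both increments are nonnegative. A
  -- start this far to the left stays in `|V| ≤ σ` during the `N` steps and hence does not rotate
  -- below the real axis. This supplies `hlin`, and it keeps orbits that do rotate away from the
  -- origin.
  have hsmall : ∀ x : ℝ, x < Real.log σ - 4 * (N * (h * L)) → 0 ≤ (orbit T (2 * N) (x : ℂ)).im := by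
    intro x hx
    suffices H : ∀ i ≤ N, 0 ≤ (orbit T (2 * i) (x : ℂ)).im ∧
        (orbit T (2 * i) (x : ℂ)).im ≤ π / 2 from (H N le_rfl).1
    have hpi := Real.pi_gt_three
    intro i
    induction i with
    | zero => intro _; simp [orbit]; positivity
    | succ i ih =>
      intro hi
      obtain ⟨h1, h2⟩ := ih (by omega)
      have hsn := Real.sin_nonneg_of_nonneg_of_le_pi h1 (by linarith)
      have hcn := Real.cos_nonneg_of_neg_pi_div_two_le_of_le (by linarith) h2
      have e1 := exp_pos (orbit T (2 * i) (x : ℂ)).re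
      have hW : 0 ≤ (exp (orbit T (2 * i) (x : ℂ))).im := by
        rw [exp_im]; positivity
      have hV : 0 ≤ (exp (orbit T (2 * i) (x : ℂ))).re := by
        rw [exp_re]; positivity
      have hgW : 0 ≤ g ((exp (orbit T (2 * i) (x : ℂ))).im / c i) := by
        rcases hW.eq_or_lt with h0 | h0
        exacts [by rw [← h0, zero_div, hg0],
          nonneg_of_mul_nonneg_right (hgs _) (div_pos h0 (hc i))]
      have hV' : 0 ≤ (exp (orbit T (2 * (i + 1)) (x : ℂ))).re := by rw [hVs]; positivity
      have hVσ : (exp (orbit T (2 * (i + 1)) (x : ℂ))).re ≤ σ := by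
        refine (Complex.re_le_norm _).trans ?_
        rw [norm_exp, ← Real.le_log_iff_exp_le hσ]
        have := (abs_re_le_norm _).trans (htot (i + 1) hi (x : ℂ))
        simp only [sub_re, ofReal_re] at this
        linarith [(abs_le.1 this).2]
      have hfV : f (exp (orbit T (2 * (i + 1)) (x : ℂ))).re ≤ 0 := by
        rcases hV'.eq_or_lt with h0 | h0
        exacts [by rw [← h0, hf0], nonpos_of_mul_nonpos_right (hfs _ (by rwa [abs_of_pos h0])) h0]
      have hW' : 0 ≤ (exp (orbit T (2 * (i + 1)) (x : ℂ))).im := by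
        rw [hWs]
        have := mul_nonneg hh.le (mul_nonneg (hc i).le (neg_nonneg.2 hfV))
        linarith
      have hd := (abs_im_le_norm _).trans (hstep i (x : ℂ))
      rw [sub_im, abs_le] at hd
      rw [exp_im] at hW'
      rw [exp_re] at hV'
      have e2 := exp_pos (orbit T (2 * (i + 1)) (x : ℂ)).re
      have s1 := nonneg_of_mul_nonneg_right hW' e2
      have s2 := nonneg_of_mul_nonneg_right hV' e2
      exact ⟨not_lt.1 fun h => s1.not_gt (Real.sin_neg_of_neg_of_neg_pi_lt h (by linarith)),
        not_lt.1 fun h => s2.not_gt (Real.cos_neg_of_pi_div_two_lt_of_lt h (by linarith))⟩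
  obtain ⟨b, O, hO, hb, hact⟩ := exists_orbit_action_le (θ := θ) (x0 := x0) (n := 2 * N) hS hθ0
    (im_pos_of_im_orbit_gt hS (fun j => by
      simp only [hθ]
      by_cases hj : Even j
      · refine Or.inl ⟨if_pos hj, fun w => ?_⟩
        have := mul_nonneg (mul_nonneg hh.le (hc (j / 2)).le) (hgs (w / c (j / 2)))
        have hcj : c (j / 2) * (w / c (j / 2)) = w := mul_div_cancel₀ _ (hc (j / 2)).ne'
        simp only [ha, if_pos hj]
        rw [← mul_assoc, mul_assoc h, hcj] at this
        linarith
      · exact Or.inr (if_neg hj)) _)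
    ⟨_, hsmall⟩
  refine ⟨b, fun i => orbit T (2 * i) O, hO, hb, fun i => hstep i O, fun hneg => ?_, fun i => hVs i O,
    fun i => hWs i O, ?_⟩
  · by_contra hcon
    have hOx : O = ((O.re : ℝ) : ℂ) := Complex.ext rfl (by simp [hO])
    have := hsmall O.re (not_le.1 hcon)
    rw [← hOx] at this
    exact this.not_gt hneg
  · have h1 := hact _ fun _ => rfl
    rw [sum_range_two_mul'] at h1
    refine le_of_eq_of_le (Finset.sum_congr rfl fun i _ => ?_) h1
    have hci := (hc i).ne'
    have e0 : θ (2 * i) = 0 := by simp [hθ]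
    have e1 : θ (2 * i + 1) = π / 2 := by simp [hθ]
    have e2 : ∀ s, a (2 * i) s = h * g (s / c i) := fun s => by simp [ha]
    have e3 : ∀ s, a (2 * i + 1) s = h * (c i * f s) := fun s => by
      simp [ha, show (2 * i + 1) / 2 = i by omega]
    have e4 : ∀ s, ∫ t in (0 : ℝ)..s, a (2 * i) t = h * (c i * primitiveF g (s / c i)) := fun s => by
      simp only [e2, intervalIntegral.integral_const_mul, intervalIntegral.integral_comp_div g hci,
        zero_div, smul_eq_mul, primitiveF]
    have e5 : ∀ s, ∫ t in (0 : ℝ)..s, a (2 * i + 1) t = h * (c i * primitiveF f s) := fun s => by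
      simp only [e3, intervalIntegral.integral_const_mul, primitiveF]
    have e6 : (exp (orbit T (2 * i + 1) O + θ (2 * i + 1) * I)).im =
        (exp (orbit T (2 * (i + 1)) O)).re := by
      rw [hre, e1, exp_add]; push_cast; rw [Complex.exp_pi_div_two_mul_I]; simp
    rw [e6, e4, e5, e2, e3, e0]
    simp only [Complex.ofReal_zero, zero_mul, add_zero]
    ring

lemma exists_tendsto_of_mem_Icc (U : Ultrafilter ℕ) {u : ℕ → ℝ}
    (h : ∀ᶠ n in (U : Filter ℕ), u n ∈ Icc a b) : ∃ x ∈ Icc a b, Tendsto u U (𝓝 x) :=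
  (isCompact_Icc (a := a) (b := b)).ultrafilter_le_nhds (U.map u) (by rwa [le_principal_iff])

lemma continuous_of_abs_sub_le {K : ℝ} (hu : ∀ s t, |u s - u t| ≤ K * |s - t|) :
    Continuous u :=
  (LipschitzWith.of_dist_le_mul (K := ⟨K, by simpa using (abs_nonneg _).trans (hu 1 0)⟩) hu).continuous

lemma sq_re_exp_add_sq_im_exp (z : ℂ) :
    (exp z).re ^ 2 + (exp z).im ^ 2 = Real.exp z.re ^ 2 := by
  rw [exp_re, exp_im, mul_pow, mul_pow, ← mul_add, Real.cos_sq_add_sin_sq, mul_one]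

/-- Along `r 0 ≤ ⋯ ≤ r m` the flux vanishes and the signs of `v` alternate. -/
def Alternates (a b : ℝ) (v y : ℝ → ℝ) (m : ℕ) (r : ℕ → ℝ) : Prop :=
  ∀ j ≤ m, r j ∈ Icc a b ∧ y (r j) = 0 ∧ 0 < (-1) ^ j * v (r j) ∧ (j < m → r j ≤ r (j + 1))

/-- Continuous functions of the values of a scheme are bounded on bounded time intervals. -/
lemma EulerScheme.exists_bound_comp {a h d : ℕ → ℝ} {V W : ℕ → ℕ → ℝ}
    (hq : IsAdmissibleWeight p q) (hE : EulerScheme q g f a h d V W) {D : ℝ} (hε : 0 < ε)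
    (ha : ∀ n, ε ≤ a n) (hgM : ∀ s, |g s| ≤ M) (hfM : ∀ s, |f s| ≤ M) (hd : ∀ n, |d n| ≤ D)
    (hh : ∀ n, h n ≤ 1) {H : ℝ × ℝ × ℝ → ℝ} (hH : ∀ r, 0 < r → ∀ z, ContinuousAt H (r, z)) (R : ℝ) :
    ∃ K : ℝ, ∀ n i : ℕ, a n + i * h n ≤ R → |H (a n + i * h n, V n (i + 1), W n i)| ≤ K := by
  have hM0 : 0 ≤ M := (abs_nonneg _).trans (hgM 0)
  have hV : ∀ n i : ℕ, |V n i| ≤ D + M * (i * h n) := by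
    intro n i
    induction i with
    | zero => simpa [hE.V_zero] using hd n
    | succ i ih =>
      rw [hE.V_succ]
      refine (abs_add_le _ _).trans ?_
      rw [abs_mul, abs_of_pos (hE.mesh_pos n)]
      have := mul_le_mul_of_nonneg_left (hgM (W n i / q (a n + i * h n))) (hE.mesh_pos n).le
      push_cast; linarith
  obtain ⟨K, hK⟩ := (isCompact_Icc.prod (isCompact_Icc.prod isCompact_Icc)).exists_bound_of_continuousOn
    (f := H) (s := Icc ε R ×ˢ (Icc (-(D + M * (R + 1))) (D + M * (R + 1)) ×ˢ
      Icc (-(M * R * q R)) (M * R * q R)))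
    fun z hz => (hH z.1 (hε.trans_le hz.1.1) z.2).continuousWithinAt
  refine ⟨K, fun n i hi => hK _ ⟨⟨?_, hi⟩, abs_le.1 ?_, abs_le.1 ?_⟩⟩
  · have := hE.mesh_pos n
    have h2 : 0 ≤ i * h n := by positivity
    exact (ha n).trans (by simpa using h2)
  · refine (hV n (i + 1)).trans ?_
    have := hh n
    have := hE.start_pos n
    push_cast
    gcongr; linarith
  · have h1 := hE.start_pos n
    have h2 := hE.mesh_pos n
    have h3 : 0 < a n + i * h n := by positivity
    have h4 := hq.mono h3 hi
    refine (hE.abs_W_le hq hfM n i).trans (mul_le_mul ?_ h4 (hq.nonneg _ h3) ?_)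
    · gcongr; linarith
    · exact mul_nonneg hM0 (h3.le.trans hi)

/-- Limit of the lifted schemes with `θ0 = -(m + 1/2) π` as the mesh tends to zero. Their ends have
either modulus `exp x0`, or angle `θ0`; in the latter case the angle passes through `0, -π, …, -m
π`, where `w = 0` and `v` alternates in sign. The area bounds the symmetric action; adding `v w / 2`
turns its density into that of `A` and costs at most `exp x0 ^ 2 / 2`. -/
lemma exists_alternating_of_lipschitz (hq : IsAdmissibleWeight p q)
    {K : ℝ} (hg0 : g 0 = 0) (hf0 : f 0 = 0) (hgK : ∀ s t, |g s - g t| ≤ K * |s - t|)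
    (hfK : ∀ s t, |f s - f t| ≤ K * |s - t|) (hgM : ∀ s, |g s| ≤ M) (hfM : ∀ s, |f s| ≤ M)
    (hgs : ∀ s, 0 ≤ s * g s) (hσ : 0 < σ) (hfs : ∀ s, |s| ≤ σ → s * f s ≤ 0) (hε : 0 < ε)
    (hερ : ε < ρ) (m : ℕ) :
    ∃ (d : ℝ) (v y A : ℝ → ℝ), 0 < d ∧ Sol g q f ε d ρ v y ∧ Continuous A ∧ A ε = 0 ∧
      A ρ ≤ sectorArea x0 (-((m + 1 / 2) * π)) + Real.exp x0 ^ 2 / 2 ∧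
      (∀ r ∈ Ioo ε ρ, HasDerivAt A
        (q r * (y r * g (y r) - primitiveF g (y r) - primitiveF f (v r))) r) ∧
      v ρ ^ 2 + (q ρ * y ρ) ^ 2 ≤ Real.exp x0 ^ 2 ∧
      (v ρ ^ 2 + (q ρ * y ρ) ^ 2 = Real.exp x0 ^ 2 ∨ ∃ r, Alternates ε ρ v y m r) := by
  have hK0 : 0 ≤ K := by simpa using (abs_nonneg _).trans (hgK 1 0)
  have hgc := continuous_of_abs_sub_le hgK
  have hfc := continuous_of_abs_sub_le hfK
  have hρ := hε.trans hερ
  have hqε := hq.pos hε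
  have hqρ := hq.pos hρ
  set L := K * max (1 / q ε) (q ρ) with hLdef
  have hL0 : 0 ≤ L := mul_nonneg hK0 (le_max_of_le_right hqρ.le)
  obtain ⟨n0, hn0⟩ := exists_nat_gt (max ((ρ - ε) * (32 * L)) (ρ - ε))
  set N : ℕ → ℕ := fun n => n + n0 with hN
  have hδ : 0 < ρ - ε := sub_pos.2 hερ
  have hn01 := (le_max_left _ _).trans_lt hn0
  have hn02 := (le_max_right _ _).trans_lt hn0
  have hNn0 : ∀ n, (n0 : ℝ) ≤ N n := fun n => by simp [hN]
  have hNpos : ∀ n, (0 : ℝ) < N n := fun n => (hδ.trans hn02).trans_le (hNn0 n)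
  set h : ℕ → ℝ := fun n => (ρ - ε) / N n with hh
  have hhpos : ∀ n, 0 < h n := fun n => div_pos hδ (hNpos n)
  have hNh : ∀ n, N n * h n = ρ - ε := fun n => mul_div_cancel₀ _ (hNpos n).ne'
  have hhL : ∀ n, h n * L ≤ 1 / 32 := fun n => by
    rw [hh]; beta_reduce
    rw [div_mul_eq_mul_div, div_le_iff₀ (hNpos n)]; linarith [hNn0 n]
  have hh1 : ∀ n, h n ≤ 1 := fun n => by
    rw [hh]; beta_reduce
    rw [div_le_one (hNpos n)]; linarith [hNn0 n]
  -- The weight is frozen beyond `ρ` so that the bound `L` holds for all indices; the first `N n`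
  -- steps are not affected.
  set c : ℕ → ℕ → ℝ := fun n i => q (min (ε + i * h n) ρ)
  have hmin : ∀ n, ∀ i : ℕ, ε ≤ min (ε + i * h n) ρ := fun n i => le_min (by
    have := hhpos n; have : 0 ≤ i * h n := by positivity
    linarith) hερ.le
  have hcL : ∀ n i, K / c n i ≤ L ∧ K * c n i ≤ L := fun n i => by
    have h1 := hq.mono hε (hmin n i)
    have h2 := hq.mono (hε.trans_le (hmin n i)) (min_le_right _ ρ)
    constructor
    · rw [hLdef, div_eq_mul_one_div]
      exact mul_le_mul_of_nonneg_left ((one_div_le_one_div_of_le hqε h1).trans (le_max_left _ _)) hK0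
    · exact mul_le_mul_of_nonneg_left (h2.trans (le_max_right _ _)) hK0
  have hceq : ∀ n, ∀ i < N n, q (min (ε + i * h n) ρ) = q (ε + i * h n) := fun n i hi => by
    have h1 : (i : ℝ) ≤ N n := by exact_mod_cast hi.le
    have := mul_le_mul_of_nonneg_right h1 (hhpos n).le
    rw [min_eq_left (by linarith [hNh n])]
  have hθ0 : -((m + 1 / 2) * π) < 0 := by have := pi_pos; rw [neg_lt_zero]; positivity
  choose b Z hZ0 hZN hZs hZσ hZV hZW hZA using fun n => exists_lifted_scheme hg0 hf0 hgK hfK hgs hσ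
    hfs (hhpos n) (fun i => hq.pos (hε.trans_le (hmin n i))) (hcL n) (hhL n) (N n) (x0 := x0) hθ0
  set Λ := 4 * (L * (ρ - ε)) with hΛ
  have hdist : ∀ n, ∀ i ≤ N n, ‖Z n i - Z n 0‖ ≤ Λ := by
    intro n i hi
    have h1 : ∀ i : ℕ, ‖Z n i - Z n 0‖ ≤ i * (4 * (h n * L)) := by
      intro i
      induction i with
      | zero => simp
      | succ i ih =>
        have := norm_add_le (Z n (i + 1) - Z n i) (Z n i - Z n 0)
        rw [sub_add_sub_cancel] at this
        push_cast; linarith [hZs n i]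
    have h2 : (i : ℝ) ≤ N n := by exact_mod_cast hi
    have h3 := hhpos n
    refine (h1 i).trans ((mul_le_mul_of_nonneg_right h2 (by positivity)).trans_eq ?_)
    rw [hΛ, ← hNh n]; ring
  have hredist : ∀ n, ∀ i ≤ N n, |(Z n i).re - (Z n 0).re| ≤ Λ := fun n i hi =>
    (abs_re_le_norm _).trans (hdist n i hi)
  have hup : ∀ n, (Z n 0).re ≤ x0 + Λ := fun n => by
    have h1 := abs_le.1 (hredist n _ le_rfl)
    rw [hZN] at h1
    simp only [corner] at h1
    linarith [min_le_right (b n) 0]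
  -- A lower bound of the initial logarithm in both cases: an end of modulus at least `exp x0`, or
  -- an end of negative angle, which excludes starts too close to the origin. It keeps the limiting
  -- height positive.
  set xm := min (Real.log σ) x0 - Λ
  have hlow : ∀ n, xm ≤ (Z n 0).re := fun n => by
    rcases le_total (b n) 0 with hb | hb
    · have h1 := hZσ n (by rw [hZN]; simpa [corner, hb] using hθ0)
      have : (N n : ℝ) * (h n * L) = L * (ρ - ε) := by rw [← hNh n]; ring
      linarith [min_le_left (Real.log σ) x0]
    · have h1 := abs_le.1 (hredist n _ le_rfl)
      rw [hZN] at h1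
      simp only [corner, min_eq_right hb, add_zero] at h1
      linarith [min_le_right (Real.log σ) x0]
  set d : ℕ → ℝ := fun n => Real.exp (Z n 0).re with hd
  set X : ℕ → ℕ → ℝ × ℝ := fun n i => Nat.rec (d n, 0) (fun i z =>
    (z.1 + h n * g (z.2 / q (ε + i * h n)), z.2 + h n * -(q (ε + i * h n) *
      f (z.1 + h n * g (z.2 / q (ε + i * h n)))))) i
  set V : ℕ → ℕ → ℝ := fun n i => (X n i).1
  set W : ℕ → ℕ → ℝ := fun n i => (X n i).2
  have hE : EulerScheme q g f (fun _ => ε) h d V W :=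
    ⟨hhpos, fun _ => hε, fun n => rfl, fun n => rfl, fun n i => rfl, fun n i => rfl⟩
  have hVW : ∀ n, ∀ i ≤ N n, V n i = (exp (Z n i)).re ∧ W n i = (exp (Z n i)).im := by
    intro n i
    induction i with
    | zero => intro _; simp [hE.V_zero, hE.W_zero, exp_re, exp_im, hZ0, hd]
    | succ i ih =>
      intro hi
      obtain ⟨h1, h2⟩ := ih (by omega)
      have h3 : V n (i + 1) = (exp (Z n (i + 1))).re := by
        rw [hE.V_succ, hZV, h1, h2, hceq n i (by omega)]
      exact ⟨h3, by rw [hE.W_succ, hZW, h2, h3, hceq n i (by omega)]⟩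
  set U : Ultrafilter ℕ := hyperfilter ℕ
  have hdb : ∀ n, |d n| ≤ Real.exp (x0 + Λ) := fun n => by
    rw [abs_of_pos (exp_pos _)]; exact exp_le_exp.2 (hup n)
  obtain ⟨d0, hd0, hdlim⟩ := exists_tendsto_of_mem_Icc U (u := d) (Eventually.of_forall fun n =>
    (⟨exp_le_exp.2 (hlow n), exp_le_exp.2 (hup n)⟩ :
      d n ∈ Icc (Real.exp xm) (Real.exp (x0 + Λ))))
  have hhlim : Tendsto h U (𝓝 0) := by
    refine Tendsto.mono_left ?_ Nat.hyperfilter_le_atTop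
    exact tendsto_const_nhds.div_atTop (tendsto_natCast_atTop_atTop.comp (tendsto_add_atTop_nat n0))
  obtain ⟨v, w, hv, hw, hinit, hwb, hdv, hdw, hlim⟩ := hE.exists_limit hq hgc hfc hfM (U := U) hε.le
    (fun _ => le_rfl) tendsto_const_nhds hhlim hdlim ⟨_, hdb⟩
  have hvc : Continuous v := by rw [← continuousOn_univ]; exact hv.continuousOn
  have hwc : Continuous w := by rw [← continuousOn_univ]; exact hw.continuousOn
  have hstep : ∀ V : ℕ → ℕ → ℝ, ∀ n, ∀ i : ℕ, stepFun (fun _ => ε) h V n (ε + i * h n) = V n i :=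
    fun V n i => by simp only [stepFun]; rw [gridIndex_eq (hhpos n)]
  have hρN : ∀ n, ε + N n * h n = ρ := fun n => by rw [hNh]; ring
  -- the action
  set k := primitiveF g
  set H : ℝ × ℝ × ℝ → ℝ := fun z => z.2.2 * g (z.2.2 / q z.1) / 2 - q z.1 * k (z.2.2 / q z.1) +
    q z.1 * (z.2.1 * f z.2.1 / 2 - primitiveF f z.2.1) with hHdef
  have hHc : ∀ r, 0 < r → ∀ z, ContinuousAt H (r, z) := by
    intro r hr z
    have h1 : ContinuousAt (fun z : ℝ × ℝ × ℝ => q z.1) (r, z) :=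
      (hq.continuousAt hr).comp continuousAt_fst
    have h2 : ContinuousAt (fun z : ℝ × ℝ × ℝ => z.2.2 / q z.1) (r, z) :=
      ContinuousAt.div (by fun_prop) h1 (hq.pos hr).ne'
    have h3 := hgc.continuousAt.comp (x := (r, z)) h2
    have h4 := (continuous_primitiveF hgc).continuousAt.comp (x := (r, z)) h2
    have h5 : Continuous (fun z : ℝ × ℝ × ℝ => z.2.1 * f z.2.1 / 2 - primitiveF f z.2.1) := by
      have := continuous_primitiveF hfc; fun_prop
    have h6 : ContinuousAt (fun z : ℝ × ℝ × ℝ => z.2.2) (r, z) := by fun_prop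
    exact (((h6.mul h3).div_const 2).sub (h1.mul h4)).add (h1.mul h5.continuousAt)
  set S : ℕ → ℕ → ℝ := fun n i => ∑ j ∈ Finset.range i, h n * H (ε + j * h n, V n (j + 1), W n j)
    with hS
  have hSs : ∀ n i, S n (i + 1) = S n i + h n * H (ε + i * h n, V n (i + 1), W n i) := fun n i =>
    Finset.sum_range_succ _ _
  obtain ⟨s, hs⟩ := exists_contConv_stepFun (U := U) (x := S) (a := fun _ => ε) hhpos hSs
    (fun _ => hε) hhlim (hE.exists_bound_comp hq hε (fun _ => le_rfl) hgM hfM hdb hh1 hHc)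
    ⟨0, fun n => by simp [hS]⟩
  have hsc : Continuous s := by rw [← continuousOn_univ]; exact hs.continuousOn
  have hds : ∀ r, ε < r → HasDerivAt s (H (r, v r, w r)) r := fun r hr =>
    hasDerivAt_of_stepFun hhpos hSs tendsto_const_nhds hhlim hr hs (hlim H hHc r hr)
  have hsε : s ε = 0 := by
    refine tendsto_nhds_unique (hs.tendsto (mem_univ ε)) (tendsto_const_nhds.congr fun n => ?_)
    simp only [stepFun]; rw [gridIndex_of_le (hhpos n) le_rfl]; simp [hS]
  have hsρ : s ρ ≤ sectorArea x0 (-((m + 1 / 2) * π)) := by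
    refine le_of_tendsto (hs.tendsto (mem_univ ρ)) (Eventually.of_forall fun n => ?_)
    rw [← hρN n, hstep]
    refine le_of_eq_of_le (Finset.sum_congr rfl fun i hi => ?_) (hZA n)
    have hi' := Finset.mem_range.1 hi
    rw [hceq n i hi', (hVW n i hi'.le).2, (hVW n (i + 1) hi').1]
  -- the values at the end point
  have hend : Tendsto (fun n => Real.exp (Z n (N n)).re ^ 2) U (𝓝 (v ρ ^ 2 + w ρ ^ 2)) := by
    refine (((hv.tendsto (mem_univ ρ)).pow 2).add ((hw.tendsto (mem_univ ρ)).pow 2)).congr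
      fun n => ?_
    rw [← sq_re_exp_add_sq_im_exp, ← (hVW n _ le_rfl).1, ← (hVW n _ le_rfl).2,
      ← hstep V, ← hstep W, hρN]
  have hendle : v ρ ^ 2 + w ρ ^ 2 ≤ Real.exp x0 ^ 2 :=
    le_of_tendsto hend (Eventually.of_forall fun n => by
      rw [hZN]
      have : (corner x0 (-((m + 1 / 2) * π)) (b n)).re ≤ x0 := by
        simp [corner]
      gcongr)
  have hqw : q ρ * (w ρ / q ρ) = w ρ := mul_div_cancel₀ _ hqρ.ne'
  set y : ℝ → ℝ := fun r => if r ≤ ε then 0 else w r / q r with hy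
  have hyr : ∀ r, ε < r → y r = w r / q r := fun r hr => if_neg (not_le.2 hr)
  refine ⟨d0, v, y, fun r => s r + v r * w r / 2, (exp_pos _).trans_le hd0.1,
    Sol.of_flux hq hε.le hvc hwc hinit hwb (fun r hr _ => hdv r hr) fun r hr _ => hdw r hr,
    by fun_prop, by simp [hsε, (hinit ε le_rfl).2], ?_, fun r hr => ?_, ?_, ?_⟩
  · beta_reduce; nlinarith [sq_nonneg (v ρ - w ρ)]
  · refine ((hds r hr.1).add (((hdv r hr.1).mul (hdw r hr.1)).div_const 2)).congr_deriv ?_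
    have := (hq.pos (hε.trans hr.1)).ne'
    rw [hyr r hr.1]
    simp only [hHdef]
    field_simp; ring
  · rwa [hyr ρ hερ, hqw]
  rw [hyr ρ hερ, hqw]
  -- The ultrafilter decides between the two sides of the corner: for `b ≥ 0` the end has modulus
  -- `exp x0`, for `b ≤ 0` it has angle `-(m + 1/2) π`.
  rcases U.eventually_or.1 (Eventually.of_forall fun n => le_total 0 (b n)) with hb | hb
  · refine Or.inl (tendsto_nhds_unique hend (tendsto_const_nhds.congr' ?_))
    filter_upwards [hb] with n hn
    rw [hZN]; simp [corner, hn]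
  right
  have hpi := pi_pos
  have hex : ∀ n, b n ≤ 0 → ∃ i : ℕ → ℕ, ∀ j ≤ m, i j ≤ N n ∧ (j < m → i j ≤ i (j + 1)) ∧
      |(Z n (i j)).im - -(j * π)| ≤ 4 * (h n * L) := by
    intro n hbn
    have hP : ∀ j ≤ m, (Z n (N n)).im ≤ -(j * π) := by
      intro j hj
      have : (j : ℝ) ≤ m := by exact_mod_cast hj
      rw [hZN]
      simp only [corner, max_eq_right hbn, add_zero]
      nlinarith
    -- The first index at which the angle is at most `-j π`. The previous angle was larger, so the
    -- overshoot is at most one step and disappears in the limit.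
    refine ⟨fun j => sInf {i | (Z n i).im ≤ -(j * π)}, fun j hj => ?_⟩
    beta_reduce
    have hne : {i | (Z n i).im ≤ -(j * π)}.Nonempty := ⟨_, hP j hj⟩
    refine ⟨Nat.sInf_le (hP j hj), fun hjm => ?_, ?_⟩
    · have hmem := Nat.sInf_mem (⟨_, hP (j + 1) hjm⟩ : {i | (Z n i).im ≤ -((j + 1 : ℕ) * π)}.Nonempty)
      refine Nat.sInf_le (show (Z n _).im ≤ _ from le_trans hmem ?_)
      push_cast; linarith
    · have hmem := Nat.sInf_mem hne
      set i0 := sInf {i | (Z n i).im ≤ -(j * π)} with hi0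
      rw [abs_le]
      have hh0 : 0 ≤ h n * L := mul_nonneg (hhpos n).le hL0
      refine ⟨?_, by linarith [show (Z n i0).im ≤ -(j * π) from hmem]⟩
      rcases Nat.eq_zero_or_pos i0 with h0 | h0
      · rw [h0, hZ0]
        have : 0 ≤ j * π := by positivity
        linarith
      · obtain ⟨i1, hi1⟩ := Nat.exists_eq_succ_of_ne_zero h0.ne'
        have h1 : ¬ (Z n i1).im ≤ -(j * π) := fun hcon => by
          have : i0 ≤ i1 := Nat.sInf_le hcon
          omega
        have h2 := (abs_im_le_norm _).trans (hZs n i1)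
        rw [sub_im, abs_le] at h2
        rw [hi1]
        linarith [h2.1, not_le.1 h1]
  choose! i hi using hex
  have htime : ∀ j ≤ m, ∃ x ∈ Icc ε ρ, Tendsto (fun n => ε + i n j * h n) U (𝓝 x) := fun j hj =>
    exists_tendsto_of_mem_Icc U (by
      filter_upwards [hb] with n hn
      have h1 : (i n j : ℝ) ≤ N n := by exact_mod_cast (hi n hn j hj).1
      have h2 := mul_le_mul_of_nonneg_right h1 (hhpos n).le
      have h3 : 0 ≤ i n j * h n := by have := hhpos n; positivity
      constructor <;> linarith [hNh n])
  choose! r hr using htime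
  refine ⟨r, fun j hj => ?_⟩
  obtain ⟨hrI, hrlim⟩ := hr j hj
  have him : Tendsto (fun n => (Z n (i n j)).im) U (𝓝 (-(j * π))) := by
    rw [tendsto_iff_dist_tendsto_zero]
    refine squeeze_zero' (Eventually.of_forall fun _ => dist_nonneg) (g := fun n => 4 * (h n * L)) ?_ ?_
    · filter_upwards [hb] with n hn
      rw [dist_eq]; exact (hi n hn j hj).2.2
    · simpa using (hhlim.mul_const L).const_mul 4
  obtain ⟨x, -, hx⟩ := exists_tendsto_of_mem_Icc U (u := fun n => (Z n (i n j)).re) (a := xm - Λ)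
    (b := x0 + 2 * Λ) (by
      filter_upwards [hb] with n hn
      have h1 := abs_le.1 (hredist n _ (hi n hn j hj).1)
      constructor <;> linarith [hlow n, hup n])
  have hvr : v (r j) = Real.exp x * cos (-(j * π)) := by
    refine tendsto_nhds_unique (hv.tendsto_comp (mem_univ _) hrlim (by simp)) ?_
    refine (((Real.continuous_exp.tendsto x).comp hx).mul
      ((Real.continuous_cos.tendsto _).comp him)).congr' ?_
    filter_upwards [hb] with n hn
    rw [hstep, (hVW n _ (hi n hn j hj).1).1, exp_re]; rfl
  have hwr : w (r j) = Real.exp x * sin (-(j * π)) := by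
    refine tendsto_nhds_unique (hw.tendsto_comp (mem_univ _) hrlim (by simp)) ?_
    refine (((Real.continuous_exp.tendsto x).comp hx).mul
      ((Real.continuous_sin.tendsto _).comp him)).congr' ?_
    filter_upwards [hb] with n hn
    rw [hstep, (hVW n _ (hi n hn j hj).1).2, exp_im]; rfl
  rw [Real.cos_neg, Real.cos_nat_mul_pi] at hvr
  rw [Real.sin_neg, Real.sin_nat_mul_pi, neg_zero, mul_zero] at hwr
  refine ⟨hrI, ?_, ?_, fun hjm => ?_⟩
  · simp only [hy]; rw [hwr]; simp
  · rw [hvr, mul_left_comm, ← mul_pow]; simpa using exp_pos x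
  · refine le_of_tendsto_of_tendsto hrlim (hr (j + 1) hjm).2 ?_
    filter_upwards [hb] with n hn
    have h1 : (i n j : ℝ) ≤ i n (j + 1) := by exact_mod_cast (hi n hn j hj).2.1 hjm
    have := mul_le_mul_of_nonneg_right h1 (hhpos n).le
    linarith

/-! ### Approximation by Lipschitz fields -/

lemma abs_clampTo_sub_le (a b s t : ℝ) : |clampTo a b s - clampTo a b t| ≤ |s - t| := by
  unfold clampTo
  refine (abs_max_sub_max_le_max _ _ _ _).trans ?_
  rw [sub_self, abs_zero]
  refine max_le (abs_nonneg _) ((abs_min_sub_min_le_max _ _ _ _).trans ?_)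
  rw [sub_self, abs_zero]
  exact max_le (abs_nonneg _) le_rfl

lemma exists_lipschitz_approx (hu : Continuous u) (hb : 0 ≤ b)
    (hδ : 0 < δ) : ∃ (h : ℝ → ℝ) (K : ℝ), 0 ≤ K ∧ (∀ s t, |h s - h t| ≤ K * |s - t|) ∧
      ∀ s, |h s - u (clampTo (-b) b s)| ≤ δ := by
  obtain ⟨P, hP⟩ := exists_polynomial_near_of_continuousOn (-b) b u hu.continuousOn δ hδ
  obtain ⟨K, hK⟩ := isCompact_Icc.exists_bound_of_continuousOn (s := Icc (-b) b)
    P.derivative.continuous.continuousOn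
  have hbb : -b ≤ b := by linarith
  have hK0 : 0 ≤ K := (norm_nonneg _).trans (hK b ⟨hbb, le_rfl⟩)
  refine ⟨fun s => P.eval (clampTo (-b) b s), K, hK0, fun s t => ?_, fun s =>
    (hP _ (clampTo_mem hbb s)).le⟩
  have := (convex_Icc (-b) b).norm_image_sub_le_of_norm_deriv_le (f := fun x => P.eval x)
    (fun x _ => P.differentiable.differentiableAt) (fun x hx => by rw [P.deriv]; exact hK x hx)
    (clampTo_mem hbb t) (clampTo_mem hbb s)
  exact this.trans (mul_le_mul_of_nonneg_left (abs_clampTo_sub_le _ _ _ _) hK0)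

/-- The approximant is shifted to vanish at zero, and only its positive part is kept on the right
and its negative part on the left; the sign of `g` shows that this does not spoil the approximation.
-/
lemma exists_lipschitz_approx_of_mul_nonneg (hg : Continuous g) (hg0 : g 0 = 0)
    (hgs : ∀ s, 0 ≤ s * g s) (hb : 0 ≤ b) (hδ : 0 < δ) :
    ∃ (u : ℝ → ℝ) (K : ℝ), (∀ s t, |u s - u t| ≤ K * |s - t|) ∧ u 0 = 0 ∧ (∀ s, 0 ≤ s * u s) ∧
      ∀ s, |u s - g (clampTo (-b) b s)| ≤ δ := by
  obtain ⟨h, K, hK0, hK, hh⟩ := exists_lipschitz_approx hg hb (half_pos hδ)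
  have hc0 : clampTo (-b) b 0 = 0 := clampTo_eq ⟨by linarith, hb⟩
  have hh0 := hh 0
  rw [hc0, hg0, sub_zero] at hh0
  set u : ℝ → ℝ := fun s => max (h (max s 0) - h 0) 0 + min (h (min s 0) - h 0) 0 with hu
  have hup : ∀ s, 0 ≤ s → u s = max (h s - h 0) 0 := fun s hs => by
    simp only [hu]; rw [max_eq_left hs, min_eq_right hs]; simp
  have hum : ∀ s ≤ 0, u s = min (h s - h 0) 0 := fun s hs => by
    simp only [hu]; rw [max_eq_right hs, min_eq_left hs]; simp
  refine ⟨u, K + K, fun s t => ?_, by rw [hup 0 le_rfl]; simp, fun s => ?_, fun s => ?_⟩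
  · have e1 := abs_max_sub_max_le_abs (h (max s 0) - h 0) (h (max t 0) - h 0) 0
    have e2 := abs_min_sub_min_le_max (h (min s 0) - h 0) 0 (h (min t 0) - h 0) 0
    rw [sub_self, abs_zero, max_eq_left (abs_nonneg _), sub_sub_sub_cancel_right] at e2
    rw [sub_sub_sub_cancel_right] at e1
    have e3 := mul_le_mul_of_nonneg_left (abs_max_sub_max_le_abs s t 0) hK0
    have e4 := abs_min_sub_min_le_max s 0 t 0
    rw [sub_self, abs_zero, max_eq_left (abs_nonneg _)] at e4
    have e5 := mul_le_mul_of_nonneg_left e4 hK0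
    simp only [hu]
    rw [add_sub_add_comm, add_mul]
    exact (abs_add_le _ _).trans (add_le_add (e1.trans ((hK _ _).trans e3))
      (e2.trans ((hK _ _).trans e5)))
  · rcases le_total 0 s with hs | hs
    · rw [hup s hs]; positivity
    · rw [hum s hs]; exact mul_nonneg_of_nonpos_of_nonpos hs (min_le_right _ _)
  · have e := hh s
    rw [abs_le] at e hh0 ⊢
    rcases le_total 0 s with hs | hs
    · have e1 : 0 ≤ g (clampTo (-b) b s) := by
        have : 0 ≤ clampTo (-b) b s := le_max_of_le_right (le_min hb hs)
        rcases this.eq_or_lt with h0 | h0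
        exacts [by rw [← h0, hg0], nonneg_of_mul_nonneg_right (hgs _) h0]
      rw [hup s hs]
      rcases max_cases (h s - h 0) 0 with h1 | h1 <;> constructor <;> linarith [h1.1, h1.2]
    · have e1 : g (clampTo (-b) b s) ≤ 0 := by
        have : clampTo (-b) b s ≤ 0 := max_le (by linarith) ((min_le_right _ _).trans hs)
        rcases this.eq_or_lt with h0 | h0
        exacts [by rw [h0, hg0], nonpos_of_mul_nonneg_right (hgs _) h0]
      rw [hum s hs]
      rcases min_cases (h s - h 0) 0 with h1 | h1 <;> constructor <;> linarith [h1.1, h1.2]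

/-- A primitive is negative if it lies below a shifted nonpositive primitive. -/
lemma primitiveF_neg_of_shift {w : ℝ → ℝ} (hu : Continuous u) (hw : Continuous w) {s0 : ℝ}
    (hσ : 0 < σ) (h1 : ∀ s ∈ Ioo 0 σ, u s < 0) (h2 : ∀ s, σ ≤ s → u s ≤ w (s - σ))
    (h3 : ∀ s ∈ Icc 0 s0, primitiveF w s ≤ 0) (hs : 0 < s) (hs0 : s ≤ s0) :
    primitiveF u s < 0 := by
  have key : ∀ s, 0 < s → s ≤ σ → primitiveF u s < 0 := by
    intro s hs hsσ
    have := strictAntiOn_of_deriv_neg (convex_Icc 0 σ) (continuous_primitiveF hu).continuousOn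
      (fun x hx => by
        rw [interior_Icc] at hx
        rw [(hasDerivAt_primitiveF hu x).deriv]; exact h1 x hx)
      (left_mem_Icc.2 hσ.le) ⟨hs.le, hsσ⟩ hs
    rwa [primitiveF_zero] at this
  rcases le_total s σ with hsσ | hsσ
  · exact key s hs hsσ
  have hcw := continuous_primitiveF hw
  have hcu := continuous_primitiveF hu
  have := le_of_hasDerivAt_nonneg (u := fun s => primitiveF w (s - σ) - primitiveF u s) hsσ
    (by fun_prop)
    (fun r hr => ((hasDerivAt_primitiveF hw (r - σ)).comp_sub_const r σ).sub
      (hasDerivAt_primitiveF hu r)) (fun r hr => sub_nonneg.2 (h2 r hr.1.le))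
  simp only [sub_self, primitiveF_zero] at this
  linarith [key σ hσ le_rfl, h3 (s - σ) ⟨by linarith, by linarith⟩]

/-- The schemes need `s u(s) ≤ 0` near zero, which `f` need not satisfy, and the well must not be
lost. The approximant is translated outwards by `σ` on both sides; the gap is filled by the linear
function of slope `-3δ/σ`, and `3δ` is subtracted on the right and added on the left. Then `u(s) ≤
f(s - σ)` for `s ≥ σ`, so that the primitive lies below a translate of `F`, plus a negative
constant. -/
lemma DoubleWell.exists_lipschitz_approx (hw : DoubleWell f βm βp)
    (hb : 0 ≤ b) (hfb : ∀ s, f s = f (clampTo (-b) b s)) (hδ : 0 < δ) :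
    ∃ (u : ℝ → ℝ) (K σ : ℝ), (∀ s t, |u s - u t| ≤ K * |s - t|) ∧ u 0 = 0 ∧ 0 < σ ∧
      (∀ s, |s| ≤ σ → s * u s ≤ 0) ∧ (∀ s, |u s - f s| ≤ 6 * δ) ∧
      ∀ s ∈ Icc βm βp, s ≠ 0 → primitiveF u s < 0 := by
  obtain ⟨h, K, hK0, hK, hh'⟩ := WeightedPLaplace.exists_lipschitz_approx hw.cont hb hδ
  have hh : ∀ s, |h s - f s| ≤ δ := fun s => by rw [hfb s]; exact hh' s
  set σ := δ / (K + 1) with hσ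
  have hσ0 : 0 < σ := by positivity
  have hKσ : K * σ ≤ δ := by
    rw [hσ, ← mul_div_assoc, div_le_iff₀ (by positivity)]; nlinarith
  have hh0 := hh 0
  rw [hw.map_zero, sub_zero] at hh0
  set T : ℝ → ℝ := fun s => s - clampTo (-σ) σ s with hT
  set u : ℝ → ℝ := fun s => h (T s) - h 0 - 3 * δ * clampTo (-1) 1 (s / σ) with hu
  have hTσ : ∀ s, |s| ≤ σ → T s = 0 ∧ clampTo (-1) 1 (s / σ) = s / σ := fun s hs => by
    have hs' := abs_le.1 hs
    refine ⟨by simp only [hT]; rw [clampTo_eq hs', sub_self], clampTo_eq ⟨?_, ?_⟩⟩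
    · rw [le_div_iff₀ hσ0]; linarith
    · rw [div_le_one hσ0]; exact hs'.2
  have hTp : ∀ s, σ ≤ s → T s = s - σ ∧ clampTo (-1) 1 (s / σ) = 1 := fun s hs => by
    have h1 : 1 ≤ s / σ := (one_le_div hσ0).2 hs
    simp only [hT, clampTo, min_eq_left hs, min_eq_left h1, max_eq_right (by linarith : -σ ≤ σ)]
    norm_num
  have hTm : ∀ s, s ≤ -σ → T s = s + σ ∧ clampTo (-1) 1 (s / σ) = -1 := fun s hs => by
    have h1 : s / σ ≤ -1 := by rw [div_le_iff₀ hσ0]; linarith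
    simp only [hT, clampTo, min_eq_right (by linarith : s ≤ σ), max_eq_left hs,
      min_eq_right (by linarith : s / σ ≤ 1), max_eq_left h1]
    norm_num
  have huσ : ∀ s, |s| ≤ σ → u s = -(3 * δ / σ) * s := fun s hs => by
    simp only [hu]; rw [(hTσ s hs).1, (hTσ s hs).2]; field_simp; ring
  have huK : ∀ s t, |u s - u t| ≤ (2 * K + 3 * δ / σ) * |s - t| := fun s t => by
    have e1 : |T s - T t| ≤ 2 * |s - t| := by
      have := abs_clampTo_sub_le (-σ) σ s t
      have e := abs_sub (s - t) (clampTo (-σ) σ s - clampTo (-σ) σ t)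
      simp only [hT]
      rw [show s - clampTo (-σ) σ s - (t - clampTo (-σ) σ t) =
        s - t - (clampTo (-σ) σ s - clampTo (-σ) σ t) by ring]
      linarith
    have e2 := abs_clampTo_sub_le (-1) 1 (s / σ) (t / σ)
    rw [← sub_div, abs_div, abs_of_pos hσ0] at e2
    have e3 : |h (T s) - h (T t)| ≤ K * (2 * |s - t|) :=
      (hK _ _).trans (mul_le_mul_of_nonneg_left e1 hK0)
    simp only [hu]
    rw [show h (T s) - h 0 - 3 * δ * clampTo (-1) 1 (s / σ) -
      (h (T t) - h 0 - 3 * δ * clampTo (-1) 1 (t / σ)) = (h (T s) - h (T t)) -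
      3 * δ * (clampTo (-1) 1 (s / σ) - clampTo (-1) 1 (t / σ)) by ring]
    refine (abs_sub _ _).trans ?_
    rw [abs_mul, abs_of_pos (by positivity : 0 < 3 * δ)]
    have e4 := mul_le_mul_of_nonneg_left e2 (by positivity : 0 ≤ 3 * δ)
    exact (add_le_add e3 e4).trans_eq (by ring)
  have hul : LipschitzWith ⟨2 * K + 3 * δ / σ, by positivity⟩ u := LipschitzWith.of_dist_le_mul huK
  refine ⟨u, _, σ, huK, by rw [huσ 0 (by simpa using hσ0.le)]; ring, hσ0, fun s hs => ?_, fun s => ?_,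
    fun s hs hs0 => ?_⟩
  · rw [huσ s hs]
    have : 0 ≤ 3 * δ / σ * s ^ 2 := by positivity
    linarith
  · have e1 : |h (T s) - h s| ≤ δ := by
      refine (hK _ _).trans (le_trans (mul_le_mul_of_nonneg_left ?_ hK0) hKσ)
      simp only [hT]
      rw [sub_sub_cancel_left, abs_neg]
      exact abs_le.2 (clampTo_mem (by linarith) s)
    have e2 := hh s
    have e3 := clampTo_mem (show (-1 : ℝ) ≤ 1 by norm_num) (s / σ)
    have e4 := mul_le_mul_of_nonneg_left e3.1 hδ.le
    have e5 := mul_le_mul_of_nonneg_left e3.2 hδ.le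
    rw [abs_le] at *
    simp only [hu]
    constructor <;> linarith
  · rcases lt_or_gt_of_ne hs0 with h0 | h0
    · have h1 := primitiveF_neg_of_shift (u := fun x => -u (-x)) (w := fun x => -f (-x)) (s0 := -βm)
        (hul.continuous.comp continuous_neg).neg (hw.cont.comp continuous_neg).neg hσ0
        (fun x hx => by
          rw [huσ (-x) (by rw [abs_neg, abs_of_pos hx.1]; exact hx.2.le)]
          have : 0 < 3 * δ / σ * x := mul_pos (by positivity) hx.1
          linarith)
        (fun x hx => by
          have e := abs_le.1 (hh (-x + σ))
          simp only [hu]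
          rw [(hTm (-x) (by linarith)).1, (hTm (-x) (by linarith)).2, show -(x - σ) = -x + σ by ring]
          linarith [(abs_le.1 hh0).2])
        (fun x hx => by
          rw [primitiveF_reflect]
          exact hw.nonpos ⟨by linarith [hx.2], by linarith [hx.1, hw.pos_right]⟩)
        (neg_pos.2 h0) (neg_le_neg hs.1)
      rwa [primitiveF_reflect, neg_neg] at h1
    · refine primitiveF_neg_of_shift hul.continuous hw.cont hσ0 (fun x hx => ?_) (fun x hx => ?_)
        (fun x hx => hw.nonpos ⟨hw.neg_left.le.trans hx.1, hx.2⟩) h0 hs.2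
      · rw [huσ x (by rw [abs_of_pos hx.1]; exact hx.2.le)]
        have : 0 < 3 * δ / σ * x := mul_pos (by positivity) hx.1
        linarith
      · have e := abs_le.1 (hh (x - σ))
        simp only [hu]
        rw [(hTp x hx).1, (hTp x hx).2]
        linarith [(abs_le.1 hh0).1]

lemma primitiveF_nonneg (hg : Continuous g) (hgs : ∀ s, 0 ≤ s * g s) (s : ℝ) :
    0 ≤ primitiveF g s := by
  have key : ∀ u : ℝ → ℝ, Continuous u → (∀ s, 0 ≤ s * u s) → ∀ s, 0 ≤ s → 0 ≤ primitiveF u s := by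
    intro u hu hus s hs
    have := le_of_hasDerivAt_nonneg hs (continuous_primitiveF hu).continuousOn
      (fun r _ => hasDerivAt_primitiveF hu r) fun r hr => nonneg_of_mul_nonneg_right (hus r) hr.1
    rwa [primitiveF_zero] at this
  rcases le_total 0 s with hs | hs
  · exact key g hg hgs s hs
  · have := key (fun x => -g (-x)) (hg.comp continuous_neg).neg
      (fun x => by have := hgs (-x); linarith) (-s) (by linarith)
    rwa [primitiveF_reflect, neg_neg] at this

/-- A solution cannot change sign after its energy has become negative. -/
lemma Alternates.primitiveF_nonneg {m : ℕ}
    {r : ℕ → ℝ} (hr : Alternates a T v y m r) (hq : IsAdmissibleWeight p q) (ha : 0 ≤ a)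
    (hg : Continuous g) (hf : Continuous f) (hgs : ∀ s, 0 ≤ s * g s) (h : Sol g q f a d T v y)
    {j : ℕ} (hj : j < m) : 0 ≤ primitiveF f (v (r j)) := by
  by_contra hcon
  obtain ⟨hrI, hy, hs, hle⟩ := hr j hj.le
  obtain ⟨hrI', -, hs', -⟩ := hr (j + 1) hj
  have hle := hle hj
  have h0 : 0 ∈ uIcc ((-1) ^ j * v (r j)) ((-1) ^ j * v (r (j + 1))) := by
    rw [pow_succ] at hs'
    exact mem_uIcc.2 (Or.inr ⟨by linarith, hs.le⟩)
  obtain ⟨t, ht, hvt⟩ := intermediate_value_uIcc (f := fun t => (-1) ^ j * v t)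
    (by have := h.cont_v; fun_prop) h0
  rw [uIcc_of_le hle] at ht
  have hvt : v t = 0 := by simpa using hvt
  have := h.energy_anti hq ha hf (hasDerivAt_primitiveF hg) hgs hrI.1 ht.1 (ht.2.trans hrI'.2)
  simp only [energy, hy, hvt, primitiveF_zero, zero_add, add_zero] at this
  linarith [WeightedPLaplace.primitiveF_nonneg hg hgs (y t), not_le.1 hcon]

lemma tendsto_prod_of_abs_sub_le {U : Filter ℕ} {u : ℕ → ℝ → ℝ} {c : ℝ → ℝ} (hu : Continuous u0)
    (hc : Continuous c) {η : ℕ → ℝ} (hη : Tendsto η U (𝓝 0)) (h : ∀ n s, |u n s - u0 s| ≤ η n * c s)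
    (s : ℝ) : Tendsto (fun z : ℕ × ℝ => u z.1 z.2) (U ×ˢ 𝓝 s) (𝓝 (u0 s)) := by
  have h1 : Tendsto (fun z : ℕ × ℝ => u z.1 z.2 - u0 z.2) (U ×ˢ 𝓝 s) (𝓝 0) := by
    refine squeeze_zero_norm (fun z => h z.1 z.2) ?_
    simpa using (hη.comp tendsto_fst).mul ((hc.tendsto s).comp (tendsto_snd (f := U)))
  simpa using h1.add ((hu.tendsto s).comp (tendsto_snd (f := U)))

lemma abs_primitiveF_le (hM : ∀ s, |u s| ≤ M) (s : ℝ) :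
    |primitiveF u s| ≤ M * |s| := by
  have := intervalIntegral.norm_integral_le_of_norm_le_const (f := u) (a := 0) (b := s) (C := M)
    fun x _ => hM x
  rwa [sub_zero] at this

lemma abs_primitiveF_sub_le {w : ℝ → ℝ} (hu : Continuous u) (hw : Continuous w) {η : ℝ}
    (h : ∀ s, |u s - w s| ≤ η) (s : ℝ) : |primitiveF u s - primitiveF w s| ≤ η * |s| := by
  have := abs_primitiveF_le h s
  rwa [primitiveF, intervalIntegral.integral_sub (hu.intervalIntegrable _ _)
    (hw.intervalIntegrable _ _)] at this

/-- Limit in the Lipschitz approximations of both fields. That `F` is nonnegative at an alternation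
time is deduced from the existence of a later one, so one time is given up. -/
lemma exists_alternating_of_clamped (hq : IsAdmissibleWeight p q) (hg : Continuous g) (hg0' : g 0 = 0) (hgs : ∀ s, 0 ≤ s * g s)
    (hw : DoubleWell f βm βp) (hb : 0 ≤ b) (hfb : ∀ s, f s = f (clampTo (-b) b s)) (hε : 0 < ε) (hερ : ε < ρ) (m : ℕ) :
    ∃ (d : ℝ) (v y A : ℝ → ℝ), 0 ≤ d ∧ Sol g q f ε d ρ v y ∧ ContinuousOn A (Icc ε ρ) ∧ A ε = 0 ∧
      A ρ ≤ sectorArea x0 (-((m + 1 / 2) * π)) + Real.exp x0 ^ 2 / 2 ∧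
      (∀ r ∈ Ioo ε ρ, HasDerivAt A
        (q r * (y r * g (y r) - primitiveF g (y r) - primitiveF f (v r))) r) ∧
      v ρ ^ 2 + (q ρ * y ρ) ^ 2 ≤ Real.exp x0 ^ 2 ∧
      (v ρ ^ 2 + (q ρ * y ρ) ^ 2 = Real.exp x0 ^ 2 ∨ ∃ r : ℕ → ℝ, ∀ j < m, r j ∈ Icc ε ρ ∧
        y (r j) = 0 ∧ 0 < (-1) ^ j * v (r j) ∧ 0 ≤ primitiveF f (v (r j)) ∧
        (j + 1 < m → r j ≤ r (j + 1))) := by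
  have hbb : -b ≤ b := by linarith
  obtain ⟨M0, hM0⟩ := exists_bound_clampTo hw.cont hbb
  have hM0 : ∀ s, |f s| ≤ M0 := fun s => by rw [hfb s]; exact hM0 s
  have hM00 : 0 ≤ M0 := (abs_nonneg _).trans (hM0 0)
  have hδ : 0 < ρ - ε := sub_pos.2 hερ
  -- The approximations satisfy `|fn - f| ≤ 6 δ` with `δ ≤ 1`; `b'` below is the resulting bound of
  -- `|y|`, beyond which `g` may be truncated.
  set M := M0 + 6
  set b' := M * (ρ - ε)
  have hb'0 : 0 ≤ b' := by positivity
  set gc : ℝ → ℝ := fun s => g (clampTo (-b') b' s) with hgc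
  have hgcc : Continuous gc := hg.comp (continuous_clampTo _ _)
  obtain ⟨M1, hM1⟩ := exists_bound_clampTo hg (show -b' ≤ b' by linarith)
  set M' := M1 + 1
  have hM10 : 0 ≤ M1 := (abs_nonneg _).trans (hM1 0)
  set δ : ℕ → ℝ := fun n => 1 / ((n : ℝ) + 1) with hδdef
  have hδ0 : ∀ n, 0 < δ n := fun n => by simp only [hδdef]; positivity
  have hδ1 : ∀ n, δ n ≤ 1 := fun n => by
    simp only [hδdef]; rw [div_le_one (by positivity)]; linarith [Nat.cast_nonneg (α := ℝ) n]
  set U : Ultrafilter ℕ := hyperfilter ℕ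
  have hδlim : Tendsto δ U (𝓝 0) :=
    tendsto_one_div_add_atTop_nhds_zero_nat.mono_left Nat.hyperfilter_le_atTop
  choose gn Kg hgK hg0 hgns hgn using fun n =>
    exists_lipschitz_approx_of_mul_nonneg hg hg0' hgs hb'0 (hδ0 n)
  choose fn Kf σ hfK hf0 hσ hfs hfn hfw using fun n => hw.exists_lipschitz_approx hb hfb (hδ0 n)
  have hfM : ∀ n s, |fn n s| ≤ M := fun n s => by
    have e := abs_le.1 (hfn n s)
    have e' := abs_le.1 (hM0 s)
    rw [abs_le]; constructor <;> linarith [hδ1 n]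
  have hgM : ∀ n s, |gn n s| ≤ M' := fun n s => by
    have e := abs_le.1 (hgn n s)
    have e' := abs_le.1 (hM1 s)
    rw [abs_le]; constructor <;> linarith [hδ1 n]
  have hgnc : ∀ n, Continuous (gn n) := fun n => continuous_of_abs_sub_le (hgK n)
  have hfnc : ∀ n, Continuous (fn n) := fun n => continuous_of_abs_sub_le (hfK n)
  have hmaxl : ∀ (K K' : ℝ) {x : ℝ} (s t : ℝ), x ≤ K * |s - t| → x ≤ max K K' * |s - t| :=
    fun K K' x s t h => h.trans (mul_le_mul_of_nonneg_right (le_max_left _ _) (abs_nonneg _))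
  choose d v y A hd hSol hAc hA0 hAρ hAd hend halt using fun n =>
    exists_alternating_of_lipschitz (x0 := x0) (K := max (Kg n) (Kf n)) (M := max M' M) hq (hg0 n)
      (hf0 n) (fun s t => hmaxl _ _ s t (hgK n s t))
      (fun s t => by rw [max_comm]; exact hmaxl _ _ s t (hfK n s t))
      (fun s => (hgM n s).trans (le_max_left _ _))
      (fun s => (hfM n s).trans (le_max_right _ _)) (hgns n) (hσ n) (hfs n) hε hερ m
  set B := Real.exp x0 + M' * (ρ - ε)
  have hvB' : ∀ n, ∀ r ∈ Icc ε ρ, |v n r| ≤ B := by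
    intro n r hr
    have e1 := abs_sub_le_of_hasDerivAt hr.2 (hSol n).cont_v.continuousOn
      (fun t ht => (hSol n).deriv_v t (hr.1.trans_lt ht.1) ht.2) fun t _ => hgM n _
    have e2 : |v n ρ| ≤ Real.exp x0 :=
      abs_le_of_sq_le_sq (by nlinarith [hend n, sq_nonneg (q ρ * y n ρ)]) (exp_pos _).le
    have e3 : M' * (ρ - r) ≤ M' * (ρ - ε) := by gcongr; exact hr.1
    rw [abs_le] at *
    constructor <;> linarith
  have hvB : ∀ n, ∀ r ≤ ρ, |v n r| ≤ B := fun n r hr => by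
    rcases le_total ε r with h1 | h1
    · exact hvB' n r ⟨h1, hr⟩
    · rw [((hSol n).init r h1).1, ← ((hSol n).init ε le_rfl).1]
      exact hvB' n ε ⟨le_rfl, hερ.le⟩
  have hyB : ∀ n, ∀ r ∈ Icc ε ρ, |y n r| ≤ b' := fun n r hr =>
    ((hSol n).abs_flux_le hq hε.le hr.1 hr.2 fun t _ => hfM n _).trans
      (mul_le_mul_of_nonneg_left (by linarith [hr.2]) (by positivity))
  obtain ⟨d0, hd0, hdlim⟩ := exists_tendsto_of_mem_Icc U (u := d) (a := 0) (b := B)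
    (Eventually.of_forall fun n => ⟨(hd n).le, by
      have := hvB n ε hερ.le
      rw [((hSol n).init ε le_rfl).1] at this
      exact (le_abs_self _).trans this⟩)
  have hgt : ∀ s, Tendsto (fun z : ℕ × ℝ => gn z.1 z.2) ((U : Filter ℕ) ×ˢ 𝓝 s) (𝓝 (gc s)) :=
    tendsto_prod_of_abs_sub_le hgcc continuous_const hδlim (c := fun _ => 1)
      fun n s => by rw [mul_one]; exact hgn n s
  have h6 : Tendsto (fun n => 6 * δ n) U (𝓝 0) := by simpa using hδlim.const_mul 6
  have hft : ∀ s, Tendsto (fun z : ℕ × ℝ => fn z.1 z.2) ((U : Filter ℕ) ×ˢ 𝓝 s) (𝓝 (f s)) :=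
    tendsto_prod_of_abs_sub_le hw.cont continuous_const h6 (c := fun _ => 1)
      fun n s => by rw [mul_one]; exact hfn n s
  have hGt : ∀ s, Tendsto (fun z : ℕ × ℝ => primitiveF (gn z.1) z.2) ((U : Filter ℕ) ×ˢ 𝓝 s)
      (𝓝 (primitiveF gc s)) :=
    tendsto_prod_of_abs_sub_le (continuous_primitiveF hgcc) continuous_abs hδlim
      fun n s => abs_primitiveF_sub_le (hgnc n) hgcc (hgn n) s
  have hFt : ∀ s, Tendsto (fun z : ℕ × ℝ => primitiveF (fn z.1) z.2) ((U : Filter ℕ) ×ˢ 𝓝 s)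
      (𝓝 (primitiveF f s)) :=
    tendsto_prod_of_abs_sub_le (continuous_primitiveF hw.cont) continuous_abs h6
      fun n s => abs_primitiveF_sub_le (hfnc n) hw.cont (hfn n) s
  obtain ⟨v0, y0, hS0, hv, hy⟩ := Sol.exists_limit hq (U := U) hε.le hερ (fun _ => le_rfl)
    tendsto_const_nhds hdlim hSol hgt hft hvB (fun n s _ => hfM n s) fun n s _ => hgM n s
  have hIcc : Icc ε ρ ⊆ Iic ρ := Icc_subset_Iic_self
  -- the actions converge
  set G : ℕ → ℝ → ℝ := fun n r => q r * (y n r * gn n (y n r) - primitiveF (gn n) (y n r) -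
    primitiveF (fn n) (v n r)) with hG
  set G0 : ℝ → ℝ := fun r => q r * (y0 r * gc (y0 r) - primitiveF gc (y0 r) - primitiveF f (v0 r))
    with hG0
  have hGc : ContConv U (Icc ε ρ) G G0 := by
    intro r hr
    have e1 := hv.mono hIcc r hr
    have e2 := hy.mono hIcc r hr
    have e3 : Tendsto (fun z : ℕ × ℝ => q z.2) ((U : Filter ℕ) ×ˢ 𝓝[Icc ε ρ] r) (𝓝 (q r)) :=
      ((hq.continuousAt (hε.trans_le hr.1)).tendsto.mono_left nhdsWithin_le_nhds).comp tendsto_snd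
    exact e3.mul (((e2.mul ((hgt _).comp (tendsto_fst.prodMk e2))).sub
      ((hGt _).comp (tendsto_fst.prodMk e2))).sub ((hFt _).comp (tendsto_fst.prodMk e1)))
  have hGb : ∀ n, ∀ r ∈ Icc ε ρ, |G n r| ≤ q ρ * (b' * M' + M' * b' + M * B) := by
    intro n r hr
    have hr0 := hε.trans_le hr.1
    have e1 : |y n r * gn n (y n r)| ≤ b' * M' := by
      rw [abs_mul]; exact mul_le_mul (hyB n r hr) (hgM n _) (abs_nonneg _) hb'0
    have e2 : |primitiveF (gn n) (y n r)| ≤ M' * b' := (abs_primitiveF_le (hgM n) _).trans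
      (mul_le_mul_of_nonneg_left (hyB n r hr) (by positivity))
    have e3 : |primitiveF (fn n) (v n r)| ≤ M * B := (abs_primitiveF_le (hfM n) _).trans
      (mul_le_mul_of_nonneg_left (hvB n r hr.2) (by positivity))
    simp only [hG]
    rw [abs_mul, abs_of_pos (hq.pos hr0)]
    refine mul_le_mul (hq.mono hr0 hr.2) ?_ (abs_nonneg _) (hq.pos (hε.trans hερ)).le
    exact (abs_sub _ _).trans (add_le_add ((abs_sub _ _).trans (add_le_add e1 e2)) e3)
  have hincr : ∀ n, IncrBound (A n) (G n) 0 (Icc ε ρ) := fun n =>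
    incrBound_of_hasDerivAt ordConnected_Icc (hAc n).continuousOn
      fun r hr => hAd n r (by rwa [interior_Icc] at hr)
  obtain ⟨A0, hA⟩ := exists_contConv (U := U) ordConnected_Icc (tendsto_const_nhds (x := (0 : ℝ)))
    hincr (fun r _ => ⟨_, 1, one_pos, Eventually.of_forall fun n t ht _ => hGb n t ht⟩)
    (fun r hr => ⟨q ρ * (b' * M' + M' * b' + M * B) * (r - ε), Eventually.of_forall fun n => by
      have := abs_sub_le_of_hasDerivAt hr.1 (hAc n).continuousOn
        (fun t ht => hAd n t ⟨ht.1, ht.2.trans_le hr.2⟩)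
        fun t ht => hGb n t ⟨ht.1.le, ht.2.le.trans hr.2⟩
      rwa [hA0 n, sub_zero] at this⟩)
  have hρm : ρ ∈ Icc ε ρ := ⟨hερ.le, le_rfl⟩
  have hεm : ε ∈ Icc ε ρ := ⟨le_rfl, hερ.le⟩
  have hcl : ∀ r ∈ Icc ε ρ, ∀ s, |s| ≤ |y0 r| → clampTo (-b') b' s = s := fun r hr s hs => by
    refine clampTo_eq (abs_le.1 (hs.trans ?_))
    exact le_of_tendsto (hy.tendsto (hIcc hr)).abs (Eventually.of_forall fun n => hyB n r hr)
  have hgeq : ∀ r ∈ Icc ε ρ, gc (y0 r) = g (y0 r) := fun r hr => by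
    simp only [hgc]; rw [hcl r hr _ le_rfl]
  have hGeq : ∀ r ∈ Icc ε ρ, primitiveF gc (y0 r) = primitiveF g (y0 r) := fun r hr =>
    primitiveF_congr (a := -|y0 r|) (b := |y0 r|) (by simp) (abs_nonneg _) (abs_le.1 le_rfl)
      fun t ht => by simp only [hgc]; rw [hcl r hr t (abs_le.2 ht)]
  have hendlim : Tendsto (fun n => v n ρ ^ 2 + (q ρ * y n ρ) ^ 2) U
      (𝓝 (v0 ρ ^ 2 + (q ρ * y0 ρ) ^ 2)) :=
    ((hv.tendsto (hIcc hρm)).pow 2).add (((hy.tendsto (hIcc hρm)).const_mul _).pow 2)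
  refine ⟨d0, v0, y0, A0, hd0.1, hS0.congr (fun r h1 h2 => hgeq r ⟨h1.le, h2.le⟩) fun _ _ _ => rfl,
    hA.continuousOn, tendsto_nhds_unique (hA.tendsto hεm) (by simp [hA0]),
    le_of_tendsto (hA.tendsto hρm) (Eventually.of_forall hAρ), fun r hr => ?_,
    le_of_tendsto hendlim (Eventually.of_forall hend), ?_⟩
  · have hr' := Ioo_subset_Icc_self hr
    have := (hasDerivWithinAt_of_contConv ordConnected_Icc (tendsto_const_nhds (x := (0 : ℝ))) hincr
      hA hr' fun ε' hε' => hGc.eventually hr' hε').hasDerivAt (Icc_mem_nhds hr.1 hr.2)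
    simp only [hG0] at this
    rwa [hgeq r hr', hGeq r hr'] at this
  rcases U.eventually_or.1 (Eventually.of_forall halt) with h1 | h1
  · exact Or.inl (tendsto_nhds_unique hendlim (tendsto_const_nhds.congr'
      (h1.mono fun n hn => hn.symm)))
  right
  have hex : ∀ n, (∃ r, Alternates ε ρ (v n) (y n) m r) → ∃ r, Alternates ε ρ (v n) (y n) m r :=
    fun _ h => h
  choose! r hr using hex
  have hlim : ∀ j ≤ m, ∃ x ∈ Icc ε ρ, Tendsto (fun n => r n j) U (𝓝 x) := fun j hj =>
    exists_tendsto_of_mem_Icc U (h1.mono fun n hn => (hr n hn j hj).1)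
  choose! x hx using hlim
  refine ⟨x, fun j hj => ?_⟩
  obtain ⟨hxI, hxl⟩ := hx j hj.le
  have hmem : ∀ᶠ n in (U : Filter ℕ), r n j ∈ Iic ρ := h1.mono fun n hn => hIcc (hr n hn j hj.le).1
  have hvl := hv.tendsto_comp (hIcc hxI) hxl hmem
  have hpos : ∀ᶠ n in (U : Filter ℕ), 0 ≤ primitiveF (fn n) (v n (r n j)) :=
    h1.mono fun n hn => (hr n hn).primitiveF_nonneg hq hε.le (hgnc n) (hfnc n) (hgns n) (hSol n) hj
  refine ⟨hxI, ?_, ?_, ?_, fun hj1 => ?_⟩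
  · refine tendsto_nhds_unique (hy.tendsto_comp (hIcc hxI) hxl hmem) (tendsto_const_nhds.congr' ?_)
    exact h1.mono fun n hn => (hr n hn j hj.le).2.1.symm
  -- Strict signs survive the limit because a nonzero value with nonnegative potential lies outside
  -- the well, hence at distance at least `min βp (-βm)` from zero.
  · have hs0 : 0 < min βp (-βm) := lt_min hw.pos_right (neg_pos.2 hw.neg_left)
    refine hs0.trans_le (ge_of_tendsto (hvl.const_mul _) ?_)
    filter_upwards [h1, hpos] with n hn hn'
    have hs := (hr n hn j hj.le).2.2.1
    by_contra hcon
    have habs : |v n (r n j)| < min βp (-βm) := by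
      rwa [not_le, ← abs_of_pos hs, abs_mul, abs_pow, abs_neg, abs_one, one_pow, one_mul] at hcon
    have h3 := abs_lt.1 habs
    exact hn'.not_gt (hfw n _ ⟨by linarith [min_le_right βp (-βm)], by
      linarith [min_le_left βp (-βm)]⟩ fun h0 => by simp [h0] at hs)
  · exact ge_of_tendsto ((hFt _).comp (tendsto_id.prodMk hvl)) hpos
  · exact le_of_tendsto_of_tendsto hxl (hx (j + 1) hj1.le).2
      (h1.mono fun n hn => (hr n hn j hj.le).2.2.2 hj)

lemma primitiveF_phi (hm : 1 < m) (s : ℝ) : primitiveF (phi m) s = kin m s := by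
  rw [primitiveF, intervalIntegral.integral_eq_sub_of_hasDerivAt (fun x _ => hasDerivAt_kin hm x)
    ((continuous_phi hm).intervalIntegrable _ _), kin_zero hm, sub_zero]

lemma DoubleWell.clamp (hw : DoubleWell f βm βp) (h1 : βp ≤ b)
    (h2 : -b ≤ βm) : DoubleWell (fun s => f (clampTo (-b) b s)) βm βp := by
  have hb : 0 ≤ b := hw.pos_right.le.trans h1
  have hF : ∀ s ∈ Icc (-b) b, primitiveF (fun s => f (clampTo (-b) b s)) s = primitiveF f s :=
    fun s hs => primitiveF_congr (by linarith) hb hs fun t ht => by rw [clampTo_eq ht]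
  have h3 := hw.neg_left
  have h4 := hw.pos_right
  refine ⟨hw.cont.comp (continuous_clampTo _ _), ?_, h3, h4, fun s hs hs0 => ?_, ?_, ?_,
    fun s hs => hw.pos _ (le_max_of_le_right (le_min h1 hs)),
    fun s hs => hw.neg _ (max_le h2 ((min_le_right _ _).trans hs))⟩
  · rw [clampTo_eq ⟨by linarith, hb⟩, hw.map_zero]
  · rw [hF s ⟨by linarith [hs.1], by linarith [hs.2]⟩]; exact hw.well s hs hs0
  · rw [hF βm ⟨h2, by linarith⟩, hw.left_eq]
  · rw [hF βp ⟨by linarith, h1⟩, hw.right_eq]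

/-- The energy at the end point is bounded in terms of the size of the end point. -/
lemma exists_energy_le (hf : Continuous f) (hp : 1 < p') (X Y : ℝ) :
    ∃ C, 0 ≤ C ∧ ∀ s t, |s| ≤ X → |t| ≤ Y → kin p' t + primitiveF f s ≤ C := by
  obtain ⟨C, hC⟩ := (isCompact_Icc.prod isCompact_Icc).exists_bound_of_continuousOn
    (s := Icc (-X) X ×ˢ Icc (-Y) Y) (f := fun z : ℝ × ℝ => kin p' z.2 + primitiveF f z.1)
    (by have := continuous_kin hp; have := continuous_primitiveF hf; fun_prop)
  exact ⟨max C 0, le_max_right _ _, fun s t hs ht => (le_abs_self _).trans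
    ((hC (s, t) ⟨abs_le.1 hs, abs_le.1 ht⟩).trans (le_max_left _ _))⟩

/-- The size of the end point bounds the energy at `ρ`, and `weighted_energy_mono` bounds it
backwards up to `ε`. As `F` is unbounded on both sides, a truncation chosen after this bound `E` is
never felt. The truncation depends on `ε`; the bound of the action does not. -/
lemma exists_alternating (hp : 1 < p') (hq : IsAdmissibleWeight p q) (hw : DoubleWell f βm βp)
    (hF : Tendsto (primitiveF f) atTop atTop) (hF' : Tendsto (primitiveF f) atBot atTop)
    (hε : 0 < ε) (hερ : ε < ρ) (m : ℕ) :
    ∃ (d : ℝ) (v y A : ℝ → ℝ), 0 ≤ d ∧ Sol (phi p') q f ε d ρ v y ∧ ContinuousOn A (Icc ε ρ) ∧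
      A ε = 0 ∧ A ρ ≤ sectorArea x0 (-((m + 1 / 2) * π)) + Real.exp x0 ^ 2 / 2 ∧
      (∀ r ∈ Ioo ε ρ, HasDerivAt A (q r * (y r * phi p' (y r) - energy (kin p') f v y r)) r) ∧
      |v ρ| ≤ Real.exp x0 ∧ |y ρ| ≤ Real.exp x0 / q ρ ∧
      (v ρ ^ 2 + (q ρ * y ρ) ^ 2 = Real.exp x0 ^ 2 ∨ ∃ r : ℕ → ℝ, ∀ j < m, r j ∈ Icc ε ρ ∧
        y (r j) = 0 ∧ 0 < (-1) ^ j * v (r j) ∧ 0 ≤ primitiveF f (v (r j)) ∧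
        (j + 1 < m → r j ≤ r (j + 1))) := by
  have hρ := hε.trans hερ
  have hqε := hq.pos hε
  have hqρ := hq.pos hρ
  obtain ⟨B, hB0, hB⟩ := hw.exists_lower_bound
  obtain ⟨C, hC0, hC⟩ := exists_energy_le hw.cont hp (Real.exp x0) (Real.exp x0 / q ρ)
  set E := q ρ ^ p' * (C + B) / q ε ^ p' with hE
  obtain ⟨b, hb1, hb2, hb3, hb4, hb5⟩ := ((eventually_ge_atTop βp).and
    ((eventually_ge_atTop (-βm)).and ((eventually_ge_atTop (Real.exp x0)).and
    ((hF.eventually (eventually_gt_atTop E)).and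
    ((hF'.comp tendsto_neg_atTop_atBot).eventually (eventually_gt_atTop E)))))).exists
  have hb0 : 0 ≤ b := hw.pos_right.le.trans hb1
  have hbb : -b ≤ b := by linarith
  set fc : ℝ → ℝ := fun s => f (clampTo (-b) b s) with hfc
  have hwc : DoubleWell fc βm βp := hw.clamp hb1 (by linarith)
  have hFc : ∀ s ∈ Icc (-b) b, primitiveF fc s = primitiveF f s := fun s hs =>
    primitiveF_congr (by linarith) hb0 hs fun t ht => by simp only [hfc]; rw [clampTo_eq ht]
  have hup : ∀ s, b ≤ s → E < primitiveF fc s := fun s hs => by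
    refine lt_of_lt_of_le ?_ (hwc.strictMonoOn.monotoneOn hb1 (hb1.trans hs) hs)
    rwa [hFc b ⟨hbb, le_rfl⟩]
  have hdn : ∀ s, s ≤ -b → E < primitiveF fc s := fun s hs => by
    have := hwc.reflect.strictMonoOn.monotoneOn (show b ∈ Ici (-βm) from hb2)
      (show -s ∈ Ici (-βm) from mem_Ici.2 (by linarith)) (by linarith)
    rw [primitiveF_reflect, primitiveF_reflect, neg_neg, hFc (-b) ⟨le_rfl, hbb⟩] at this
    exact lt_of_lt_of_le hb5 this
  have hE0 : 0 ≤ E := by positivity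
  have hFcB : ∀ s, -B ≤ primitiveF fc s := fun s => by
    rcases le_total b s with h1 | h1
    · linarith [hup s h1]
    rcases le_total s (-b) with h2 | h2
    · linarith [hdn s h2]
    · rw [hFc s ⟨h2, h1⟩]; exact hB s
  have hgs := mul_phi_nonneg hp
  obtain ⟨d, v, y, A, hd, hS, hAc, hA0, hAρ, hAd, hend, halt⟩ := exists_alternating_of_clamped
    (x0 := x0) hq (continuous_phi hp) (phi_zero _) hgs hwc hb0 (fun s => by
      simp only [hfc]; rw [clampTo_eq (clampTo_mem hbb s)]) hε hερ m
  have hX := exp_pos x0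
  have hvρ : |v ρ| ≤ Real.exp x0 :=
    abs_le_of_sq_le_sq (by nlinarith [sq_nonneg (q ρ * y ρ)]) hX.le
  have hyρ : |y ρ| ≤ Real.exp x0 / q ρ := by
    have : |q ρ * y ρ| ≤ Real.exp x0 := abs_le_of_sq_le_sq (by nlinarith [sq_nonneg (v ρ)]) hX.le
    rw [abs_mul, abs_of_pos hqρ] at this
    rwa [le_div_iff₀' hqρ]
  have hk := hasDerivAt_kin hp
  have hen : ∀ r ∈ Icc ε ρ, energy (kin p') fc v y r ≤ E := by
    intro r hr
    refine (hS.energy_anti hq hε.le hwc.cont hk hgs le_rfl hr.1 hr.2).trans ?_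
    have h1 := hS.weighted_energy_mono hq hwc.cont hk (m := p') (B := B) (by linarith)
      (fun s => (mul_phi_eq_kin hp s).le) hε le_rfl hερ.le le_rfl fun r _ => hFcB _
    have h2 : energy (kin p') fc v y ρ ≤ C := by
      rw [energy, hFc _ (abs_le.1 (hvρ.trans hb3))]; exact hC _ _ hvρ hyρ
    have h3 : 0 < q ε ^ p' := rpow_pos_of_pos hqε _
    have h4 : energy (kin p') fc v y ε + B ≤ E := by
      rw [hE, le_div_iff₀ h3, mul_comm]
      refine h1.trans (mul_le_mul_of_nonneg_left (by linarith) (by positivity))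
    linarith
  have hvb : ∀ r ∈ Icc ε ρ, v r ∈ Icc (-b) b := by
    intro r hr
    have h1 := hen r hr
    have h2 := kin_nonneg hp (y r)
    rw [energy] at h1
    constructor <;> by_contra hcon
    · linarith [hdn (v r) (not_le.1 hcon).le]
    · linarith [hup (v r) (not_le.1 hcon).le]
  refine ⟨d, v, y, A, hd, hS.congr (fun _ _ _ => rfl) fun r h1 h2 => ?_, hAc, hA0, hAρ,
    fun r hr => ?_, hvρ, hyρ, halt.imp id ?_⟩
  · simp only [hfc]; rw [clampTo_eq (hvb r ⟨h1.le, h2.le⟩)]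
  · have := hAd r hr
    rwa [primitiveF_phi hp, hFc _ (hvb r ⟨hr.1.le, hr.2.le⟩), sub_sub] at this
  · rintro ⟨r, hr⟩
    refine ⟨r, fun j hj => ?_⟩
    have := hr j hj
    rwa [hFc _ (hvb _ this.1)] at this

/-! ### Sub-criticality and bounds of the height -/

/-- A solution stays close to its initial value for a time that depends on the size of `f`. -/
lemma Sol.mem_of_small_time
    (hp : 1 < p') (hq : IsAdmissibleWeight p q) (hw : DoubleWell f βm βp) (ha : 0 ≤ a)
    (h : Sol (phi p') q f a d T v y) {R : ℝ} (hα : α ∈ Ioo (0 : ℝ) 1) (hd : βp ≤ α * d)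
    (hm : 0 < m) (hfm : ∀ s ∈ Icc (α * d) d, f s ≤ m) (hR : phi p' m * R ^ p' = (1 - α) * d) (har : a ≤ r) (hrR : r ≤ a + R) (hrT : r ≤ T) : α * d < v r ∧ v r ≤ d ∧ y r ≤ 0 := by
  have hαd : 0 < α * d := hw.pos_right.trans_le hd
  have hd0 : 0 < d := pos_of_mul_pos_right hαd hα.1.le
  have hαd' : α * d < d := by nlinarith [hα.2]
  have key : ∀ t ∈ Icc a T, (∀ s ∈ Ico a t, α * d < v s) → v t ≤ d ∧ y t ≤ 0 := by
    intro t ht hs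
    have hy : ∀ s ∈ Icc a t, y s ≤ 0 := by
      intro s hst
      rcases eq_or_lt_of_le hst.1 with he | hlt
      · rw [← he, (h.init a le_rfl).2]
      have := h.flux_le hq ha le_rfl hst.1 (hst.2.trans ht.2) (c := 0) fun x hx =>
        (hw.pos _ (hd.trans (hs x ⟨hx.1.le, hx.2.trans_le hst.2⟩).le)).le
      rw [(h.init a le_rfl).2, zero_mul, mul_zero, add_zero, extWeight_of_pos q (ha.trans_lt hlt)]
        at this
      exact nonpos_of_mul_nonpos_right this (hq.pos (ha.trans_lt hlt))
    have := le_of_hasDerivAt_nonneg (u := fun x => -v x) ht.1 h.cont_v.neg.continuousOn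
      (fun x hx => (h.deriv_v x hx.1 (hx.2.trans_le ht.2)).neg) fun x hx => by
        have := phi_mono hp (hy x ⟨hx.1.le, hx.2.le⟩)
        rw [phi_zero] at this; linarith
    rw [(h.init a le_rfl).1] at this
    exact ⟨by linarith, hy t ⟨ht.1, le_rfl⟩⟩
  have hva : α * d < v a := by rw [(h.init a le_rfl).1]; exact hαd'
  have hall : ∀ t ∈ Icc a r, α * d < v t := by
    intro t ht
    by_contra hcon
    obtain ⟨z, hz, hvz, hlt⟩ := exists_first_le h.cont_v ht.1 hva (not_lt.1 hcon)
    have hzT : z ≤ T := hz.2.trans (ht.2.trans hrT)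
    have hy : ∀ x ∈ Ioo a z, -(m * (x - a)) ≤ y x := fun x hx =>
      (abs_le.1 (h.abs_flux_le hq ha hx.1.le (hx.2.le.trans hzT) fun s hs => by
        have h1 := hlt s ⟨hs.1.le, hs.2.trans hx.2⟩
        have h2 := key s ⟨hs.1.le, (hs.2.trans hx.2).le.trans hzT⟩ fun x' hx' =>
          hlt x' ⟨hx'.1, hx'.2.trans (hs.2.trans hx.2)⟩
        rw [abs_of_pos (hw.pos _ (hd.trans h1.le))]
        exact hfm _ ⟨h1.le, h2.1⟩)).1
    -- From `y ≥ -m (x - a)` the fall of `v` up to `z` is at most `kin p' (m (z - a)) / m`. The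
    -- choice of `R` makes this at most `(1 - α) d / p'`, which is less than the fall `(1 - α) d`
    -- needed to reach `α d`.
    have h1 := le_of_hasDerivAt_nonneg (u := fun x => v x + kin p' (m * (x - a)) / m)
      (u' := fun x => phi p' (y x) + phi p' (m * (x - a))) hz.1.le
      (by have := continuous_kin hp; have := h.cont_v; fun_prop)
      (fun x hx => (h.deriv_v x hx.1 (hx.2.trans_le hzT)).add
        ((((hasDerivAt_kin hp _).comp x (((hasDerivAt_id x).sub_const a).const_mul m)).div_const
          m).congr_deriv (by simp [hm.ne'])))
      fun x hx => by
        have := phi_mono hp (hy x hx)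
        rw [phi_neg] at this; linarith
    simp only [sub_self, mul_zero, kin_zero hp, zero_div, add_zero] at h1
    rw [(h.init a le_rfl).1, hvz] at h1
    have hza : 0 ≤ z - a := by linarith [hz.1]
    have h2 : kin p' (m * (z - a)) / m ≤ (1 - α) * d / p' := by
      have e1 : phi p' m * m = m ^ p' := by rw [mul_comm, mul_phi hp, abs_of_pos hm]
      have e2 : (z - a) ^ p' ≤ R ^ p' :=
        rpow_le_rpow hza (by linarith [hz.2, ht.2]) (by linarith)
      rw [kin, abs_of_nonneg (by positivity), mul_rpow hm.le hza, ← e1, ← hR]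
      have := phi_pos (m := p') hm
      rw [div_div, mul_right_comm, mul_comm p' m, ← div_div, mul_div_cancel_right₀ _ hm.ne']
      gcongr
    have h3 : (1 - α) * d / p' < (1 - α) * d :=
      div_lt_self (mul_pos (by linarith [hα.2]) hd0) hp
    linarith
  have := key r ⟨har, hrT⟩ fun s hs => hall s ⟨hs.1, hs.2.le⟩
  exact ⟨hall r ⟨har, le_rfl⟩, this⟩

lemma IsAdmissibleNonlinearity.lipschitzOffZeros (hf : IsAdmissibleNonlinearity f) :
    LipschitzOffZeros f := by
  intro s hs
  have hs0 : s ∈ ({0}ᶜ : Set ℝ) := fun h => hs (by rw [mem_singleton_iff.1 h, hf.map_zero])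
  obtain ⟨K, t, ht, hK⟩ := hf.locallyLipschitzOn hs0
  rw [isOpen_compl_singleton.nhdsWithin_eq hs0] at ht
  exact ⟨K, t, ht, hK⟩

/-- The sub-criticality condition with the parameters `α` and `μ`. -/
def Subcritical (p α μ : ℝ) (q f : ℝ → ℝ) : Prop :=
  ∀ C, ∀ᶠ s in atTop, ∀ s1 ∈ Icc (α * s) s, ∀ s2 ∈ Icc (α * s) s, C ≤ subcritExpr p α μ q f s s1 s2

lemma subcritical_of_tendsto
    (h : Tendsto (fun s => sInf ((fun x : ℝ × ℝ => subcritExpr p α μ q f s x.1 x.2) ''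
      (Icc (α * s) s ×ˢ Icc (α * s) s))) atTop atTop) : Subcritical p α μ q f := by
  intro C
  -- The real infimum of a set that is unbounded below is 0 by convention; the 1 in the maximum
  -- excludes this case.
  filter_upwards [h.eventually (eventually_ge_atTop (max C 1))] with s hs s1 h1 s2 h2
  have hb : BddBelow ((fun x : ℝ × ℝ => subcritExpr p α μ q f s x.1 x.2) ''
      (Icc (α * s) s ×ˢ Icc (α * s) s)) := by
    by_contra hcon
    rw [Real.sInf_of_not_bddBelow hcon] at hs
    linarith [le_max_right C 1]
  exact (le_max_left C 1).trans (hs.trans (csInf_le hb ⟨(s1, s2), ⟨h1, h2⟩, rfl⟩))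

/-- The radius that the sub-criticality condition provides for a large height `d`. -/
lemma exists_radius (hpp : p.HolderConjugate p')
    (hq : IsAdmissibleWeight p q) (hw : DoubleWell f βm βp) (hα : α ∈ Ioo (0 : ℝ) 1)
    (hd : βp ≤ α * d) (hC : 0 < C)
    (h : ∀ s1 ∈ Icc (α * d) d, ∀ s2 ∈ Icc (α * d) d, C ≤ subcritExpr p α μ q f d s1 s2) :
    ∃ m G R : ℝ, 0 < m ∧ 0 < G ∧ 0 < R ∧ (∃ s ∈ Icc (α * d) d, m = f s) ∧
      (∀ s ∈ Icc (α * d) d, f s ≤ m) ∧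
      (∀ s ∈ Icc (α * d) d, G ≤ primitiveF f s - μ * s * f s) ∧ phi p' m * R ^ p' = (1 - α) * d ∧
      C ≤ G * primitiveQ q R ∧ ∃ s ∈ Icc (α * d) d, G = primitiveF f s - μ * s * f s := by
  have hp := hpp.symm.lt
  have hαd : 0 < α * d := hw.pos_right.trans_le hd
  have hd0 : 0 < d := pos_of_mul_pos_right hαd hα.1.le
  have hαd' : α * d ≤ d := by nlinarith [hα.2]
  have hne : (Icc (α * d) d).Nonempty := nonempty_Icc.2 hαd'
  obtain ⟨s1, hs1, h1⟩ := isCompact_Icc.exists_isMaxOn hne hw.cont.continuousOn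
  obtain ⟨s2, hs2, h2⟩ := isCompact_Icc.exists_isMinOn hne
    (f := fun s => primitiveF f s - μ * s * f s) (by
      have := continuous_primitiveF hw.cont; have := hw.cont; fun_prop)
  have hm : 0 < f s1 := hw.pos _ (hd.trans hs1.1)
  have hφ := phi_pos (m := p') hm
  have hbase : 0 < (1 - α) * d / phi p' (f s1) :=
    div_pos (mul_pos (by linarith [hα.2]) hd0) hφ
  have hR : 0 < ((1 - α) * d / phi p' (f s1)) ^ (1 / p') := rpow_pos_of_pos hbase _
  have hexpr := h s1 hs1 s2 hs2
  rw [subcritExpr, hpp.conjExponent_eq] at hexpr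
  refine ⟨f s1, _, _, hm, ?_, hR, ⟨s1, hs1, rfl⟩, fun s hs => h1 hs, fun s hs => h2 hs, ?_, hexpr,
    ⟨s2, hs2, rfl⟩⟩
  · exact pos_of_mul_pos_left (hC.trans_le hexpr) (hq.primitiveQ_pos hR).le
  · rw [← rpow_mul hbase.le, one_div_mul_cancel (by linarith), rpow_one,
      mul_div_cancel₀ _ hφ.ne']

lemma IsAdmissibleWeight.ratioDeriv_eq (hq : IsAdmissibleWeight p q)
    (hr : 0 < r) : ratioDeriv q r = 1 - primitiveQ q r * (deriv q r / q r) / q r := by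
  have h0 := (hq.pos hr).ne'
  rw [ratioDeriv, ((hq.hasDerivAt_primitiveQ hr).fun_div (hq.hasDerivAt hr) h0).deriv]
  field_simp

/-- The action bounds the initial height in the sub-critical range. -/
lemma exists_height_bound {X : ℝ}
    (hpp : p.HolderConjugate p') (hq : IsAdmissibleWeight p q) (hw : DoubleWell f βm βp)
    (hα : α ∈ Ioo (0 : ℝ) 1) (hμ : 0 ≤ μ) (hc : 0 < c) (hcμ : c = 1 / p - μ) (hρ : 0 < ρ)
    (hratio : ∀ r ∈ Ioo 0 ρ, c ≤ ratioDeriv q r) (hsc : Subcritical p α μ q f) :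
    ∃ D, ∀ {ε d : ℝ} {v y A : ℝ → ℝ}, 0 < ε → ε < ρ → βp ≤ d → Sol (phi p') q f ε d ρ v y →
      ContinuousOn A (Icc ε ρ) → A ε = 0 → A ρ ≤ C →
      (∀ r ∈ Ioo ε ρ, HasDerivAt A (q r * (y r * phi p' (y r) - energy (kin p') f v y r)) r) →
      |v ρ| ≤ X → |y ρ| ≤ X / q ρ → d ≤ D := by
  have hp := hpp.symm.lt
  obtain ⟨B, hB0, hB⟩ := hw.exists_lower_bound
  obtain ⟨E, hE0, hE⟩ := exists_energy_le hw.cont hp X (X / q ρ)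
  have hQρ := hq.primitiveQ_pos hρ
  -- A bound of the value at `ρ` of the monotone quantity in `hQI_le`, in terms of the end energy
  -- `E` and the action `C`; it does not involve `ε` or `d`.
  set C2 := primitiveQ q ρ * E + (|C| + primitiveQ q ρ * E) / c + B * primitiveQ q ρ with hC2
  have hC20 : 0 ≤ C2 := by positivity
  obtain ⟨D, hD⟩ := ((hsc (C2 + 1)).and ((eventually_ge_atTop (βp / α)).and
    (eventually_gt_atTop (X / α)))).exists_forall_of_atTop
  refine ⟨D, fun {ε d v y A} hε hερ hβd hS hAc hA0 hAρ hAd hvρ hyρ => ?_⟩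
  by_contra hcon
  obtain ⟨hscd, hβα, hXα⟩ := hD d (not_le.1 hcon).le
  rw [div_le_iff₀' hα.1] at hβα
  rw [div_lt_iff₀' hα.1] at hXα
  obtain ⟨m, G, R, hm, hG, hR, -, hfm, hGF, hmR, hGQ, -⟩ :=
    exists_radius hpp hq hw hα hβα (by linarith) hscd
  have hd0 : 0 < d := hw.pos_right.trans_le hβd
  have hdI : d ∈ Icc (α * d) d := ⟨by nlinarith [hα.2], le_rfl⟩
  have hGFd : G ≤ primitiveF f d := (hGF d hdI).trans (by
    have := mul_nonneg (mul_nonneg hμ hd0.le) (hw.pos d hβd).le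
    linarith)
  set I := energy (kin p') f v y with hI
  have hIε : I ε = primitiveF f d := hS.energy_start (kin_zero hp)
  have hk := hasDerivAt_kin hp
  have hIc : Continuous I := hS.continuous_energy hw.cont hk
  have hQc : ContinuousOn (primitiveQ q) (Icc ε ρ) :=
    hq.continuousOn_primitiveQ.mono fun r hr => hε.le.trans hr.1
  have hQI : ∀ r ∈ Ioo ε ρ, HasDerivAt (fun r => primitiveQ q r * I r)
      (q r * I r + primitiveQ q r * -(deriv q r / q r * (y r * phi p' (y r)))) r := fun r hr =>
    (hq.hasDerivAt_primitiveQ (hε.trans hr.1)).mul (hS.hasDerivAt_energy hw.cont hk hr.1 hr.2)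
  have hrd : ∀ r ∈ Ioo ε ρ, primitiveQ q r * (deriv q r / q r) = q r - q r * ratioDeriv q r :=
    fun r hr => by
      have h0 := (hq.pos (hε.trans hr.1)).ne'
      rw [hq.ratioDeriv_eq (hε.trans hr.1)]; field_simp; ring
  have hφ := mul_phi_nonneg hp
  -- In the Pohozaev identity for `Q I` the action cancels all terms except `q (Q/q)' y φ(y) ≥ 0`,
  -- so no sign of `F(v) - μ v f(v)` is needed.
  have hX' : ∀ r ∈ Ioo ε ρ, HasDerivAt (fun r => A r + primitiveQ q r * I r)
      (q r * ratioDeriv q r * (y r * phi p' (y r))) r := fun r hr =>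
    ((hAd r hr).add (hQI r hr)).congr_deriv (by linear_combination -(y r * phi p' (y r)) * hrd r hr)
  have hlow : ∀ r ∈ Icc ε ρ, 0 ≤ A r + primitiveQ q r * I r := by
    intro r hr
    have hsub : Icc ε r ⊆ Icc ε ρ := Icc_subset_Icc_right hr.2
    have := le_of_hasDerivAt_nonneg hr.1 ((hAc.add (hQc.mul hIc.continuousOn)).mono hsub)
      (fun t ht => hX' t ⟨ht.1, ht.2.trans_le hr.2⟩) fun t ht => by
        have h1 := hratio t ⟨hε.trans ht.1, ht.2.trans_le hr.2⟩
        exact mul_nonneg (mul_nonneg (hq.pos (hε.trans ht.1)).le (hc.le.trans h1)) (hφ _)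
    have h0 : 0 ≤ A ε + primitiveQ q ε * I ε := by
      rw [hA0, hIε, zero_add]; exact mul_nonneg (hq.primitiveQ_pos hε).le (hG.le.trans hGFd)
    exact h0.trans this
  -- The negative term in `(Q I)'` is absorbed by `(A + Q I)' / c`, because `(Q/q)' ≥ c`, and the
  -- negative part of the energy by `B Q'`. The sum is nondecreasing and bounded at `ρ`.
  have hQI_le : ∀ r ∈ Icc ε ρ, primitiveQ q r * I r ≤ C2 := by
    intro r hr
    have hsub : Icc r ρ ⊆ Icc ε ρ := Icc_subset_Icc_left hr.1
    have h1 := le_of_hasDerivAt_nonneg (u := fun r => primitiveQ q r * I r +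
      (A r + primitiveQ q r * I r) / c + B * primitiveQ q r) hr.2
      (((hQc.mul hIc.continuousOn).add ((hAc.add (hQc.mul hIc.continuousOn)).div_const c)).add
        (hQc.const_mul B) |>.mono hsub)
      (fun t ht => ((hQI t ⟨hr.1.trans_lt ht.1, ht.2⟩).add
        ((hX' t ⟨hr.1.trans_lt ht.1, ht.2⟩).div_const c)).add
        ((hq.hasDerivAt_primitiveQ (hε.trans_le (hr.1.trans ht.1.le))).const_mul B)) fun t ht => by
        have ht0 := hε.trans (hr.1.trans_lt ht.1)
        have e1 := hratio t ⟨ht0, ht.2⟩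
        have e2 := hrd t ⟨hr.1.trans_lt ht.1, ht.2⟩
        have e3 : 0 ≤ I t + B := by
          have := hB (v t); have := kin_nonneg hp (y t); simp only [hI, energy]; linarith
        have e4 := (one_le_div hc).2 e1
        have e5 := hq.pos ht0
        have e6 : 0 ≤ q t * (y t * phi p' (y t)) := mul_nonneg e5.le (hφ _)
        have e7 := mul_nonneg e5.le e3
        have e8 := mul_nonneg e6 (show 0 ≤ ratioDeriv q t - 1 + ratioDeriv q t / c by linarith)
        exact (add_nonneg e7 e8).trans_eq (by linear_combination y t * phi p' (y t) * e2)
    have h2 : I ρ ≤ E := hE _ _ hvρ hyρ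
    have h3 : primitiveQ q ρ * I ρ ≤ primitiveQ q ρ * E := mul_le_mul_of_nonneg_left h2 hQρ.le
    have h4 : (A ρ + primitiveQ q ρ * I ρ) / c ≤ (|C| + primitiveQ q ρ * E) / c := by
      gcongr; exact hAρ.trans (le_abs_self C)
    have h5 : 0 ≤ (A r + primitiveQ q r * I r) / c := div_nonneg (hlow r hr) hc.le
    have h6 : 0 ≤ B * primitiveQ q r :=
      mul_nonneg hB0 (hq.primitiveQ_pos (hε.trans_le hr.1)).le
    linarith
  have hstay : ∀ r ∈ Icc ε ρ, r ≤ R → α * d < v r ∧ v r ≤ d ∧ y r ≤ 0 := fun r hr hrR =>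
    hS.mem_of_small_time hp hq hw hε.le hα hβα hm hfm hmR hr.1 (by linarith) hr.2
  rcases lt_or_ge ρ R with hρR | hRρ
  · have := (hstay ρ ⟨hερ.le, le_rfl⟩ hρR.le).1
    linarith [le_abs_self (v ρ)]
  have hQε := hq.primitiveQ_pos hε
  -- If the start lies beyond `R`, the initial energy alone contradicts the bound of `Q I`.
  -- Otherwise the Pohozaev identity is used on the first descent `[ε, R]`, where (SC) applies.
  rcases le_total R ε with hRε | hεR
  · have h1 := hQI_le ε ⟨le_rfl, hερ.le⟩
    rw [hIε] at h1
    have h2 : primitiveQ q R ≤ primitiveQ q ε := by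
      rcases eq_or_lt_of_le hRε with he | hlt
      · rw [he]
      · exact (hq.primitiveQ_strictMono hR.le hlt).le
    have h3 : G * primitiveQ q R ≤ primitiveF f d * primitiveQ q ε :=
      mul_le_mul hGFd h2 (hq.primitiveQ_pos hR).le (hG.le.trans hGFd)
    linarith
  · have hRm : R ∈ Icc ε ρ := ⟨hεR, hRρ⟩
    -- While `v` is in `[α d, d]`, the derivative of `Q I + μ q y v` is at least `q (F(v) - μ v
    -- f(v)) ≥ G q`. Since `y ≤ 0` at `R`, this gives `Q(R) I(R) ≥ G Q(R) ≥ C2 + 1`.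
    have h1 := le_of_hasDerivAt_nonneg (u := fun r => primitiveQ q r * I r +
      μ * (extWeight q r * y r * v r) - G * primitiveQ q r) hεR
      (((hQc.mul hIc.continuousOn).add (((hS.continuous_flux hq).mul hS.cont_v).const_mul
        μ).continuousOn).sub (hQc.const_mul G) |>.mono (Icc_subset_Icc_right hRρ))
      (fun t ht => ((hQI t ⟨ht.1, ht.2.trans_le hRρ⟩).add
        (((hS.hasDerivAt_flux hq hε.le ht.1 (ht.2.trans_le hRρ)).mul
          (hS.deriv_v t ht.1 (ht.2.trans_le hRρ))).const_mul μ)).sub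
        ((hq.hasDerivAt_primitiveQ (hε.trans ht.1)).const_mul G)) fun t ht => by
        have htρ := ht.2.trans_le hRρ
        have e0 := hq.pos (hε.trans ht.1)
        have e1 := hratio t ⟨hε.trans ht.1, htρ⟩
        have e2 := hrd t ⟨ht.1, htρ⟩
        have e3 := hstay t ⟨ht.1.le, htρ.le⟩ ht.2.le
        have e4 := hGF (v t) ⟨e3.1.le, e3.2.1⟩
        rw [extWeight_of_pos q (hε.trans ht.1)]
        have e6 : I t = (1 - 1 / p) * (y t * phi p' (y t)) + primitiveF f (v t) := by
          rw [mul_phi_eq_kin hp, ← mul_assoc, one_div, hpp.one_sub_inv, inv_mul_cancel₀ (by linarith),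
            one_mul]
          rfl
        have e7 := mul_nonneg e0.le (sub_nonneg.2 e4)
        have e8 := mul_nonneg (mul_nonneg e0.le (sub_nonneg.2 e1)) (hφ (y t))
        exact (add_nonneg e7 e8).trans_eq (by
          linear_combination y t * phi p' (y t) * e2 - q t * e6 - q t * (y t * phi p' (y t)) * hcμ)
    have e1 := hQI_le R hRm
    have e2 := hstay R hRm le_rfl
    have e3 : extWeight q R * y R * v R ≤ 0 := by
      rw [extWeight_of_pos q hR]
      exact mul_nonpos_of_nonpos_of_nonneg (mul_nonpos_of_nonneg_of_nonpos (hq.pos hR).le e2.2.2)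
        (by linarith [hw.pos_right])
    have e4 := mul_nonpos_of_nonneg_of_nonpos hμ e3
    have e5 : 0 ≤ primitiveQ q ε * (primitiveF f d - G) := mul_nonneg hQε.le (sub_nonneg.2 hGFd)
    simp only [(hS.init ε le_rfl).2, hIε, mul_zero, zero_mul, add_zero] at h1
    linarith

/-- A large end point has large energy. -/
lemma exists_radius_of_energy {κ : ℝ} (hp : 1 < p') (hκ : 0 < κ)
    (hw : DoubleWell f βm βp) (hF : Tendsto (primitiveF f) atTop atTop)
    (hF' : Tendsto (primitiveF f) atBot atTop) (E : ℝ) :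
    ∃ x0, ∀ s t, s ^ 2 + (κ * t) ^ 2 = Real.exp x0 ^ 2 → E ≤ kin p' t + primitiveF f s := by
  obtain ⟨B, hB0, hB⟩ := hw.exists_lower_bound
  have hkin : Tendsto (kin p') atTop atTop :=
    ((tendsto_rpow_atTop (show 0 < p' by linarith)).comp tendsto_abs_atTop_atTop).atTop_div_const
      (by linarith)
  obtain ⟨b, hb⟩ := ((hF.eventually (eventually_ge_atTop E)).and
    (((hF'.comp tendsto_neg_atTop_atBot).eventually (eventually_ge_atTop E)).and
    ((hkin.eventually (eventually_ge_atTop (E + B))).and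
    (eventually_gt_atTop 0)))).exists_forall_of_atTop
  have hb0 := (hb b le_rfl).2.2.2
  -- A radius with `s ^ 2 + (κ t) ^ 2 = (b + κ b) ^ 2` excludes that both `|s|` and `|t|` are below
  -- `b`.
  refine ⟨Real.log (b + κ * b), fun s t hst => ?_⟩
  rw [Real.exp_log (by positivity)] at hst
  rcases le_or_gt b |s| with h1 | h1
  · have hFs : E ≤ primitiveF f s := by
      rcases abs_cases s with ⟨h2, -⟩ | ⟨h2, -⟩ <;> rw [h2] at h1
      exacts [(hb s h1).1, by simpa using (hb (-s) h1).2.1]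
    linarith [kin_nonneg hp t]
  rcases le_or_gt b |t| with h2 | h2
  · have := (hb |t| h2).2.2.1
    rw [show kin p' |t| = kin p' t by simp [kin]] at this
    linarith [hB s]
  · have e1 : s ^ 2 < b ^ 2 := sq_lt_sq' (abs_lt.1 h1).1 (abs_lt.1 h1).2
    have e2 : t ^ 2 < b ^ 2 := sq_lt_sq' (abs_lt.1 h2).1 (abs_lt.1 h2).2
    have e3 : κ ^ 2 * t ^ 2 ≤ κ ^ 2 * b ^ 2 := by gcongr
    have e4 : 0 < κ * b * b := by positivity
    nlinarith

/-! ### Heights with many zeros -/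

section
variable {V Y : ℝ → ℝ → ℝ}

lemma IsFlow.eq_of_sol (hp : 1 < p') (hq : IsAdmissibleWeight p q) (hw : DoubleWell f βm βp)
    (hL : LipschitzOffZeros f) (hV : IsFlow p' q f (Ici βp) V Y)
    (hd : βp ≤ d) (h : Sol (phi p') q f 0 d T v y) (hrT : r ≤ T)
    (he : 0 < energy (kin p') f v y r) : v r = V d r ∧ y r = Y d r :=
  (h.mono hrT).unique hp hq hw.cont hL le_rfl (hV.sol d hd r) (fun _ hs hsr =>
    nonstationary_of_energy_pos hp hw (he.trans_le (h.energy_anti hq le_rfl hw.cont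
      (hasDerivAt_kin hp) (mul_phi_nonneg hp) hs hsr.le hrT))) le_rfl

/-- Between consecutive times there is a zero. If its energy were not positive, the energy would be
constant up to the next time, and so would `v`, which contradicts the sign there. By uniqueness at
positive energy the zeros belong to the solution of the given family. -/
lemma IsFlow.hasZeros_of_alternating (hp : 1 < p') (hq : IsAdmissibleWeight p q)
    (hw : DoubleWell f βm βp) (hL : LipschitzOffZeros f) (hV : IsFlow p' q f (Ici βp) V Y) (hd : βp ≤ d) (h : Sol (phi p') q f 0 d ρ v y) {r : ℕ → ℝ}
    (hr : ∀ j ≤ n, r j ∈ Icc 0 ρ ∧ 0 < (-1) ^ j * v (r j) ∧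
      0 ≤ energy (kin p') f v y (r j) ∧ (j < n → r j ≤ r (j + 1))) :
    HasZeros p' f (V d) (Y d) 0 n := by
  have hz : ∀ j < n, ∃ z ∈ Ioo (r j) (r (j + 1)), v z = 0 := by
    intro j hj
    obtain ⟨-, h1, -, h2⟩ := hr j hj.le
    obtain ⟨-, h1', -⟩ := hr (j + 1) hj
    have h0 : 0 ∈ uIcc ((-1) ^ j * v (r j)) ((-1) ^ j * v (r (j + 1))) :=
      mem_uIcc.2 (Or.inr ⟨by rw [pow_succ] at h1'; linarith, h1.le⟩)
    obtain ⟨z, hz, hvz⟩ := intermediate_value_uIcc (f := fun t => (-1) ^ j * v t)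
      (by have := h.cont_v; fun_prop) h0
    rw [uIcc_of_le (h2 hj)] at hz
    have hvz : v z = 0 := by simpa using hvz
    exact ⟨z, ⟨hz.1.lt_of_ne fun he => by simp [he, hvz] at h1,
      hz.2.lt_of_ne fun he => by simp [← he, hvz] at h1'⟩, hvz⟩
  choose! z hz using hz
  have hmono : StrictMonoOn z (Iio n) := by
    intro i hi j hj hij
    have hrm : ∀ k, i + 1 + k ≤ n → r (i + 1) ≤ r (i + 1 + k) := by
      intro k
      induction k with
      | zero => intro _; exact le_rfl
      | succ k ih => intro hk; exact (ih (by omega)).trans ((hr _ (by omega)).2.2.2 (by omega))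
    obtain ⟨k, rfl⟩ := Nat.exists_eq_add_of_le (show i + 1 ≤ j from hij)
    have hj' : i + 1 + k < n := hj
    exact (hz i hi).1.2.trans_le ((hrm k hj'.le).trans (hz _ hj).1.1.le)
  refine ⟨(Finset.range n).image z, ?_, fun x hx => ?_⟩
  · rw [Finset.card_image_of_injOn, Finset.card_range]
    exact hmono.injOn.mono fun i hi => Finset.mem_range.1 hi
  obtain ⟨j, hj, rfl⟩ := Finset.mem_image.1 hx
  have hj := Finset.mem_range.1 hj
  obtain ⟨hzI, hvz⟩ := hz j hj
  have hz0 : 0 < z j := (hr j hj.le).1.1.trans_lt hzI.1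
  obtain ⟨hrI, hs, he, -⟩ := hr (j + 1) hj
  have hpos : 0 < energy (kin p') f v y (z j) := by
    by_contra hcon
    have := h.eq_of_energy_le hp hq hw.cont le_rfl hz0.le hzI.2.le hrI.2 ((not_lt.1 hcon).trans he)
    simp [this, hvz] at hs
  obtain ⟨e1, e2⟩ := hV.eq_of_sol hp hq hw hL hd h (hzI.2.le.trans hrI.2) hpos
  refine ⟨hz0, by rw [← e1, hvz], ?_⟩
  rwa [energy, ← e1, ← e2]

/-- Solutions with many zeros in the sub-critical range. -/
lemma IsFlow.exists_hasZeros_of_subcritical (hpp : p.HolderConjugate p')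
    (hq : IsAdmissibleWeight p q) (hw : DoubleWell f βm βp) (hL : LipschitzOffZeros f)
    (hV : IsFlow p' q f (Ici βp) V Y) (hF : Tendsto (primitiveF f) atTop atTop)
    (hF' : Tendsto (primitiveF f) atBot atTop) (hα : α ∈ Ioo (0 : ℝ) 1) (hμ : 0 ≤ μ) (hc : 0 < c)
    (hcμ : c = 1 / p - μ) (hρ : 0 < ρ) (hratio : ∀ r ∈ Ioo 0 ρ, c ≤ ratioDeriv q r)
    (hsc : Subcritical p α μ q f) (n : ℕ) :
    ∃ d ∈ Ici βp, HasZeros p' f (V d) (Y d) 0 n := by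
  have hp := hpp.symm.lt
  have hk := hasDerivAt_kin hp
  have hgs := mul_phi_nonneg hp
  obtain ⟨E, hE⟩ := exists_hasZeros_of_unbounded hp hq hw n hF hF' hρ
  -- Ends of modulus `exp x0` carry the energy `E` that yields `n` zeros beyond `ρ`; the 1 makes the
  -- energy positive, as uniqueness requires.
  obtain ⟨x0, hx0⟩ := exists_radius_of_energy hp (hq.pos hρ) hw hF hF' (max E 1)
  obtain ⟨D, hD⟩ := exists_height_bound (X := Real.exp x0)
    (C := sectorArea x0 (-(((n + 1 : ℕ) + 1 / 2) * π)) + Real.exp x0 ^ 2 / 2)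
    hpp hq hw hα hμ hc hcμ hρ hratio hsc
  set a : ℕ → ℝ := fun N => ρ / ((N : ℝ) + 1 + 1) with ha
  have ha0 : ∀ N, 0 < a N := fun N => by simp only [ha]; positivity
  have haρ : ∀ N, a N < ρ := fun N => div_lt_self hρ (by
    have := Nat.cast_nonneg (α := ℝ) N; linarith)
  choose d v y A hd0 hS hAc hA0 hAρ hAd hvρ hyρ halt using fun N =>
    exists_alternating (x0 := x0) hp hq hw hF hF' (ha0 N) (haρ N) (n + 1)
  have hstart : ∀ N, energy (kin p') f (v N) (y N) (a N) = primitiveF f (d N) := fun N =>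
    (hS N).energy_start (kin_zero hp)
  -- Heights inside the well have nonpositive energy, which neither a large end point nor an
  -- alternation time with `F ≥ 0` permits.
  have hβd : ∀ N, βp ≤ d N := by
    intro N
    rcases halt N with h | ⟨r, hr⟩
    · have h1 := (hS N).energy_anti hq (ha0 N).le hw.cont hk hgs le_rfl (haρ N).le le_rfl
      have h2 : 1 ≤ energy (kin p') f (v N) (y N) ρ := (le_max_right E 1).trans (hx0 _ _ h)
      rw [hstart] at h1
      exact (hw.gt_of_pos (by linarith) (hd0 N)).le
    · obtain ⟨hrI, hyr, hs, hFr, -⟩ := hr 0 (by omega)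
      have h1 : 0 ≤ energy (kin p') f (v N) (y N) (r 0) := by
        rwa [energy, hyr, kin_zero hp, zero_add]
      by_contra hcon
      have h2 : primitiveF f (d N) ≤ 0 :=
        hw.nonpos ⟨hw.neg_left.le.trans (hd0 N), (not_le.1 hcon).le⟩
      have h3 := (hS N).eq_of_energy_le hp hq hw.cont (ha0 N).le le_rfl hrI.1 hrI.2
        (by rw [hstart]; exact h2.trans h1)
      rw [((hS N).init _ le_rfl).1] at h3
      rw [h3, pow_zero, one_mul] at hs
      rw [h3] at hFr
      exact hFr.not_gt (hw.well _ ⟨hw.neg_left.trans hs, not_le.1 hcon⟩ hs.ne')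
  -- The heights are bounded uniformly in the starting radius `a N`; this gives compactness as `a N
  -- → 0`.
  have hdD : ∀ N, d N ≤ D := fun N => hD (ha0 N) (haρ N) (hβd N) (hS N) (hAc N) (hA0 N) (hAρ N)
    (hAd N) (hvρ N) (hyρ N)
  obtain ⟨b, hb⟩ := ((hF.eventually (eventually_gt_atTop (primitiveF f D))).and
    ((hF'.comp tendsto_neg_atTop_atBot).eventually
      (eventually_gt_atTop (primitiveF f D)))).exists_forall_of_atTop
  have hvB : ∀ N, ∀ r ≤ ρ, |v N r| ≤ b := by
    intro N r hr
    have h1 : primitiveF f (v N r) ≤ primitiveF f D := by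
      have h2 := hw.strictMonoOn.monotoneOn (hβd N) ((hβd N).trans (hdD N)) (hdD N)
      rcases le_total r (a N) with h3 | h3
      · rwa [((hS N).init r h3).1]
      · have := (hS N).energy_anti hq (ha0 N).le hw.cont hk hgs le_rfl h3 hr
        rw [hstart, energy] at this
        linarith [kin_nonneg hp (y N r)]
    by_contra hcon
    rcases abs_cases (v N r) with ⟨h2, -⟩ | ⟨h2, -⟩ <;> rw [h2, not_le] at hcon
    · linarith [(hb _ hcon.le).1]
    · have := (hb _ hcon.le).2
      simp only [Function.comp_apply, neg_neg] at this; linarith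
  set U : Ultrafilter ℕ := hyperfilter ℕ
  obtain ⟨d0, hd₀, hdlim⟩ := exists_tendsto_of_mem_Icc U (u := d)
    (Eventually.of_forall fun N => (⟨hβd N, hdD N⟩ : d N ∈ Icc βp D))
  have halim : Tendsto a U (𝓝 0) := by
    refine Tendsto.mono_left ?_ Nat.hyperfilter_le_atTop
    exact tendsto_const_nhds.div_atTop (tendsto_atTop_add_const_right _ _
      (tendsto_atTop_add_const_right _ _ tendsto_natCast_atTop_atTop))
  obtain ⟨M, hM⟩ := isCompact_Icc.exists_bound_of_continuousOn (s := Icc (-b) b) hw.cont.continuousOn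
  obtain ⟨M', hM'⟩ := isCompact_Icc.exists_bound_of_continuousOn
    (s := Icc (-(M * (ρ - 0))) (M * (ρ - 0))) (continuous_phi hp).continuousOn
  obtain ⟨v0, y0, hS0, hv, hy⟩ := Sol.exists_limit hq (U := U) le_rfl hρ (fun N => (ha0 N).le) halim
    hdlim hS (fun s => ((continuous_phi hp).tendsto s).comp tendsto_snd)
    (fun s => (hw.cont.tendsto s).comp tendsto_snd) hvB (fun _ s hs => hM s (abs_le.1 hs))
    fun _ s hs => hM' s (abs_le.1 hs)
  refine ⟨d0, hd₀.1, ?_⟩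
  rcases U.eventually_or.1 (Eventually.of_forall halt) with h1 | h1
  · have hend : v0 ρ ^ 2 + (q ρ * y0 ρ) ^ 2 = Real.exp x0 ^ 2 :=
      tendsto_nhds_unique (((hv.tendsto self_mem_Iic).pow 2).add
        (((hy.tendsto self_mem_Iic).const_mul (q ρ)).pow 2))
        (tendsto_const_nhds.congr' (h1.mono fun N hN => hN.symm))
    have h2 := hx0 _ _ hend
    obtain ⟨e1, e2⟩ := hV.eq_of_sol hp hq hw hL hd₀.1 hS0 le_rfl
      (one_pos.trans_le ((le_max_right E 1).trans h2))
    rw [e1, e2] at h2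
    exact (hE (hV.sol d0 hd₀.1) (hV.bound hd₀.1) ρ le_rfl ((le_max_left E 1).trans h2)).mono hρ.le
  have h1 : ∀ᶠ N in (U : Filter ℕ), ∃ r : ℕ → ℝ, ∀ j ≤ n, r j ∈ Icc 0 ρ ∧
      0 < (-1) ^ j * v N (r j) ∧ 0 ≤ primitiveF f (v N (r j)) ∧ (j < n → r j ≤ r (j + 1)) := by
    refine h1.mono fun N ⟨r, hr⟩ => ⟨r, fun j hj => ?_⟩
    obtain ⟨h1, -, h3, h4, h5⟩ := hr j (by omega)
    exact ⟨⟨(ha0 N).le.trans h1.1, h1.2⟩, h3, h4, fun hj' => h5 (by omega)⟩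
  obtain ⟨r, h1⟩ := h1.choice
  have hlim : ∀ j ≤ n, ∃ x ∈ Icc 0 ρ, Tendsto (fun N => r N j) U (𝓝 x) := fun j hj =>
    exists_tendsto_of_mem_Icc U (h1.mono fun N hN => (hN j hj).1)
  choose! x hx using hlim
  refine hV.hasZeros_of_alternating hp hq hw hL hd₀.1 hS0 (r := x) fun j hj => ?_
  obtain ⟨hxI, hxl⟩ := hx j hj
  have hmem : ∀ᶠ N in (U : Filter ℕ), r N j ∈ Iic ρ := h1.mono fun N hN => (hN j hj).1.2
  have hvl := hv.tendsto_comp hxI.2 hxl hmem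
  have hFc := continuous_primitiveF hw.cont
  refine ⟨hxI, ?_, ?_, fun hj1 => ?_⟩
  · refine (lt_min hw.pos_right (neg_pos.2 hw.neg_left)).trans_le
      (ge_of_tendsto (hvl.const_mul ((-1) ^ j)) (h1.mono fun N hN => ?_))
    have h2 := (hN j hj).2.1
    have h3 := hw.le_abs (fun h0 => by simp [h0] at h2) (hN j hj).2.2.1
    rwa [← abs_of_pos h2, abs_mul, abs_pow, abs_neg, abs_one, one_pow, one_mul]
  · refine add_nonneg (kin_nonneg hp _) (ge_of_tendsto ((hFc.tendsto _).comp hvl) ?_)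
    exact h1.mono fun N hN => (hN j hj).2.2.1
  · exact le_of_tendsto_of_tendsto hxl (hx (j + 1) hj1).2
      (h1.mono fun N hN => (hN j hj).2.2.2 hj1)

lemma IsFlow.lt_of_small_time (hp : 1 < p') (hq : IsAdmissibleWeight p q)
    (hw : DoubleWell f βm βp) (hV : IsFlow p' q f (Ici βp) V Y) {R : ℝ}
    (hα : α ∈ Ioo (0 : ℝ) 1) (hd : βp ≤ α * d) (hm : 0 < m) (hfm : ∀ s ∈ Icc (α * d) d, f s ≤ m)
    (hR : phi p' m * R ^ p' = (1 - α) * d) (hr : 0 ≤ r) (hrR : r ≤ R) :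
    βp ≤ d ∧ primitiveF f (α * d) ≤ energy (kin p') f (V d) (Y d) r := by
  have hd0 : 0 < d := pos_of_mul_pos_right (hw.pos_right.trans_le hd) hα.1.le
  have hβd : βp ≤ d := hd.trans (by nlinarith [hα.2])
  have h1 := ((hV.sol d hβd r).mem_of_small_time hp hq hw le_rfl hα hd hm hfm hR hr (by linarith)
    le_rfl).1
  have h2 := hw.strictMonoOn.monotoneOn hd (hd.trans h1.le) h1.le
  rw [energy]
  exact ⟨hβd, by linarith [kin_nonneg hp (Y d r)]⟩

lemma eventually_le_const_mul (hα : 0 < α) (C : ℝ) : ∀ᶠ d in atTop, C ≤ α * d :=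
  (tendsto_id.const_mul_atTop hα).eventually (eventually_ge_atTop C)

/-- When `F` stays below `ℓ`, the first factor in (SC) is at most `ℓ`, so the radius `R` must become
large. A tall solution therefore keeps energy close to `ℓ` up to a radius from which
`exists_hasZeros` applies. -/
lemma IsFlow.exists_hasZeros_of_bounded {ℓ : ℝ} (hpp : p.HolderConjugate p')
    (hq : IsAdmissibleWeight p q) (hw : DoubleWell f βm βp)
    (hV : IsFlow p' q f (Ici βp) V Y) (hF : Tendsto (primitiveF f) atTop (𝓝 ℓ))
    (hF' : Tendsto (primitiveF f) atBot (𝓝 ℓ)) (hℓ : ∀ s, βp ≤ s → primitiveF f s < ℓ)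
    (hα : α ∈ Ioo (0 : ℝ) 1) (hμ : 0 ≤ μ) (hsc : Subcritical p α μ q f) (n : ℕ) :
    ∃ d ∈ Ici βp, HasZeros p' f (V d) (Y d) 0 n := by
  have hp := hpp.symm.lt
  have hℓ0 : 0 < ℓ := hw.right_eq ▸ hℓ βp le_rfl
  have h2 : ℓ / 2 < ℓ := half_lt_self hℓ0
  obtain ⟨s, hs, hFs⟩ := ((eventually_ge_atTop βp).and (hF.eventually (lt_mem_nhds h2))).exists
  obtain ⟨s', hs', hFs'⟩ := ((eventually_le_atBot βm).and (hF'.eventually (lt_mem_nhds h2))).exists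
  obtain ⟨R0, hR0, h⟩ := exists_hasZeros hp hq hw n (half_pos hℓ0) ⟨s, hs, hFs.le⟩
    ⟨s', hs', hFs'.le⟩
  have hQ := hq.primitiveQ_pos (one_pos.trans_le hR0)
  obtain ⟨d, hscd, hds⟩ := ((hsc (ℓ * primitiveQ q R0)).and (eventually_le_const_mul hα.1 s)).exists
  obtain ⟨m, G, R, hm, hG, hR, -, hfm, -, hmR, hGQ, s2, hs2, rfl⟩ :=
    exists_radius hpp hq hw hα (hs.trans hds) (mul_pos hℓ0 hQ) hscd
  have hs2β : βp ≤ s2 := (hs.trans hds).trans hs2.1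
  have hGℓ : primitiveF f s2 - μ * s2 * f s2 ≤ ℓ := by
    have := mul_nonneg (mul_nonneg hμ (hw.pos_right.le.trans hs2β)) (hw.pos s2 hs2β).le
    linarith [hℓ s2 hs2β]
  -- The height was chosen with `G Q(R) ≥ ℓ Q(R0)`, while `G ≤ ℓ`.
  have hR0R : R0 ≤ R := by
    by_contra hcon
    have e1 := hq.primitiveQ_strictMono hR.le (not_le.1 hcon)
    have e2 := mul_le_mul_of_nonneg_right hGℓ (hq.primitiveQ_pos hR).le
    have e3 := mul_lt_mul_of_pos_left e1 hℓ0
    linarith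
  obtain ⟨hd, he⟩ := hV.lt_of_small_time hp hq hw hα (hs.trans hds) hm hfm hmR
    (by linarith : (0 : ℝ) ≤ R0) hR0R
  have h3 := hw.strictMonoOn.monotoneOn hs (hs.trans hds) hds
  exact ⟨d, hd, (h (hV.sol d hd) (hV.bound hd) R0 le_rfl (hFs.le.trans (h3.trans he))).mono
    (by linarith)⟩

/-- A nonlinearity with `s f(s) ≤ p F(s)` grows at most like `s ^ (p - 1)`. -/
lemma exists_le_rpow (hw : DoubleWell f βm βp) {s0 : ℝ} (hs₀ : βp ≤ s0)
    (h : ∀ s, s0 ≤ s → s * f s ≤ p * primitiveF f s) :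
    ∃ K > 0, ∀ s, s0 ≤ s → f s ≤ K * s ^ (p - 1) := by
  have h0 : 0 < s0 := hw.pos_right.trans_le hs₀
  set K := primitiveF f s0 * s0 ^ (-p) with hK
  refine ⟨max (p * K) 1, lt_max_of_lt_right one_pos, fun s hs => ?_⟩
  have hs0 : 0 < s := h0.trans_le hs
  have h1 := le_of_hasDerivAt_nonneg (u := fun s => -(primitiveF f s * s ^ (-p)))
    (u' := fun s => -(f s * s ^ (-p) + primitiveF f s * (-p * s ^ (-p - 1)))) hs
    (fun x hx => (((hasDerivAt_primitiveF hw.cont x).mul (hasDerivAt_rpow_const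
      (Or.inl (h0.trans_le hx.1).ne'))).neg).continuousAt.continuousWithinAt)
    (fun x hx => ((hasDerivAt_primitiveF hw.cont x).mul (hasDerivAt_rpow_const
      (Or.inl (h0.trans hx.1).ne'))).neg) fun x hx => by
      have hx0 : 0 < x := h0.trans hx.1
      have e1 := h x hx.1.le
      have e2 : x ^ (-p) = x ^ (-p - 1) * x := by
        rw [← Real.rpow_add_one hx0.ne', sub_add_cancel]
      have e3 := mul_nonneg (sub_nonneg.2 e1) (rpow_pos_of_pos hx0 (-p - 1)).le
      rw [e2]; linarith
  have h2 : primitiveF f s ≤ K * s ^ p := by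
    have e : s ^ (-p) * s ^ p = 1 := by rw [← rpow_add hs0]; simp
    have := mul_le_mul_of_nonneg_right (neg_le_neg_iff.1 h1) (rpow_pos_of_pos hs0 p).le
    rwa [mul_assoc, e, mul_one] at this
  rcases le_or_gt p 0 with hp | hp
  · exact absurd (h s hs) (not_le.2 ((mul_nonpos_of_nonpos_of_nonneg hp
      (hw.nonneg_of_ge (hs₀.trans hs))).trans_lt (mul_pos hs0 (hw.pos s (hs₀.trans hs)))))
  have h3 : s * f s ≤ s * (p * K * s ^ (p - 1)) := by
    refine (h s hs).trans ((mul_le_mul_of_nonneg_left h2 hp.le).trans_eq ?_)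
    rw [rpow_sub_one hs0.ne']; field_simp
  exact (le_of_mul_le_mul_left h3 hs0).trans (mul_le_mul_of_nonneg_right (le_max_left _ _)
    (rpow_nonneg hs0.le _))

/-- For `μ ≥ 1/p`, positivity in (SC) already yields `s f(s) ≤ p F(s)` for large `s`, hence `f(s) ≤
K s^{p-1}`. By homogeneity the time spent above `α d` is then bounded below independently of `d`, so
the energy at a fixed radius tends to infinity with `d`. -/
lemma IsFlow.exists_hasZeros_of_le (hpp : p.HolderConjugate p')
    (hq : IsAdmissibleWeight p q) (hw : DoubleWell f βm βp)
    (hV : IsFlow p' q f (Ici βp) V Y) (hF : Tendsto (primitiveF f) atTop atTop)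
    (hF' : Tendsto (primitiveF f) atBot atTop) (hα : α ∈ Ioo (0 : ℝ) 1) (hμ : 1 / p ≤ μ)
    (hsc : Subcritical p α μ q f) (n : ℕ) :
    ∃ d ∈ Ici βp, HasZeros p' f (V d) (Y d) 0 n := by
  have hp := hpp.symm.lt
  have hp0 : 0 < p := hpp.pos
  obtain ⟨s0, hs₀⟩ := ((hsc 1).and (eventually_le_const_mul hα.1 βp)).exists_forall_of_atTop
  have hgrow : ∀ s, max s0 βp ≤ s → s * f s ≤ p * primitiveF f s := by
    intro s hs
    obtain ⟨h1, h2⟩ := hs₀ s ((le_max_left _ _).trans hs)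
    obtain ⟨-, G, -, -, hG, -, -, -, hGF, -⟩ := exists_radius hpp hq hw hα h2 one_pos h1
    have hsβ := (le_max_right _ _).trans hs
    have hs0 := hw.pos_right.trans_le hsβ
    have e1 := hGF s ⟨by nlinarith [hα.2], le_rfl⟩
    have e2 := mul_le_mul_of_nonneg_right hμ (mul_pos hs0 (hw.pos s hsβ)).le
    rw [one_div, inv_mul_eq_div, div_le_iff₀ hp0] at e2
    nlinarith
  obtain ⟨K, hK0, hK⟩ := exists_le_rpow hw (le_max_right s0 βp) hgrow
  -- Since `m ≤ K d^{p-1}` gives `φ_{p'}(m) ≤ K^{p'-1} d`, the equation for `R` implies `R ≥ ρ`,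
  -- with `ρ` independent of `d`.
  set ρ := ((1 - α) / K ^ (p' - 1)) ^ (1 / p') with hρ
  have hα1 : 0 < 1 - α := by linarith [hα.2]
  have hKp : 0 < K ^ (p' - 1) := rpow_pos_of_pos hK0 _
  have hρ0 : 0 < ρ := rpow_pos_of_pos (div_pos hα1 hKp) _
  obtain ⟨E, hE⟩ := exists_hasZeros_of_unbounded hp hq hw n hF hF' hρ0
  obtain ⟨d, hscd, hdm, hdE⟩ := ((hsc 1).and ((eventually_le_const_mul hα.1 (max s0 βp)).and
    ((tendsto_id.const_mul_atTop hα.1).eventually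
      (hF.eventually (eventually_ge_atTop E))))).exists
  have hdβ := (le_max_right s0 βp).trans hdm
  obtain ⟨m, -, R, hm, -, hR, ⟨s1, hs1, hms⟩, hfm, -, hmR, -⟩ :=
    exists_radius hpp hq hw hα hdβ one_pos hscd
  have hs10 : 0 < s1 := (hw.pos_right.trans_le hdβ).trans_le hs1.1
  have hd0 : 0 < d := hs10.trans_le hs1.2
  have hφm : phi p' m ≤ K ^ (p' - 1) * d := by
    have e1 : m ≤ K * d ^ (p - 1) := by
      rw [hms]
      refine (hK s1 (hdm.trans hs1.1)).trans (mul_le_mul_of_nonneg_left ?_ hK0.le)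
      exact rpow_le_rpow hs10.le hs1.2 (by linarith [hpp.lt])
    have e2 : (p - 1) * (p' - 1) = 1 := by linarith [hpp.mul_eq_add]
    rw [phi_of_pos hm]
    refine (rpow_le_rpow hm.le e1 (by linarith)).trans_eq ?_
    rw [mul_rpow hK0.le (rpow_nonneg hd0.le _), ← rpow_mul hd0.le, e2, rpow_one]
  have hρR : ρ ≤ R := by
    have e1 : (1 - α) * d ≤ K ^ (p' - 1) * d * R ^ p' :=
      hmR ▸ mul_le_mul_of_nonneg_right hφm (rpow_nonneg hR.le _)
    have e2 : (1 - α) / K ^ (p' - 1) ≤ R ^ p' := by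
      rw [div_le_iff₀' hKp]
      exact le_of_mul_le_mul_right (by linarith) hd0
    refine (rpow_le_rpow (div_pos hα1 hKp).le e2 (by positivity)).trans_eq ?_
    rw [← rpow_mul hR.le, mul_one_div_cancel (by linarith), rpow_one]
  obtain ⟨hd, he⟩ := hV.lt_of_small_time hp hq hw hα hdβ hm hfm hmR hρ0.le hρR
  exact ⟨d, hd, (hE (hV.sol d hd) (hV.bound hd) ρ le_rfl (hdE.trans he)).mono hρ0.le⟩

end

end WeightedPLaplace
end

theorem theorem1p1 (p : ℝ) (hp : 1 < p) (q f : ℝ → ℝ)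
    (hq : WeightedPLaplace.IsAdmissibleWeight p q)
    (hf : WeightedPLaplace.IsAdmissibleNonlinearity f)
    (hsc : WeightedPLaplace.IsSubcritical p q f) (k : ℕ) :
    ∃ v : ℝ → ℝ, WeightedPLaplace.IsClassicalSolution p q f v ∧ 0 < v 0 ∧
      (WeightedPLaplace.nodes v).encard = k := by
  open Set Filter Topology WeightedPLaplace in
  have hpp : p.HolderConjugate (Real.conjExponent p) := Real.HolderConjugate.conjExponent hp
  obtain ⟨βm, βp, hm, hp', hwell, hFm, hFp, hpos, hneg⟩ := hf.exists_beta
  have hw : DoubleWell f βm βp := ⟨hf.continuous, hf.map_zero, hm, hp',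
    fun s hs h0 => hwell s ⟨hs, h0⟩, hFm, hFp, hpos, hneg⟩
  obtain ⟨L, hL, hL'⟩ := hf.limits_eq
  -- On the right `F` increases strictly to `L`, so no height attains `L`; as `L` is also the limit
  -- on the left, every height has a barrier there.
  have hFL : ∀ s, βp ≤ s → ((primitiveF f s : ℝ) : EReal) < L := fun s hs => by
    refine lt_of_lt_of_le (EReal.coe_lt_coe_iff.2 (hw.strictMonoOn hs (hs.trans (by linarith) :
      βp ≤ s + 1) (lt_add_one s))) (ge_of_tendsto hL ?_)
    filter_upwards [eventually_ge_atTop (s + 1)] with t ht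
    exact EReal.coe_le_coe_iff.2 (hw.strictMonoOn.monotoneOn (show βp ≤ s + 1 by linarith)
      (show βp ≤ t by linarith) ht)
  obtain ⟨V, Y, hV⟩ := exists_flow hpp.symm.lt hq hw fun d hd => by
    obtain ⟨A, hA, hFA⟩ := ((eventually_le_atBot βm).and
      (hL'.eventually (lt_mem_nhds (hFL d hd)))).exists
    exact ⟨A, hA, EReal.coe_lt_coe_iff.1 hFA⟩
  refine exists_solution_of_hasZeros hpp hq hw hf.lipschitzOffZeros hV k ?_
  obtain ⟨α, hα, μ, hμ, r0, hr0, hratio, hlim⟩ := hsc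
  have hμ0 : 0 ≤ μ := (le_max_right _ _).trans hμ
  have hsc := subcritical_of_tendsto hlim
  -- A finite limit is the case of bounded `F`. An infinite one splits into `μ ≥ 1/p` and `μ < 1/p`;
  -- in the latter case `c = 1/p - μ > 0` is a lower bound of `(Q/q)'` near the origin.
  induction L with
  | bot => exact absurd (hFL βp le_rfl) not_lt_bot
  | coe ℓ =>
    exact hV.exists_hasZeros_of_bounded hpp hq hw (EReal.tendsto_coe.1 hL) (EReal.tendsto_coe.1 hL')
      (fun s hs => EReal.coe_lt_coe_iff.1 (hFL s hs)) hα hμ0 hsc _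
  | top =>
    rw [EReal.tendsto_coe_nhds_top_iff] at hL hL'
    rcases le_or_gt (1 / p) μ with h | h
    · exact hV.exists_hasZeros_of_le hpp hq hw hL hL' hα h hsc _
    · exact hV.exists_hasZeros_of_subcritical hpp hq hw hf.lipschitzOffZeros hL hL' hα hμ0
        (sub_pos.2 h) rfl hr0 (fun r hr => by linarith [hratio r hr]) hsc _
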